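/- **Theorem (Grothendieck construction in the context of tangent categories).** All categories below are small. *Fibrations and indexed categories.* $\mathrm{FIB}$ is the strict 2-category of cloven fibrations $\Pi\colon\mathbb{X}'\to\mathbb{X}$; a 1-morphism is a strictly commutative square of functors $(F,F')$ with $F'$ preserving cartesian morphisms, and a 2-morphism is a pair of natural transformations, the total one lying over the base one. $\mathrm{INDX}$ is the strict 2-category of indexed categories, i.e. pseudofunctors $\mathfrak{I}\colon\mathbb{X}^{\mathrm{op}}\to\mathrm{Cat}$; a 1-morphism consists of a functor $F$ between the base categories, functors $F^A\colon\mathfrak{I}(A)\to\mathfrak{I}'(FA)$ and coherent natural isomorphisms $\kappa^f\colon F^A f^*\cong (Ff)^*F^B$ for $f\colon A\to B$, and a 2-morphism consists of a natural transformation $\theta\colon F\Rightarrow G$ and a family $F^A\Rightarrow\theta_A^*G^A$ compatible with the $\kappa$'s. The category-of-elements construction is a strict 2-functor $\mathrm{INDX}\to\mathrm{FIB}$. *Tangent objects.* Let $\mathbb{K}$ be a strict 2-category. A limit in $\mathbb{K}(X,Y)$ is *pointwise* if it is preserved by precomposition with every 1-morphism $W\to X$. A *tangent object* of $\mathbb{K}$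 is an object $X$ with a 1-morphism $T\colon X\to X$ and 2-morphisms $p\colon T\Rightarrow\mathrm{id}$, $z\colon\mathrm{id}\Rightarrow T$, $s\colon T_2\Rightarrow T$, $l\colon T\Rightarrow T^2$, $c\colon T^2\Rightarrow T^2$, where $T_2$ is a chosen pullback of $p$ along itself, such that: for all $n\ge1$ the $n$-fold pullback of $p$ along itself exists in $\mathbb{K}(X,X)$, is pointwise, and is preserved, as a pointwise limit, by all iterates $T^m$; $(\mathrm{id},T,p,z,s)$ is a commutative monoid over $\mathrm{id}$ (an additive bundle); $(z,l)\colon(\mathrm{id},T,p,z,s)\to(T,T^2,Tp,Tz,Ts)$ and $(\mathrm{id}_T,c)\colon(T,T^2,Tp,Tz,Ts)\to(T,T^2,p_T,z_T,s_T)$ are morphisms of additive bundles; $Tl\circ l=l_T\circ l$; $c^2=\mathrm{id}$ and $Tc\circ c_T\circ Tc=c_T\circ Tc\circ c_T$; $c\circ l=l$ and $c_T\circ Tc\circ l_T=Tl\circ c$; and the square $Tp\circ\phi=z\circ p\circ\pi_1$, with $\phi=Ts\circ\langle l\pi_1,z_T\pi_2\rangle\colon T_2\Rightarrow T^2$, is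 a pointwise pullback. A *tangent category* is a category with such data whose axioms and pullbacks hold at every object. *Morphisms.* A *lax* morphism $(X,T)\to(X',T')$ is a 1-morphism $F$ with $\alpha\colon FT\Rightarrow T'F$ such that $(\mathrm{id}_F,\alpha)$ is a morphism of additive bundles, $T'\alpha\circ\alpha_T\circ Fl=l'_F\circ\alpha$ and $T'\alpha\circ\alpha_T\circ Fc=c'_F\circ T'\alpha\circ\alpha_T$. A *colax* morphism is a 1-morphism $G$ with $\beta\colon T'G\Rightarrow GT$ satisfying the dual conditions, such that postcomposition with $G$ carries the $n$-fold pullbacks ($n\ge1$) of $p$ and the pullback square of $\phi$ to pointwise pullbacks. A *strong* (resp. *strict*) morphism is a colax morphism with invertible (resp. identity) law; it is regarded as a lax morphism through the inverse of its law. A 2-morphism is a 2-morphism of $\mathbb{K}$ compatible with the laws. For $\flat$ = lax, colax, strong, strict, let $\mathrm{TNG}_\flat(\mathbb{K})$ be the 2-category of tangent objects of $\mathbb{K}$ whose 1-morphisms are the finite composites (with composite laws) of $\flat$ morphisms. Morphisms of tangent categories are defined in the same way, the pullbacks being those at every object. A *tangent fibration* is a cloven fibration between two tangent categories whose underlying functor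 is a strict tangent morphism and whose tangent bundle functors form a 1-morphism of $\mathrm{FIB}$. A $\flat$ morphism of tangent fibrations is a 1-morphism $(F,F')$ of $\mathrm{FIB}$ with laws on $F$ and $F'$, the second lying over the first, making both into $\flat$ tangent morphisms. 2-morphisms are 2-morphisms of $\mathrm{FIB}$ compatible with the laws, and $\mathrm{TNGFIB}_\flat$ is the resulting 2-category, whose 1-morphisms are the finite composites of $\flat$ morphisms. **Statement.** There is a strict 2-equivalence $\mathrm{INDX}\simeq\mathrm{FIB}$ (2-functors in both directions whose composites are 2-naturally isomorphic to the identities) whose 2-functor $\mathrm{INDX}\to\mathrm{FIB}$ is the category-of-elements construction and whose inverse preserves base categories. Applied to carriers, tangent 1-morphisms, laws and 2-morphisms, it lifts to four strict 2-equivalences $$\mathrm{TNG}_\flat(\mathrm{INDX})\simeq\mathrm{TNGFIB}_\flat ,\qquad \flat=\text{lax, colax, strong, strict}.$$ They have the same action on objects; the strong and strict ones are restrictions of the lax one as regards 1-morphisms, 2-morphisms, units and counits (all are restrictions of the lifted equivalence of objects with an endomorphism); and they preserve and reflect $\flat$ morphisms. On objects they preserve the base tangent category on the nose in both directions, and the total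 tangent category of the tangent fibration associated with a tangent indexed category is its category of elements with the induced tangent structure. Finally, for every tangent category $(\mathbb{X},\mathbb{T})$, each of the four equivalences restricts to a strict 2-equivalence $$\mathrm{TNG}_\flat(\mathrm{INDX})(\mathbb{X},\mathbb{T})\simeq\mathrm{TNGFIB}_\flat(\mathbb{X},\mathbb{T})$$ between the sub-2-categories of objects with base tangent category $(\mathbb{X},\mathbb{T})$, 1-morphisms whose base functor and base law are identities, and 2-morphisms whose base component is an identity. -/

import Mathlib

open CategoryTheory Bicategory Opposite

universe w₁ w₂ w₃ v₁ v₂ v₃ u₁ u₂ u₃ v u t t' x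

set_option linter.checkUnivs false
set_option linter.unusedVariables false

namespace TangentFib

/-! ### Cloven fibrations -/

/-- A cloven fibration: a functor `proj : total ⟶ base` with a chosen cartesian lift
`lift E f : f^* E ⟶ E` of every `f : A ⟶ proj E`. -/
structure Fib where
  base : Cat.{v, u}
  total : Cat.{v, u}
  proj : total ⟶ base
  pull {A : base} (E : total) (f : A ⟶ proj.toFunctor.obj E) : total
  lift {A : base} (E : total) (f : A ⟶ proj.toFunctor.obj E) : pull E f ⟶ E
  cart {A : base} (E : total) (f : A ⟶ proj.toFunctor.obj E) :
    Functor.IsStronglyCartesian proj.toFunctor f (lift E f)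

namespace Fib

/-- A `1`-morphism of cloven fibrations: a strictly commutative square whose top functor carries
the chosen cartesian lifts to cartesian morphisms. -/
@[ext]
structure Hom (P Q : Fib.{v, u}) where
  base : P.base ⟶ Q.base
  total : P.total ⟶ Q.total
  comm : total ≫ Q.proj = P.proj ≫ base
  cart {A : P.base} (E : P.total) (f : A ⟶ P.proj.toFunctor.obj E) :
    Functor.IsStronglyCartesian Q.proj.toFunctor (base.toFunctor.map f) (total.toFunctor.map (P.lift E f))

namespace Hom

variable {P Q R : Fib.{v, u}}

lemma proj_obj (F : Hom P Q) (E : P.total) :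
    Q.proj.toFunctor.obj (F.total.toFunctor.obj E) =
      F.base.toFunctor.obj (P.proj.toFunctor.obj E) :=
  Functor.congr_obj (congrArg Cat.Hom.toFunctor F.comm) E

lemma isHomLift (F : Hom P Q) {A B : P.base} {E E' : P.total} (f : A ⟶ B) (g : E ⟶ E')
    (h : P.proj.toFunctor.IsHomLift f g) :
    Q.proj.toFunctor.IsHomLift (F.base.toFunctor.map f) (F.total.toFunctor.map g) := by
  have h2 := Functor.congr_hom (congrArg Cat.Hom.toFunctor F.comm) g
  subst_hom_lift P.proj.toFunctor f g
  exact CategoryTheory.IsHomLift.of_fac Q.proj.toFunctor (F.base.toFunctor.map (P.proj.toFunctor.map g))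
    (F.total.toFunctor.map g) (F.proj_obj E) (F.proj_obj E')
    (by simp only [Cat.Hom.comp_toFunctor, Functor.comp_map] at h2; simp [h2])

/-- A `1`-morphism of cloven fibrations preserves all cartesian morphisms. -/
lemma map_cart (F : Hom P Q) {A B : P.base} {E E' : P.total} (f : A ⟶ B)
    (g : E ⟶ E') (h : Functor.IsStronglyCartesian P.proj.toFunctor f g) :
    Functor.IsStronglyCartesian Q.proj.toFunctor (F.base.toFunctor.map f) (F.total.toFunctor.map g) := by
  have hd := CategoryTheory.IsHomLift.codomain_eq P.proj.toFunctor f g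
  subst hd
  have hl := P.cart E' f
  have hc := F.cart E' f
  let i := Functor.IsStronglyCartesian.domainIsoOfBaseIso P.proj.toFunctor
    (g := Iso.refl A) (f := f) (f' := f) (by simp) (P.lift E' f) g
  have hi : P.proj.toFunctor.IsHomLift (𝟙 A) i.hom :=
    Functor.IsStronglyCartesian.domainUniqueUpToIso_inv_isHomLift P.proj.toFunctor
      (g := Iso.refl A) (f := f) (f' := f) (by simp) (P.lift E' f) g
  have hf : i.hom ≫ P.lift E' f = g := by
    simp only [i, Functor.IsStronglyCartesian.domainIsoOfBaseIso_hom]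
    exact Functor.IsStronglyCartesian.fac _ _ _ _ _
  have hi' := F.isHomLift _ _ hi
  have hj : Functor.IsStronglyCartesian Q.proj.toFunctor (F.base.toFunctor.map (𝟙 A))
      (F.total.toFunctor.map i.hom) := inferInstance
  have := Functor.IsStronglyCartesian.comp (p := Q.proj.toFunctor)
    (f := F.base.toFunctor.map (𝟙 A)) (g := F.base.toFunctor.map f)
    (φ := F.total.toFunctor.map i.hom) (ψ := F.total.toFunctor.map (P.lift E' f))
  rwa [← Functor.map_comp, ← Functor.map_comp, hf, Category.id_comp] at this

end Hom

instance : CategoryStruct Fib.{v, u} where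
  Hom := Hom
  id P := ⟨𝟙 _, 𝟙 _, rfl, fun E f => P.cart E f⟩
  comp {P Q R} F G :=
    { base := F.base ≫ G.base
      total := F.total ≫ G.total
      comm := by
        rw [show (F.total ≫ G.total) ≫ R.proj = F.total ≫ (G.total ≫ R.proj) from rfl, G.comm,
          show F.total ≫ (Q.proj ≫ G.base) = (F.total ≫ Q.proj) ≫ G.base from rfl, F.comm]
        rfl
      cart := fun E f => G.map_cart _ _ (F.cart E f) }

/-- A `2`-morphism of cloven fibrations: a pair of natural transformations, the one between the
top functors lying over the one between the base functors. -/
@[ext]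
structure Hom₂ {P Q : Fib.{v, u}} (F G : P ⟶ Q) where
  base : F.base ⟶ G.base
  total : F.total ⟶ G.total
  isLift (E : P.total) : Q.proj.toFunctor.IsHomLift
    (base.toNatTrans.app (P.proj.toFunctor.obj E)) (total.toNatTrans.app E)

variable {P Q R S : Fib.{v, u}}

instance : Category (P ⟶ Q) where
  Hom F G := Hom₂ F G
  id F := ⟨𝟙 _, 𝟙 _, fun E => CategoryTheory.IsHomLift.id (F.proj_obj E)⟩
  comp a b := ⟨a.base ≫ b.base, a.total ≫ b.total, fun E => by
    have := a.isLift E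
    have := b.isLift E
    exact CategoryTheory.IsHomLift.comp Q.proj.toFunctor (a.base.toNatTrans.app (P.proj.toFunctor.obj E))
      (b.base.toNatTrans.app (P.proj.toFunctor.obj E)) (a.total.toNatTrans.app E)
      (b.total.toNatTrans.app E)⟩
  id_comp a := Hom₂.ext (Category.id_comp a.base) (Category.id_comp a.total)
  comp_id a := Hom₂.ext (Category.comp_id a.base) (Category.comp_id a.total)
  assoc a b c := Hom₂.ext (Category.assoc a.base b.base c.base)
    (Category.assoc a.total b.total c.total)

lemma hom₂_ext {F G : P ⟶ Q} {a b : F ⟶ G} (h : a.base = b.base) (h' : a.total = b.total) :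
    a = b := Hom₂.ext h h'

/-- Invertible `2`-morphisms from invertible components. -/
def isoMk {F G : P ⟶ Q} (b : F.base ≅ G.base) (t : F.total ≅ G.total)
    (h : ∀ E, Q.proj.toFunctor.IsHomLift
      (b.hom.toNatTrans.app (P.proj.toFunctor.obj E)) (t.hom.toNatTrans.app E))
    (h' : ∀ E, Q.proj.toFunctor.IsHomLift
      (b.inv.toNatTrans.app (P.proj.toFunctor.obj E)) (t.inv.toNatTrans.app E)) : F ≅ G where
  hom := ⟨b.hom, t.hom, h⟩
  inv := ⟨b.inv, t.inv, h'⟩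
  hom_inv_id := Hom₂.ext b.hom_inv_id t.hom_inv_id
  inv_hom_id := Hom₂.ext b.inv_hom_id t.inv_hom_id

instance : Bicategory Fib.{v, u} where
  homCategory := inferInstance
  whiskerLeft {P Q R} F G H a := ⟨F.base ◁ a.base, F.total ◁ a.total, fun E => by
    have h := a.isLift (F.total.toFunctor.obj E)
    rw [F.proj_obj] at h
    exact h⟩
  whiskerRight {P Q R} F G a H := ⟨a.base ▷ H.base, a.total ▷ H.total, fun E =>
    H.isHomLift _ _ (a.isLift E)⟩
  associator F G H := isoMk (α_ F.base G.base H.base) (α_ F.total G.total H.total)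
    (fun E => CategoryTheory.IsHomLift.id ((F ≫ G ≫ H).proj_obj E)) (fun E => CategoryTheory.IsHomLift.id ((F ≫ G ≫ H).proj_obj E))
  leftUnitor F := isoMk (λ_ F.base) (λ_ F.total)
    (fun E => CategoryTheory.IsHomLift.id (F.proj_obj E)) (fun E => CategoryTheory.IsHomLift.id (F.proj_obj E))
  rightUnitor F := isoMk (ρ_ F.base) (ρ_ F.total)
    (fun E => CategoryTheory.IsHomLift.id (F.proj_obj E)) (fun E => CategoryTheory.IsHomLift.id (F.proj_obj E))
  whiskerLeft_id _ _ := Hom₂.ext (whiskerLeft_id _ _) (whiskerLeft_id _ _)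
  whiskerLeft_comp _ _ _ _ _ _ := Hom₂.ext (whiskerLeft_comp _ _ _) (whiskerLeft_comp _ _ _)
  id_whiskerLeft _ := Hom₂.ext (id_whiskerLeft _) (id_whiskerLeft _)
  comp_whiskerLeft _ _ _ _ _ := Hom₂.ext (comp_whiskerLeft _ _ _) (comp_whiskerLeft _ _ _)
  id_whiskerRight _ _ := Hom₂.ext (id_whiskerRight _ _) (id_whiskerRight _ _)
  comp_whiskerRight _ _ _ := Hom₂.ext (comp_whiskerRight _ _ _) (comp_whiskerRight _ _ _)
  whiskerRight_id _ := Hom₂.ext (whiskerRight_id _) (whiskerRight_id _)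
  whiskerRight_comp _ _ _ := Hom₂.ext (whiskerRight_comp _ _ _) (whiskerRight_comp _ _ _)
  whisker_assoc _ _ _ _ _ := Hom₂.ext (whisker_assoc _ _ _) (whisker_assoc _ _ _)
  whisker_exchange _ _ := Hom₂.ext (whisker_exchange _ _) (whisker_exchange _ _)
  pentagon _ _ _ _ := Hom₂.ext (pentagon _ _ _ _) (pentagon _ _ _ _)
  triangle _ _ := Hom₂.ext (triangle _ _) (triangle _ _)

lemma eqToHom_base {F G : P ⟶ Q} (h : F = G) :
    (eqToHom h : F ⟶ G).base = eqToHom (congrArg Hom.base h) := by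
  subst h; rfl

lemma eqToHom_total {F G : P ⟶ Q} (h : F = G) :
    (eqToHom h : F ⟶ G).total = eqToHom (congrArg Hom.total h) := by
  subst h; rfl

instance : Bicategory.Strict Fib.{v, u} where
  id_comp _ := rfl
  comp_id _ := rfl
  assoc _ _ _ := rfl
  leftUnitor_eqToIso _ := rfl
  rightUnitor_eqToIso _ := rfl
  associator_eqToIso _ _ _ := rfl

/-- The `2`-functor that sends a cloven fibration to its base category. -/
def baseFunctor : StrictPseudofunctor Fib.{v, u} Cat.{v, u} :=
  StrictPseudofunctor.mk'
    { obj P := P.base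
      map F := F.base
      map₂ a := a.base
      map₂_id _ := rfl
      map₂_comp _ _ := rfl
      map_id _ := rfl
      map_comp _ _ := rfl
      map₂_whisker_left _ _ _ _ := ((Category.id_comp _).trans (Category.comp_id _)).symm
      map₂_whisker_right _ _ := ((Category.id_comp _).trans (Category.comp_id _)).symm
      map₂_left_unitor _ := (Category.id_comp _).symm
      map₂_right_unitor _ := (Category.id_comp _).symm
      map₂_associator _ _ _ := ((Category.id_comp _).trans (Category.comp_id _)).symm }

/-- The `2`-functor that sends a cloven fibration to its total category. -/
def totalFunctor : StrictPseudofunctor Fib.{v, u} Cat.{v, u} :=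
  StrictPseudofunctor.mk'
    { obj P := P.total
      map F := F.total
      map₂ a := a.total
      map₂_id _ := rfl
      map₂_comp _ _ := rfl
      map_id _ := rfl
      map_comp _ _ := rfl
      map₂_whisker_left _ _ _ _ := ((Category.id_comp _).trans (Category.comp_id _)).symm
      map₂_whisker_right _ _ := ((Category.id_comp _).trans (Category.comp_id _)).symm
      map₂_left_unitor _ := (Category.id_comp _).symm
      map₂_right_unitor _ := (Category.id_comp _).symm
      map₂_associator _ _ _ := ((Category.id_comp _).trans (Category.comp_id _)).symm }

end Fib

/-! ### Indexed categories -/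

/-- An indexed category: a pseudofunctor `baseᵒᵖ ⥤ Cat`. -/
structure Indx where
  base : Cat.{v, u}
  fib : LocallyDiscrete baseᵒᵖ ⥤ᵖ Cat.{v, u}

namespace Indx

/-- The fibre over `A`. -/
abbrev Fiber (I : Indx.{v, u}) (A : I.base) : Cat.{v, u} := I.fib.obj ⟨op A⟩

/-- The substitution functor `f^*`. -/
def re (I : Indx.{v, u}) {A B : I.base} (f : A ⟶ B) : I.Fiber B ⥤ I.Fiber A :=
  (I.fib.map f.op.toLoc).toFunctor

/-- The compositor `f^* (g^* E) ⟶ (f ≫ g)^* E`. -/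
def compHom (I : Indx.{v, u}) {A B C : I.base} (f : A ⟶ B) (g : B ⟶ C) (E : I.Fiber C) :
    (I.re f).obj ((I.re g).obj E) ⟶ (I.re (f ≫ g)).obj E :=
  (I.fib.mapComp g.op.toLoc f.op.toLoc).inv.toNatTrans.app E

/-- The unitor `E ⟶ (𝟙 A)^* E`. -/
def idHom (I : Indx.{v, u}) (A : I.base) (E : I.Fiber A) : E ⟶ (I.re (𝟙 A)).obj E :=
  (I.fib.mapId ⟨op A⟩).inv.toNatTrans.app E

instance (I : Indx.{v, u}) {A B C : I.base} (f : A ⟶ B) (g : B ⟶ C) (E : I.Fiber C) :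
    IsIso (I.compHom f g E) :=
  ⟨(I.fib.mapComp g.op.toLoc f.op.toLoc).hom.toNatTrans.app E,
    Cat.Hom.inv_hom_id_toNatTrans_app (I.fib.mapComp g.op.toLoc f.op.toLoc) E,
    Cat.Hom.hom_inv_id_toNatTrans_app (I.fib.mapComp g.op.toLoc f.op.toLoc) E⟩

instance (I : Indx.{v, u}) (A : I.base) (E : I.Fiber A) : IsIso (I.idHom A E) :=
  ⟨(I.fib.mapId ⟨op A⟩).hom.toNatTrans.app E,
    Cat.Hom.inv_hom_id_toNatTrans_app (I.fib.mapId ⟨op A⟩) E,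
    Cat.Hom.hom_inv_id_toNatTrans_app (I.fib.mapId ⟨op A⟩) E⟩

lemma re_obj_congr (I : Indx.{v, u}) {A B : I.base} {f g : A ⟶ B} (h : f = g) (E : I.Fiber B) :
    (I.re f).obj E = (I.re g).obj E := by rw [h]

/-- The identification `f^* E ⟶ g^* E` for `f = g`. -/
def reCongr (I : Indx.{v, u}) {A B : I.base} {f g : A ⟶ B} (h : f = g) (E : I.Fiber B) :
    (I.re f).obj E ⟶ (I.re g).obj E :=
  eqToHom (I.re_obj_congr h E)

/-- The category of elements of an indexed category: objects are pairs `(A, E)`, morphisms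
`(A, E) ⟶ (B, E')` are pairs `(f : A ⟶ B, ξ : E ⟶ f^* E')`. -/
abbrev El (I : Indx.{v, u}) : Type u := Pseudofunctor.CoGrothendieck I.fib

/-- An object of the category of elements. -/
def elObj (I : Indx.{v, u}) (A : I.base) (E : I.Fiber A) : I.El := ⟨A, E⟩

/-- A morphism of the category of elements. -/
def elHom (I : Indx.{v, u}) {A B : I.base} {E : I.Fiber A} {E' : I.Fiber B} (f : A ⟶ B)
    (ξ : E ⟶ (I.re f).obj E') : I.elObj A E ⟶ I.elObj B E' := ⟨f, ξ⟩

lemma elHom_ext (I : Indx.{v, u}) {A B : I.base} {E : I.Fiber A} {E' : I.Fiber B} {f g : A ⟶ B}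
    {ξ : E ⟶ (I.re f).obj E'} {ζ : E ⟶ (I.re g).obj E'} (h : f = g)
    (h' : ξ ≫ I.reCongr h E' = ζ) : I.elHom f ξ = I.elHom g ζ := by
  subst h; subst h'; simp [reCongr]

lemma elHom_inj (I : Indx.{v, u}) {A B : I.base} {E : I.Fiber A} {E' : I.Fiber B} {f g : A ⟶ B}
    {ξ : E ⟶ (I.re f).obj E'} {ζ : E ⟶ (I.re g).obj E'} (e : I.elHom f ξ = I.elHom g ζ) (h : f = g) :
    ξ ≫ I.reCongr h E' = ζ := by
  subst h
  have e' := eq_of_heq (Pseudofunctor.CoGrothendieck.Hom.mk.inj e).2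
  simp only [reCongr, eqToHom_refl, Category.comp_id]
  exact e'

lemma elHom_comp (I : Indx.{v, u}) {A B C : I.base} {E : I.Fiber A} {E' : I.Fiber B}
    {E'' : I.Fiber C} (f : A ⟶ B) (g : B ⟶ C)
    (ξ : E ⟶ (I.re f).obj E') (ζ : E' ⟶ (I.re g).obj E'') :
    I.elHom f ξ ≫ I.elHom g ζ =
      I.elHom (f ≫ g) (ξ ≫ (I.re f).map ζ ≫ I.compHom f g E'') := rfl

lemma elHom_id (I : Indx.{v, u}) (A : I.base) (E : I.Fiber A) :
    𝟙 (I.elObj A E) = I.elHom (𝟙 A) (I.idHom A E) := rfl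

/-- A `1`-morphism of indexed categories: a functor `F` between the base categories, functors
`F^A` between the fibres, and coherent isomorphisms `κ^f : F^A f^* ≅ (F f)^* F^B`. -/
structure Hom (I J : Indx.{v, u}) where
  base : I.base ⟶ J.base
  fib (A : I.base) : I.Fiber A ⥤ J.Fiber (base.toFunctor.obj A)
  κ {A B : I.base} (f : A ⟶ B) : I.re f ⋙ fib A ≅ fib B ⋙ J.re (base.toFunctor.map f)
  κ_id (A : I.base) (E : I.Fiber A) :
    (fib A).map (I.idHom A E) ≫ (κ (𝟙 A)).hom.app E =
      J.idHom (base.toFunctor.obj A) ((fib A).obj E) ≫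
        J.reCongr (base.toFunctor.map_id A).symm _
  κ_comp {A B C : I.base} (f : A ⟶ B) (g : B ⟶ C) (E : I.Fiber C) :
    (fib A).map (I.compHom f g E) ≫ (κ (f ≫ g)).hom.app E =
      (κ f).hom.app ((I.re g).obj E) ≫ (J.re (base.toFunctor.map f)).map ((κ g).hom.app E) ≫
        J.compHom (base.toFunctor.map f) (base.toFunctor.map g) ((fib C).obj E) ≫
        J.reCongr (base.toFunctor.map_comp f g).symm _

namespace Hom

variable {I J K : Indx.{v, u}}

/-- The component of `κ^f` at `E`. -/
def k (F : Hom I J) {A B : I.base} (f : A ⟶ B) (E : I.Fiber B) :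
    (F.fib A).obj ((I.re f).obj E) ⟶ (J.re (F.base.toFunctor.map f)).obj ((F.fib B).obj E) :=
  (F.κ f).hom.app E

instance k_isIso (F : Hom I J) {A B : I.base} (f : A ⟶ B) (E : I.Fiber B) : IsIso (F.k f E) :=
  inferInstanceAs (IsIso ((F.κ f).hom.app E))

lemma k_nat (F : Hom I J) {A B : I.base} (f : A ⟶ B) {E E' : I.Fiber B} (ξ : E ⟶ E') :
    (F.fib A).map ((I.re f).map ξ) ≫ F.k f E' =
      F.k f E ≫ (J.re (F.base.toFunctor.map f)).map ((F.fib B).map ξ) :=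
  (F.κ f).hom.naturality ξ

lemma k_comp (F : Hom I J) {A B C : I.base} (f : A ⟶ B) (g : B ⟶ C) (E : I.Fiber C) :
    (F.fib A).map (I.compHom f g E) ≫ F.k (f ≫ g) E =
      F.k f ((I.re g).obj E) ≫ (J.re (F.base.toFunctor.map f)).map (F.k g E) ≫
        J.compHom (F.base.toFunctor.map f) (F.base.toFunctor.map g) ((F.fib C).obj E) ≫
        J.reCongr (F.base.toFunctor.map_comp f g).symm _ :=
  F.κ_comp f g E

lemma k_id (F : Hom I J) (A : I.base) (E : I.Fiber A) :
    (F.fib A).map (I.idHom A E) ≫ F.k (𝟙 A) E =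
      J.idHom (F.base.toFunctor.obj A) ((F.fib A).obj E) ≫
        J.reCongr (F.base.toFunctor.map_id A).symm _ :=
  F.κ_id A E

/-- The action of a `1`-morphism on morphisms of the categories of elements. -/
def elMap (F : Hom I J) {A B : I.base} {E : I.Fiber A} {E' : I.Fiber B} (f : A ⟶ B)
    (ξ : E ⟶ (I.re f).obj E') :
    J.elObj (F.base.toFunctor.obj A) ((F.fib A).obj E) ⟶
      J.elObj (F.base.toFunctor.obj B) ((F.fib B).obj E') :=
  J.elHom (F.base.toFunctor.map f) ((F.fib A).map ξ ≫ F.k f E')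

lemma elMap_id (F : Hom I J) (A : I.base) (E : I.Fiber A) :
    F.elMap (𝟙 A) (I.idHom A E) = 𝟙 _ := by
  rw [elHom_id, elMap]
  refine elHom_ext _ (F.base.toFunctor.map_id A) ?_
  rw [k_id]
  simp [reCongr]

lemma elMap_comp (F : Hom I J) {A B C : I.base} {E : I.Fiber A} {E' : I.Fiber B}
    {E'' : I.Fiber C} (f : A ⟶ B) (g : B ⟶ C)
    (ξ : E ⟶ (I.re f).obj E') (ζ : E' ⟶ (I.re g).obj E'') :
    F.elMap (f ≫ g) (ξ ≫ (I.re f).map ζ ≫ I.compHom f g E'') = F.elMap f ξ ≫ F.elMap g ζ := by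
  rw [elMap, elMap, elMap, elHom_comp]
  refine elHom_ext _ (F.base.toFunctor.map_comp f g) ?_
  have h := F.k_nat f ζ
  simp only [Functor.map_comp, Category.assoc, k_comp, reassoc_of% h]
  simp [reCongr]

/-- The functor between categories of elements induced by a `1`-morphism. -/
def el (F : Hom I J) : I.El ⥤ J.El where
  obj X := J.elObj (F.base.toFunctor.obj X.base) ((F.fib X.base).obj X.fiber)
  map {X Y} f := F.elMap (E := X.fiber) (E' := Y.fiber) f.base f.fiber
  map_id X := F.elMap_id X.base X.fiber
  map_comp {X Y Z} f g := F.elMap_comp (E := X.fiber) (E' := Y.fiber) (E'' := Z.fiber)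
    f.base g.base f.fiber g.fiber

/-- The isomorphisms `κ` of a composite. -/
def compκ (F : Hom I J) (G : Hom J K) {A B : I.base} (f : A ⟶ B) :
    I.re f ⋙ F.fib A ⋙ G.fib (F.base.toFunctor.obj A) ≅
      (F.fib B ⋙ G.fib (F.base.toFunctor.obj B)) ⋙
        K.re (G.base.toFunctor.map (F.base.toFunctor.map f)) :=
  (Functor.associator _ _ _).symm ≪≫ Functor.isoWhiskerRight (F.κ f) _ ≪≫
    Functor.associator _ _ _ ≪≫
    Functor.isoWhiskerLeft (F.fib B) (G.κ (F.base.toFunctor.map f)) ≪≫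
    (Functor.associator _ _ _).symm

lemma compκ_app (F : Hom I J) (G : Hom J K) {A B : I.base} (f : A ⟶ B) (E : I.Fiber B) :
    (compκ F G f).hom.app E = (G.fib (F.base.toFunctor.obj A)).map (F.k f E) ≫
      G.k (F.base.toFunctor.map f) ((F.fib B).obj E) := by
  simp [compκ, k]

lemma elMap_elMap (F : Hom I J) (G : Hom J K) {A B : I.base} {E : I.Fiber A} {E' : I.Fiber B}
    (f : A ⟶ B) (ξ : E ⟶ (I.re f).obj E') :
    G.elMap (F.base.toFunctor.map f) ((F.fib A).map ξ ≫ F.k f E') =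
      K.elHom (G.base.toFunctor.map (F.base.toFunctor.map f))
        ((G.fib _).map ((F.fib A).map ξ) ≫ (compκ F G f).hom.app E') := by
  rw [elMap, compκ_app]
  simp

/-- Composition of `1`-morphisms. -/
def comp (F : Hom I J) (G : Hom J K) : Hom I K where
  base := F.base ≫ G.base
  fib A := F.fib A ⋙ G.fib (F.base.toFunctor.obj A)
  κ f := compκ F G f
  κ_id A E := by
    have h : G.elMap (F.base.toFunctor.map (𝟙 A)) ((F.fib A).map (I.idHom A E) ≫ F.k (𝟙 A) E) =
      𝟙 (K.elObj _ _) := (F.el ⋙ G.el).map_id (I.elObj A E)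
    rw [elMap_elMap, elHom_id] at h
    exact (elHom_inj _ h.symm ((F.base ≫ G.base).toFunctor.map_id A).symm).symm
  κ_comp {A B C} f g E := by
    have h : G.elMap (F.base.toFunctor.map (f ≫ g)) ((F.fib A).map
        (𝟙 _ ≫ (I.re f).map (𝟙 _) ≫ I.compHom f g E) ≫ F.k (f ≫ g) E) =
        G.elMap (F.base.toFunctor.map f) ((F.fib A).map (𝟙 _) ≫ F.k f ((I.re g).obj E)) ≫
        G.elMap (F.base.toFunctor.map g) ((F.fib B).map (𝟙 _) ≫ F.k g E) :=
      (F.el ⋙ G.el).map_comp (I.elHom f (𝟙 ((I.re f).obj ((I.re g).obj E))))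
        (I.elHom g (𝟙 ((I.re g).obj E)))
    rw [elMap_elMap, elMap_elMap, elMap_elMap, elHom_comp] at h
    have h2 := elHom_inj _ h.symm ((F.base ≫ G.base).toFunctor.map_comp f g).symm
    simp only [CategoryTheory.Functor.map_id, Category.id_comp, Category.assoc] at h2
    exact h2.symm

end Hom
end Indx

namespace Indx

/-- The isomorphisms `κ` of an identity. -/
def Hom.idκ (I : Indx.{v, u}) {A B : I.base} (f : A ⟶ B) :
    I.re f ⋙ 𝟭 (I.Fiber A) ≅ 𝟭 (I.Fiber B) ⋙ I.re f :=
  (I.re f).rightUnitor ≪≫ (I.re f).leftUnitor.symm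

lemma Hom.idκ_app (I : Indx.{v, u}) {A B : I.base} (f : A ⟶ B) (E : I.Fiber B) :
    (Hom.idκ I f).hom.app E = 𝟙 ((I.re f).obj E) := by
  simp [idκ]

instance : CategoryStruct Indx.{v, u} where
  Hom := Hom
  id I :=
    { base := 𝟙 _
      fib := fun A => 𝟭 _
      κ := fun f => Hom.idκ I f
      κ_id := fun A E => by
        show I.idHom A E ≫ (Hom.idκ I (𝟙 A)).hom.app E = I.idHom A E ≫ 𝟙 _
        rw [Hom.idκ_app]
      κ_comp := fun f g E => by
        show I.compHom f g E ≫ (Hom.idκ I (f ≫ g)).hom.app E =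
          (Hom.idκ I f).hom.app ((I.re g).obj E) ≫ (I.re f).map ((Hom.idκ I g).hom.app E) ≫
            I.compHom f g E ≫ 𝟙 _
        rw [Hom.idκ_app, Hom.idκ_app, Hom.idκ_app, CategoryTheory.Functor.map_id,
          Category.comp_id]
        exact ((Category.id_comp _).trans (Category.id_comp _)).symm }
  comp F G := Hom.comp F G

variable {I J K L : Indx.{v, u}}

/-- The morphism of the category of elements that is `ξ` in the fibre over `A`. -/
def elVert (I : Indx.{v, u}) {A : I.base} {E E' : I.Fiber A} (ξ : E ⟶ E') :
    I.elObj A E ⟶ I.elObj A E' := I.elHom (𝟙 A) (ξ ≫ I.idHom A E')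

lemma elVert_elHom {A B : I.base} {E E' : I.Fiber A} {E'' : I.Fiber B} (ξ : E ⟶ E')
    (f : A ⟶ B) (ζ : E' ⟶ (I.re f).obj E'') :
    I.elVert ξ ≫ I.elHom f ζ = I.elHom f (ξ ≫ ζ) := by
  have h : I.elHom (𝟙 A) (I.idHom A E') ≫ I.elHom f ζ = I.elHom f ζ :=
    Category.id_comp (I.elHom f ζ)
  rw [elHom_comp] at h
  rw [elVert, elHom_comp]
  refine I.elHom_ext (Category.id_comp f) ?_
  have h2 := I.elHom_inj h (Category.id_comp f)
  simp only [Category.assoc] at h2 ⊢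
  rw [h2]

lemma elHom_elVert {A B : I.base} {E : I.Fiber A} {E' E'' : I.Fiber B} (f : A ⟶ B)
    (ζ : E ⟶ (I.re f).obj E') (ξ : E' ⟶ E'') :
    I.elHom f ζ ≫ I.elVert ξ = I.elHom f (ζ ≫ (I.re f).map ξ) := by
  have h : I.elHom f (ζ ≫ (I.re f).map ξ) ≫ I.elHom (𝟙 B) (I.idHom B E'') =
    I.elHom f (ζ ≫ (I.re f).map ξ) := Category.comp_id _
  rw [elHom_comp] at h
  rw [elVert, elHom_comp]
  refine I.elHom_ext (Category.comp_id f) ?_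
  have h2 := I.elHom_inj h (Category.comp_id f)
  simpa only [Category.assoc, Functor.map_comp] using h2

lemma Hom.elMap_vert (F : Hom I J) {A : I.base} {E E' : I.Fiber A} (ξ : E ⟶ E') :
    F.elMap (𝟙 A) (ξ ≫ I.idHom A E') = J.elVert ((F.fib A).map ξ) := by
  rw [elMap, elVert]
  refine J.elHom_ext (F.base.toFunctor.map_id A) ?_
  rw [Functor.map_comp, Category.assoc, Category.assoc, ← Category.assoc (F.fib A |>.map (I.idHom A E')),
    F.k_id]
  simp [reCongr]

/-- A `2`-morphism of indexed categories: a natural transformation `θ` between the base functors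
and natural transformations `θ^A : F^A ⟶ θ_A^* G^A` compatible with the isomorphisms `κ`. -/
@[ext]
structure Hom₂ (F G : I ⟶ J) where
  base : F.base ⟶ G.base
  fib (A : I.base) : F.fib A ⟶ G.fib A ⋙ J.re (base.toNatTrans.app A)
  compat {A B : I.base} (f : A ⟶ B) (E : I.Fiber B) :
    ((F.κ f).hom.app E ≫ (J.re (F.base.toFunctor.map f)).map ((fib B).app E) ≫
        J.compHom (F.base.toFunctor.map f) (base.toNatTrans.app B) ((G.fib B).obj E)) ≫
      J.reCongr (base.toNatTrans.naturality f) _ =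
    (fib A).app ((I.re f).obj E) ≫ (J.re (base.toNatTrans.app A)).map ((G.κ f).hom.app E) ≫
      J.compHom (base.toNatTrans.app A) (G.base.toFunctor.map f) ((G.fib B).obj E)

namespace Hom₂

variable {F G H : I ⟶ J}

/-- The component of a `2`-morphism at `(A, E)`, a morphism of the category of elements. -/
def comp (a : Hom₂ F G) (A : I.base) (E : I.Fiber A) :
    J.elObj (F.base.toFunctor.obj A) ((F.fib A).obj E) ⟶
      J.elObj (G.base.toFunctor.obj A) ((G.fib A).obj E) :=
  J.elHom (a.base.toNatTrans.app A) ((a.fib A).app E)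

lemma comp_nat (a : Hom₂ F G) {A B : I.base} {E : I.Fiber A} {E' : I.Fiber B} (f : A ⟶ B)
    (ξ : E ⟶ (I.re f).obj E') :
    Hom.elMap F f ξ ≫ a.comp B E' = a.comp A E ≫ Hom.elMap G f ξ := by
  rw [comp, comp, Hom.elMap, Hom.elMap, elHom_comp, elHom_comp]
  refine J.elHom_ext (a.base.toNatTrans.naturality f) ?_
  have h := a.compat f E'
  have h2 := (a.fib A).naturality ξ
  simp only [Category.assoc, Functor.map_comp, Functor.comp_map, Hom.k] at h h2 ⊢
  rw [h, reassoc_of% h2]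

/-- A `2`-morphism can be given by its components, natural with respect to all morphisms of
the categories of elements. -/
def mkEl (base : F.base ⟶ G.base)
    (fib : ∀ (A : I.base) (E : I.Fiber A),
      (F.fib A).obj E ⟶ (J.re (base.toNatTrans.app A)).obj ((G.fib A).obj E))
    (nat : ∀ {A B : I.base} {E : I.Fiber A} {E' : I.Fiber B} (f : A ⟶ B)
      (ξ : E ⟶ (I.re f).obj E'),
      Hom.elMap F f ξ ≫ J.elHom (base.toNatTrans.app B) (fib B E') =
        J.elHom (base.toNatTrans.app A) (fib A E) ≫ Hom.elMap G f ξ) : Hom₂ F G where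
  base := base
  fib A :=
    { app := fib A
      naturality := fun E E' ξ => by
        have h := nat (𝟙 A) (ξ ≫ I.idHom A E')
        rw [Hom.elMap_vert, Hom.elMap_vert, elVert_elHom, elHom_elVert] at h
        simpa [reCongr] using J.elHom_inj h rfl }
  compat f E := by
    have h := nat f (𝟙 ((I.re f).obj E))
    rw [Hom.elMap, Hom.elMap, elHom_comp, elHom_comp] at h
    have h2 := J.elHom_inj h (base.toNatTrans.naturality f)
    simp only [CategoryTheory.Functor.map_id, Category.id_comp] at h2
    exact h2

lemma ext_comp {a b : Hom₂ F G} (h : a.base = b.base) (h' : ∀ A E, a.comp A E = b.comp A E) :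
    a = b := by
  obtain ⟨a, fa, ha⟩ := a
  obtain ⟨b, fb, hb⟩ := b
  dsimp at h
  subst h
  congr 1
  funext A
  ext E
  simpa [reCongr] using J.elHom_inj (h' A E) rfl

end Hom₂

instance : Category (I ⟶ J) where
  Hom F G := Hom₂ F G
  id F := Hom₂.mkEl (𝟙 F.base) (fun A E => J.idHom _ _) (fun f ξ => by
    exact (Category.comp_id (Hom.elMap F f ξ)).trans (Category.id_comp _).symm)
  comp {F G H} a b := Hom₂.mkEl (a.base ≫ b.base)
    (fun A E => (a.fib A).app E ≫ (J.re (a.base.toNatTrans.app A)).map ((b.fib A).app E) ≫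
      J.compHom _ _ _)
    (fun {A B E E'} f ξ => by
      show Hom.elMap F f ξ ≫ Hom₂.comp a B E' ≫ Hom₂.comp b B E' =
        (Hom₂.comp a A E ≫ Hom₂.comp b A E) ≫ Hom.elMap H f ξ
      rw [Category.assoc, ← Hom₂.comp_nat, ← Category.assoc, Hom₂.comp_nat, Category.assoc])
  id_comp {F G} a := Hom₂.ext_comp (Category.id_comp a.base)
    (fun A E => Category.id_comp (Hom₂.comp a A E))
  comp_id {F G} a := Hom₂.ext_comp (Category.comp_id a.base)
    (fun A E => Category.comp_id (Hom₂.comp a A E))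
  assoc {F G H K} a b c := Hom₂.ext_comp (Category.assoc a.base b.base c.base)
    (fun A E => Category.assoc (Hom₂.comp a A E) (Hom₂.comp b A E) (Hom₂.comp c A E))

lemma hom₂_ext {F G : I ⟶ J} {a b : F ⟶ G} (h : Hom₂.base a = Hom₂.base b)
    (h' : ∀ A E, Hom₂.comp a A E = Hom₂.comp b A E) : a = b := Hom₂.ext_comp h h'

lemma comp_comp {F G H : I ⟶ J} (a : F ⟶ G) (b : G ⟶ H) (A : I.base) (E : I.Fiber A) :
    Hom₂.comp (a ≫ b) A E = Hom₂.comp a A E ≫ Hom₂.comp b A E := rfl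

lemma comp_id (F : I ⟶ J) (A : I.base) (E : I.Fiber A) : Hom₂.comp (𝟙 F) A E = 𝟙 _ := rfl

lemma Hom.elMap_comp' (F : I ⟶ J) (G : J ⟶ K) {A B : I.base} {E : I.Fiber A} {E' : I.Fiber B}
    (f : A ⟶ B) (ξ : E ⟶ (I.re f).obj E') :
    Hom.elMap (F ≫ G) f ξ =
      Hom.elMap G ((Hom.base F).toFunctor.map f) ((Hom.fib F A).map ξ ≫ Hom.k F f E') := by
  rw [elMap_elMap]
  rfl

lemma Hom.elMap_id' (I : Indx.{v, u}) {A B : I.base} {E : I.Fiber A} {E' : I.Fiber B}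
    (f : A ⟶ B) (ξ : E ⟶ (I.re f).obj E') :
    Hom.elMap (𝟙 I) f ξ = I.elHom f ξ := by
  show I.elHom f (ξ ≫ (Hom.idκ I f).hom.app E') = _
  rw [Hom.idκ_app]
  exact congrArg _ (Category.comp_id ξ)

/-- Whiskering on the left. -/
def wL (F : I ⟶ J) {G H : J ⟶ K} (a : G ⟶ H) : F ≫ G ⟶ F ≫ H :=
  Hom₂.mkEl (F := F ≫ G) (G := F ≫ H) (Hom.base F ◁ Hom₂.base a)
    (fun A E => (Hom₂.fib a ((Hom.base F).toFunctor.obj A)).app ((Hom.fib F A).obj E))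
    (fun {A B E E'} f ξ => by
      rw [Hom.elMap_comp', Hom.elMap_comp']
      exact Hom₂.comp_nat a _ _)

/-- Whiskering on the right. -/
def wR {F G : I ⟶ J} (a : F ⟶ G) (H : J ⟶ K) : F ≫ H ⟶ G ≫ H :=
  Hom₂.mkEl (F := F ≫ H) (G := G ≫ H) (Hom₂.base a ▷ Hom.base H)
    (fun A E => (Hom.fib H _).map ((Hom₂.fib a A).app E) ≫
      Hom.k H ((Hom₂.base a).toNatTrans.app A) ((Hom.fib G A).obj E))
    (fun {A B E E'} f ξ => by
      rw [Hom.elMap_comp', Hom.elMap_comp']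
      exact ((Hom.el H).map_comp (Hom.elMap F f ξ) (Hom₂.comp a B E')).symm.trans
        ((congrArg (Hom.el H).map (Hom₂.comp_nat a f ξ)).trans
          ((Hom.el H).map_comp (Hom₂.comp a A E) (Hom.elMap G f ξ))))

lemma comp_wL (F : I ⟶ J) {G H : J ⟶ K} (a : G ⟶ H) (A : I.base) (E : I.Fiber A) :
    Hom₂.comp (wL F a) A E = Hom₂.comp a ((Hom.base F).toFunctor.obj A) ((Hom.fib F A).obj E) :=
  rfl

lemma comp_wR {F G : I ⟶ J} (a : F ⟶ G) (H : J ⟶ K) (A : I.base) (E : I.Fiber A) :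
    Hom₂.comp (wR a H) A E = (Hom.el H).map (Hom₂.comp a A E) :=
  rfl

lemma Hom.elMap_el (F : I ⟶ J) (G : J ⟶ K) {A B : I.base} {E : I.Fiber A} {E' : I.Fiber B}
    (f : A ⟶ B) (ξ : E ⟶ (I.re f).obj E') :
    Hom.elMap (F ≫ G) f ξ = (Hom.el G).map (Hom.elMap F f ξ) :=
  Hom.elMap_comp' F G f ξ

lemma Hom.elMap_assoc (F : I ⟶ J) (G : J ⟶ K) (H : K ⟶ L) {A B : I.base} {E : I.Fiber A}
    {E' : I.Fiber B} (f : A ⟶ B) (ξ : E ⟶ (I.re f).obj E') :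
    Hom.elMap ((F ≫ G) ≫ H) f ξ = Hom.elMap (F ≫ G ≫ H) f ξ := by
  rw [Hom.elMap_el, Hom.elMap_el, Hom.elMap_el]
  exact (Hom.elMap_el G H _ _).symm

/-- The associator, with identity components. -/
def assoc (F : I ⟶ J) (G : J ⟶ K) (H : K ⟶ L) : (F ≫ G) ≫ H ≅ F ≫ G ≫ H where
  hom := Hom₂.mkEl (F := (F ≫ G) ≫ H) (G := F ≫ G ≫ H)
    (α_ (Hom.base F) (Hom.base G) (Hom.base H)).hom
    (fun A E => L.idHom _ _)
    (fun f ξ => (Category.comp_id _).trans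
      ((Hom.elMap_assoc F G H f ξ).trans (Category.id_comp _).symm))
  inv := Hom₂.mkEl (F := F ≫ G ≫ H) (G := (F ≫ G) ≫ H)
    (α_ (Hom.base F) (Hom.base G) (Hom.base H)).inv
    (fun A E => L.idHom _ _)
    (fun f ξ => (Category.comp_id _).trans
      ((Hom.elMap_assoc F G H f ξ).symm.trans (Category.id_comp _).symm))
  hom_inv_id := hom₂_ext (α_ (Hom.base F) (Hom.base G) (Hom.base H)).hom_inv_id
    (fun A E => show 𝟙 (L.elObj _ _) ≫ 𝟙 (L.elObj _ _) = 𝟙 _ from Category.comp_id _)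
  inv_hom_id := hom₂_ext (α_ (Hom.base F) (Hom.base G) (Hom.base H)).inv_hom_id
    (fun A E => show 𝟙 (L.elObj _ _) ≫ 𝟙 (L.elObj _ _) = 𝟙 _ from Category.comp_id _)

lemma Hom.elMap_idl (F : I ⟶ J) {A B : I.base} {E : I.Fiber A}
    {E' : I.Fiber B} (f : A ⟶ B) (ξ : E ⟶ (I.re f).obj E') :
    Hom.elMap (𝟙 I ≫ F) f ξ = Hom.elMap F f ξ := by
  rw [Hom.elMap_el, Hom.elMap_id']
  rfl

lemma Hom.elMap_idr (F : I ⟶ J) {A B : I.base} {E : I.Fiber A}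
    {E' : I.Fiber B} (f : A ⟶ B) (ξ : E ⟶ (I.re f).obj E') :
    Hom.elMap (F ≫ 𝟙 J) f ξ = Hom.elMap F f ξ := by
  rw [Hom.elMap_el]
  exact Hom.elMap_id' J _ _

/-- The left unitor, with identity components. -/
def unitL (F : I ⟶ J) : 𝟙 I ≫ F ≅ F where
  hom := Hom₂.mkEl (F := 𝟙 I ≫ F) (G := F) (λ_ (Hom.base F)).hom
    (fun A E => J.idHom _ _)
    (fun f ξ => (Category.comp_id _).trans
      ((Hom.elMap_idl F f ξ).trans (Category.id_comp _).symm))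
  inv := Hom₂.mkEl (F := F) (G := 𝟙 I ≫ F) (λ_ (Hom.base F)).inv
    (fun A E => J.idHom _ _)
    (fun f ξ => (Category.comp_id _).trans
      ((Hom.elMap_idl F f ξ).symm.trans (Category.id_comp _).symm))
  hom_inv_id := hom₂_ext (λ_ (Hom.base F)).hom_inv_id
    (fun A E => show 𝟙 (J.elObj _ _) ≫ 𝟙 (J.elObj _ _) = 𝟙 _ from Category.comp_id _)
  inv_hom_id := hom₂_ext (λ_ (Hom.base F)).inv_hom_id
    (fun A E => show 𝟙 (J.elObj _ _) ≫ 𝟙 (J.elObj _ _) = 𝟙 _ from Category.comp_id _)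

/-- The right unitor, with identity components. -/
def unitR (F : I ⟶ J) : F ≫ 𝟙 J ≅ F where
  hom := Hom₂.mkEl (F := F ≫ 𝟙 J) (G := F) (ρ_ (Hom.base F)).hom
    (fun A E => J.idHom _ _)
    (fun f ξ => (Category.comp_id _).trans
      ((Hom.elMap_idr F f ξ).trans (Category.id_comp _).symm))
  inv := Hom₂.mkEl (F := F) (G := F ≫ 𝟙 J) (ρ_ (Hom.base F)).inv
    (fun A E => J.idHom _ _)
    (fun f ξ => (Category.comp_id _).trans
      ((Hom.elMap_idr F f ξ).symm.trans (Category.id_comp _).symm))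
  hom_inv_id := hom₂_ext (ρ_ (Hom.base F)).hom_inv_id
    (fun A E => show 𝟙 (J.elObj _ _) ≫ 𝟙 (J.elObj _ _) = 𝟙 _ from Category.comp_id _)
  inv_hom_id := hom₂_ext (ρ_ (Hom.base F)).inv_hom_id
    (fun A E => show 𝟙 (J.elObj _ _) ≫ 𝟙 (J.elObj _ _) = 𝟙 _ from Category.comp_id _)

lemma el_id_map {X Y : I.El} (f : X ⟶ Y) : (Hom.el (𝟙 I)).map f = f :=
  Hom.elMap_id' I _ _

lemma el_comp_map (F : I ⟶ J) (G : J ⟶ K) {X Y : I.El} (f : X ⟶ Y) :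
    (Hom.el (F ≫ G)).map f = (Hom.el G).map ((Hom.el F).map f) :=
  Hom.elMap_el F G _ _

instance : Bicategory Indx.{v, u} where
  homCategory := inferInstance
  whiskerLeft F _ _ a := wL F a
  whiskerRight a H := wR a H
  associator F G H := assoc F G H
  leftUnitor F := unitL F
  rightUnitor F := unitR F
  whiskerLeft_id _ _ := hom₂_ext (Bicategory.whiskerLeft_id _ _) (fun _ _ => rfl)
  whiskerLeft_comp _ _ _ _ _ _ := hom₂_ext (Bicategory.whiskerLeft_comp _ _ _) (fun _ _ => rfl)
  id_whiskerLeft _ := hom₂_ext (Bicategory.id_whiskerLeft _)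
    (fun _ _ => ((Category.id_comp _).trans (Category.comp_id _)).symm)
  comp_whiskerLeft _ _ _ _ _ := hom₂_ext (Bicategory.comp_whiskerLeft _ _ _)
    (fun _ _ => ((Category.id_comp _).trans (Category.comp_id _)).symm)
  id_whiskerRight F H := hom₂_ext (Bicategory.id_whiskerRight _ _)
    (fun A E => (Hom.el H).map_id (elObj _ ((Hom.base F).toFunctor.obj A) ((Hom.fib F A).obj E)))
  comp_whiskerRight a b H := hom₂_ext (Bicategory.comp_whiskerRight _ _ _)
    (fun A E => (Hom.el H).map_comp (Hom₂.comp a A E) (Hom₂.comp b A E))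
  whiskerRight_id a := hom₂_ext (Bicategory.whiskerRight_id _)
    (fun A E => (el_id_map (Hom₂.comp a A E)).trans
      ((Category.id_comp _).trans (Category.comp_id _)).symm)
  whiskerRight_comp a G H := hom₂_ext (Bicategory.whiskerRight_comp _ _ _)
    (fun A E => (el_comp_map G H (Hom₂.comp a A E)).trans
      ((Category.id_comp _).trans (Category.comp_id _)).symm)
  whisker_assoc _ _ _ _ _ := hom₂_ext (Bicategory.whisker_assoc _ _ _)
    (fun _ _ => ((Category.id_comp _).trans (Category.comp_id _)).symm)
  whisker_exchange a b := hom₂_ext (Bicategory.whisker_exchange _ _)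
    (fun A E => (Hom₂.comp_nat b (Hom₂.comp a A E).base (Hom₂.comp a A E).fiber).symm)
  pentagon F G H K := hom₂_ext (Bicategory.pentagon _ _ _ _)
    (fun A E => by
      have h := (Hom.el K).map_id ((Hom.el H).obj ((Hom.el G).obj ((Hom.el F).obj (elObj _ A E))))
      exact (congrArg (· ≫ 𝟙 _ ≫ 𝟙 _) h).trans (Category.id_comp _))
  triangle F G := hom₂_ext (Bicategory.triangle _ _)
    (fun A E => by
      have h := (Hom.el G).map_id ((Hom.el F).obj (elObj _ A E))
      exact (Category.comp_id _).trans h.symm)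

lemma Hom.ext' {F G : I ⟶ J} (hb : Hom.base F = Hom.base G)
    (hf : ∀ A, HEq (Hom.fib F A) (Hom.fib G A))
    (h : ∀ {A B : I.base} (f : A ⟶ B) (E : I.Fiber B), HEq (Hom.k F f E) (Hom.k G f E)) :
    F = G := by
  obtain ⟨bF, fF, kF, _, _⟩ := F
  obtain ⟨bG, fG, kG, _, _⟩ := G
  dsimp at hb
  subst hb
  obtain rfl : fF = fG := funext fun A => eq_of_heq (hf A)
  congr 1
  ext A B f E
  exact eq_of_heq (h f E)

lemma k_comp' (F : I ⟶ J) (G : J ⟶ K) {A B : I.base} (f : A ⟶ B) (E : I.Fiber B) :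
    Hom.k (F ≫ G) f E = (Hom.fib G _).map (Hom.k F f E) ≫
      Hom.k G ((Hom.base F).toFunctor.map f) ((Hom.fib F B).obj E) :=
  Hom.compκ_app F G f E

lemma k_id' (I : Indx.{v, u}) {A B : I.base} (f : A ⟶ B) (E : I.Fiber B) :
    Hom.k (𝟙 I) f E = 𝟙 ((I.re f).obj E) :=
  Hom.idκ_app I f E

lemma id_comp_eq (F : I ⟶ J) : 𝟙 I ≫ F = F :=
  Hom.ext' rfl (fun _ => HEq.rfl) (fun f E => heq_of_eq (by
    refine (k_comp' (𝟙 I) F f E).trans ?_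
    rw [k_id']
    exact (congrArg (· ≫ _) ((Hom.fib F _).map_id _)).trans (Category.id_comp _)))

lemma comp_id_eq (F : I ⟶ J) : F ≫ 𝟙 J = F :=
  Hom.ext' rfl (fun _ => HEq.rfl) (fun f E => heq_of_eq (by
    refine (k_comp' F (𝟙 J) f E).trans ?_
    rw [k_id']
    exact Category.comp_id _))

lemma assoc_eq (F : I ⟶ J) (G : J ⟶ K) (H : K ⟶ L) : (F ≫ G) ≫ H = F ≫ G ≫ H :=
  Hom.ext' rfl (fun _ => HEq.rfl) (fun f E => heq_of_eq (by
    refine (k_comp' (F ≫ G) H f E).trans (Eq.trans ?_ (k_comp' F (G ≫ H) f E).symm)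
    rw [k_comp', k_comp']
    exact (congrArg (· ≫ _) ((Hom.fib H _).map_comp _ _)).trans (Category.assoc _ _ _)))

lemma eqToHom_base {F G : I ⟶ J} (h : F = G) :
    Hom₂.base (eqToHom h : F ⟶ G) = eqToHom (congrArg Hom.base h) := by
  subst h; rfl

lemma eqToHom_comp {F G : I ⟶ J} (h : F = G) (A : I.base) (E : I.Fiber A) :
    Hom₂.comp (eqToHom h : F ⟶ G) A E =
      eqToHom (congrArg (fun H : I ⟶ J => (Hom.el H).obj (I.elObj A E)) h) := by
  subst h; rfl

instance : Bicategory.Strict Indx.{v, u} where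
  id_comp := id_comp_eq
  comp_id := comp_id_eq
  assoc := assoc_eq
  leftUnitor_eqToIso F := Iso.ext (hom₂_ext
    (((congrArg Iso.hom (Strict.leftUnitor_eqToIso (Hom.base F))).trans rfl).trans
      (eqToHom_base (id_comp_eq F)).symm) (fun A E => (eqToHom_comp (id_comp_eq F) A E).symm))
  rightUnitor_eqToIso F := Iso.ext (hom₂_ext
    (((congrArg Iso.hom (Strict.rightUnitor_eqToIso (Hom.base F))).trans rfl).trans
      (eqToHom_base (comp_id_eq F)).symm) (fun A E => (eqToHom_comp (comp_id_eq F) A E).symm))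
  associator_eqToIso F G H := Iso.ext (hom₂_ext
    (((congrArg Iso.hom (Strict.associator_eqToIso (Hom.base F) (Hom.base G) (Hom.base H))).trans
      rfl).trans
      (eqToHom_base (assoc_eq F G H)).symm) (fun A E => (eqToHom_comp (assoc_eq F G H) A E).symm))

/-- The `2`-functor that sends an indexed category to its base category. -/
def baseFunctor : StrictPseudofunctor Indx.{v, u} Cat.{v, u} :=
  StrictPseudofunctor.mk'
    { obj I := I.base
      map F := Hom.base F
      map₂ a := Hom₂.base a
      map₂_id _ := rfl
      map₂_comp _ _ := rfl
      map_id _ := rfl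
      map_comp _ _ := rfl
      map₂_whisker_left _ _ _ _ := ((Category.id_comp _).trans (Category.comp_id _)).symm
      map₂_whisker_right _ _ := ((Category.id_comp _).trans (Category.comp_id _)).symm
      map₂_left_unitor _ := (Category.id_comp _).symm
      map₂_right_unitor _ := (Category.id_comp _).symm
      map₂_associator _ _ _ := ((Category.id_comp _).trans (Category.comp_id _)).symm }

end Indx

/-! ### The Grothendieck construction -/

namespace Groth

variable {I J K : Indx.{v, u}}

lemma isHomLift_elHom (I : Indx.{v, u}) {A B : I.base} {E : I.Fiber A} {E' : I.Fiber B} (f : A ⟶ B)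
    (ξ : E ⟶ (I.re f).obj E') :
    (Pseudofunctor.CoGrothendieck.forget I.fib).IsHomLift f (I.elHom f ξ) :=
  IsHomLift.map (Pseudofunctor.CoGrothendieck.forget I.fib) (I.elHom f ξ)

lemma lift_cart (I : Indx.{v, u}) {A B : I.base} (f : A ⟶ B) (E : I.Fiber B) :
    (Pseudofunctor.CoGrothendieck.forget I.fib).IsStronglyCartesian f
      (I.elHom f (𝟙 ((I.re f).obj E))) :=
  Pseudofunctor.CoGrothendieck.isStronglyCartesian_homCartesianLift (F := I.fib) E f

lemma elHom_cart (I : Indx.{v, u}) {A B : I.base} {E : I.Fiber A} {E' : I.Fiber B} (f : A ⟶ B)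
    (ξ : E ⟶ (I.re f).obj E') [IsIso ξ] :
    (Pseudofunctor.CoGrothendieck.forget I.fib).IsStronglyCartesian f (I.elHom f ξ) := by
  have h1 : I.elVert ξ ≫ I.elVert (inv ξ) = 𝟙 _ := by
    conv_lhs => arg 2; rw [Indx.elVert]
    rw [Indx.elVert_elHom, ← Category.assoc, IsIso.hom_inv_id, Category.id_comp]
    rfl
  have h2 : I.elVert (inv ξ) ≫ I.elVert ξ = 𝟙 _ := by
    conv_lhs => arg 2; rw [Indx.elVert]
    rw [Indx.elVert_elHom, ← Category.assoc, IsIso.inv_hom_id, Category.id_comp]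
    rfl
  have : IsIso (I.elVert ξ) := ⟨_, h1, h2⟩
  have : (Pseudofunctor.CoGrothendieck.forget I.fib).IsHomLift (𝟙 A) (I.elVert ξ) :=
    isHomLift_elHom I (𝟙 A) (ξ ≫ I.idHom A _)
  have hv : (Pseudofunctor.CoGrothendieck.forget I.fib).IsStronglyCartesian (𝟙 A)
    (I.elVert ξ) := Functor.IsStronglyCartesian.of_isIso _ _ _
  have hl := lift_cart I f E'
  have h := Functor.IsStronglyCartesian.comp (Pseudofunctor.CoGrothendieck.forget I.fib)
    (f := 𝟙 A) (g := f) (φ := I.elVert ξ) (ψ := I.elHom f (𝟙 ((I.re f).obj E')))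
  rw [Indx.elVert_elHom, Category.comp_id] at h
  have e : 𝟙 A ≫ f = f := Category.id_comp f
  rw [e] at h
  exact h

/-- The cloven fibration of elements of an indexed category. -/
def obj (I : Indx.{v, u}) : Fib.{v, u} where
  base := I.base
  total := Cat.of I.El
  proj := (Pseudofunctor.CoGrothendieck.forget I.fib).toCatHom
  pull {A} E f := I.elObj A ((I.re f).obj E.fiber)
  lift {A} E f := I.elHom (E' := E.fiber) f (𝟙 ((I.re f).obj E.fiber))
  cart E f := lift_cart I f E.fiber

/-- The Grothendieck construction on `1`-morphisms. -/
def map (F : I ⟶ J) : obj I ⟶ obj J where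
  base := Indx.Hom.base F
  total := (Indx.Hom.el F).toCatHom
  comm := rfl
  cart {A} E f := by
    have : IsIso ((Indx.Hom.fib F A).map (𝟙 ((I.re f).obj E.fiber)) ≫ Indx.Hom.k F f E.fiber) := by
      rw [CategoryTheory.Functor.map_id, Category.id_comp]
      exact Indx.Hom.k_isIso F f E.fiber
    exact elHom_cart J ((Indx.Hom.base F).toFunctor.map f)
      ((Indx.Hom.fib F A).map (𝟙 _) ≫ Indx.Hom.k F f E.fiber)

/-- The Grothendieck construction on `2`-morphisms. -/
def map₂ {F G : I ⟶ J} (a : F ⟶ G) : map F ⟶ map G where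
  base := Indx.Hom₂.base a
  total := NatTrans.toCatHom₂
    { app := fun X => Indx.Hom₂.comp a X.base X.fiber
      naturality := fun X Y f => Indx.Hom₂.comp_nat a f.base f.fiber }
  isLift E := isHomLift_elHom J _ _

lemma map_id (I : Indx.{v, u}) : map (𝟙 I) = 𝟙 (obj I) :=
  Fib.Hom.ext rfl (congrArg Functor.toCatHom
    (CategoryTheory.Functor.hext (fun _ => rfl) (fun _ _ f => heq_of_eq (Indx.el_id_map f))))

lemma map_comp (F : I ⟶ J) (G : J ⟶ K) : map (F ≫ G) = map F ≫ map G :=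
  Fib.Hom.ext rfl (congrArg Functor.toCatHom
    (CategoryTheory.Functor.hext (fun _ => rfl) (fun _ _ f => heq_of_eq (Indx.el_comp_map F G f))))

lemma eq_conj {P Q : Fib.{v, u}} {F F' G G' : P ⟶ Q} (h : F = G) (h' : G' = F')
    (a : F ⟶ F') (b : G ⟶ G')
    (hb : ∀ A, HEq ((Fib.Hom₂.base a).toNatTrans.app A) ((Fib.Hom₂.base b).toNatTrans.app A))
    (ht : ∀ A, HEq ((Fib.Hom₂.total a).toNatTrans.app A) ((Fib.Hom₂.total b).toNatTrans.app A)) :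
    a = eqToHom h ≫ b ≫ eqToHom h' := by
  subst h
  subst h'
  simp only [eqToHom_refl, Category.comp_id, Category.id_comp]
  exact Fib.hom₂_ext (Cat.Hom₂.ext (NatTrans.ext (funext fun A => eq_of_heq (hb A))))
    (Cat.Hom₂.ext (NatTrans.ext (funext fun A => eq_of_heq (ht A))))

end Groth

/-- The Grothendieck construction, a `2`-functor from indexed categories to cloven fibrations. -/
def grothendieck : StrictPseudofunctor Indx.{v, u} Fib.{v, u} :=
  StrictPseudofunctor.mk''
    { obj := Groth.obj
      map := Groth.map
      map₂ := Groth.map₂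
      map₂_id _ := rfl
      map₂_comp _ _ := rfl
      map_id := Groth.map_id
      map_comp := Groth.map_comp
      map₂_whisker_left F G H a :=
        Groth.eq_conj _ _ _ _ (fun _ => HEq.rfl) (fun _ => HEq.rfl)
      map₂_whisker_right a F :=
        Groth.eq_conj _ _ _ _ (fun _ => HEq.rfl) (fun _ => HEq.rfl) }

/-! ### Equivalences of `2`-categories -/

section Equivalence

variable {B : Type u₁} [Bicategory.{w₁, v₁} B] {C : Type u₂} [Bicategory.{w₂, v₂} C]

/-- A `2`-natural isomorphism between `2`-functors. -/
structure TwoNatIso (F G : StrictPseudofunctor B C) where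
  app (X : B) : F.obj X ⟶ G.obj X
  inv (X : B) : G.obj X ⟶ F.obj X
  app_inv (X : B) : app X ≫ inv X = 𝟙 (F.obj X)
  inv_app (X : B) : inv X ≫ app X = 𝟙 (G.obj X)
  nat {X Y : B} (f : X ⟶ Y) : F.map f ≫ app Y = app X ≫ G.map f
  nat₂ {X Y : B} {f g : X ⟶ Y} (η : f ⟶ g) :
    F.map₂ η ▷ app Y ≫ eqToHom (nat g) = eqToHom (nat f) ≫ app X ◁ G.map₂ η

variable (B C) in
/-- A `2`-equivalence of `2`-categories: `2`-functors in both directions whose composites are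
`2`-naturally isomorphic to the identities. -/
structure TwoEquivalence where
  functor : StrictPseudofunctor B C
  inverse : StrictPseudofunctor C B
  unit : TwoNatIso (StrictPseudofunctor.id B) (functor.comp inverse)
  counit : TwoNatIso (inverse.comp functor) (StrictPseudofunctor.id C)

end Equivalence

/-! ### Sub-`2`-categories -/

section Sub

variable {B : Type u₁} [Bicategory.{w₁, v₁} B] {O : Type u₂}

variable (B O) in
/-- A family of objects of a `2`-category, together with classes of `1`-morphisms and of
`2`-morphisms between them that are closed under all operations. -/
structure SubData where
  ι : O → B
  one {a b : O} (f : ι a ⟶ ι b) : Prop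
  two {a b : O} {f g : ι a ⟶ ι b} (η : f ⟶ g) : Prop
  one_id (a : O) : one (𝟙 (ι a))
  one_comp {a b c : O} (f : ι a ⟶ ι b) (g : ι b ⟶ ι c) : one f → one g → one (f ≫ g)
  two_id {a b : O} (f : ι a ⟶ ι b) : two (𝟙 f)
  two_comp {a b : O} {f g h : ι a ⟶ ι b} (η : f ⟶ g) (θ : g ⟶ h) : two η → two θ → two (η ≫ θ)
  two_left {a b c : O} (f : ι a ⟶ ι b) {g h : ι b ⟶ ι c} (η : g ⟶ h) :
    one f → two η → two (f ◁ η)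
  two_right {a b c : O} {f g : ι a ⟶ ι b} (η : f ⟶ g) (h : ι b ⟶ ι c) :
    one h → two η → two (η ▷ h)
  two_assoc {a b c d : O} (f : ι a ⟶ ι b) (g : ι b ⟶ ι c) (h : ι c ⟶ ι d) :
    two (α_ f g h).hom ∧ two (α_ f g h).inv
  two_unitL {a b : O} (f : ι a ⟶ ι b) : two (λ_ f).hom ∧ two (λ_ f).inv
  two_unitR {a b : O} (f : ι a ⟶ ι b) : two (ρ_ f).hom ∧ two (ρ_ f).inv

/-- The sub-`2`-category given by `S`. -/
structure Sub (S : SubData B O) where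
  as : O

namespace Sub

variable {S : SubData B O}

/-- The `1`-morphisms of a sub-`2`-category. -/
@[ext]
structure Hom (a b : Sub S) where
  hom : S.ι a.as ⟶ S.ι b.as
  prop : S.one hom

instance : CategoryStruct (Sub S) where
  Hom := Hom
  id a := ⟨𝟙 _, S.one_id _⟩
  comp f g := ⟨f.hom ≫ g.hom, S.one_comp _ _ f.prop g.prop⟩

/-- The `2`-morphisms of a sub-`2`-category. -/
@[ext]
structure Hom₂ {a b : Sub S} (f g : a ⟶ b) where
  hom : f.hom ⟶ g.hom
  prop : S.two hom

instance {a b : Sub S} : Category (a ⟶ b) where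
  Hom f g := Hom₂ f g
  id f := ⟨𝟙 _, S.two_id _⟩
  comp η θ := ⟨η.hom ≫ θ.hom, S.two_comp _ _ η.prop θ.prop⟩
  id_comp η := Hom₂.ext (Category.id_comp η.hom)
  comp_id η := Hom₂.ext (Category.comp_id η.hom)
  assoc η θ ζ := Hom₂.ext (Category.assoc η.hom θ.hom ζ.hom)

/-- An invertible `2`-morphism of a sub-`2`-category. -/
def isoMk {a b : Sub S} {f g : a ⟶ b} (e : Hom.hom f ≅ Hom.hom g)
    (h : S.two e.hom ∧ S.two e.inv) : f ≅ g where
  hom := ⟨e.hom, h.1⟩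
  inv := ⟨e.inv, h.2⟩
  hom_inv_id := Hom₂.ext e.hom_inv_id
  inv_hom_id := Hom₂.ext e.inv_hom_id

instance : Bicategory (Sub S) where
  homCategory := inferInstance
  whiskerLeft f _ _ η := ⟨Hom.hom f ◁ Hom₂.hom η, S.two_left _ _ f.prop η.prop⟩
  whiskerRight η h := ⟨Hom₂.hom η ▷ Hom.hom h, S.two_right _ _ h.prop η.prop⟩
  associator f g h := isoMk (α_ f.hom g.hom h.hom) (S.two_assoc _ _ _)
  leftUnitor f := isoMk (λ_ f.hom) (S.two_unitL _)
  rightUnitor f := isoMk (ρ_ f.hom) (S.two_unitR _)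
  whiskerLeft_id _ _ := Hom₂.ext (whiskerLeft_id _ _)
  whiskerLeft_comp _ _ _ _ _ _ := Hom₂.ext (whiskerLeft_comp _ _ _)
  id_whiskerLeft _ := Hom₂.ext (id_whiskerLeft _)
  comp_whiskerLeft _ _ _ _ _ := Hom₂.ext (comp_whiskerLeft _ _ _)
  id_whiskerRight _ _ := Hom₂.ext (id_whiskerRight _ _)
  comp_whiskerRight _ _ _ := Hom₂.ext (comp_whiskerRight _ _ _)
  whiskerRight_id _ := Hom₂.ext (whiskerRight_id _)
  whiskerRight_comp _ _ _ := Hom₂.ext (whiskerRight_comp _ _ _)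
  whisker_assoc _ _ _ _ _ := Hom₂.ext (whisker_assoc _ _ _)
  whisker_exchange _ _ := Hom₂.ext (whisker_exchange _ _)
  pentagon _ _ _ _ := Hom₂.ext (pentagon _ _ _ _)
  triangle _ _ := Hom₂.ext (triangle _ _)

lemma eqToHom_hom {a b : Sub S} {f g : a ⟶ b} (h : f = g) :
    Hom₂.hom (eqToHom h : f ⟶ g) = eqToHom (congrArg Hom.hom h) := by
  subst h; rfl

lemma id_comp_eq [Strict B] {a b : Sub S} (f : a ⟶ b) : 𝟙 a ≫ f = f :=
  Hom.ext (Strict.id_comp (Hom.hom f))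

lemma comp_id_eq [Strict B] {a b : Sub S} (f : a ⟶ b) : f ≫ 𝟙 b = f :=
  Hom.ext (Strict.comp_id (Hom.hom f))

lemma assoc_eq [Strict B] {a b c d : Sub S} (f : a ⟶ b) (g : b ⟶ c) (h : c ⟶ d) :
    (f ≫ g) ≫ h = f ≫ g ≫ h :=
  Hom.ext (Strict.assoc (Hom.hom f) (Hom.hom g) (Hom.hom h))

instance [Strict B] : Strict (Sub S) where
  id_comp := id_comp_eq
  comp_id := comp_id_eq
  assoc := assoc_eq
  leftUnitor_eqToIso f := Iso.ext (Hom₂.ext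
    ((congrArg Iso.hom (Strict.leftUnitor_eqToIso (Hom.hom f))).trans
      (eqToHom_hom (id_comp_eq f)).symm))
  rightUnitor_eqToIso f := Iso.ext (Hom₂.ext
    ((congrArg Iso.hom (Strict.rightUnitor_eqToIso (Hom.hom f))).trans
      (eqToHom_hom (comp_id_eq f)).symm))
  associator_eqToIso f g h := Iso.ext (Hom₂.ext
    ((congrArg Iso.hom (Strict.associator_eqToIso (Hom.hom f) (Hom.hom g) (Hom.hom h))).trans
      (eqToHom_hom (assoc_eq f g h)).symm))

/-- The inclusion of a sub-`2`-category. -/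
def incl (S : SubData B O) : StrictPseudofunctor (Sub S) B :=
  StrictPseudofunctor.mk'
    { obj a := S.ι a.as
      map f := Hom.hom f
      map₂ η := Hom₂.hom η
      map₂_id _ := rfl
      map₂_comp _ _ := rfl
      map_id _ := rfl
      map_comp _ _ := rfl
      map₂_whisker_left _ _ _ _ := ((Category.id_comp _).trans (Category.comp_id _)).symm
      map₂_whisker_right _ _ := ((Category.id_comp _).trans (Category.comp_id _)).symm
      map₂_left_unitor _ := (Category.id_comp _).symm
      map₂_right_unitor _ := (Category.id_comp _).symm
      map₂_associator _ _ _ := ((Category.id_comp _).trans (Category.comp_id _)).symm }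

end Sub

/-- The closure of a class of `1`-morphisms under identities and composition. -/
inductive Gen (ι : O → B) (V : ∀ a b : O, (ι a ⟶ ι b) → Prop) : ∀ a b : O, (ι a ⟶ ι b) → Prop
  | of {a b : O} (f : ι a ⟶ ι b) : V a b f → Gen ι V a b f
  | id (a : O) : Gen ι V a a (𝟙 (ι a))
  | comp {a b c : O} (f : ι a ⟶ ι b) (g : ι b ⟶ ι c) :
      Gen ι V a b f → Gen ι V b c g → Gen ι V a c (f ≫ g)

/-- The locally full sub-`2`-category with the objects `ι a` whose `1`-morphisms are the
composites of `1`-morphisms in the class `V`. -/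
def genData (ι : O → B) (V : ∀ a b : O, (ι a ⟶ ι b) → Prop) : SubData B O where
  ι := ι
  one {a b} f := Gen ι V a b f
  two _ := True
  one_id a := Gen.id a
  one_comp f g hf hg := Gen.comp f g hf hg
  two_id _ := trivial
  two_comp _ _ _ _ := trivial
  two_left _ _ _ _ _ _ := trivial
  two_right _ _ _ _ := trivial
  two_assoc _ _ _ := ⟨trivial, trivial⟩
  two_unitL _ := ⟨trivial, trivial⟩
  two_unitR _ := ⟨trivial, trivial⟩

/-- The sub-`2`-category of those `1`-morphisms and `2`-morphisms between the objects `ι a` that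
the `2`-functor `P` sends to identities. -/
def vertData [Strict B] {C : Type u₃} [Bicategory.{w₂, v₂} C] [Strict C]
    (P : StrictPseudofunctor B C) (ι : O → B) : SubData B O where
  ι := ι
  one {a b} f := ∃ h : P.obj (ι a) = P.obj (ι b), P.map f = eqToHom h
  two {a b f g} η := ∃ h : P.map f = P.map g, P.map₂ η = eqToHom h
  one_id a := ⟨rfl, P.map_id _⟩
  one_comp f g := by
    rintro ⟨h, e⟩ ⟨h', e'⟩
    exact ⟨h.trans h', by rw [P.map_comp, e, e', eqToHom_trans]⟩
  two_id f := ⟨rfl, P.map₂_id f⟩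
  two_comp η θ := by
    rintro ⟨h, e⟩ ⟨h', e'⟩
    exact ⟨h.trans h', by rw [P.map₂_comp, e, e', eqToHom_trans]⟩
  two_left f g h η := by
    rintro - ⟨e, he⟩
    refine ⟨by rw [P.map_comp, P.map_comp, e], ?_⟩
    rw [P.map₂_whisker_left, he, whiskerLeft_eqToHom, P.mapComp_eq_eqToIso,
      P.mapComp_eq_eqToIso, eqToIso.hom, eqToIso.inv, eqToHom_trans, eqToHom_trans]
  two_right η h := by
    rintro - ⟨e, he⟩
    refine ⟨by rw [P.map_comp, P.map_comp, e], ?_⟩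
    rw [P.map₂_whisker_right, he, eqToHom_whiskerRight, P.mapComp_eq_eqToIso,
      P.mapComp_eq_eqToIso, eqToIso.hom, eqToIso.inv, eqToHom_trans, eqToHom_trans]
  two_assoc f g h := by
    rw [Strict.associator_eqToIso]
    exact ⟨⟨by rw [Strict.assoc], by rw [eqToIso.hom, PrelaxFunctor.map₂_eqToHom]⟩,
      ⟨by rw [Strict.assoc], by rw [eqToIso.inv, PrelaxFunctor.map₂_eqToHom]⟩⟩
  two_unitL f := by
    rw [Strict.leftUnitor_eqToIso]
    exact ⟨⟨by rw [Strict.id_comp], by rw [eqToIso.hom, PrelaxFunctor.map₂_eqToHom]⟩,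
      ⟨by rw [Strict.id_comp], by rw [eqToIso.inv, PrelaxFunctor.map₂_eqToHom]⟩⟩
  two_unitR f := by
    rw [Strict.rightUnitor_eqToIso]
    exact ⟨⟨by rw [Strict.comp_id], by rw [eqToIso.hom, PrelaxFunctor.map₂_eqToHom]⟩,
      ⟨by rw [Strict.comp_id], by rw [eqToIso.inv, PrelaxFunctor.map₂_eqToHom]⟩⟩

end Sub

/-! ### Endomorphisms with lax and colax distributive laws -/

/-- An object with an endomorphism. -/
structure EndLax (K : Type u₁) [Bicategory.{w₁, v₁} K] where
  carrier : K
  T : carrier ⟶ carrier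

namespace EndLax

variable {K : Type u₁} [Bicategory.{w₁, v₁} K]

/-- A `1`-morphism `F` with a lax distributive law `F ∘ T ⇒ T' ∘ F`. -/
structure Hom (X Y : EndLax K) where
  one : X.carrier ⟶ Y.carrier
  law : X.T ≫ one ⟶ one ≫ Y.T

instance : CategoryStruct (EndLax K) where
  Hom := Hom
  id X := ⟨𝟙 _, (ρ_ X.T).hom ≫ (λ_ X.T).inv⟩
  comp {X Y Z} F G := ⟨F.one ≫ G.one, (α_ X.T F.one G.one).inv ≫ F.law ▷ G.one ≫
    (α_ F.one Y.T G.one).hom ≫ F.one ◁ G.law ≫ (α_ F.one G.one Z.T).inv⟩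

/-- A `2`-morphism compatible with the distributive laws. -/
@[ext]
structure Hom₂ {X Y : EndLax K} (F G : X ⟶ Y) where
  two : F.one ⟶ G.one
  compat : F.law ≫ two ▷ Y.T = X.T ◁ two ≫ G.law

instance {X Y : EndLax K} : Category (X ⟶ Y) where
  Hom F G := Hom₂ F G
  id F := ⟨𝟙 _, by simp⟩
  comp a b := ⟨a.two ≫ b.two, by
    rw [comp_whiskerRight, reassoc_of% a.compat, b.compat, whiskerLeft_comp, Category.assoc]⟩
  id_comp a := Hom₂.ext (Category.id_comp a.two)
  comp_id a := Hom₂.ext (Category.comp_id a.two)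
  assoc a b c := Hom₂.ext (Category.assoc a.two b.two c.two)

/-- An invertible `2`-morphism. -/
def isoMk {X Y : EndLax K} {F G : X ⟶ Y} (e : Hom.one F ≅ Hom.one G)
    (h : F.law ≫ e.hom ▷ Y.T = X.T ◁ e.hom ≫ G.law) : F ≅ G where
  hom := ⟨e.hom, h⟩
  inv := ⟨e.inv, by
    rw [← cancel_epi (X.T ◁ e.hom), ← reassoc_of% h]
    simp⟩
  hom_inv_id := Hom₂.ext e.hom_inv_id
  inv_hom_id := Hom₂.ext e.inv_hom_id

instance : Bicategory (EndLax K) where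
  homCategory := inferInstance
  whiskerLeft {X Y Z} F G H a := ⟨Hom.one F ◁ Hom₂.two a, by
    have h := Hom₂.compat a
    show ((α_ X.T F.one G.one).inv ≫ F.law ▷ G.one ≫
      (α_ F.one Y.T G.one).hom ≫ F.one ◁ G.law ≫ (α_ F.one G.one Z.T).inv) ≫ _ = _ ≫
      ((α_ X.T F.one H.one).inv ≫ F.law ▷ H.one ≫
      (α_ F.one Y.T H.one).hom ≫ F.one ◁ H.law ≫ (α_ F.one H.one Z.T).inv)
    have h1 : F.one ◁ G.law ≫ F.one ◁ (Hom₂.two a ▷ Z.T) =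
        F.one ◁ (Y.T ◁ Hom₂.two a) ≫ F.one ◁ H.law := by
      rw [← Bicategory.whiskerLeft_comp, ← Bicategory.whiskerLeft_comp, h]
    have h2 := whisker_exchange F.law (Hom₂.two a)
    simp only [Category.assoc]
    rw [← associator_inv_naturality_middle, reassoc_of% h1, ← associator_naturality_right_assoc, ← reassoc_of% h2,
      ← associator_inv_naturality_right_assoc]⟩
  whiskerRight {X Y Z} F G a H := ⟨Hom₂.two a ▷ Hom.one H, by
    have h := Hom₂.compat a
    show ((α_ X.T F.one H.one).inv ≫ F.law ▷ H.one ≫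
      (α_ F.one Y.T H.one).hom ≫ F.one ◁ H.law ≫ (α_ F.one H.one Z.T).inv) ≫ _ = _ ≫
      ((α_ X.T G.one H.one).inv ≫ G.law ▷ H.one ≫
      (α_ G.one Y.T H.one).hom ≫ G.one ◁ H.law ≫ (α_ G.one H.one Z.T).inv)
    have h1 : F.law ▷ H.one ≫ (Hom₂.two a ▷ Y.T) ▷ H.one =
        (X.T ◁ Hom₂.two a) ▷ H.one ≫ G.law ▷ H.one := by
      rw [← Bicategory.comp_whiskerRight, ← Bicategory.comp_whiskerRight, h]
    have h2 := whisker_exchange (Hom₂.two a) H.law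
    simp only [Category.assoc]
    rw [← associator_inv_naturality_left, reassoc_of% h2, ← associator_naturality_left_assoc,
      reassoc_of% h1, ← associator_inv_naturality_middle_assoc]⟩
  associator {X Y Z W} F G H := isoMk (α_ F.one G.one H.one) (by
    show ((α_ X.T (F.one ≫ G.one) H.one).inv ≫ ((α_ X.T F.one G.one).inv ≫ F.law ▷ G.one ≫
      (α_ F.one Y.T G.one).hom ≫ F.one ◁ G.law ≫ (α_ F.one G.one Z.T).inv) ▷ H.one ≫
      (α_ (F.one ≫ G.one) Z.T H.one).hom ≫ (F.one ≫ G.one) ◁ H.law ≫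
      (α_ (F.one ≫ G.one) H.one W.T).inv) ≫ _ = _ ≫
      ((α_ X.T F.one (G.one ≫ H.one)).inv ≫ F.law ▷ (G.one ≫ H.one) ≫
      (α_ F.one Y.T (G.one ≫ H.one)).hom ≫ F.one ◁ ((α_ Y.T G.one H.one).inv ≫ G.law ▷ H.one ≫
      (α_ G.one Z.T H.one).hom ≫ G.one ◁ H.law ≫ (α_ G.one H.one W.T).inv) ≫
      (α_ F.one (G.one ≫ H.one) W.T).inv)
    simp)
  leftUnitor {X Y} F := isoMk (λ_ F.one) (by
    show ((α_ X.T (𝟙 _) F.one).inv ≫ ((ρ_ X.T).hom ≫ (λ_ X.T).inv) ▷ F.one ≫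
      (α_ (𝟙 _) X.T F.one).hom ≫ (𝟙 _) ◁ F.law ≫ (α_ (𝟙 _) F.one Y.T).inv) ≫ _ = _ ≫ F.law
    simp)
  rightUnitor {X Y} F := isoMk (ρ_ F.one) (by
    show ((α_ X.T F.one (𝟙 _)).inv ≫ F.law ▷ (𝟙 _) ≫
      (α_ F.one Y.T (𝟙 _)).hom ≫ F.one ◁ ((ρ_ Y.T).hom ≫ (λ_ Y.T).inv) ≫
      (α_ F.one (𝟙 _) Y.T).inv) ≫ _ = _ ≫ F.law
    simp)
  whiskerLeft_id _ _ := Hom₂.ext (whiskerLeft_id _ _)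
  whiskerLeft_comp _ _ _ _ _ _ := Hom₂.ext (whiskerLeft_comp _ _ _)
  id_whiskerLeft _ := Hom₂.ext (id_whiskerLeft _)
  comp_whiskerLeft _ _ _ _ _ := Hom₂.ext (comp_whiskerLeft _ _ _)
  id_whiskerRight _ _ := Hom₂.ext (id_whiskerRight _ _)
  comp_whiskerRight _ _ _ := Hom₂.ext (comp_whiskerRight _ _ _)
  whiskerRight_id _ := Hom₂.ext (whiskerRight_id _)
  whiskerRight_comp _ _ _ := Hom₂.ext (whiskerRight_comp _ _ _)
  whisker_assoc _ _ _ _ _ := Hom₂.ext (whisker_assoc _ _ _)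
  whisker_exchange _ _ := Hom₂.ext (whisker_exchange _ _)
  pentagon _ _ _ _ := Hom₂.ext (pentagon _ _ _ _)
  triangle _ _ := Hom₂.ext (triangle _ _)

lemma eq_mk {X Y : EndLax K} (F G : X ⟶ Y) (h : F.one = G.one)
    (h' : F.law ≫ eqToHom h ▷ Y.T = X.T ◁ eqToHom h ≫ G.law) : F = G := by
  obtain ⟨F, f⟩ := F
  obtain ⟨G, g⟩ := G
  dsimp at h
  subst h
  congr 1
  simpa using h'

lemma eqToHom_two {X Y : EndLax K} {F G : X ⟶ Y} (h : F = G) :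
    (eqToHom h : F ⟶ G).two = eqToHom (congrArg Hom.one h) := by
  subst h; rfl

lemma id_comp_eq [Strict K] {X Y : EndLax K} (F : X ⟶ Y) : 𝟙 X ≫ F = F :=
  eq_mk _ _ (Strict.id_comp F.one) (by
    have h := Hom₂.compat (λ_ F).hom
    have e : Hom₂.two (λ_ F).hom = eqToHom (Strict.id_comp F.one) :=
      congrArg Iso.hom (Strict.leftUnitor_eqToIso F.one)
    rwa [e] at h)

lemma comp_id_eq [Strict K] {X Y : EndLax K} (F : X ⟶ Y) : F ≫ 𝟙 Y = F :=
  eq_mk _ _ (Strict.comp_id F.one) (by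
    have h := Hom₂.compat (ρ_ F).hom
    have e : Hom₂.two (ρ_ F).hom = eqToHom (Strict.comp_id F.one) :=
      congrArg Iso.hom (Strict.rightUnitor_eqToIso F.one)
    rwa [e] at h)

lemma assoc_eq [Strict K] {X Y Z W : EndLax K} (F : X ⟶ Y) (G : Y ⟶ Z) (H : Z ⟶ W) :
    (F ≫ G) ≫ H = F ≫ G ≫ H :=
  eq_mk _ _ (Strict.assoc F.one G.one H.one) (by
    have h := Hom₂.compat (α_ F G H).hom
    have e : Hom₂.two (α_ F G H).hom = eqToHom (Strict.assoc F.one G.one H.one) :=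
      congrArg Iso.hom (Strict.associator_eqToIso F.one G.one H.one)
    rwa [e] at h)

instance [Strict K] : Strict (EndLax K) where
  id_comp := id_comp_eq
  comp_id := comp_id_eq
  assoc := assoc_eq
  leftUnitor_eqToIso F := Iso.ext (Hom₂.ext
    ((congrArg Iso.hom (Strict.leftUnitor_eqToIso F.one)).trans
      (eqToHom_two (id_comp_eq F)).symm))
  rightUnitor_eqToIso F := Iso.ext (Hom₂.ext
    ((congrArg Iso.hom (Strict.rightUnitor_eqToIso F.one)).trans
      (eqToHom_two (comp_id_eq F)).symm))
  associator_eqToIso F G H := Iso.ext (Hom₂.ext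
    ((congrArg Iso.hom (Strict.associator_eqToIso F.one G.one H.one)).trans
      (eqToHom_two (assoc_eq F G H)).symm))

section Map

variable {L : Type u₂} [Bicategory.{w₂, v₂} L]

/-- The action of a `2`-functor on `1`-morphisms with distributive laws. -/
def mapHom (P : StrictPseudofunctor K L) {X Y : EndLax K} (F : X ⟶ Y) :
    (⟨P.obj X.carrier, P.map X.T⟩ : EndLax L) ⟶ ⟨P.obj Y.carrier, P.map Y.T⟩ where
  one := P.map F.one
  law := (P.mapComp X.T F.one).inv ≫ P.map₂ F.law ≫ (P.mapComp F.one Y.T).hom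

/-- The action of a `2`-functor on `2`-morphisms. -/
def mapHom₂ (P : StrictPseudofunctor K L) {X Y : EndLax K} {F G : X ⟶ Y} (a : F ⟶ G) :
    mapHom P F ⟶ mapHom P G where
  two := P.map₂ a.two
  compat := by
    have h := congrArg P.map₂ (Hom₂.compat a)
    rw [P.map₂_comp, P.map₂_comp, P.map₂_whisker_left, P.map₂_whisker_right] at h
    simp only [mapHom, Category.assoc]
    rw [← cancel_epi (P.mapComp X.T F.one).hom, ← cancel_mono (P.mapComp G.one Y.T).inv]
    simpa using h

lemma mapHom_id [Strict K] [Strict L] (P : StrictPseudofunctor K L) (X : EndLax K) :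
    mapHom P (𝟙 X) = 𝟙 _ := eq_mk _ _ (P.map_id X.carrier) (by
        show ((P.mapComp X.T (𝟙 _)).inv ≫ P.map₂ ((ρ_ X.T).hom ≫ (λ_ X.T).inv) ≫
          (P.mapComp (𝟙 _) X.T).hom) ≫ eqToHom (P.map_id X.carrier) ▷ P.map X.T =
            P.map X.T ◁ eqToHom (P.map_id X.carrier) ≫ (ρ_ _).hom ≫ (λ_ _).inv
        simp [Strict.leftUnitor_eqToIso, Strict.rightUnitor_eqToIso,
          PrelaxFunctor.map₂_eqToHom, P.mapComp_eq_eqToIso])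

lemma mapHom_comp [Strict K] [Strict L] (P : StrictPseudofunctor K L) {X Y Z : EndLax K}
    (F : X ⟶ Y) (G : Y ⟶ Z) : mapHom P (F ≫ G) = mapHom P F ≫ mapHom P G := eq_mk _ _ (P.map_comp F.one G.one) (by
        show ((P.mapComp X.T (F.one ≫ G.one)).inv ≫ P.map₂ ((α_ X.T F.one G.one).inv ≫
          F.law ▷ G.one ≫ (α_ F.one Y.T G.one).hom ≫ F.one ◁ G.law ≫ (α_ F.one G.one Z.T).inv) ≫
          (P.mapComp (F.one ≫ G.one) Z.T).hom) ≫ eqToHom (P.map_comp F.one G.one) ▷ P.map Z.T =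
          P.map X.T ◁ eqToHom (P.map_comp F.one G.one) ≫
          ((α_ _ _ _).inv ≫
          ((P.mapComp X.T F.one).inv ≫ P.map₂ F.law ≫ (P.mapComp F.one Y.T).hom) ▷ P.map G.one ≫
          (α_ _ _ _).hom ≫
          P.map F.one ◁ ((P.mapComp Y.T G.one).inv ≫ P.map₂ G.law ≫ (P.mapComp G.one Z.T).hom) ≫
            (α_ _ _ _).inv)
        simp [Strict.associator_eqToIso, PrelaxFunctor.map₂_eqToHom, P.mapComp_eq_eqToIso])

/-- The action of a `2`-functor on objects with an endomorphism. -/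
def map [Strict K] [Strict L] (P : StrictPseudofunctor K L) :
    StrictPseudofunctor (EndLax K) (EndLax L) :=
  StrictPseudofunctor.mk''
    { obj X := ⟨P.obj X.carrier, P.map X.T⟩
      map F := mapHom P F
      map₂ a := mapHom₂ P a
      map₂_id _ := Hom₂.ext (P.map₂_id _)
      map₂_comp _ _ := Hom₂.ext (P.map₂_comp _ _)
      map_id X := mapHom_id P X
      map_comp F G := mapHom_comp P F G
      map₂_whisker_left F G H a := Hom₂.ext (by
        refine Eq.trans ?_ (congrArg₂ (fun x y => x ≫ Hom.one (mapHom P F) ◁ P.map₂ (Hom₂.two a) ≫ y)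
          (eqToHom_two (mapHom_comp P F G)) (eqToHom_two (mapHom_comp P F H).symm)).symm
        refine (P.map₂_whisker_left F.one (Hom₂.two a)).trans ?_
        rw [P.mapComp_eq_eqToIso, P.mapComp_eq_eqToIso]
        rfl)
      map₂_whisker_right a F := Hom₂.ext (by
        refine Eq.trans ?_ (congrArg₂ (fun x y => x ≫ P.map₂ (Hom₂.two a) ▷ Hom.one (mapHom P F) ≫ y)
          (eqToHom_two (mapHom_comp P _ F)) (eqToHom_two (mapHom_comp P _ F).symm)).symm
        refine (P.map₂_whisker_right (Hom₂.two a) F.one).trans ?_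
        rw [P.mapComp_eq_eqToIso, P.mapComp_eq_eqToIso]
        rfl) }

end Map

end EndLax

/-- An object with an endomorphism. -/
structure EndColax (K : Type u₁) [Bicategory.{w₁, v₁} K] where
  carrier : K
  T : carrier ⟶ carrier

namespace EndColax

variable {K : Type u₁} [Bicategory.{w₁, v₁} K]

/-- A `1`-morphism `F` with a colax distributive law `T' ∘ F ⇒ F ∘ T`. -/
structure Hom (X Y : EndColax K) where
  one : X.carrier ⟶ Y.carrier
  law : one ≫ Y.T ⟶ X.T ≫ one

instance : CategoryStruct (EndColax K) where
  Hom := Hom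
  id X := ⟨𝟙 _, (λ_ X.T).hom ≫ (ρ_ X.T).inv⟩
  comp {X Y Z} F G := ⟨F.one ≫ G.one, (α_ F.one G.one Z.T).hom ≫ F.one ◁ G.law ≫
    (α_ F.one Y.T G.one).inv ≫ F.law ▷ G.one ≫ (α_ X.T F.one G.one).hom⟩

/-- A `2`-morphism compatible with the distributive laws. -/
@[ext]
structure Hom₂ {X Y : EndColax K} (F G : X ⟶ Y) where
  two : F.one ⟶ G.one
  compat : F.law ≫ X.T ◁ two = two ▷ Y.T ≫ G.law

instance {X Y : EndColax K} : Category (X ⟶ Y) where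
  Hom F G := Hom₂ F G
  id F := ⟨𝟙 _, by simp⟩
  comp a b := ⟨a.two ≫ b.two, by
    rw [whiskerLeft_comp, reassoc_of% a.compat, b.compat, comp_whiskerRight, Category.assoc]⟩
  id_comp a := Hom₂.ext (Category.id_comp a.two)
  comp_id a := Hom₂.ext (Category.comp_id a.two)
  assoc a b c := Hom₂.ext (Category.assoc a.two b.two c.two)

/-- An invertible `2`-morphism. -/
def isoMk {X Y : EndColax K} {F G : X ⟶ Y} (e : Hom.one F ≅ Hom.one G)
    (h : F.law ≫ X.T ◁ e.hom = e.hom ▷ Y.T ≫ G.law) : F ≅ G where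
  hom := ⟨e.hom, h⟩
  inv := ⟨e.inv, by
    rw [← cancel_epi (e.hom ▷ Y.T), ← reassoc_of% h]
    simp⟩
  hom_inv_id := Hom₂.ext e.hom_inv_id
  inv_hom_id := Hom₂.ext e.inv_hom_id

instance : Bicategory (EndColax K) where
  homCategory := inferInstance
  whiskerLeft {X Y Z} F G H a := ⟨Hom.one F ◁ Hom₂.two a, by
    have h := Hom₂.compat a
    show ((α_ F.one G.one Z.T).hom ≫ F.one ◁ G.law ≫ (α_ F.one Y.T G.one).inv ≫
      F.law ▷ G.one ≫ (α_ X.T F.one G.one).hom) ≫ _ = _ ≫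
      ((α_ F.one H.one Z.T).hom ≫ F.one ◁ H.law ≫ (α_ F.one Y.T H.one).inv ≫
      F.law ▷ H.one ≫ (α_ X.T F.one H.one).hom)
    have h1 : F.one ◁ G.law ≫ F.one ◁ (Y.T ◁ Hom₂.two a) =
        F.one ◁ (Hom₂.two a ▷ Z.T) ≫ F.one ◁ H.law := by
      rw [← Bicategory.whiskerLeft_comp, ← Bicategory.whiskerLeft_comp, h]
    have h2 := whisker_exchange F.law (Hom₂.two a)
    simp only [Category.assoc]
    rw [← associator_naturality_right, ← reassoc_of% h2, ← associator_inv_naturality_right_assoc,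
      reassoc_of% h1, ← associator_naturality_middle_assoc]⟩
  whiskerRight {X Y Z} F G a H := ⟨Hom₂.two a ▷ Hom.one H, by
    have h := Hom₂.compat a
    show ((α_ F.one H.one Z.T).hom ≫ F.one ◁ H.law ≫ (α_ F.one Y.T H.one).inv ≫
      F.law ▷ H.one ≫ (α_ X.T F.one H.one).hom) ≫ _ = _ ≫
      ((α_ G.one H.one Z.T).hom ≫ G.one ◁ H.law ≫ (α_ G.one Y.T H.one).inv ≫
      G.law ▷ H.one ≫ (α_ X.T G.one H.one).hom)
    have h1 : F.law ▷ H.one ≫ (X.T ◁ Hom₂.two a) ▷ H.one =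
        (Hom₂.two a ▷ Y.T) ▷ H.one ≫ G.law ▷ H.one := by
      rw [← Bicategory.comp_whiskerRight, ← Bicategory.comp_whiskerRight, h]
    have h2 := whisker_exchange (Hom₂.two a) H.law
    simp only [Category.assoc]
    rw [← associator_naturality_middle, reassoc_of% h1, ← associator_inv_naturality_left_assoc,
      reassoc_of% h2, ← associator_naturality_left_assoc]⟩
  associator {X Y Z W} F G H := isoMk (α_ F.one G.one H.one) (by
    show ((α_ (F.one ≫ G.one) H.one W.T).hom ≫ (F.one ≫ G.one) ◁ H.law ≫
      (α_ (F.one ≫ G.one) Z.T H.one).inv ≫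
      ((α_ F.one G.one Z.T).hom ≫ F.one ◁ G.law ≫
      (α_ F.one Y.T G.one).inv ≫ F.law ▷ G.one ≫ (α_ X.T F.one G.one).hom) ▷ H.one ≫
      (α_ X.T (F.one ≫ G.one) H.one).hom) ≫ _ = _ ≫
      ((α_ F.one (G.one ≫ H.one) W.T).hom ≫ F.one ◁ ((α_ G.one H.one W.T).hom ≫ G.one ◁ H.law ≫
      (α_ G.one Z.T H.one).inv ≫ G.law ▷ H.one ≫ (α_ Y.T G.one H.one).hom) ≫
      (α_ F.one Y.T (G.one ≫ H.one)).inv ≫ F.law ▷ (G.one ≫ H.one) ≫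
      (α_ X.T F.one (G.one ≫ H.one)).hom)
    simp)
  leftUnitor {X Y} F := isoMk (λ_ F.one) (by
    show ((α_ (𝟙 _) F.one Y.T).hom ≫ (𝟙 _) ◁ F.law ≫ (α_ (𝟙 _) X.T F.one).inv ≫
      ((λ_ X.T).hom ≫ (ρ_ X.T).inv) ▷ F.one ≫ (α_ X.T (𝟙 _) F.one).hom) ≫ _ = _ ≫ F.law
    simp)
  rightUnitor {X Y} F := isoMk (ρ_ F.one) (by
    show ((α_ F.one (𝟙 _) Y.T).hom ≫ F.one ◁ ((λ_ Y.T).hom ≫ (ρ_ Y.T).inv) ≫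
      (α_ F.one Y.T (𝟙 _)).inv ≫ F.law ▷ (𝟙 _) ≫ (α_ X.T F.one (𝟙 _)).hom) ≫ _ = _ ≫ F.law
    simp)
  whiskerLeft_id _ _ := Hom₂.ext (whiskerLeft_id _ _)
  whiskerLeft_comp _ _ _ _ _ _ := Hom₂.ext (whiskerLeft_comp _ _ _)
  id_whiskerLeft _ := Hom₂.ext (id_whiskerLeft _)
  comp_whiskerLeft _ _ _ _ _ := Hom₂.ext (comp_whiskerLeft _ _ _)
  id_whiskerRight _ _ := Hom₂.ext (id_whiskerRight _ _)
  comp_whiskerRight _ _ _ := Hom₂.ext (comp_whiskerRight _ _ _)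
  whiskerRight_id _ := Hom₂.ext (whiskerRight_id _)
  whiskerRight_comp _ _ _ := Hom₂.ext (whiskerRight_comp _ _ _)
  whisker_assoc _ _ _ _ _ := Hom₂.ext (whisker_assoc _ _ _)
  whisker_exchange _ _ := Hom₂.ext (whisker_exchange _ _)
  pentagon _ _ _ _ := Hom₂.ext (pentagon _ _ _ _)
  triangle _ _ := Hom₂.ext (triangle _ _)

lemma eq_mk {X Y : EndColax K} (F G : X ⟶ Y) (h : F.one = G.one)
    (h' : F.law ≫ X.T ◁ eqToHom h = eqToHom h ▷ Y.T ≫ G.law) : F = G := by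
  obtain ⟨F, f⟩ := F
  obtain ⟨G, g⟩ := G
  dsimp at h
  subst h
  congr 1
  simpa using h'

lemma eqToHom_two {X Y : EndColax K} {F G : X ⟶ Y} (h : F = G) :
    (eqToHom h : F ⟶ G).two = eqToHom (congrArg Hom.one h) := by
  subst h; rfl

lemma id_comp_eq [Strict K] {X Y : EndColax K} (F : X ⟶ Y) : 𝟙 X ≫ F = F :=
  eq_mk _ _ (Strict.id_comp F.one) (by
    have h := Hom₂.compat (λ_ F).hom
    have e : Hom₂.two (λ_ F).hom = eqToHom (Strict.id_comp F.one) :=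
      congrArg Iso.hom (Strict.leftUnitor_eqToIso F.one)
    rwa [e] at h)

lemma comp_id_eq [Strict K] {X Y : EndColax K} (F : X ⟶ Y) : F ≫ 𝟙 Y = F :=
  eq_mk _ _ (Strict.comp_id F.one) (by
    have h := Hom₂.compat (ρ_ F).hom
    have e : Hom₂.two (ρ_ F).hom = eqToHom (Strict.comp_id F.one) :=
      congrArg Iso.hom (Strict.rightUnitor_eqToIso F.one)
    rwa [e] at h)

lemma assoc_eq [Strict K] {X Y Z W : EndColax K} (F : X ⟶ Y) (G : Y ⟶ Z) (H : Z ⟶ W) :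
    (F ≫ G) ≫ H = F ≫ G ≫ H :=
  eq_mk _ _ (Strict.assoc F.one G.one H.one) (by
    have h := Hom₂.compat (α_ F G H).hom
    have e : Hom₂.two (α_ F G H).hom = eqToHom (Strict.assoc F.one G.one H.one) :=
      congrArg Iso.hom (Strict.associator_eqToIso F.one G.one H.one)
    rwa [e] at h)

instance [Strict K] : Strict (EndColax K) where
  id_comp := id_comp_eq
  comp_id := comp_id_eq
  assoc := assoc_eq
  leftUnitor_eqToIso F := Iso.ext (Hom₂.ext
    ((congrArg Iso.hom (Strict.leftUnitor_eqToIso F.one)).trans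
      (eqToHom_two (id_comp_eq F)).symm))
  rightUnitor_eqToIso F := Iso.ext (Hom₂.ext
    ((congrArg Iso.hom (Strict.rightUnitor_eqToIso F.one)).trans
      (eqToHom_two (comp_id_eq F)).symm))
  associator_eqToIso F G H := Iso.ext (Hom₂.ext
    ((congrArg Iso.hom (Strict.associator_eqToIso F.one G.one H.one)).trans
      (eqToHom_two (assoc_eq F G H)).symm))

section Map

variable {L : Type u₂} [Bicategory.{w₂, v₂} L]

/-- The action of a `2`-functor on `1`-morphisms with distributive laws. -/
def mapHom (P : StrictPseudofunctor K L) {X Y : EndColax K} (F : X ⟶ Y) :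
    (⟨P.obj X.carrier, P.map X.T⟩ : EndColax L) ⟶ ⟨P.obj Y.carrier, P.map Y.T⟩ where
  one := P.map F.one
  law := (P.mapComp F.one Y.T).inv ≫ P.map₂ F.law ≫ (P.mapComp X.T F.one).hom

/-- The action of a `2`-functor on `2`-morphisms. -/
def mapHom₂ (P : StrictPseudofunctor K L) {X Y : EndColax K} {F G : X ⟶ Y} (a : F ⟶ G) :
    mapHom P F ⟶ mapHom P G where
  two := P.map₂ a.two
  compat := by
    have h := congrArg P.map₂ (Hom₂.compat a)
    rw [P.map₂_comp, P.map₂_comp, P.map₂_whisker_left, P.map₂_whisker_right] at h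
    simp only [mapHom, Category.assoc]
    rw [← cancel_epi (P.mapComp F.one Y.T).hom, ← cancel_mono (P.mapComp X.T G.one).inv]
    simpa using h

lemma mapHom_id [Strict K] [Strict L] (P : StrictPseudofunctor K L) (X : EndColax K) :
    mapHom P (𝟙 X) = 𝟙 _ :=
  eq_mk _ _ (P.map_id X.carrier) (by
    show ((P.mapComp (𝟙 _) X.T).inv ≫ P.map₂ ((λ_ X.T).hom ≫ (ρ_ X.T).inv) ≫
      (P.mapComp X.T (𝟙 _)).hom) ≫ P.map X.T ◁ eqToHom (P.map_id X.carrier) =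
        eqToHom (P.map_id X.carrier) ▷ P.map X.T ≫ (λ_ _).hom ≫ (ρ_ _).inv
    simp [Strict.leftUnitor_eqToIso, Strict.rightUnitor_eqToIso,
      PrelaxFunctor.map₂_eqToHom, P.mapComp_eq_eqToIso])

lemma mapHom_comp [Strict K] [Strict L] (P : StrictPseudofunctor K L) {X Y Z : EndColax K}
    (F : X ⟶ Y) (G : Y ⟶ Z) : mapHom P (F ≫ G) = mapHom P F ≫ mapHom P G :=
  eq_mk _ _ (P.map_comp F.one G.one) (by
    show ((P.mapComp (F.one ≫ G.one) Z.T).inv ≫ P.map₂ ((α_ F.one G.one Z.T).hom ≫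
      F.one ◁ G.law ≫ (α_ F.one Y.T G.one).inv ≫ F.law ▷ G.one ≫ (α_ X.T F.one G.one).hom) ≫
      (P.mapComp X.T (F.one ≫ G.one)).hom) ≫ P.map X.T ◁ eqToHom (P.map_comp F.one G.one) =
      eqToHom (P.map_comp F.one G.one) ▷ P.map Z.T ≫ ((α_ _ _ _).hom ≫
      P.map F.one ◁ ((P.mapComp G.one Z.T).inv ≫ P.map₂ G.law ≫ (P.mapComp Y.T G.one).hom) ≫
      (α_ _ _ _).inv ≫
      ((P.mapComp F.one Y.T).inv ≫ P.map₂ F.law ≫ (P.mapComp X.T F.one).hom) ▷ P.map G.one ≫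
      (α_ _ _ _).hom)
    simp [Strict.associator_eqToIso, PrelaxFunctor.map₂_eqToHom, P.mapComp_eq_eqToIso])

/-- The action of a `2`-functor on objects with an endomorphism. -/
def map [Strict K] [Strict L] (P : StrictPseudofunctor K L) :
    StrictPseudofunctor (EndColax K) (EndColax L) :=
  StrictPseudofunctor.mk''
    { obj X := ⟨P.obj X.carrier, P.map X.T⟩
      map F := mapHom P F
      map₂ a := mapHom₂ P a
      map₂_id _ := Hom₂.ext (P.map₂_id _)
      map₂_comp _ _ := Hom₂.ext (P.map₂_comp _ _)
      map_id X := mapHom_id P X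
      map_comp F G := mapHom_comp P F G
      map₂_whisker_left F G H a := Hom₂.ext (by
        refine Eq.trans ?_ (congrArg₂ (fun x y => x ≫ Hom.one (mapHom P F) ◁ P.map₂ (Hom₂.two a) ≫ y)
          (eqToHom_two (mapHom_comp P F G)) (eqToHom_two (mapHom_comp P F H).symm)).symm
        refine (P.map₂_whisker_left F.one (Hom₂.two a)).trans ?_
        rw [P.mapComp_eq_eqToIso, P.mapComp_eq_eqToIso]
        rfl)
      map₂_whisker_right a F := Hom₂.ext (by
        refine Eq.trans ?_ (congrArg₂ (fun x y => x ≫ P.map₂ (Hom₂.two a) ▷ Hom.one (mapHom P F) ≫ y)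
          (eqToHom_two (mapHom_comp P _ F)) (eqToHom_two (mapHom_comp P _ F).symm)).symm
        refine (P.map₂_whisker_right (Hom₂.two a) F.one).trans ?_
        rw [P.mapComp_eq_eqToIso, P.mapComp_eq_eqToIso]
        rfl) }

end Map

end EndColax

/-! ### Additive bundles -/

/-- `P`, with projections `π i`, is the `n`-fold pullback of `q` along itself. -/
structure IsNFoldPullback {C : Type u₁} [Category.{v₁} C] {E B P : C} (q : E ⟶ B) {n : ℕ}
    (π : Fin n → (P ⟶ E)) : Prop where
  comm (i j : Fin n) : π i ≫ q = π j ≫ q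
  exists_unique (W : C) (h : Fin n → (W ⟶ E)) (hh : ∀ i j, h i ≫ q = h j ≫ q) :
    ∃! k : W ⟶ P, ∀ i, k ≫ π i = h i

/-- The data of an additive bundle: a projection `q`, a zero morphism `z`, the pullback `E₂` of `q`
along itself with its projections, and a sum morphism `s`. -/
structure BundleData (C : Type u₁) [Category.{v₁} C] where
  B : C
  E : C
  E₂ : C
  q : E ⟶ B
  z : B ⟶ E
  π₁ : E₂ ⟶ E
  π₂ : E₂ ⟶ E
  s : E₂ ⟶ E

namespace BundleData

variable {C : Type u₁} [Category.{v₁} C]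

/-- The image of the data of an additive bundle under a functor. -/
def map (D : BundleData C) {C' : Type u₂} [Category.{v₂} C'] (F : C ⥤ C') : BundleData C' where
  B := F.obj D.B
  E := F.obj D.E
  E₂ := F.obj D.E₂
  q := F.map D.q
  z := F.map D.z
  π₁ := F.map D.π₁
  π₂ := F.map D.π₂
  s := F.map D.s

/-- The axioms of an additive bundle. The sum of two generalized elements `a b : W ⟶ E` with
`a ≫ q = b ≫ q` is `ab ≫ s`, where `ab : W ⟶ E₂` is the morphism with components `a` and `b`. -/
structure IsAdditive (D : BundleData C) : Prop where
  zero_proj : D.z ≫ D.q = 𝟙 D.B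
  isPullback : IsPullback D.π₁ D.π₂ D.q D.q
  nfold (n : ℕ) (hn : 0 < n) : ∃ (P : C) (π : Fin n → (P ⟶ D.E)), IsNFoldPullback D.q π
  sum_proj : D.s ≫ D.q = D.π₁ ≫ D.q
  assoc (W : C) (ab bc ab_c a_bc : W ⟶ D.E₂) :
    ab ≫ D.π₂ = bc ≫ D.π₁ →
    ab_c ≫ D.π₁ = ab ≫ D.s → ab_c ≫ D.π₂ = bc ≫ D.π₂ →
    a_bc ≫ D.π₁ = ab ≫ D.π₁ → a_bc ≫ D.π₂ = bc ≫ D.s →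
    ab_c ≫ D.s = a_bc ≫ D.s
  zero_sum (a : D.E ⟶ D.E₂) : a ≫ D.π₁ = D.q ≫ D.z → a ≫ D.π₂ = 𝟙 D.E → a ≫ D.s = 𝟙 D.E
  sum_comm (τ : D.E₂ ⟶ D.E₂) : τ ≫ D.π₁ = D.π₂ → τ ≫ D.π₂ = D.π₁ → τ ≫ D.s = D.s

/-- The axioms of a morphism `(f, g)` of additive bundles. -/
structure IsMorphism (D D' : BundleData C) (f : D.B ⟶ D'.B) (g : D.E ⟶ D'.E) : Prop where
  proj : g ≫ D'.q = D.q ≫ f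
  zero : D.z ≫ g = f ≫ D'.z
  sum (g₂ : D.E₂ ⟶ D'.E₂) : g₂ ≫ D'.π₁ = D.π₁ ≫ g → g₂ ≫ D'.π₂ = D.π₂ ≫ g →
    D.s ≫ g = g₂ ≫ D'.s

end BundleData

/-! ### Tangent structures on an object of a `2`-category -/

section Tangent

variable {K : Type u₁} [Bicategory.{w₁, v₁} K]

/-- The data of a tangent structure on an object of a `2`-category. -/
structure TangentData (X : K) where
  T : X ⟶ X
  T₂ : X ⟶ X
  p : T ⟶ 𝟙 X
  z : 𝟙 X ⟶ T
  π₁ : T₂ ⟶ T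
  π₂ : T₂ ⟶ T
  s : T₂ ⟶ T
  l : T ⟶ T ≫ T
  c : T ≫ T ⟶ T ≫ T

/-- The iterate `T^m`. -/
def iter {X : K} (T : X ⟶ X) : ℕ → (X ⟶ X)
  | 0 => 𝟙 X
  | m + 1 => iter T m ≫ T

namespace TangentData

/-- The image of the data of a tangent structure under a `2`-functor. -/
def map {L : Type u₂} [Bicategory.{w₂, v₂} L] {X : K} (D : TangentData X)
    (P : StrictPseudofunctor K L) : TangentData (P.obj X) where
  T := P.map D.T
  T₂ := P.map D.T₂
  p := P.map₂ D.p ≫ (P.mapId X).hom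
  z := (P.mapId X).inv ≫ P.map₂ D.z
  π₁ := P.map₂ D.π₁
  π₂ := P.map₂ D.π₂
  s := P.map₂ D.s
  l := P.map₂ D.l ≫ (P.mapComp D.T D.T).hom
  c := (P.mapComp D.T D.T).inv ≫ P.map₂ D.c ≫ (P.mapComp D.T D.T).hom

variable {X Y : K}

/-- The bundle `(𝟙, T, p, z, s)` in the category of endomorphisms of `X`. -/
def bundle (D : TangentData X) : BundleData (X ⟶ X) :=
  ⟨𝟙 X, D.T, D.T₂, D.p, D.z, D.π₁, D.π₂, D.s⟩

/-- `v : T₂ ⟶ T T₂` is the morphism with components `l` and `z T`. -/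
def IsLiftPair (D : TangentData X) (v : D.T₂ ⟶ D.T₂ ≫ D.T) : Prop :=
  v ≫ D.π₁ ▷ D.T = D.π₁ ≫ D.l ∧ v ≫ D.π₂ ▷ D.T = D.π₂ ≫ (ρ_ D.T).inv ≫ D.T ◁ D.z

/-- The axioms of a tangent structure. A limit in `X ⟶ X` is pointwise if it is preserved by
precomposition with every `h : W ⟶ X`. -/
structure IsTangent (D : TangentData X) : Prop where
  additive : D.bundle.IsAdditive
  nfold (n : ℕ) (hn : 0 < n) : ∃ (Tn : X ⟶ X) (π : Fin n → (Tn ⟶ D.T)),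
    ∀ (m : ℕ) (W : K) (h : W ⟶ X), IsNFoldPullback (h ◁ (D.p ▷ iter D.T m))
      (fun i => h ◁ (π i ▷ iter D.T m))
  lift_additive : D.bundle.IsMorphism (D.bundle.map (postcomp X D.T)) (D.z ≫ (λ_ D.T).inv) D.l
  flip_additive : (D.bundle.map (postcomp X D.T)).IsMorphism (D.bundle.map (precomp X D.T))
    ((λ_ D.T).hom ≫ (ρ_ D.T).inv) D.c
  lift_coassoc : D.l ≫ D.l ▷ D.T ≫ (α_ _ _ _).hom = D.l ≫ D.T ◁ D.l
  flip_flip : D.c ≫ D.c = 𝟙 (D.T ≫ D.T)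
  yang_baxter :
    D.c ▷ D.T ≫ ((α_ _ _ _).hom ≫ D.T ◁ D.c ≫ (α_ _ _ _).inv) ≫ D.c ▷ D.T =
      ((α_ _ _ _).hom ≫ D.T ◁ D.c ≫ (α_ _ _ _).inv) ≫ D.c ▷ D.T ≫
        ((α_ _ _ _).hom ≫ D.T ◁ D.c ≫ (α_ _ _ _).inv)
  lift_flip : D.l ≫ D.c = D.l
  lift_flip_flip :
    D.T ◁ D.l ≫ (α_ _ _ _).inv ≫ D.c ▷ D.T ≫ (α_ _ _ _).hom ≫ D.T ◁ D.c ≫ (α_ _ _ _).inv =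
      D.c ≫ D.l ▷ D.T
  lift_universal : ∃ v : D.T₂ ⟶ D.T₂ ≫ D.T, D.IsLiftPair v ∧ ∀ (W : K) (h : W ⟶ X),
    IsPullback (h ◁ (v ≫ D.s ▷ D.T)) (h ◁ (D.π₁ ≫ D.p)) (h ◁ (D.p ▷ D.T ≫ (λ_ D.T).hom)) (h ◁ D.z)

variable (D : TangentData X) (D' : TangentData Y)

/-- The axioms of a lax morphism `(F, law)` of tangent objects. -/
structure IsLax (F : X ⟶ Y) (law : D.T ≫ F ⟶ F ≫ D'.T) : Prop where
  additive : (D.bundle.map (postcomp X F)).IsMorphism (D'.bundle.map (precomp Y F))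
    ((λ_ F).hom ≫ (ρ_ F).inv) law
  lift : D.l ▷ F ≫ (α_ _ _ _).hom ≫ D.T ◁ law ≫ (α_ _ _ _).inv ≫ law ▷ D'.T ≫ (α_ _ _ _).hom =
    law ≫ F ◁ D'.l
  flip : D.c ▷ F ≫ (α_ _ _ _).hom ≫ D.T ◁ law ≫ (α_ _ _ _).inv ≫ law ▷ D'.T ≫ (α_ _ _ _).hom =
    ((α_ _ _ _).hom ≫ D.T ◁ law ≫ (α_ _ _ _).inv ≫ law ▷ D'.T ≫ (α_ _ _ _).hom) ≫ F ◁ D'.c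

/-- The axioms of a colax morphism `(F, law)` of tangent objects: the duals of the axioms of a lax
morphism, and preservation of the pointwise pullbacks of the tangent structure. -/
structure IsColax (F : X ⟶ Y) (law : F ≫ D'.T ⟶ D.T ≫ F) : Prop where
  additive : (D'.bundle.map (precomp Y F)).IsMorphism (D.bundle.map (postcomp X F))
    ((ρ_ F).hom ≫ (λ_ F).inv) law
  lift : F ◁ D'.l ≫ (α_ _ _ _).inv ≫ law ▷ D'.T ≫ (α_ _ _ _).hom ≫ D.T ◁ law ≫ (α_ _ _ _).inv =
    law ≫ D.l ▷ F
  flip : F ◁ D'.c ≫ (α_ _ _ _).inv ≫ law ▷ D'.T ≫ (α_ _ _ _).hom ≫ D.T ◁ law ≫ (α_ _ _ _).inv =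
    ((α_ _ _ _).inv ≫ law ▷ D'.T ≫ (α_ _ _ _).hom ≫ D.T ◁ law ≫ (α_ _ _ _).inv) ≫ D.c ▷ F
  nfold (n : ℕ) (hn : 0 < n) (Tn : X ⟶ X) (π : Fin n → (Tn ⟶ D.T)) : IsNFoldPullback D.p π →
    ∀ (W : K) (h : W ⟶ X), IsNFoldPullback (h ◁ (D.p ▷ F)) (fun i => h ◁ (π i ▷ F))
  lift_universal (v : D.T₂ ⟶ D.T₂ ≫ D.T) : D.IsLiftPair v → ∀ (W : K) (h : W ⟶ X),
    IsPullback (h ◁ ((v ≫ D.s ▷ D.T) ▷ F)) (h ◁ ((D.π₁ ≫ D.p) ▷ F))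
      (h ◁ ((D.p ▷ D.T ≫ (λ_ D.T).hom) ▷ F)) (h ◁ (D.z ▷ F))

/-- Strong morphisms: colax morphisms with an invertible law, here written through the inverse
`law` of their colax law. -/
def IsStrong (F : X ⟶ Y) (law : D.T ≫ F ⟶ F ≫ D'.T) : Prop :=
  ∃ e : D.T ≫ F ≅ F ≫ D'.T, e.hom = law ∧ IsColax D D' F e.inv

/-- Strict morphisms: colax morphisms whose law is an identity. -/
def IsStrict (F : X ⟶ Y) (law : D.T ≫ F ⟶ F ≫ D'.T) : Prop :=
  ∃ h : D.T ≫ F = F ≫ D'.T, law = eqToHom h ∧ IsColax D D' F (eqToHom h.symm)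

end TangentData

variable (K) in
/-- A tangent object of a `2`-category. -/
structure TangentObject where
  carrier : K
  data : TangentData carrier
  isTangent : data.IsTangent

end Tangent

/-! ### Tangent categories -/

namespace TangentData

section Cat

variable {X Y : Cat.{v, u}} (D : TangentData X) (D' : TangentData Y)

/-- The additive bundle `(A, T A, p, z, s)`. -/
def bundleAt (A : X) : BundleData X where
  B := A
  E := D.T.toFunctor.obj A
  E₂ := D.T₂.toFunctor.obj A
  q := D.p.toNatTrans.app A
  z := D.z.toNatTrans.app A
  π₁ := D.π₁.toNatTrans.app A
  π₂ := D.π₂.toNatTrans.app A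
  s := D.s.toNatTrans.app A

/-- The component `T A ⟶ T T A` of the vertical lift. -/
def liftAt (A : X) : D.T.toFunctor.obj A ⟶ D.T.toFunctor.obj (D.T.toFunctor.obj A) :=
  D.l.toNatTrans.app A

/-- The component `T T A ⟶ T T A` of the canonical flip. -/
def flipAt (A : X) : D.T.toFunctor.obj (D.T.toFunctor.obj A) ⟶
    D.T.toFunctor.obj (D.T.toFunctor.obj A) :=
  D.c.toNatTrans.app A

/-- `v : T₂ A ⟶ T T₂ A` is the morphism with components `l` and `z T`. -/
def IsLiftPairAt (A : X) (v : (D.bundleAt A).E₂ ⟶ D.T.toFunctor.obj (D.bundleAt A).E₂) : Prop :=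
  v ≫ D.T.toFunctor.map (D.bundleAt A).π₁ = (D.bundleAt A).π₁ ≫ D.liftAt A ∧
    v ≫ D.T.toFunctor.map (D.bundleAt A).π₂ =
      (D.bundleAt A).π₂ ≫ (D.bundleAt (D.T.toFunctor.obj A)).z

/-- The axioms of a tangent category. -/
structure IsTangentCategory : Prop where
  additive (A : X) : (D.bundleAt A).IsAdditive
  nfold (n : ℕ) (hn : 0 < n) (A : X) : ∃ (P : X) (π : Fin n → (P ⟶ (D.bundleAt A).E)),
    ∀ m : ℕ, IsNFoldPullback ((iter D.T m).toFunctor.map (D.bundleAt A).q)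
      (fun i => (iter D.T m).toFunctor.map (π i))
  lift_additive (A : X) : (D.bundleAt A).IsMorphism ((D.bundleAt A).map D.T.toFunctor)
    (D.bundleAt A).z (D.liftAt A)
  flip_additive (A : X) : ((D.bundleAt A).map D.T.toFunctor).IsMorphism
    (D.bundleAt (D.T.toFunctor.obj A)) (𝟙 (D.T.toFunctor.obj A)) (D.flipAt A)
  lift_coassoc (A : X) : D.liftAt A ≫ D.T.toFunctor.map (D.liftAt A) =
    D.liftAt A ≫ D.liftAt (D.T.toFunctor.obj A)
  flip_flip (A : X) : D.flipAt A ≫ D.flipAt A = 𝟙 _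
  yang_baxter (A : X) :
    D.T.toFunctor.map (D.flipAt A) ≫ D.flipAt (D.T.toFunctor.obj A) ≫
        D.T.toFunctor.map (D.flipAt A) =
      D.flipAt (D.T.toFunctor.obj A) ≫ D.T.toFunctor.map (D.flipAt A) ≫
        D.flipAt (D.T.toFunctor.obj A)
  lift_flip (A : X) : D.liftAt A ≫ D.flipAt A = D.liftAt A
  lift_flip_flip (A : X) :
    D.liftAt (D.T.toFunctor.obj A) ≫ D.T.toFunctor.map (D.flipAt A) ≫
      D.flipAt (D.T.toFunctor.obj A) = D.flipAt A ≫ D.T.toFunctor.map (D.liftAt A)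
  lift_universal (A : X) : ∃ v, D.IsLiftPairAt A v ∧
    IsPullback (v ≫ D.T.toFunctor.map (D.bundleAt A).s) ((D.bundleAt A).π₁ ≫ (D.bundleAt A).q)
      (D.T.toFunctor.map (D.bundleAt A).q) (D.bundleAt A).z

/-- The component `F T A ⟶ T' F A` of a lax distributive law. -/
def laxAt {F : X ⟶ Y} (law : D.T ≫ F ⟶ F ≫ D'.T) (A : X) :
    F.toFunctor.obj (D.T.toFunctor.obj A) ⟶ D'.T.toFunctor.obj (F.toFunctor.obj A) :=
  law.toNatTrans.app A

/-- The component `T' F A ⟶ F T A` of a colax distributive law. -/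
def colaxAt {F : X ⟶ Y} (law : F ≫ D'.T ⟶ D.T ≫ F) (A : X) :
    D'.T.toFunctor.obj (F.toFunctor.obj A) ⟶ F.toFunctor.obj (D.T.toFunctor.obj A) :=
  law.toNatTrans.app A

/-- The axioms of a lax tangent morphism of tangent categories. -/
structure IsLaxFunctor (F : X ⟶ Y) (law : D.T ≫ F ⟶ F ≫ D'.T) : Prop where
  additive (A : X) : ((D.bundleAt A).map F.toFunctor).IsMorphism
    (D'.bundleAt (F.toFunctor.obj A)) (𝟙 (F.toFunctor.obj A)) (laxAt D D' law A)
  lift (A : X) : F.toFunctor.map (D.liftAt A) ≫ laxAt D D' law (D.T.toFunctor.obj A) ≫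
      D'.T.toFunctor.map (laxAt D D' law A) =
    laxAt D D' law A ≫ D'.liftAt (F.toFunctor.obj A)
  flip (A : X) : F.toFunctor.map (D.flipAt A) ≫ laxAt D D' law (D.T.toFunctor.obj A) ≫
      D'.T.toFunctor.map (laxAt D D' law A) =
    laxAt D D' law (D.T.toFunctor.obj A) ≫ D'.T.toFunctor.map (laxAt D D' law A) ≫
      D'.flipAt (F.toFunctor.obj A)

/-- The axioms of a colax tangent morphism of tangent categories. -/
structure IsColaxFunctor (F : X ⟶ Y) (law : F ≫ D'.T ⟶ D.T ≫ F) : Prop where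
  additive (A : X) : (D'.bundleAt (F.toFunctor.obj A)).IsMorphism
    ((D.bundleAt A).map F.toFunctor) (𝟙 (F.toFunctor.obj A)) (colaxAt D D' law A)
  lift (A : X) : D'.liftAt (F.toFunctor.obj A) ≫ D'.T.toFunctor.map (colaxAt D D' law A) ≫
      colaxAt D D' law (D.T.toFunctor.obj A) =
    colaxAt D D' law A ≫ F.toFunctor.map (D.liftAt A)
  flip (A : X) : D'.flipAt (F.toFunctor.obj A) ≫ D'.T.toFunctor.map (colaxAt D D' law A) ≫
      colaxAt D D' law (D.T.toFunctor.obj A) =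
    D'.T.toFunctor.map (colaxAt D D' law A) ≫ colaxAt D D' law (D.T.toFunctor.obj A) ≫
      F.toFunctor.map (D.flipAt A)
  nfold (n : ℕ) (hn : 0 < n) (A P : X) (π : Fin n → (P ⟶ (D.bundleAt A).E)) :
    IsNFoldPullback (D.bundleAt A).q π →
    IsNFoldPullback (F.toFunctor.map (D.bundleAt A).q) (fun i => F.toFunctor.map (π i))
  lift_universal (A : X) (v : (D.bundleAt A).E₂ ⟶ D.T.toFunctor.obj (D.bundleAt A).E₂) :
    D.IsLiftPairAt A v →
    IsPullback (F.toFunctor.map (v ≫ D.T.toFunctor.map (D.bundleAt A).s))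
      (F.toFunctor.map ((D.bundleAt A).π₁ ≫ (D.bundleAt A).q))
      (F.toFunctor.map (D.T.toFunctor.map (D.bundleAt A).q))
      (F.toFunctor.map (D.bundleAt A).z)

/-- Strong tangent morphisms of tangent categories: colax tangent morphisms with an invertible
law, here written through the inverse `law` of their colax law. -/
def IsStrongFunctor (F : X ⟶ Y) (law : D.T ≫ F ⟶ F ≫ D'.T) : Prop :=
  ∃ e : D.T ≫ F ≅ F ≫ D'.T, e.hom = law ∧ IsColaxFunctor D D' F e.inv

/-- Strict tangent morphisms of tangent categories: colax tangent morphisms whose law is an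
identity. -/
def IsStrictFunctor (F : X ⟶ Y) (law : D.T ≫ F ⟶ F ≫ D'.T) : Prop :=
  ∃ h : D.T ≫ F = F ≫ D'.T, law = eqToHom h ∧ IsColaxFunctor D D' F (eqToHom h.symm)

end Cat

end TangentData

/-! ### Tangent fibrations -/

/-- A cloven tangent fibration: a cloven fibration between tangent categories whose projection is
a strict tangent morphism and whose tangent bundle functors preserve the cartesian lifts. -/
structure TangentFibration where
  fib : Fib.{v, u}
  baseData : TangentData fib.base
  totalData : TangentData fib.total
  base_isTangent : baseData.IsTangentCategory
  total_isTangent : totalData.IsTangentCategory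
  comm : totalData.T ≫ fib.proj = fib.proj ≫ baseData.T
  strict : totalData.IsStrictFunctor baseData fib.proj (eqToHom comm)
  cart {A : fib.base} (E : fib.total) (f : A ⟶ fib.proj.toFunctor.obj E) :
    Functor.IsStronglyCartesian fib.proj.toFunctor (baseData.T.toFunctor.map f)
      (totalData.T.toFunctor.map (fib.lift E f))

namespace TangentFibration

/-- The `1`-morphism of cloven fibrations formed by the tangent bundle functors. -/
def endo (Q : TangentFibration.{v, u}) : Q.fib ⟶ Q.fib :=
  ⟨Q.baseData.T, Q.totalData.T, Q.comm, Q.cart⟩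

/-- The base tangent category: the base category with its tangent data. -/
def base (Q : TangentFibration.{v, u}) : Σ X : Cat.{v, u}, TangentData X := ⟨_, Q.baseData⟩

/-- The total tangent category: the total category with its tangent data. -/
def total (Q : TangentFibration.{v, u}) : Σ X : Cat.{v, u}, TangentData X := ⟨_, Q.totalData⟩

end TangentFibration

/-! ### The `2`-categories of tangent objects -/

section TNG

variable {K : Type u₁} [Bicategory.{w₁, v₁} K]

/-- The carrier of a tangent object with its tangent `1`-morphism. -/
def TangentObject.endLax (o : TangentObject K) : EndLax K := ⟨o.carrier, o.data.T⟩

/-- The carrier of a tangent object with its tangent `1`-morphism. -/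
def TangentObject.endColax (o : TangentObject K) : EndColax K := ⟨o.carrier, o.data.T⟩

namespace TNG

/-- Lax `1`-morphisms of tangent objects. -/
def laxMor (a b : TangentObject K) (f : a.endLax ⟶ b.endLax) : Prop :=
  a.data.IsLax b.data f.one f.law

/-- Colax `1`-morphisms of tangent objects. -/
def colaxMor (a b : TangentObject K) (f : a.endColax ⟶ b.endColax) : Prop :=
  a.data.IsColax b.data f.one f.law

/-- Strong `1`-morphisms of tangent objects. -/
def strongMor (a b : TangentObject K) (f : a.endLax ⟶ b.endLax) : Prop :=
  a.data.IsStrong b.data f.one f.law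

/-- Strict `1`-morphisms of tangent objects. -/
def strictMor (a b : TangentObject K) (f : a.endLax ⟶ b.endLax) : Prop :=
  a.data.IsStrict b.data f.one f.law

end TNG

variable (K) in
/-- The `2`-category of tangent objects of `K` and lax morphisms. -/
abbrev TNG := Sub (genData (TangentObject.endLax (K := K)) TNG.laxMor)

variable (K) in
/-- The `2`-category of tangent objects of `K` and (composites of) colax morphisms. -/
abbrev TNGco := Sub (genData (TangentObject.endColax (K := K)) TNG.colaxMor)

variable (K) in
/-- The `2`-category of tangent objects of `K` and strong morphisms. -/
abbrev TNGstrong := Sub (genData (TangentObject.endLax (K := K)) TNG.strongMor)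

variable (K) in
/-- The `2`-category of tangent objects of `K` and strict morphisms. -/
abbrev TNGstrict := Sub (genData (TangentObject.endLax (K := K)) TNG.strictMor)

end TNG

/-! ### The `2`-categories of tangent fibrations -/

/-- The underlying cloven fibration of a tangent fibration with its tangent bundle functors. -/
def TangentFibration.endLax (Q : TangentFibration.{v, u}) : EndLax Fib.{v, u} := ⟨Q.fib, Q.endo⟩

/-- The underlying cloven fibration of a tangent fibration with its tangent bundle functors. -/
def TangentFibration.endColax (Q : TangentFibration.{v, u}) : EndColax Fib.{v, u} :=
  ⟨Q.fib, Q.endo⟩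

namespace TNGFIB

/-- Lax morphisms of tangent fibrations: `1`-morphisms of fibrations with distributive laws on the
base and on the total categories, the latter over the former, that make both functors into lax
tangent morphisms. -/
def laxMor (a b : TangentFibration.{v, u}) (f : a.endLax ⟶ b.endLax) : Prop :=
  a.baseData.IsLaxFunctor b.baseData f.one.base f.law.base ∧
    a.totalData.IsLaxFunctor b.totalData f.one.total f.law.total

/-- Colax morphisms of tangent fibrations. -/
def colaxMor (a b : TangentFibration.{v, u}) (f : a.endColax ⟶ b.endColax) : Prop :=
  a.baseData.IsColaxFunctor b.baseData f.one.base f.law.base ∧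
    a.totalData.IsColaxFunctor b.totalData f.one.total f.law.total

/-- Strong morphisms of tangent fibrations. -/
def strongMor (a b : TangentFibration.{v, u}) (f : a.endLax ⟶ b.endLax) : Prop :=
  a.baseData.IsStrongFunctor b.baseData f.one.base f.law.base ∧
    a.totalData.IsStrongFunctor b.totalData f.one.total f.law.total

/-- Strict morphisms of tangent fibrations. -/
def strictMor (a b : TangentFibration.{v, u}) (f : a.endLax ⟶ b.endLax) : Prop :=
  a.baseData.IsStrictFunctor b.baseData f.one.base f.law.base ∧
    a.totalData.IsStrictFunctor b.totalData f.one.total f.law.total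

end TNGFIB

/-- The `2`-category of tangent fibrations and lax morphisms. -/
abbrev TNGFIB := Sub (genData TangentFibration.endLax.{v, u} TNGFIB.laxMor)

/-- The `2`-category of tangent fibrations and (composites of) colax morphisms. -/
abbrev TNGFIBco := Sub (genData TangentFibration.endColax.{v, u} TNGFIB.colaxMor)

/-- The `2`-category of tangent fibrations and strong morphisms. -/
abbrev TNGFIBstrong := Sub (genData TangentFibration.endLax.{v, u} TNGFIB.strongMor)

/-- The `2`-category of tangent fibrations and strict morphisms. -/
abbrev TNGFIBstrict := Sub (genData TangentFibration.endLax.{v, u} TNGFIB.strictMor)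

/-! ### Lifting an equivalence -/

/-- The base of a tangent indexed category, with its tangent data. -/
def TangentObject.base (o : TangentObject Indx.{v, u}) : Σ X : Cat.{v, u}, TangentData X :=
  ⟨_, o.data.map Indx.baseFunctor⟩

/-- The category of elements of a tangent indexed category, with its tangent data. -/
def TangentObject.total (o : TangentObject Indx.{v, u}) : Σ X : Cat.{v, u}, TangentData X :=
  ⟨_, o.data.map (grothendieck.comp Fib.totalFunctor)⟩

section Lift

variable {B : Type u₁} [Bicategory.{w₁, v₁} B] {C : Type u₂} [Bicategory.{w₂, v₂} C]

/-- The `2`-equivalence `E` restricts to the `2`-equivalence `E'` between sub-`2`-categories. -/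
structure RestrictsTo {O : Type t} {O' : Type t'} (E : TwoEquivalence B C) {S : SubData B O}
    {S' : SubData C O'} (E' : TwoEquivalence (Sub S) (Sub S')) : Prop where
  functor : E'.functor.comp (Sub.incl S') = (Sub.incl S).comp E.functor
  inverse : E'.inverse.comp (Sub.incl S) = (Sub.incl S').comp E.inverse
  unit (a : Sub S) : HEq (Sub.Hom.hom (E'.unit.app a)) (E.unit.app (S.ι a.as))
  counit (a : Sub S') : HEq (Sub.Hom.hom (E'.counit.app a)) (E.counit.app (S'.ι a.as))

/-- The `2`-equivalence `E'` is obtained by applying `E` to objects with an endomorphism and to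
lax distributive laws. -/
structure IsEndLaxLift [Strict B] [Strict C] (E : TwoEquivalence B C)
    (E' : TwoEquivalence (EndLax B) (EndLax C)) : Prop where
  functor : E'.functor = EndLax.map E.functor
  inverse : E'.inverse = EndLax.map E.inverse
  unit (X : EndLax B) : HEq (EndLax.Hom.one (E'.unit.app X)) (E.unit.app X.carrier)
  counit (X : EndLax C) : HEq (EndLax.Hom.one (E'.counit.app X)) (E.counit.app X.carrier)

/-- The `2`-equivalence `E'` is obtained by applying `E` to objects with an endomorphism and to
colax distributive laws. -/
structure IsEndColaxLift [Strict B] [Strict C] (E : TwoEquivalence B C)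
    (E' : TwoEquivalence (EndColax B) (EndColax C)) : Prop where
  functor : E'.functor = EndColax.map E.functor
  inverse : E'.inverse = EndColax.map E.inverse
  unit (X : EndColax B) : HEq (EndColax.Hom.one (E'.unit.app X)) (E.unit.app X.carrier)
  counit (X : EndColax C) : HEq (EndColax.Hom.one (E'.counit.app X)) (E.counit.app X.carrier)

/-- The sub-`2`-category of those objects of `Sub (genData ι V)` whose base is `d`, with the
`1`-morphisms and `2`-morphisms that the `2`-functor `Q` sends to identities. -/
abbrev FixedBase {D : Type u₃} [Bicategory.{w₃, v₃} D] [Strict B] [Strict D] {O : Type t}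
    (ι : O → B) (V : ∀ a b : O, (ι a ⟶ ι b) → Prop) (Q : StrictPseudofunctor B D)
    {X : Type x} (base : O → X) (d : X) :=
  Sub (vertData ((Sub.incl (genData ι V)).comp Q)
    (fun a : {a : Sub (genData ι V) // base a.as = d} => a.1))

/-- The `2`-equivalence `E` restricts to the `2`-equivalence `E'` between the sub-`2`-categories
with objects `ι a` and `ι' a` whose `1`-morphisms are the composites of the morphisms in the
classes `V` and `V'`. It is given by `Fo` and `Go` on objects, it preserves and reflects the two
classes, and it restricts further to the sub-`2`-categories over every fixed base. -/
structure Restricts {D : Type u₃} [Bicategory.{w₃, v₃} D] [Strict B] [Strict C] [Strict D]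
    {O : Type t} {O' : Type t'} (E : TwoEquivalence B C)
    {ι : O → B} {V : ∀ a b : O, (ι a ⟶ ι b) → Prop}
    {ι' : O' → C} {V' : ∀ a b : O', (ι' a ⟶ ι' b) → Prop}
    (E' : TwoEquivalence (Sub (genData ι V)) (Sub (genData ι' V')))
    (Q : StrictPseudofunctor B D) (Q' : StrictPseudofunctor C D)
    {X : Type x} (base : O → X) (base' : O' → X) (Fo : O → O') (Go : O' → O) : Prop where
  restrictsTo : RestrictsTo E E'
  functor_obj (a : Sub (genData ι V)) : (E'.functor.obj a).as = Fo a.as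
  inverse_obj (a : Sub (genData ι' V')) : (E'.inverse.obj a).as = Go a.as
  functor_map (a b : Sub (genData ι V)) (f : a ⟶ b) :
    V a.as b.as (Sub.Hom.hom f) ↔ V' _ _ (Sub.Hom.hom (E'.functor.map f))
  inverse_map (a b : Sub (genData ι' V')) (f : a ⟶ b) :
    V' a.as b.as (Sub.Hom.hom f) ↔ V _ _ (Sub.Hom.hom (E'.inverse.map f))
  fixedBase (d : X) : ∃ E'' : TwoEquivalence (FixedBase ι V Q base d) (FixedBase ι' V' Q' base' d),
    RestrictsTo E' E''

end Lift

end TangentFib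

open TangentFib

set_option linter.unusedSectionVars false

namespace TangentFib

/-! ### Equivalences of strict `2`-categories -/

section TwoCat

variable {B : Type u₁} [Bicategory.{w₁, v₁} B] {C : Type u₂} [Bicategory.{w₂, v₂} C]

lemma strictPseudofunctor_ext {F G : StrictPseudofunctor B C}
    (h : F.toPrelaxFunctor = G.toPrelaxFunctor) : F = G := by
  obtain ⟨⟨⟨F, mapId, mapComp, _, _, _, _, _⟩, hi, hi'⟩, hc, hc'⟩ := F
  obtain ⟨⟨⟨G, mapId', mapComp', _, _, _, _, _⟩, gi, gi'⟩, gc, gc'⟩ := G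
  dsimp at h
  subst h
  obtain rfl : mapId = mapId' := funext fun X => (hi' X).trans (gi' X).symm
  obtain rfl : @mapComp = @mapComp' := by
    funext a b c f g
    exact (hc' f g).trans (gc' f g).symm
  rfl

lemma strictPseudofunctor_hext {F G : StrictPseudofunctor B C} (ho : F.obj = G.obj)
    (hm : ∀ {X Y : B} (f : X ⟶ Y), HEq (F.map f) (G.map f))
    (hm₂ : ∀ {X Y : B} {f g : X ⟶ Y} (η : f ⟶ g), HEq (F.map₂ η) (G.map₂ η)) : F = G := by
  refine strictPseudofunctor_ext ?_
  obtain ⟨⟨⟨⟨⟨⟨Fo, Fm⟩, Fm₂⟩, _, _⟩, _, _, _, _, _, _, _⟩, _, _⟩, _, _⟩ := F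
  obtain ⟨⟨⟨⟨⟨⟨Go, Gm⟩, Gm₂⟩, _, _⟩, _, _, _, _, _, _, _⟩, _, _⟩, _, _⟩ := G
  dsimp at ho hm hm₂
  subst ho
  obtain rfl : @Fm = @Gm := by
    funext X Y f
    exact eq_of_heq (hm f)
  obtain rfl : @Fm₂ = @Gm₂ := by
    funext X Y f g η
    exact eq_of_heq (hm₂ η)
  rfl

/-- A `2`-functor that is bijective on `1`-morphisms and on `2`-morphisms. -/
structure LocalIso (P : StrictPseudofunctor B C) : Prop where
  map_bij (X Y : B) : Function.Bijective (fun f : X ⟶ Y => P.map f)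
  map₂_bij {X Y : B} (f g : X ⟶ Y) : Function.Bijective (fun η : f ⟶ g => P.map₂ η)

namespace LocalIso

variable {P : StrictPseudofunctor B C} (hP : LocalIso P)

include hP

lemma map_inj {X Y : B} {f g : X ⟶ Y} (h : P.map f = P.map g) : f = g := (hP.map_bij X Y).1 h

lemma map₂_inj {X Y : B} {f g : X ⟶ Y} {η θ : f ⟶ g} (h : P.map₂ η = P.map₂ θ) : η = θ :=
  (hP.map₂_bij f g).1 h

/-- The preimage of a `1`-morphism. -/
noncomputable def pre {X Y : B} (f : P.obj X ⟶ P.obj Y) : X ⟶ Y :=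
  ((hP.map_bij X Y).2 f).choose

lemma map_pre {X Y : B} (f : P.obj X ⟶ P.obj Y) : P.map (hP.pre f) = f :=
  ((hP.map_bij X Y).2 f).choose_spec

/-- The preimage of a `2`-morphism. -/
noncomputable def pre₂ {X Y : B} {f g : X ⟶ Y} (η : P.map f ⟶ P.map g) : f ⟶ g :=
  ((hP.map₂_bij f g).2 η).choose

lemma map₂_pre₂ {X Y : B} {f g : X ⟶ Y} (η : P.map f ⟶ P.map g) : P.map₂ (hP.pre₂ η) = η :=
  ((hP.map₂_bij f g).2 η).choose_spec

end LocalIso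

lemma whiskerLeft_cancel [Strict C] {X Y Z : C} {e : X ⟶ Y} {e' : Y ⟶ X} (h : e ≫ e' = 𝟙 X)
    {f g : X ⟶ Z} (η : f ⟶ g) : e ◁ e' ◁ η =
      eqToHom (by rw [← Strict.assoc, h, Strict.id_comp]) ≫ η ≫
        eqToHom (by rw [← Strict.assoc, h, Strict.id_comp]) := by
  have h1 := comp_whiskerLeft e e' η
  rw [congr_whiskerLeft h η, id_whiskerLeft] at h1
  simp only [Strict.associator_eqToIso, Strict.leftUnitor_eqToIso, eqToIso.hom, eqToIso.inv] at h1
  have h2 := congrArg (fun x => eqToHom (Strict.assoc e e' f).symm ≫ x ≫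
    eqToHom (Strict.assoc e e' g)) h1
  simpa using h2.symm

lemma whiskerRight_cancel [Strict C] {X Y Z : C} {e : X ⟶ Y} {e' : Y ⟶ X} (h : e ≫ e' = 𝟙 X)
    {f g : Z ⟶ X} (η : f ⟶ g) : (η ▷ e) ▷ e' =
      eqToHom (by rw [Strict.assoc, h, Strict.comp_id]) ≫ η ≫
        eqToHom (by rw [Strict.assoc, h, Strict.comp_id]) := by
  have h1 := whiskerRight_comp η e e'
  rw [whiskerRight_congr h η, whiskerRight_id] at h1
  simp only [Strict.associator_eqToIso, Strict.rightUnitor_eqToIso, eqToIso.hom, eqToIso.inv] at h1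
  have h2 := congrArg (fun x => eqToHom (Strict.assoc f e e') ≫ x ≫
    eqToHom (Strict.assoc g e e').symm) h1
  simpa using h2.symm

variable (P : StrictPseudofunctor B C)

/-- The data exhibiting every object of the target of a `2`-functor as isomorphic to a value. -/
structure Cover where
  obj : C → B
  hom (Y : C) : P.obj (obj Y) ⟶ Y
  inv (Y : C) : Y ⟶ P.obj (obj Y)
  hom_inv (Y : C) : hom Y ≫ inv Y = 𝟙 _
  inv_hom (Y : C) : inv Y ≫ hom Y = 𝟙 _

namespace Cover

variable {P} (S : Cover P)

/-- Conjugation of a `1`-morphism. -/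
def cj {Y Z : C} (f : Y ⟶ Z) : P.obj (S.obj Y) ⟶ P.obj (S.obj Z) := (S.hom Y ≫ f) ≫ S.inv Z

/-- Conjugation of a `2`-morphism. -/
def cj₂ {Y Z : C} {f g : Y ⟶ Z} (η : f ⟶ g) : S.cj f ⟶ S.cj g := (S.hom Y ◁ η) ▷ S.inv Z

variable [Strict C]

lemma cj_id (Y : C) : S.cj (𝟙 Y) = 𝟙 _ := by rw [cj, Strict.comp_id, S.hom_inv]

lemma cj_comp {X Y Z : C} (f : X ⟶ Y) (g : Y ⟶ Z) : S.cj (f ≫ g) = S.cj f ≫ S.cj g := by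
  have h : S.inv Y ≫ S.hom Y ≫ g ≫ S.inv Z = g ≫ S.inv Z := by
    rw [← Strict.assoc, S.inv_hom, Strict.id_comp]
  simp only [cj, Strict.assoc, h]

lemma cj₂_id {Y Z : C} (f : Y ⟶ Z) : S.cj₂ (𝟙 f) = 𝟙 (S.cj f) := by
  show (S.hom Y ◁ 𝟙 f) ▷ S.inv Z = 𝟙 ((S.hom Y ≫ f) ≫ S.inv Z)
  simp

lemma cj₂_comp {Y Z : C} {f g h : Y ⟶ Z} (η : f ⟶ g) (θ : g ⟶ h) :
    S.cj₂ (η ≫ θ) = S.cj₂ η ≫ S.cj₂ θ := by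
  show (S.hom Y ◁ (η ≫ θ)) ▷ S.inv Z = (S.hom Y ◁ η) ▷ S.inv Z ≫ (S.hom Y ◁ θ) ▷ S.inv Z
  simp

lemma cj₂_whiskerLeft {X Y Z : C} (f : X ⟶ Y) {g g' : Y ⟶ Z} (η : g ⟶ g') :
    S.cj₂ (f ◁ η) = eqToHom (S.cj_comp f g) ≫ S.cj f ◁ S.cj₂ η ≫
      eqToHom (S.cj_comp f g').symm := by
  have h := S.cj_comp f g
  have h' := S.cj_comp f g'
  dsimp only [cj] at h h'
  show (S.hom X ◁ f ◁ η) ▷ S.inv Z = eqToHom h ≫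
    ((S.hom X ≫ f) ≫ S.inv Y) ◁ ((S.hom Y ◁ η) ▷ S.inv Z) ≫ eqToHom h'.symm
  simp [whiskerLeft_cancel (S.inv_hom _), Strict.associator_eqToIso]

lemma cj₂_whiskerRight {X Y Z : C} {f f' : X ⟶ Y} (η : f ⟶ f') (g : Y ⟶ Z) :
    S.cj₂ (η ▷ g) = eqToHom (S.cj_comp f g) ≫ S.cj₂ η ▷ S.cj g ≫
      eqToHom (S.cj_comp f' g).symm := by
  have h := S.cj_comp f g
  have h' := S.cj_comp f' g
  dsimp only [cj] at h h'
  show (S.hom X ◁ (η ▷ g)) ▷ S.inv Z = eqToHom h ≫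
    ((S.hom X ◁ η) ▷ S.inv Y) ▷ ((S.hom Y ≫ g) ≫ S.inv Z) ≫ eqToHom h'.symm
  simp [whiskerRight_cancel (S.inv_hom _), Strict.associator_eqToIso]

lemma cj_hom {X Y : C} (f : X ⟶ Y) : S.cj f ≫ S.hom Y = S.hom X ≫ f := by
  rw [cj, Strict.assoc, S.inv_hom, Strict.comp_id]

lemma inv_cj {X Y : C} (f : X ⟶ Y) : S.inv X ≫ S.cj f = f ≫ S.inv Y := by
  rw [cj, Strict.assoc, ← Strict.assoc, S.inv_hom, Strict.id_comp]

lemma cj₂_hom {X Y : C} {f g : X ⟶ Y} (η : f ⟶ g) :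
    S.cj₂ η ▷ S.hom Y ≫ eqToHom (S.cj_hom g) = eqToHom (S.cj_hom f) ≫ S.hom X ◁ η := by
  have h := S.cj_hom f
  have h' := S.cj_hom g
  dsimp only [cj] at h h'
  show ((S.hom X ◁ η) ▷ S.inv Y) ▷ S.hom Y ≫ eqToHom h' = eqToHom h ≫ S.hom X ◁ η
  rw [whiskerRight_cancel (S.inv_hom _)]
  simp

lemma inv_cj₂ {X Y : C} {f g : X ⟶ Y} (η : f ⟶ g) :
    η ▷ S.inv Y ≫ eqToHom (S.inv_cj g).symm = eqToHom (S.inv_cj f).symm ≫ S.inv X ◁ S.cj₂ η := by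
  have h := S.inv_cj f
  have h' := S.inv_cj g
  dsimp only [cj] at h h'
  show η ▷ S.inv Y ≫ eqToHom h'.symm = eqToHom h.symm ≫ S.inv X ◁ ((S.hom X ◁ η) ▷ S.inv Y)
  simp [whiskerLeft_cancel (S.inv_hom _), Strict.associator_eqToIso]

lemma cj_bij (Y Z : C) : Function.Bijective (fun f : Y ⟶ Z => S.cj f) := by
  refine ⟨fun f g h => ?_, fun g => ⟨(S.inv Y ≫ g) ≫ S.hom Z, ?_⟩⟩
  · have h1 := S.inv_cj f
    have h2 := S.inv_cj g
    rw [show S.cj f = S.cj g from h, h2] at h1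
    have h3 := congrArg (· ≫ S.hom Z) h1
    simpa [Strict.assoc, S.inv_hom, Strict.comp_id] using h3.symm
  · show (S.hom Y ≫ (S.inv Y ≫ g) ≫ S.hom Z) ≫ S.inv Z = g
    rw [Strict.assoc (S.inv Y), ← Strict.assoc (S.hom Y), S.hom_inv, Strict.id_comp, Strict.assoc,
      S.hom_inv, Strict.comp_id]

lemma cj₂_bij {Y Z : C} (f g : Y ⟶ Z) : Function.Bijective (fun η : f ⟶ g => S.cj₂ η) := by
  refine ⟨fun η θ h => ?_, ?_⟩
  rotate_left
  · intro θ
    change (S.hom Y ≫ f) ≫ S.inv Z ⟶ (S.hom Y ≫ g) ≫ S.inv Z at θ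
    have e (f : Y ⟶ Z) : (S.inv Y ≫ (S.hom Y ≫ f) ≫ S.inv Z) ≫ S.hom Z = f := by
      rw [Strict.assoc (S.hom Y), ← Strict.assoc (S.inv Y), S.inv_hom, Strict.id_comp,
        Strict.assoc, S.inv_hom, Strict.comp_id]
    refine ⟨eqToHom (e f).symm ≫ (S.inv Y ◁ θ) ▷ S.hom Z ≫ eqToHom (e g), ?_⟩
    show (S.hom Y ◁ (eqToHom (e f).symm ≫ (S.inv Y ◁ θ) ▷ S.hom Z ≫
      eqToHom (e g))) ▷ S.inv Z = θ
    simp [whiskerLeft_cancel (S.hom_inv _), whiskerRight_cancel (S.hom_inv _),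
      Strict.associator_eqToIso]
  · have h1 := S.cj₂_hom η
    have h2 := S.cj₂_hom θ
    rw [show S.cj₂ η = S.cj₂ θ from h, h2] at h1
    have h3 := congrArg (S.inv Y ◁ ·) ((cancel_epi _).1 h1)
    simp only [whiskerLeft_cancel (S.inv_hom _)] at h3
    exact ((cancel_mono _).1 ((cancel_epi _).1 h3)).symm

variable [Strict B] (hP : LocalIso P)

/-- The preimage of a conjugated `1`-morphism. -/
noncomputable def inverseMap {Y Z : C} (f : Y ⟶ Z) : S.obj Y ⟶ S.obj Z := hP.pre (S.cj f)

lemma map_inverseMap {Y Z : C} (f : Y ⟶ Z) : P.map (S.inverseMap hP f) = S.cj f := hP.map_pre _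

/-- The preimage of a conjugated `2`-morphism. -/
noncomputable def inverseMap₂ {Y Z : C} {f g : Y ⟶ Z} (η : f ⟶ g) :
    S.inverseMap hP f ⟶ S.inverseMap hP g :=
  hP.pre₂ (eqToHom (S.map_inverseMap hP f) ≫ S.cj₂ η ≫ eqToHom (S.map_inverseMap hP g).symm)

lemma map₂_inverseMap₂ {Y Z : C} {f g : Y ⟶ Z} (η : f ⟶ g) :
    P.map₂ (S.inverseMap₂ hP η) = eqToHom (S.map_inverseMap hP f) ≫ S.cj₂ η ≫
      eqToHom (S.map_inverseMap hP g).symm :=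
  hP.map₂_pre₂ _

/-- The inverse of a locally bijective `2`-functor. -/
noncomputable def inverse : StrictPseudofunctor C B :=
  StrictPseudofunctor.mk''
    { obj := S.obj
      map f := S.inverseMap hP f
      map₂ η := S.inverseMap₂ hP η
      map₂_id f := hP.map₂_inj (by simp [map₂_inverseMap₂, cj₂_id])
      map₂_comp η θ := hP.map₂_inj (by simp [map₂_inverseMap₂, cj₂_comp])
      map_id X := hP.map_inj (by rw [map_inverseMap, S.cj_id, P.map_id])
      map_comp f g := hP.map_inj (by
        rw [map_inverseMap, S.cj_comp, P.map_comp, map_inverseMap, map_inverseMap])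
      map₂_whisker_left {X Y Z} f {g g'} η := hP.map₂_inj (by
        rw [map₂_inverseMap₂, P.map₂_comp, P.map₂_comp, P.map₂_whisker_left, map₂_inverseMap₂,
          congr_whiskerLeft (S.map_inverseMap hP f), P.mapComp_eq_eqToIso, P.mapComp_eq_eqToIso,
          PrelaxFunctor.map₂_eqToHom, PrelaxFunctor.map₂_eqToHom, cj₂_whiskerLeft]
        simp)
      map₂_whisker_right {X Y Z} {f f'} η g := hP.map₂_inj (by
        rw [map₂_inverseMap₂, P.map₂_comp, P.map₂_comp, P.map₂_whisker_right, map₂_inverseMap₂,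
          whiskerRight_congr (S.map_inverseMap hP g), P.mapComp_eq_eqToIso, P.mapComp_eq_eqToIso,
          PrelaxFunctor.map₂_eqToHom, PrelaxFunctor.map₂_eqToHom, cj₂_whiskerRight]
        simp) }

lemma localIso_inverse : LocalIso (S.inverse hP) where
  map_bij Y Z := by
    refine ⟨fun f g h => (S.cj_bij Y Z).1 ?_, fun g => ?_⟩
    · have h' : S.inverseMap hP f = S.inverseMap hP g := h
      show S.cj f = S.cj g
      rw [← S.map_inverseMap hP, h', S.map_inverseMap]
    · obtain ⟨f, hf⟩ := (S.cj_bij Y Z).2 (P.map g)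
      exact ⟨f, hP.map_inj ((S.map_inverseMap hP f).trans hf)⟩
  map₂_bij {Y Z} f g := by
    refine ⟨fun η θ h => (S.cj₂_bij f g).1 ?_, fun θ => ?_⟩
    · have h' := congrArg P.map₂ (show S.inverseMap₂ hP η = S.inverseMap₂ hP θ from h)
      rw [map₂_inverseMap₂, map₂_inverseMap₂] at h'
      exact (cancel_mono _).1 ((cancel_epi _).1 h')
    · obtain ⟨η, hη⟩ := (S.cj₂_bij f g).2 (eqToHom (S.map_inverseMap hP f).symm ≫
        P.map₂ (show S.inverseMap hP f ⟶ S.inverseMap hP g from θ) ≫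
        eqToHom (S.map_inverseMap hP g))
      refine ⟨η, hP.map₂_inj ((S.map₂_inverseMap₂ hP η).trans ?_)⟩
      rw [show S.cj₂ η = _ from hη]
      simp only [Category.assoc, eqToHom_trans_assoc, eqToHom_trans, eqToHom_refl,
        Category.comp_id, Category.id_comp]
      rfl

omit [Strict B] [Strict C] in
lemma pre_inv_hom (X : B) : hP.pre (S.inv (P.obj X)) ≫ hP.pre (S.hom (P.obj X)) = 𝟙 X :=
  hP.map_inj (by rw [P.map_comp, hP.map_pre, hP.map_pre, S.inv_hom, P.map_id])

omit [Strict B] [Strict C] in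
lemma pre_hom_inv (X : B) :
    hP.pre (S.hom (P.obj X)) ≫ hP.pre (S.inv (P.obj X)) = 𝟙 (S.obj (P.obj X)) :=
  hP.map_inj (by rw [P.map_comp, hP.map_pre, hP.map_pre, S.hom_inv, P.map_id])

lemma pre_inv_nat {X Y : B} (f : X ⟶ Y) : f ≫ hP.pre (S.inv (P.obj Y)) =
    hP.pre (S.inv (P.obj X)) ≫ S.inverseMap hP (P.map f) :=
  hP.map_inj (by
    rw [P.map_comp, hP.map_pre, P.map_comp, hP.map_pre, S.map_inverseMap, S.inv_cj])

lemma pre_inv_nat₂ {X Y : B} {f g : X ⟶ Y} (η : f ⟶ g) :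
    η ▷ hP.pre (S.inv (P.obj Y)) ≫ eqToHom (S.pre_inv_nat hP g) =
      eqToHom (S.pre_inv_nat hP f) ≫
        hP.pre (S.inv (P.obj X)) ◁ S.inverseMap₂ hP (P.map₂ η) :=
  hP.map₂_inj (by
    rw [P.map₂_comp, P.map₂_comp, P.map₂_whisker_left, P.map₂_whisker_right,
      PrelaxFunctor.map₂_eqToHom, PrelaxFunctor.map₂_eqToHom, map₂_inverseMap₂,
      congr_whiskerLeft (hP.map_pre _), whiskerRight_congr (hP.map_pre _),
      P.mapComp_eq_eqToIso, P.mapComp_eq_eqToIso, P.mapComp_eq_eqToIso, P.mapComp_eq_eqToIso]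
    have h := S.inv_cj₂ (P.map₂ η)
    rw [← cancel_mono (eqToHom (S.inv_cj (P.map g)))] at h
    simp only [Category.assoc, eqToHom_trans, eqToHom_refl, Category.comp_id] at h
    simp [h])

lemma counit_nat {X Y : C} (f : X ⟶ Y) :
    P.map (S.inverseMap hP f) ≫ S.hom Y = S.hom X ≫ f := by
  rw [map_inverseMap, cj_hom]

lemma counit_nat₂ {X Y : C} {f g : X ⟶ Y} (η : f ⟶ g) :
    P.map₂ (S.inverseMap₂ hP η) ▷ S.hom Y ≫ eqToHom (S.counit_nat hP g) =
      eqToHom (S.counit_nat hP f) ≫ S.hom X ◁ η := by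
  have h := S.cj₂_hom η
  rw [← cancel_epi (eqToHom (S.cj_hom f).symm)] at h
  simp only [eqToHom_trans_assoc, eqToHom_refl, Category.id_comp] at h
  rw [map₂_inverseMap₂, ← h]
  simp

/-- The `2`-equivalence given by a locally bijective `2`-functor that is surjective on objects
up to isomorphism. -/
noncomputable def twoEquivalence : TwoEquivalence B C where
  functor := P
  inverse := S.inverse hP
  unit :=
    { app X := hP.pre (S.inv (P.obj X))
      inv X := hP.pre (S.hom (P.obj X))
      app_inv X := S.pre_inv_hom hP X
      inv_app X := S.pre_hom_inv hP X
      nat f := S.pre_inv_nat hP f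
      nat₂ η := S.pre_inv_nat₂ hP η }
  counit :=
    { app Y := S.hom Y
      inv Y := S.inv Y
      app_inv Y := S.hom_inv Y
      inv_app Y := S.inv_hom Y
      nat f := S.counit_nat hP f
      nat₂ η := S.counit_nat₂ hP η }

end Cover

end TwoCat

/-! ### The Grothendieck construction is locally bijective -/

namespace Indx

variable {I J : Indx.{v, u}}

lemma elHom_injective {A B : I.base} {E : I.Fiber A} {E' : I.Fiber B} {f : A ⟶ B}
    {ξ ζ : E ⟶ (I.re f).obj E'} (h : I.elHom f ξ = I.elHom f ζ) : ξ = ζ := by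
  simpa [reCongr] using I.elHom_inj h rfl

lemma base_of_isHomLift {X Y : I.El} (f : X.base ⟶ Y.base) (m : X ⟶ Y)
    (h : (Pseudofunctor.CoGrothendieck.forget I.fib).IsHomLift f m) :
    Pseudofunctor.CoGrothendieck.Hom.base m = f :=
  (@CategoryTheory.IsHomLift.eq_of_isHomLift _ _ _ _ (Pseudofunctor.CoGrothendieck.forget I.fib)
    X Y f m h).symm

lemma exists_elHom {A B : I.base} {E : I.Fiber A} {E' : I.Fiber B}
    (m : I.elObj A E ⟶ I.elObj B E') (f : A ⟶ B)
    (h : Pseudofunctor.CoGrothendieck.Hom.base m = f) : ∃ ξ, I.elHom f ξ = m := by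
  subst h
  exact ⟨m.fiber, rfl⟩

lemma exists_elObj (X : I.El) (A : I.base) (h : X.base = A) : ∃ E, I.elObj A E = X := by
  subst h
  exact ⟨X.fiber, rfl⟩

lemma elVert_injective {A : I.base} {E E' : I.Fiber A} {ξ ζ : E ⟶ E'}
    (h : I.elVert ξ = I.elVert ζ) : ξ = ζ :=
  (cancel_mono _).1 (elHom_injective h)

lemma elVert_id {A : I.base} (E : I.Fiber A) : I.elVert (𝟙 E) = 𝟙 _ := by
  rw [elVert, elHom_id, Category.id_comp]

lemma elVert_comp {A : I.base} {E E' E'' : I.Fiber A} (ξ : E ⟶ E') (ζ : E' ⟶ E'') :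
    I.elVert (ξ ≫ ζ) = I.elVert ξ ≫ I.elVert ζ := by
  have h := elVert_elHom ξ (𝟙 A) (ζ ≫ I.idHom A E'')
  rw [← Category.assoc] at h
  exact h.symm

/-- The data of a `1`-morphism of indexed categories in terms of the categories of elements. -/
structure ElData (I J : Indx.{v, u}) where
  base : I.base ⟶ J.base
  obj (A : I.base) : I.Fiber A → J.Fiber (base.toFunctor.obj A)
  map {A B : I.base} {E : I.Fiber A} {E' : I.Fiber B} (f : A ⟶ B) (ξ : E ⟶ (I.re f).obj E') :
    obj A E ⟶ (J.re (base.toFunctor.map f)).obj (obj B E')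
  map_id (A : I.base) (E : I.Fiber A) :
    J.elHom (base.toFunctor.map (𝟙 A)) (map (𝟙 A) (I.idHom A E)) = 𝟙 _
  map_comp {A B C : I.base} {E : I.Fiber A} {E' : I.Fiber B} {E'' : I.Fiber C} (f : A ⟶ B)
    (g : B ⟶ C) (ξ : E ⟶ (I.re f).obj E') (ζ : E' ⟶ (I.re g).obj E'') :
    J.elHom (base.toFunctor.map (f ≫ g)) (map (f ≫ g) (ξ ≫ (I.re f).map ζ ≫ I.compHom f g E'')) =
      J.elHom (base.toFunctor.map f) (map f ξ) ≫ J.elHom (base.toFunctor.map g) (map g ζ)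
  isIso {A B : I.base} (f : A ⟶ B) (E : I.Fiber B) : IsIso (map f (𝟙 ((I.re f).obj E)))

namespace ElData

variable (T : ElData I J)

/-- The action on a morphism of the category of elements. -/
def el {A B : I.base} {E : I.Fiber A} {E' : I.Fiber B} (m : I.elObj A E ⟶ I.elObj B E') :
    J.elObj _ (T.obj A E) ⟶ J.elObj _ (T.obj B E') :=
  J.elHom (T.base.toFunctor.map (Pseudofunctor.CoGrothendieck.Hom.base m))
    (T.map (Pseudofunctor.CoGrothendieck.Hom.base m) (Pseudofunctor.CoGrothendieck.Hom.fiber m))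

lemma el_comp {A B C : I.base} {E : I.Fiber A} {E' : I.Fiber B} {E'' : I.Fiber C}
    (m : I.elObj A E ⟶ I.elObj B E') (n : I.elObj B E' ⟶ I.elObj C E'') :
    T.el (m ≫ n) = T.el m ≫ T.el n :=
  T.map_comp _ _ _ _

lemma el_elHom {A B : I.base} {E : I.Fiber A} {E' : I.Fiber B} (f : A ⟶ B)
    (ξ : E ⟶ (I.re f).obj E') :
    T.el (I.elHom f ξ) = J.elHom (T.base.toFunctor.map f) (T.map f ξ) := rfl

lemma exists_vert {A : I.base} {E E' : I.Fiber A} (ξ : E ⟶ E') :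
    ∃ ζ : T.obj A E ⟶ T.obj A E', J.elVert ζ = T.el (I.elVert ξ) := by
  refine ⟨T.map (𝟙 A) (ξ ≫ I.idHom A E') ≫ J.reCongr (T.base.toFunctor.map_id A) _ ≫
    inv (J.idHom _ _), ?_⟩
  rw [elVert, elVert, el_elHom]
  refine (J.elHom_ext (T.base.toFunctor.map_id A) ?_).symm
  simp

/-- The action on morphisms in the fibres. -/
noncomputable def fibMap {A : I.base} {E E' : I.Fiber A} (ξ : E ⟶ E') : T.obj A E ⟶ T.obj A E' :=
  (T.exists_vert ξ).choose

lemma elVert_fibMap {A : I.base} {E E' : I.Fiber A} (ξ : E ⟶ E') :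
    J.elVert (T.fibMap ξ) = T.el (I.elVert ξ) := (T.exists_vert ξ).choose_spec

lemma el_id {A : I.base} (E : I.Fiber A) : T.el (𝟙 (I.elObj A E)) = 𝟙 _ := T.map_id A E

/-- The functors between the fibres. -/
noncomputable def fib (A : I.base) : I.Fiber A ⥤ J.Fiber (T.base.toFunctor.obj A) where
  obj := T.obj A
  map ξ := T.fibMap ξ
  map_id E := elVert_injective (by rw [elVert_fibMap, elVert_id, elVert_id, el_id])
  map_comp ξ ζ := elVert_injective (by rw [elVert_fibMap, elVert_comp, elVert_comp, el_comp,
    elVert_fibMap, elVert_fibMap])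

lemma map_eq {A B : I.base} {E : I.Fiber A} {E' : I.Fiber B} (f : A ⟶ B)
    (ξ : E ⟶ (I.re f).obj E') : T.map f ξ = T.fibMap ξ ≫ T.map f (𝟙 _) := by
  refine elHom_injective ?_
  rw [← elVert_elHom, elVert_fibMap, ← el_elHom, ← el_elHom, ← el_comp, elVert_elHom,
    Category.comp_id]

lemma map_naturality {A B : I.base} (f : A ⟶ B) {E E' : I.Fiber B} (ξ : E ⟶ E') :
    T.fibMap ((I.re f).map ξ) ≫ T.map f (𝟙 _) =
      T.map f (𝟙 _) ≫ (J.re (T.base.toFunctor.map f)).map (T.fibMap ξ) := by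
  rw [← map_eq]
  refine elHom_injective ?_
  rw [← elHom_elVert, elVert_fibMap, ← el_elHom, ← el_elHom, ← el_comp, elHom_elVert,
    Category.id_comp]

/-- The isomorphisms `κ`. -/
noncomputable def κ {A B : I.base} (f : A ⟶ B) :
    I.re f ⋙ T.fib A ≅ T.fib B ⋙ J.re (T.base.toFunctor.map f) :=
  NatIso.ofComponents (fun E => @asIso _ _ _ _ (T.map f (𝟙 ((I.re f).obj E))) (T.isIso f E))
    (fun ξ => T.map_naturality f ξ)

lemma κ_hom_app {A B : I.base} (f : A ⟶ B) (E : I.Fiber B) :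
    (T.κ f).hom.app E = T.map f (𝟙 ((I.re f).obj E)) := rfl

/-- The `1`-morphism of indexed categories given by its action on the categories of elements. -/
noncomputable def hom : I ⟶ J where
  base := T.base
  fib := T.fib
  κ := T.κ
  κ_id A E := by
    rw [κ_hom_app]
    refine (T.map_eq (𝟙 A) (I.idHom A E)).symm.trans ?_
    exact (J.elHom_inj (T.map_id A E).symm (T.base.toFunctor.map_id A).symm).symm
  κ_comp {A B C} f g E := by
    rw [κ_hom_app, κ_hom_app, κ_hom_app]
    refine (T.map_eq (f ≫ g) (I.compHom f g E)).symm.trans ?_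
    have h := T.map_comp f g (𝟙 ((I.re f).obj ((I.re g).obj E))) (𝟙 ((I.re g).obj E))
    rw [elHom_comp] at h
    have h2 := J.elHom_inj h.symm (T.base.toFunctor.map_comp f g).symm
    simp only [CategoryTheory.Functor.map_id, Category.id_comp, Category.assoc] at h2
    exact h2.symm

lemma elMap_hom {A B : I.base} {E : I.Fiber A} {E' : I.Fiber B} (f : A ⟶ B)
    (ξ : E ⟶ (I.re f).obj E') :
    Hom.elMap T.hom f ξ = J.elHom (T.base.toFunctor.map f) (T.map f ξ) := by
  rw [map_eq]
  rfl

end ElData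

end Indx

namespace Groth

variable {I J : Indx.{v, u}}

lemma isIso_of_elHom_cart {A B : I.base} {E : I.Fiber A} {E' : I.Fiber B} (f : A ⟶ B)
    (ξ : E ⟶ (I.re f).obj E')
    (h : (Pseudofunctor.CoGrothendieck.forget I.fib).IsStronglyCartesian f (I.elHom f ξ)) :
    IsIso ξ := by
  have hl := lift_cart I f E'
  have hlift : (Pseudofunctor.CoGrothendieck.forget I.fib).IsHomLift (𝟙 A) (I.elVert ξ) :=
    isHomLift_elHom I (𝟙 A) (ξ ≫ I.idHom A _)
  have e : I.elVert ξ ≫ I.elHom f (𝟙 _) = I.elHom f ξ := by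
    rw [Indx.elVert_elHom, Category.comp_id]
  have h' : (Pseudofunctor.CoGrothendieck.forget I.fib).IsStronglyCartesian (𝟙 A ≫ f)
      (I.elVert ξ ≫ I.elHom f (𝟙 _)) := by
    rw [e, Category.id_comp]; exact h
  have hv := Functor.IsStronglyCartesian.of_comp (Pseudofunctor.CoGrothendieck.forget I.fib)
    (f := 𝟙 A) (g := f) (φ := I.elVert ξ) (ψ := I.elHom f (𝟙 ((I.re f).obj E')))
  have hi := Functor.IsStronglyCartesian.isIso_of_base_isIso
    (Pseudofunctor.CoGrothendieck.forget I.fib) (𝟙 A) (I.elVert ξ)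
  have hil : (Pseudofunctor.CoGrothendieck.forget I.fib).IsHomLift (𝟙 A) (inv (I.elVert ξ)) :=
    inferInstance
  have hb : Pseudofunctor.CoGrothendieck.Hom.base (inv (I.elVert ξ)) = 𝟙 A :=
    Indx.base_of_isHomLift _ _ hil
  obtain ⟨ζ, hζ⟩ := Indx.exists_elHom (inv (I.elVert ξ)) (𝟙 A) hb
  have hζ' : I.elVert (ζ ≫ inv (I.idHom A E)) = inv (I.elVert ξ) := by
    rw [Indx.elVert, Category.assoc, IsIso.inv_hom_id, Category.comp_id, hζ]
  exact ⟨ζ ≫ inv (I.idHom A E),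
    Indx.elVert_injective (by rw [Indx.elVert_comp, hζ', IsIso.hom_inv_id, Indx.elVert_id]),
    Indx.elVert_injective (by rw [Indx.elVert_comp, hζ', IsIso.inv_hom_id, Indx.elVert_id])⟩

lemma map₂_bij (F G : I ⟶ J) : Function.Bijective (fun a : F ⟶ G => map₂ a) := by
  refine ⟨fun a b h => Indx.hom₂_ext (congrArg Fib.Hom₂.base h) fun A E => ?_, fun b => ?_⟩
  · exact congrArg (fun x : map F ⟶ map G => (Fib.Hom₂.total x).toNatTrans.app (I.elObj A E)) h
  · have hb (A : I.base) (E : I.Fiber A) : ∃ ξ, J.elHom ((Fib.Hom₂.base b).toNatTrans.app A) ξ =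
        (Fib.Hom₂.total b).toNatTrans.app (I.elObj A E) := by
      refine Indx.exists_elHom (E := (Indx.Hom.fib F A).obj E) (E' := (Indx.Hom.fib G A).obj E)
        _ _ ?_
      exact Indx.base_of_isHomLift _ _ (Fib.Hom₂.isLift b (I.elObj A E))
    choose fib hfib using hb
    refine ⟨Indx.Hom₂.mkEl (F := F) (G := G) (Fib.Hom₂.base b) fib ?_, ?_⟩
    · intro A B E E' f ξ
      refine (congrArg (Indx.Hom.elMap F f ξ ≫ ·) (hfib B E')).trans (Eq.trans ?_
        (congrArg (· ≫ Indx.Hom.elMap G f ξ) (hfib A E).symm))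
      exact (Fib.Hom₂.total b).toNatTrans.naturality (I.elHom f ξ)
    · refine Fib.hom₂_ext rfl (Cat.Hom₂.ext (NatTrans.ext (funext fun X => ?_)))
      exact hfib X.base X.fiber

end Groth

namespace Indx

variable {I J : Indx.{v, u}}

lemma elObj_injective {A : I.base} {E E' : I.Fiber A} (h : I.elObj A E = I.elObj A E') :
    E = E' :=
  eq_of_heq (Pseudofunctor.CoGrothendieck.mk.inj h).2

lemma heq_of_elVert_heq {A : I.base} {E₁ E₂ E₁' E₂' : I.Fiber A} (h₁ : E₁ = E₁')
    (h₂ : E₂ = E₂') {ξ : E₁ ⟶ E₂} {ζ : E₁' ⟶ E₂'} (h : HEq (I.elVert ξ) (I.elVert ζ)) :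
    HEq ξ ζ := by
  subst h₁ h₂
  exact heq_of_eq (elVert_injective (eq_of_heq h))

lemma heq_of_elHom_heq {A B : I.base} {f : A ⟶ B} {E₁ E₁' : I.Fiber A} {E₂ E₂' : I.Fiber B}
    (h₁ : E₁ = E₁') (h₂ : E₂ = E₂') {ξ : E₁ ⟶ (I.re f).obj E₂} {ζ : E₁' ⟶ (I.re f).obj E₂'}
    (h : HEq (I.elHom f ξ) (I.elHom f ζ)) : HEq ξ ζ := by
  subst h₁ h₂
  exact heq_of_eq (elHom_injective (eq_of_heq h))

lemma functor_map_heq {C : Type u₁} [Category.{v₁} C] {D : Type u₂} [Category.{v₂} D]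
    {F G : C ⥤ D} (h : F = G) {X Y : C} (f : X ⟶ Y) : HEq (F.map f) (G.map f) := by
  subst h; rfl

lemma Hom.elMap_one (F : I ⟶ J) {A B : I.base} (f : A ⟶ B) (E : I.Fiber B) :
    Hom.elMap F f (𝟙 ((I.re f).obj E)) = J.elHom ((Hom.base F).toFunctor.map f) (Hom.k F f E) := by
  rw [Hom.elMap, CategoryTheory.Functor.map_id, Category.id_comp]

lemma Hom.ext_el {F G : I ⟶ J} (hb : Hom.base F = Hom.base G) (h : Hom.el F = Hom.el G) :
    F = G := by
  have hobj (A : I.base) (E : I.Fiber A) := Functor.congr_obj h (I.elObj A E)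
  have hvert {A : I.base} {E E' : I.Fiber A} (ξ : E ⟶ E') :
      HEq (J.elVert ((Hom.fib F A).map ξ)) (J.elVert ((Hom.fib G A).map ξ)) := by
    have h1 := functor_map_heq h (I.elVert ξ)
    have h2 : (Hom.el F).map (I.elVert ξ) = J.elVert ((Hom.fib F A).map ξ) := Hom.elMap_vert F ξ
    have h3 : (Hom.el G).map (I.elVert ξ) = J.elVert ((Hom.fib G A).map ξ) := Hom.elMap_vert G ξ
    exact (heq_of_eq h2.symm).trans (h1.trans (heq_of_eq h3))
  have hk {A B : I.base} (f : A ⟶ B) (E : I.Fiber B) :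
      HEq (J.elHom ((Hom.base F).toFunctor.map f) (Hom.k F f E))
        (J.elHom ((Hom.base G).toFunctor.map f) (Hom.k G f E)) := by
    have h1 := functor_map_heq h (I.elHom f (𝟙 ((I.re f).obj E)))
    exact (heq_of_eq (Hom.elMap_one F f E).symm).trans (h1.trans (heq_of_eq (Hom.elMap_one G f E)))
  clear h
  obtain ⟨bF, fF, kF, iF, cF⟩ := F
  obtain ⟨bG, fG, kG, iG, cG⟩ := G
  dsimp at hb
  subst hb
  have hf (A : I.base) : fF A = fG A :=
    CategoryTheory.Functor.hext (fun E => elObj_injective (hobj A E))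
      (fun E E' ξ => heq_of_elVert_heq (elObj_injective (hobj A E)) (elObj_injective (hobj A E'))
        (hvert ξ))
  obtain rfl : fF = fG := funext hf
  exact Hom.ext' rfl (fun _ => HEq.rfl) (fun f E => heq_of_elHom_heq rfl rfl (hk f E))

end Indx

namespace Groth

variable {I J : Indx.{v, u}}

lemma map_injective : Function.Injective (fun F : I ⟶ J => map F) := fun F G h =>
  Indx.Hom.ext_el (congrArg Fib.Hom.base h)
    (congrArg (fun x : obj I ⟶ obj J => (Fib.Hom.total x).toFunctor) h)

lemma functor_copy {C : Type u₁} [Category.{v₁} C] {D : Type u₂} [Category.{v₂} D]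
    (F : C ⥤ D) (o : C → D) (h : ∀ X, o X = F.obj X) :
    ∃ m : ∀ {X Y : C}, (X ⟶ Y) → (o X ⟶ o Y), ∃ (hi : ∀ X, m (𝟙 X) = 𝟙 (o X))
      (hc : ∀ {X Y Z : C} (f : X ⟶ Y) (g : Y ⟶ Z), m (f ≫ g) = m f ≫ m g),
      (⟨o, m, hi, hc⟩ : C ⥤ D) = F := by
  obtain rfl : o = F.obj := funext h
  exact ⟨F.map, F.map_id, F.map_comp, rfl⟩

lemma exists_hom_of_functor (b : I.base ⟶ J.base) (T : I.El ⥤ J.El)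
    (hcomm : T ⋙ Pseudofunctor.CoGrothendieck.forget J.fib =
      Pseudofunctor.CoGrothendieck.forget I.fib ⋙ b.toFunctor)
    (hcart : ∀ {A : I.base} (X : I.El) (f : A ⟶ X.base),
      (Pseudofunctor.CoGrothendieck.forget J.fib).IsStronglyCartesian (b.toFunctor.map f)
        (T.map (I.elHom (E' := X.fiber) f (𝟙 ((I.re f).obj X.fiber))))) :
    ∃ F : I ⟶ J, Indx.Hom.base F = b ∧ Indx.Hom.el F = T := by
  have ho (A : I.base) (E : I.Fiber A) :
      ∃ E', J.elObj (b.toFunctor.obj A) E' = T.obj (I.elObj A E) :=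
    Indx.exists_elObj _ _ (Functor.congr_obj hcomm (I.elObj A E))
  choose fo hfo using ho
  obtain ⟨m, mi, mc, hm⟩ := functor_copy T
    (fun X : I.El => J.elObj (b.toFunctor.obj X.base) (fo X.base X.fiber))
    (fun X => hfo X.base X.fiber)
  subst hm
  have hmb {X Y : I.El} (f : X ⟶ Y) : Pseudofunctor.CoGrothendieck.Hom.base (m f) =
      b.toFunctor.map (Pseudofunctor.CoGrothendieck.Hom.base f) :=
    (Functor.congr_hom hcomm f).trans ((Category.id_comp _).trans (Category.comp_id _))
  have hmp {A B : I.base} {E : I.Fiber A} {E' : I.Fiber B} (f : A ⟶ B)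
      (ξ : E ⟶ (I.re f).obj E') : ∃ ζ : fo A E ⟶ (J.re _).obj (fo B E'),
        J.elHom (b.toFunctor.map f) ζ = m (I.elHom f ξ) :=
    Indx.exists_elHom (E := fo A E) (E' := fo B E') (m (I.elHom f ξ)) _ (hmb _)
  choose mp hmp' using @hmp
  let T : Indx.ElData I J :=
    { base := b
      obj := fo
      map := fun f ξ => mp f ξ
      map_id := fun A E => (hmp' _ _).trans (mi (I.elObj A E))
      map_comp := fun f g ξ ζ => (hmp' _ _).trans ((mc (I.elHom f ξ) (I.elHom g ζ)).trans
        (congrArg₂ (· ≫ ·) (hmp' _ _).symm (hmp' _ _).symm))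
      isIso := fun {A B} f E => isIso_of_elHom_cart _ _ (by
        rw [hmp']
        exact hcart (I.elObj B E) f) }
  refine ⟨T.hom, rfl, ?_⟩
  refine CategoryTheory.Functor.hext (fun _ => rfl) (fun X Y f => heq_of_eq ?_)
  exact (T.elMap_hom (E := X.fiber) (E' := Y.fiber) _ _).trans (hmp' (E := X.fiber) (E' := Y.fiber) _ _)

lemma map_surjective : Function.Surjective (fun F : I ⟶ J => map F) := by
  intro Φ
  obtain ⟨F, hb, ht⟩ := exists_hom_of_functor (Fib.Hom.base Φ) (Fib.Hom.total Φ).toFunctor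
    (congrArg Cat.Hom.toFunctor (Fib.Hom.comm Φ)) (fun X f => Fib.Hom.cart Φ X f)
  exact ⟨F, Fib.Hom.ext hb (Cat.Hom.ext ht)⟩

end Groth

lemma localIso_grothendieck : LocalIso grothendieck.{v, u} where
  map_bij _ _ := ⟨Groth.map_injective, Groth.map_surjective⟩
  map₂_bij F G := Groth.map₂_bij F G

/-! ### The indexed category of the fibres of a cloven fibration -/

section Cartesian

variable {S : Type u₁} [Category.{v₁} S] {C : Type u₂} [Category.{v₂} C] (p : C ⥤ S)

lemma isHomLift_comp_iff {D : Type u₃} [Category.{v₃} D] (F : D ⥤ C) {A B : S} (f : A ⟶ B)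
    {X Y : D} (m : X ⟶ Y) : (F ⋙ p).IsHomLift f m ↔ p.IsHomLift f (F.map m) := by
  refine ⟨fun h => ?_, fun h => ?_⟩
  · cases h
    exact CategoryTheory.IsHomLift.map p (F.map m)
  · exact CategoryTheory.IsHomLift.of_fac (F ⋙ p) f m
      (CategoryTheory.IsHomLift.domain_eq p f (F.map m))
      (CategoryTheory.IsHomLift.codomain_eq p f (F.map m))
      (CategoryTheory.IsHomLift.fac p f (F.map m))

lemma isStronglyCartesian_of_map {D : Type u₃} [Category.{v₃} D] (F : D ⥤ C) [F.Full]
    [F.Faithful] {A B : S} (f : A ⟶ B) {X Y : D} (m : X ⟶ Y)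
    (h : p.IsStronglyCartesian f (F.map m)) : (F ⋙ p).IsStronglyCartesian f m where
  toIsHomLift := (isHomLift_comp_iff p F f m).2 inferInstance
  universal_property' {Z} g m' hm' := by
    have hm'' := (isHomLift_comp_iff p F (g ≫ f) m').1 hm'
    obtain ⟨χ, ⟨hχ, hχ'⟩, hu⟩ := Functor.IsStronglyCartesian.universal_property p f (F.map m) g _ rfl
      (F.map m')
    refine ⟨F.preimage χ, ⟨(isHomLift_comp_iff p F _ _).2 (by simpa using hχ),
      F.map_injective (by simpa using hχ')⟩, ?_⟩
    rintro ψ ⟨hψ, hψ'⟩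
    refine F.map_injective ?_
    rw [F.map_preimage]
    exact hu _ ⟨(isHomLift_comp_iff p F _ _).1 hψ, by rw [← F.map_comp, hψ']⟩

lemma isStronglyCartesian_eqToHom {A B : S} (f : A ⟶ B) {X X' Y Y' : C} (h : X' = X) (m : X ⟶ Y)
    (h' : Y = Y') (hm : p.IsStronglyCartesian f m) :
    p.IsStronglyCartesian f (eqToHom h ≫ m ≫ eqToHom h') := by
  subst h h'
  simpa using hm

lemma isStronglyCartesian_comp_eqToHom_iff {A B B' : S} (f : A ⟶ B) (h : B = B') {X Y : C}
    (m : X ⟶ Y) : p.IsStronglyCartesian (f ≫ eqToHom h) m ↔ p.IsStronglyCartesian f m := by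
  subst h
  simp

lemma exists_inverse (F : C ⥤ S) [F.Full] [F.Faithful] (h : Function.Bijective F.obj) :
    ∃ G : S ⥤ C, F ⋙ G = 𝟭 C ∧ G ⋙ F = 𝟭 S := by
  choose o ho using h.2
  let G : S ⥤ C :=
    { obj := o
      map := fun {X Y} g => F.preimage (eqToHom (ho X) ≫ g ≫ eqToHom (ho Y).symm)
      map_id := fun X => F.map_injective (by simp)
      map_comp := fun f g => F.map_injective (by simp) }
  refine ⟨G, CategoryTheory.Functor.ext (fun X => h.1 (ho _)) (fun X Y f => ?_),
    CategoryTheory.Functor.ext ho (fun X Y f => ?_)⟩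
  · refine F.map_injective ?_
    simp [G, eqToHom_map]
  · simp [G]

end Cartesian

namespace Fib

/-- The fibre of a cloven fibration. -/
structure FiberAt (P : Fib.{v, u}) (A : P.base) where
  obj : P.total
  isOver : P.proj.toFunctor.obj obj = A

variable {P : Fib.{v, u}}

namespace FiberAt

/-- The morphisms of a fibre. -/
@[ext]
structure Hom {A : P.base} (E E' : P.FiberAt A) where
  hom : E.obj ⟶ E'.obj
  isLift : P.proj.toFunctor.IsHomLift (𝟙 A) hom

instance (A : P.base) : Category (P.FiberAt A) where
  Hom E E' := Hom E E'
  id E := ⟨𝟙 _, CategoryTheory.IsHomLift.id E.isOver⟩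
  comp ξ ζ := ⟨ξ.hom ≫ ζ.hom, by
    have := ξ.isLift
    have := ζ.isLift
    infer_instance⟩
  id_comp ξ := Hom.ext (Category.id_comp ξ.hom)
  comp_id ξ := Hom.ext (Category.comp_id ξ.hom)
  assoc ξ ζ χ := Hom.ext (Category.assoc ξ.hom ζ.hom χ.hom)

variable {A : P.base} {E E' E'' : P.FiberAt A}

lemma hom_ext {ξ ζ : E ⟶ E'} (h : ξ.hom = ζ.hom) : ξ = ζ := Hom.ext h

@[simp] lemma comp_hom (ξ : E ⟶ E') (ζ : E' ⟶ E'') : (ξ ≫ ζ).hom = ξ.hom ≫ ζ.hom := rfl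

@[simp] lemma id_hom (E : P.FiberAt A) : (𝟙 E : E ⟶ E).hom = 𝟙 E.obj := rfl

lemma id_lift (E : P.FiberAt A) : P.proj.toFunctor.IsHomLift (𝟙 A) (𝟙 E.obj) :=
  CategoryTheory.IsHomLift.id E.isOver

lemma id_cart (E : P.FiberAt A) : P.proj.toFunctor.IsStronglyCartesian (𝟙 A) (𝟙 E.obj) := by
  have := id_lift E
  infer_instance

lemma lift_comp {B : P.base} {f : A ⟶ B} {X : P.total} (ξ : E ⟶ E') {m : E'.obj ⟶ X}
    (hm : P.proj.toFunctor.IsHomLift f m) : P.proj.toFunctor.IsHomLift f (ξ.hom ≫ m) := by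
  have := ξ.isLift
  infer_instance

lemma comp_lift {B : P.base} {f : B ⟶ A} {X : P.total} {m : X ⟶ E.obj} (ξ : E ⟶ E')
    (hm : P.proj.toFunctor.IsHomLift f m) : P.proj.toFunctor.IsHomLift f (m ≫ ξ.hom) := by
  have := ξ.isLift
  infer_instance

variable {B : P.base} {f : A ⟶ B} {X : P.total}

/-- The morphism of a fibre induced by a cartesian morphism. -/
noncomputable def ind {m : E'.obj ⟶ X} (hm : P.proj.toFunctor.IsStronglyCartesian f m)
    {n : E.obj ⟶ X} (hn : P.proj.toFunctor.IsHomLift f n) : E ⟶ E' :=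
  ⟨Functor.IsStronglyCartesian.map P.proj.toFunctor f m (Category.id_comp f).symm n, inferInstance⟩

@[simp]
lemma ind_hom_comp {m : E'.obj ⟶ X} (hm : P.proj.toFunctor.IsStronglyCartesian f m)
    {n : E.obj ⟶ X} (hn : P.proj.toFunctor.IsHomLift f n) : (ind hm hn).hom ≫ m = n :=
  Functor.IsStronglyCartesian.fac P.proj.toFunctor f m (Category.id_comp f).symm n

lemma ind_ext {m : E'.obj ⟶ X} (hm : P.proj.toFunctor.IsStronglyCartesian f m) {ξ ζ : E ⟶ E'}
    (h : ξ.hom ≫ m = ζ.hom ≫ m) : ξ = ζ := by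
  have := ξ.isLift
  have := ζ.isLift
  exact hom_ext (Functor.IsStronglyCartesian.ext P.proj.toFunctor f m (𝟙 A) h)

/-- The isomorphism between two cartesian lifts. -/
noncomputable def cmp {n : E.obj ⟶ X} (hn : P.proj.toFunctor.IsStronglyCartesian f n)
    {m : E'.obj ⟶ X} (hm : P.proj.toFunctor.IsStronglyCartesian f m) : E ≅ E' where
  hom := ind hm hn.toIsHomLift
  inv := ind hn hm.toIsHomLift
  hom_inv_id := ind_ext hn (by
    rw [comp_hom, Category.assoc, ind_hom_comp, ind_hom_comp, id_hom, Category.id_comp])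
  inv_hom_id := ind_ext hm (by
    rw [comp_hom, Category.assoc, ind_hom_comp, ind_hom_comp, id_hom, Category.id_comp])

end FiberAt

open FiberAt

variable {A B C : P.base}

lemma cart_pull (f : A ⟶ B) (E : P.FiberAt B) : P.proj.toFunctor.IsStronglyCartesian f
    (P.lift E.obj (f ≫ eqToHom E.isOver.symm)) :=
  (isStronglyCartesian_comp_eqToHom_iff _ _ _ _).1 (P.cart E.obj (f ≫ eqToHom E.isOver.symm))

/-- The substitution functors on objects. -/
def reObj (f : A ⟶ B) (E : P.FiberAt B) : P.FiberAt A :=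
  ⟨P.pull E.obj (f ≫ eqToHom E.isOver.symm),
    have := cart_pull f E
    CategoryTheory.IsHomLift.domain_eq P.proj.toFunctor f (P.lift E.obj (f ≫ eqToHom E.isOver.symm))⟩

/-- The cartesian lift with codomain an object of a fibre. -/
def lft (f : A ⟶ B) (E : P.FiberAt B) : (reObj f E).obj ⟶ E.obj :=
  P.lift E.obj (f ≫ eqToHom E.isOver.symm)

lemma lft_cart (f : A ⟶ B) (E : P.FiberAt B) :
    P.proj.toFunctor.IsStronglyCartesian f (lft f E) := cart_pull f E

lemma lft_comp_cart (f : A ⟶ B) (g : B ⟶ C) (E : P.FiberAt C) :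
    P.proj.toFunctor.IsStronglyCartesian (f ≫ g) (lft f (reObj g E) ≫ lft g E) := by
  have := lft_cart f (reObj g E)
  have := lft_cart g E
  exact Functor.IsStronglyCartesian.comp (p := P.proj.toFunctor) (φ := lft f (reObj g E))
    (ψ := lft g E)

/-- The substitution functors on morphisms. -/
noncomputable def reMap (f : A ⟶ B) {E E' : P.FiberAt B} (ξ : E ⟶ E') : reObj f E ⟶ reObj f E' :=
  ind (lft_cart f E') (comp_lift ξ (lft_cart f E).toIsHomLift)

@[simp]
lemma reMap_hom_comp (f : A ⟶ B) {E E' : P.FiberAt B} (ξ : E ⟶ E') :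
    (reMap f ξ).hom ≫ lft f E' = lft f E ≫ ξ.hom :=
  ind_hom_comp _ _

@[simp]
lemma reMap_hom_comp_assoc (f : A ⟶ B) {E E' : P.FiberAt B} (ξ : E ⟶ E') {X : P.total}
    (m : E'.obj ⟶ X) : (reMap f ξ).hom ≫ lft f E' ≫ m = lft f E ≫ ξ.hom ≫ m := by
  rw [← Category.assoc, reMap_hom_comp, Category.assoc]

/-- The substitution functor between the fibres. -/
noncomputable def reFunctor (f : A ⟶ B) : P.FiberAt B ⥤ P.FiberAt A where
  obj E := reObj f E
  map ξ := reMap f ξ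
  map_id E := ind_ext (lft_cart f E) (by simp)
  map_comp ξ ζ := ind_ext (lft_cart f _) (by simp)

/-- The components of the unitor of the substitution functors. -/
noncomputable def reIdApp (E : P.FiberAt A) : reObj (𝟙 A) E ≅ E :=
  cmp (lft_cart (𝟙 A) E) (id_cart E)

@[simp]
lemma reIdApp_hom_hom (E : P.FiberAt A) : (reIdApp E).hom.hom = lft (𝟙 A) E :=
  (Category.comp_id _).symm.trans (ind_hom_comp _ _)

@[simp]
lemma reIdApp_inv_hom_comp (E : P.FiberAt A) : (reIdApp E).inv.hom ≫ lft (𝟙 A) E = 𝟙 E.obj :=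
  ind_hom_comp _ _

/-- The unitor of the substitution functors. -/
noncomputable def reId (A : P.base) : reFunctor (𝟙 A) ≅ 𝟭 (P.FiberAt A) :=
  NatIso.ofComponents (fun E => reIdApp E) (fun {E E'} ξ => hom_ext (by
    show (reMap (𝟙 A) ξ).hom ≫ (reIdApp E').hom.hom = (reIdApp E).hom.hom ≫ ξ.hom
    simp))

/-- The components of the compositor of the substitution functors. -/
noncomputable def reCompApp (f : A ⟶ B) (g : B ⟶ C) (E : P.FiberAt C) :
    reObj (f ≫ g) E ≅ reObj f (reObj g E) :=
  cmp (lft_cart (f ≫ g) E) (lft_comp_cart f g E)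

@[simp]
lemma reCompApp_hom_hom_comp (f : A ⟶ B) (g : B ⟶ C) (E : P.FiberAt C) :
    (reCompApp f g E).hom.hom ≫ lft f (reObj g E) ≫ lft g E = lft (f ≫ g) E :=
  ind_hom_comp _ _

@[simp]
lemma reCompApp_hom_hom_comp_assoc (f : A ⟶ B) (g : B ⟶ C) (E : P.FiberAt C) {X : P.total}
    (m : E.obj ⟶ X) :
    (reCompApp f g E).hom.hom ≫ lft f (reObj g E) ≫ lft g E ≫ m = lft (f ≫ g) E ≫ m := by
  rw [← reCompApp_hom_hom_comp f g E, Category.assoc, Category.assoc]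

@[simp]
lemma reCompApp_inv_hom_comp (f : A ⟶ B) (g : B ⟶ C) (E : P.FiberAt C) :
    (reCompApp f g E).inv.hom ≫ lft (f ≫ g) E = lft f (reObj g E) ≫ lft g E :=
  ind_hom_comp _ _

@[simp]
lemma reCompApp_inv_hom_comp_assoc (f : A ⟶ B) (g : B ⟶ C) (E : P.FiberAt C) {X : P.total}
    (m : E.obj ⟶ X) :
    (reCompApp f g E).inv.hom ≫ lft (f ≫ g) E ≫ m = lft f (reObj g E) ≫ lft g E ≫ m := by
  rw [← Category.assoc, reCompApp_inv_hom_comp, Category.assoc]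

/-- The compositor of the substitution functors. -/
noncomputable def reComp (f : A ⟶ B) (g : B ⟶ C) :
    reFunctor (P := P) (f ≫ g) ≅ reFunctor g ⋙ reFunctor f :=
  NatIso.ofComponents (fun E => reCompApp f g E) (fun {E E'} ξ => ind_ext (lft_comp_cart f g E') (by
    show ((reMap (f ≫ g) ξ).hom ≫ (reCompApp f g E').hom.hom) ≫ lft f (reObj g E') ≫ lft g E' =
      ((reCompApp f g E).hom.hom ≫ (reMap f (reMap g ξ)).hom) ≫ lft f (reObj g E') ≫ lft g E'
    simp))

lemma eqToHom_hom_lft {f g : A ⟶ B} (h : f = g) (E : P.FiberAt B) (h' : reObj f E = reObj g E) :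
    (eqToHom h' : reObj f E ⟶ reObj g E).hom ≫ lft g E = lft f E := by
  subst h
  exact Category.id_comp _

lemma re_assoc {D : P.base} (h : A ⟶ B) (g : B ⟶ C) (f : C ⟶ D) (E : P.FiberAt D) :
    (reCompApp h (g ≫ f) E).hom ≫ reMap h (reCompApp g f E).hom ≫ 𝟙 (reObj h (reObj g (reObj f E))) ≫
      (reCompApp h g (reObj f E)).inv ≫ (reCompApp (h ≫ g) f E).inv =
        eqToHom (by rw [Category.assoc]) := by
  refine ind_ext (lft_cart ((h ≫ g) ≫ f) E) ?_
  rw [eqToHom_hom_lft (Category.assoc h g f).symm]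
  simp

lemma re_left_unitor (f : A ⟶ B) (E : P.FiberAt B) :
    (reCompApp f (𝟙 B) E).hom ≫ reMap f (reIdApp E).hom ≫ 𝟙 (reObj f E) =
        eqToHom (by rw [Category.comp_id]) := by
  refine ind_ext (lft_cart f E) ?_
  rw [eqToHom_hom_lft (Category.comp_id f)]
  simp

lemma re_right_unitor (f : A ⟶ B) (E : P.FiberAt B) :
    (reCompApp (𝟙 A) f E).hom ≫ (reIdApp (reObj f E)).hom ≫ 𝟙 (reObj f E) =
        eqToHom (by rw [Category.id_comp]) := by
  refine ind_ext (lft_cart f E) ?_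
  rw [eqToHom_hom_lft (Category.id_comp f)]
  simp

lemma cat_eqToHom_app {X Y : Cat.{v, u}} {F G : X ⟶ Y} (h : F = G) (E : X) :
    (eqToHom h).toNatTrans.app E = eqToHom (congrArg (fun H : X ⟶ Y => H.toFunctor.obj E) h) := by
  subst h; rfl

/-- The indexed category of the fibres of a cloven fibration. -/
noncomputable def toIndx (P : Fib.{v, u}) : Indx.{v, u} where
  base := P.base
  fib := LocallyDiscrete.mkPseudofunctor (fun A => Cat.of (P.FiberAt A.unop))
    (fun f => (reFunctor f.unop).toCatHom)
    (fun A => Cat.Hom.isoMk (reId A.unop))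
    (fun f g => Cat.Hom.isoMk (reComp g.unop f.unop))
    (fun f g h => Cat.Hom₂.ext (NatTrans.ext (funext fun E => by
      refine Eq.trans ?_ (cat_eqToHom_app _ E).symm
      exact re_assoc h.unop g.unop f.unop E)))
    (fun f => Cat.Hom₂.ext (NatTrans.ext (funext fun E => by
      refine Eq.trans ?_ (cat_eqToHom_app _ E).symm
      exact re_left_unitor f.unop E)))
    (fun f => Cat.Hom₂.ext (NatTrans.ext (funext fun E => by
      refine Eq.trans ?_ (cat_eqToHom_app _ E).symm
      exact re_right_unitor f.unop E)))

/-- The morphism of the total category given by a morphism of the category of elements. -/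
noncomputable def ofEl (f : A ⟶ B) {E : P.FiberAt A} {E' : P.FiberAt B} (ξ : E ⟶ reObj f E') :
    E.obj ⟶ E'.obj := ξ.hom ≫ lft f E'

lemma ofEl_comp (f : A ⟶ B) (g : B ⟶ C) {E : P.FiberAt A} {E' : P.FiberAt B} {E'' : P.FiberAt C}
    (ξ : E ⟶ reObj f E') (ζ : E' ⟶ reObj g E'') :
    ofEl (f ≫ g) (ξ ≫ reMap f ζ ≫ (reCompApp f g E'').inv) = ofEl f ξ ≫ ofEl g ζ := by
  simp [ofEl]

/-- The comparison of the category of elements of `P.toIndx` with the total category of `P`. -/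
noncomputable def elFunctor (P : Fib.{v, u}) : P.toIndx.El ⥤ P.total where
  obj X := FiberAt.obj X.fiber
  map {X Y} m := ofEl (E := X.fiber) (E' := Y.fiber) m.base m.fiber
  map_id X := reIdApp_inv_hom_comp (A := X.base) X.fiber
  map_comp {X Y Z} m n := ofEl_comp (E := X.fiber) (E' := Y.fiber) (E'' := Z.fiber)
    m.base n.base m.fiber n.fiber

lemma ofEl_isHomLift (f : A ⟶ B) {E : P.FiberAt A} {E' : P.FiberAt B} (ξ : E ⟶ reObj f E') :
    P.proj.toFunctor.IsHomLift f (ofEl f ξ) :=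
  lift_comp ξ (lft_cart f E').toIsHomLift

lemma ofEl_injective (f : A ⟶ B) {E : P.FiberAt A} {E' : P.FiberAt B} {ξ ζ : E ⟶ reObj f E'}
    (h : ofEl f ξ = ofEl f ζ) : ξ = ζ :=
  ind_ext (lft_cart f E') h

lemma elHom_ofEl_ext {f g : A ⟶ B} {E : P.FiberAt A} {E' : P.FiberAt B}
    (ξ : E ⟶ reObj f E') (ζ : E ⟶ reObj g E') (h : ofEl f ξ = ofEl g ζ) :
    P.toIndx.elHom (E := E) (E' := E') f ξ = P.toIndx.elHom (E := E) (E' := E') g ζ := by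
  have hf := ofEl_isHomLift f ξ
  have hg := ofEl_isHomLift g ζ
  rw [h] at hf
  obtain rfl : f = g := by
    have h1 := CategoryTheory.IsHomLift.fac P.proj.toFunctor f (ofEl g ζ)
    have h2 := CategoryTheory.IsHomLift.fac P.proj.toFunctor g (ofEl g ζ)
    exact h1.trans h2.symm
  rw [ofEl_injective f h]

instance : (elFunctor P).Faithful where
  map_injective {X Y} m n h := elHom_ofEl_ext (E := X.fiber) (E' := Y.fiber) m.fiber n.fiber h

lemma exists_ofEl {E : P.FiberAt A} {E' : P.FiberAt B} (m : E.obj ⟶ E'.obj) :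
    ∃ (f : A ⟶ B) (ξ : E ⟶ reObj f E'), ofEl f ξ = m := by
  obtain ⟨X, rfl⟩ := E
  obtain ⟨Y, rfl⟩ := E'
  exact ⟨P.proj.toFunctor.map m, ind (lft_cart _ _) (CategoryTheory.IsHomLift.map _ m),
    ind_hom_comp _ _⟩

instance : (elFunctor P).Full where
  map_surjective {X Y} m := by
    obtain ⟨f, ξ, h⟩ := exists_ofEl (E := X.fiber) (E' := Y.fiber) m
    exact ⟨P.toIndx.elHom (E := X.fiber) (E' := Y.fiber) f ξ, h⟩

lemma elObj_eq {X : P.total} (hA : P.proj.toFunctor.obj X = A) (hB : P.proj.toFunctor.obj X = B) :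
    P.toIndx.elObj A (FiberAt.mk X hA) = P.toIndx.elObj B (FiberAt.mk X hB) := by
  subst hA
  subst hB
  rfl

lemma elFunctor_bijective (P : Fib.{v, u}) : Function.Bijective (elFunctor P).obj := by
  constructor
  · rintro ⟨A, X, hX⟩ ⟨B, Y, hY⟩ h
    obtain rfl : X = Y := h
    exact elObj_eq hX hY
  · exact fun X => ⟨P.toIndx.elObj (P.proj.toFunctor.obj X) (FiberAt.mk X rfl), rfl⟩

lemma elFunctor_comp_proj (P : Fib.{v, u}) :
    elFunctor P ⋙ P.proj.toFunctor = Pseudofunctor.CoGrothendieck.forget P.toIndx.fib := by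
  refine CategoryTheory.Functor.ext (fun X => FiberAt.isOver X.fiber) (fun X Y m => ?_)
  exact @CategoryTheory.IsHomLift.fac' _ _ _ _ P.proj.toFunctor _ _ _ _ m.base _
    (ofEl_isHomLift (E := X.fiber) (E' := Y.fiber) m.base m.fiber)

/-- The comparison `1`-morphism, the identity on the base. -/
noncomputable def comparison (P : Fib.{v, u}) : grothendieck.obj P.toIndx ⟶ P where
  base := 𝟙 P.base
  total := (elFunctor P).toCatHom
  comm := congrArg Functor.toCatHom (elFunctor_comp_proj P)
  cart {A} E f := by
    have h := lft_cart (P := P) f E.fiber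
    have e : (elFunctor P).map ((grothendieck.obj P.toIndx).lift E f) = lft (P := P) f E.fiber :=
      Category.id_comp (lft (P := P) f E.fiber)
    exact e ▸ h

/-- The inverse of the comparison functor. -/
noncomputable def invFunctor (P : Fib.{v, u}) : P.total ⥤ P.toIndx.El :=
  (exists_inverse (elFunctor P) (elFunctor_bijective P)).choose

lemma elFunctor_comp_invFunctor (P : Fib.{v, u}) : elFunctor P ⋙ invFunctor P = 𝟭 _ :=
  (exists_inverse (elFunctor P) (elFunctor_bijective P)).choose_spec.1

lemma invFunctor_comp_elFunctor (P : Fib.{v, u}) : invFunctor P ⋙ elFunctor P = 𝟭 _ :=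
  (exists_inverse (elFunctor P) (elFunctor_bijective P)).choose_spec.2

lemma invFunctor_comp_proj (P : Fib.{v, u}) :
    invFunctor P ⋙ (elFunctor P ⋙ P.proj.toFunctor) = P.proj.toFunctor :=
  congrArg (· ⋙ P.proj.toFunctor) (invFunctor_comp_elFunctor P)

lemma invFunctor_map_cart {X Y : P.total} (f : A ⟶ B) (m : X ⟶ Y)
    (h : P.proj.toFunctor.IsStronglyCartesian f m) {F : P.toIndx.El ⥤ P.base}
    (hF : elFunctor P ⋙ P.proj.toFunctor = F) :
    F.IsStronglyCartesian f ((invFunctor P).map m) := by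
  subst hF
  refine isStronglyCartesian_of_map P.proj.toFunctor (elFunctor P) f ((invFunctor P).map m) ?_
  have e := Functor.congr_hom (invFunctor_comp_elFunctor P) m
  have h' := isStronglyCartesian_eqToHom P.proj.toFunctor f
    (Functor.congr_obj (invFunctor_comp_elFunctor P) X) m
    (Functor.congr_obj (invFunctor_comp_elFunctor P) Y).symm h
  exact e ▸ h'

/-- The inverse of the comparison `1`-morphism. -/
noncomputable def comparisonInv (P : Fib.{v, u}) : P ⟶ grothendieck.obj P.toIndx where
  base := 𝟙 P.base
  total := (invFunctor P).toCatHom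
  comm := congrArg Functor.toCatHom ((congrArg (invFunctor P ⋙ ·) (elFunctor_comp_proj P).symm).trans
    (invFunctor_comp_proj P))
  cart {A} E f := invFunctor_map_cart f (P.lift E f) (P.cart E f) (elFunctor_comp_proj P)

end Fib

/-- Every cloven fibration is isomorphic to a category of elements. -/
noncomputable def grothendieckCover : Cover grothendieck.{v, u} where
  obj := Fib.toIndx
  hom := Fib.comparison
  inv := Fib.comparisonInv
  hom_inv P := Fib.Hom.ext (Category.id_comp (𝟙 P.base))
    (congrArg Functor.toCatHom (Fib.elFunctor_comp_invFunctor P))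
  inv_hom P := Fib.Hom.ext (Category.id_comp (𝟙 P.base))
    (congrArg Functor.toCatHom (Fib.invFunctor_comp_elFunctor P))

/-- The equivalence of indexed categories and cloven fibrations. -/
noncomputable def grothendieckEquivalence : TwoEquivalence Indx.{v, u} Fib.{v, u} :=
  grothendieckCover.twoEquivalence localIso_grothendieck

lemma grothendieckEquivalence_functor : grothendieckEquivalence.{v, u}.functor = grothendieck := rfl

lemma base_inverseMap {P Q : Fib.{v, u}} (F : P ⟶ Q) :
    Indx.Hom.base (grothendieckEquivalence.inverse.map F) = F.base :=
  congrArg Fib.Hom.base (grothendieckCover.map_inverseMap localIso_grothendieck F)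

lemma heq_conj_eqToHom {C : Type u₁} [Category.{v₁} C] {X X' Y Y' : C} (h : X' = X) (m : X ⟶ Y)
    (h' : Y = Y') : HEq (eqToHom h ≫ m ≫ eqToHom h') m := by
  subst h h'
  simp

lemma Fib.heq_base_conj {P Q : Fib.{v, u}} {F F' G G' : P ⟶ Q} (h : F' = F) (a : F ⟶ G)
    (h' : G = G') : HEq (eqToHom h ≫ a ≫ eqToHom h').base a.base := by
  subst h h'
  simp

lemma heq_base_inverseMap₂ {P Q : Fib.{v, u}} {F G : P ⟶ Q} (η : F ⟶ G) :
    HEq (Indx.Hom₂.base (grothendieckEquivalence.inverse.map₂ η)) η.base :=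
  (heq_of_eq (congrArg Fib.Hom₂.base
      (grothendieckCover.map₂_inverseMap₂ localIso_grothendieck η))).trans
    (Fib.heq_base_conj (grothendieckCover.map_inverseMap localIso_grothendieck F)
      (grothendieckCover.cj₂ η) (grothendieckCover.map_inverseMap localIso_grothendieck G).symm)

lemma grothendieckEquivalence_inverse_base :
    grothendieckEquivalence.{v, u}.inverse.comp Indx.baseFunctor = Fib.baseFunctor :=
  strictPseudofunctor_hext rfl (fun F => heq_of_eq (base_inverseMap F))
    (fun η => heq_base_inverseMap₂ η)

/-! ### Lifting an equivalence to objects with an endomorphism -/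

section EndLift

variable {B : Type u₁} [Bicategory.{w₁, v₁} B] {C : Type u₂} [Bicategory.{w₂, v₂} C]
  {D : Type u₃} [Bicategory.{w₃, v₃} D]

lemma TwoNatIso.nat₂' {F G : StrictPseudofunctor B C} (α : TwoNatIso F G) {X Y : B} {f g : X ⟶ Y}
    (η : f ⟶ g) : F.map₂ η ▷ α.app Y =
      eqToHom (α.nat f) ≫ α.app X ◁ G.map₂ η ≫ eqToHom (α.nat g).symm := by
  rw [← Category.assoc, ← α.nat₂ η, Category.assoc, eqToHom_trans, eqToHom_refl, Category.comp_id]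

lemma map₂_heq (F : StrictPseudofunctor B C) {X Y : B} {f f' g g' : X ⟶ Y} (h : f = f')
    (h' : g = g') {η : f ⟶ g} {θ : f' ⟶ g'} (e : HEq η θ) : HEq (F.map₂ η) (F.map₂ θ) := by
  subst h h'
  rw [eq_of_heq e]

lemma whiskerRight_heq {X Y Z : B} {f f' g g' : X ⟶ Y} (h : f = f') (h' : g = g') {η : f ⟶ g}
    {θ : f' ⟶ g'} (e : HEq η θ) (k : Y ⟶ Z) : HEq (η ▷ k) (θ ▷ k) := by
  subst h h'
  rw [eq_of_heq e]

lemma whiskerLeft_heq {X Y Z : B} (k : X ⟶ Y) {f f' g g' : Y ⟶ Z} (h : f = f') (h' : g = g')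
    {η : f ⟶ g} {θ : f' ⟶ g'} (e : HEq η θ) : HEq (k ◁ η) (k ◁ θ) := by
  subst h h'
  rw [eq_of_heq e]

variable [Strict B] [Strict C] [Strict D]

namespace EndLax

lemma hom_hext {X Y : EndLax B} {f g : X ⟶ Y} (h : Hom.one f = Hom.one g)
    (h' : HEq (Hom.law f) (Hom.law g)) : f = g := by
  obtain ⟨f, a⟩ := f
  obtain ⟨g, b⟩ := g
  dsimp at h h'
  subst h
  subst h'
  rfl

lemma hom₂_hext {X Y : EndLax B} {f f' g g' : X ⟶ Y} (h : f = f') (h' : g = g') {η : f ⟶ g}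
    {θ : f' ⟶ g'} (e : HEq (Hom₂.two η) (Hom₂.two θ)) : HEq η θ := by
  subst h h'
  exact heq_of_eq (Hom₂.ext (eq_of_heq e))

lemma comp_law {X Y Z : EndLax B} (f : X ⟶ Y) (g : Y ⟶ Z) : Hom.law (f ≫ g) =
    (α_ X.T (Hom.one f) (Hom.one g)).inv ≫ Hom.law f ▷ Hom.one g ≫
      (α_ (Hom.one f) Y.T (Hom.one g)).hom ≫ Hom.one f ◁ Hom.law g ≫
        (α_ (Hom.one f) (Hom.one g) Z.T).inv := rfl

lemma mapHom_law (P : StrictPseudofunctor B C) {X Y : EndLax B} (f : X ⟶ Y) :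
    Hom.law (mapHom P f) = eqToHom (P.map_comp X.T (Hom.one f)).symm ≫ P.map₂ (Hom.law f) ≫
      eqToHom (P.map_comp (Hom.one f) Y.T) := by
  show (P.mapComp X.T f.one).inv ≫ P.map₂ f.law ≫ (P.mapComp f.one Y.T).hom = _
  rw [P.mapComp_eq_eqToIso, P.mapComp_eq_eqToIso]
  rfl

lemma mapHom_law_heq (P : StrictPseudofunctor B C) {X Y : EndLax B} (f : X ⟶ Y) :
    HEq (Hom.law (mapHom P f)) (P.map₂ (Hom.law f)) := by
  rw [mapHom_law]
  exact heq_conj_eqToHom _ _ _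

lemma mapHom_mapHom (P : StrictPseudofunctor B C) (Q : StrictPseudofunctor C D) {X Y : EndLax B}
    (f : X ⟶ Y) : mapHom (P.comp Q) f = mapHom Q (mapHom P f) :=
  hom_hext rfl ((mapHom_law_heq (P.comp Q) f).trans
    ((mapHom_law_heq Q (mapHom P f)).trans (map₂_heq Q (P.map_comp _ _).symm (P.map_comp _ _).symm
      (mapHom_law_heq P f))).symm)

lemma map_comp (P : StrictPseudofunctor B C) (Q : StrictPseudofunctor C D) :
    map (P.comp Q) = (map P).comp (map Q) :=
  strictPseudofunctor_hext rfl (fun f => heq_of_eq (mapHom_mapHom P Q f))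
    (fun {X Y f g} η => hom₂_hext (mapHom_mapHom P Q f) (mapHom_mapHom P Q g) HEq.rfl)

lemma mapHom_idFunctor {X Y : EndLax B} (f : X ⟶ Y) : mapHom (StrictPseudofunctor.id B) f = f :=
  hom_hext rfl (mapHom_law_heq _ f)

/-- A `1`-morphism that commutes strictly with the endomorphisms. -/
def ofEq {X Y : EndLax B} (f : X.carrier ⟶ Y.carrier) (h : X.T ≫ f = f ≫ Y.T) : X ⟶ Y :=
  ⟨f, eqToHom h⟩

lemma ofEq_congr {X Y : EndLax B} {f g : X.carrier ⟶ Y.carrier} (e : f = g)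
    (h : X.T ≫ f = f ≫ Y.T) (h' : X.T ≫ g = g ≫ Y.T) : ofEq f h = ofEq g h' := by
  subst e
  rfl

lemma ofEq_id (X : EndLax B) (h : X.T ≫ 𝟙 X.carrier = 𝟙 X.carrier ≫ X.T) :
    ofEq (𝟙 X.carrier) h = 𝟙 X :=
  hom_hext rfl (heq_of_eq (by
    show eqToHom h = (ρ_ X.T).hom ≫ (λ_ X.T).inv
    simp [Strict.leftUnitor_eqToIso, Strict.rightUnitor_eqToIso]))

lemma ofEq_comp {X Y Z : EndLax B} (f : X.carrier ⟶ Y.carrier) (h : X.T ≫ f = f ≫ Y.T)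
    (g : Y.carrier ⟶ Z.carrier) (h' : Y.T ≫ g = g ≫ Z.T) :
    ofEq f h ≫ ofEq g h' =
      ofEq (f ≫ g) (by rw [← Strict.assoc, h, Strict.assoc, h', Strict.assoc]) :=
  hom_hext rfl (heq_of_eq (by
    show (α_ X.T f g).inv ≫ eqToHom h ▷ g ≫ (α_ f Y.T g).hom ≫ f ◁ eqToHom h' ≫
      (α_ f g Z.T).inv = eqToHom (by rw [← Strict.assoc, h, Strict.assoc, h', Strict.assoc])
    simp [Strict.associator_eqToIso]))

lemma comp_ofEq_law_heq {X Y Z : EndLax B} (f : X ⟶ Y) (g : Y.carrier ⟶ Z.carrier)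
    (h : Y.T ≫ g = g ≫ Z.T) : HEq (Hom.law (f ≫ ofEq g h)) (Hom.law f ▷ g) := by
  have e : Hom.law (f ≫ ofEq g h) = eqToHom (Strict.assoc _ _ _).symm ≫ Hom.law f ▷ g ≫
      eqToHom (show (Hom.one f ≫ Y.T) ≫ g = (Hom.one f ≫ g) ≫ Z.T by
        rw [Strict.assoc, h, Strict.assoc]) := by
    rw [comp_law]
    show _ ≫ Hom.law f ▷ g ≫ (α_ (Hom.one f) Y.T g).hom ≫ Hom.one f ◁ eqToHom h ≫
      (α_ (Hom.one f) g Z.T).inv = _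
    simp [Strict.associator_eqToIso]
    rfl
  exact (heq_of_eq e).trans (heq_conj_eqToHom _ _ _)

lemma ofEq_comp_law_heq {X Y Z : EndLax B} (f : X.carrier ⟶ Y.carrier) (h : X.T ≫ f = f ≫ Y.T)
    (g : Y ⟶ Z) : HEq (Hom.law (ofEq f h ≫ g)) (f ◁ Hom.law g) := by
  have e : Hom.law (ofEq f h ≫ g) = eqToHom (show X.T ≫ f ≫ Hom.one g = f ≫ Y.T ≫ Hom.one g by
      rw [← Strict.assoc, h, Strict.assoc]) ≫ f ◁ Hom.law g ≫
      eqToHom (Strict.assoc _ _ _).symm := by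
    rw [comp_law]
    show (α_ X.T f (Hom.one g)).inv ≫ eqToHom h ▷ Hom.one g ≫ (α_ f Y.T (Hom.one g)).hom ≫
      f ◁ Hom.law g ≫ (α_ f (Hom.one g) Z.T).inv = _
    simp [Strict.associator_eqToIso]
  exact (heq_of_eq e).trans (heq_conj_eqToHom _ _ _)

lemma mapHom_ofEq (P : StrictPseudofunctor B C) {X Y : EndLax B} (f : X.carrier ⟶ Y.carrier)
    (h : X.T ≫ f = f ≫ Y.T) : (map P).map (ofEq f h) =
      ofEq (P.map f) (by
        show P.map X.T ≫ P.map f = P.map f ≫ P.map Y.T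
        rw [← P.map_comp, h, P.map_comp]) :=
  hom_hext rfl (heq_of_eq ((mapHom_law P (ofEq f h)).trans (by
    show eqToHom (P.map_comp X.T f).symm ≫ P.map₂ (eqToHom h) ≫ eqToHom (P.map_comp f Y.T) =
      eqToHom (by rw [← P.map_comp, h, P.map_comp])
    rw [PrelaxFunctor.map₂_eqToHom, eqToHom_trans, eqToHom_trans])))

/-- The lift of a `2`-natural isomorphism. -/
def mapIso {F G : StrictPseudofunctor B C} (α : TwoNatIso F G) : TwoNatIso (map F) (map G) where
  app X := ofEq (α.app X.carrier) (α.nat X.T)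
  inv X := ofEq (α.inv X.carrier) (by
    show G.map X.T ≫ α.inv X.carrier = α.inv X.carrier ≫ F.map X.T
    rw [← Strict.id_comp (G.map X.T), ← α.inv_app, Strict.assoc (α.inv _), ← α.nat, Strict.assoc,
      Strict.assoc, α.app_inv, Strict.comp_id])
  app_inv X := (ofEq_comp _ _ _ _).trans
    ((ofEq_congr (α.app_inv X.carrier) _ (by rw [Strict.comp_id, Strict.id_comp])).trans (ofEq_id _ _))
  inv_app X := (ofEq_comp _ _ _ _).trans
    ((ofEq_congr (α.inv_app X.carrier) _ (by rw [Strict.comp_id, Strict.id_comp])).trans (ofEq_id _ _))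
  nat {X Y} f := hom_hext (α.nat (Hom.one f))
    (((comp_ofEq_law_heq (Z := (map G).obj Y) ((map F).map f) (α.app Y.carrier) (α.nat Y.T)).trans
      (whiskerRight_heq (F.map_comp _ _).symm (F.map_comp _ _).symm (mapHom_law_heq F f) _)).trans
      (((heq_of_eq (α.nat₂' (Hom.law f))).trans (heq_conj_eqToHom _ _ _)).trans
        ((ofEq_comp_law_heq (X := (map F).obj X) (Y := (map G).obj X) (α.app X.carrier) (α.nat X.T) ((map G).map f)).trans
          (whiskerLeft_heq _ (G.map_comp _ _).symm (G.map_comp _ _).symm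
            (mapHom_law_heq G f))).symm))
  nat₂ {X Y f g} η := Hom₂.ext (by
    refine (congrArg (F.map₂ (Hom₂.two η) ▷ α.app Y.carrier ≫ ·) (eqToHom_two _)).trans
      ((α.nat₂ (Hom₂.two η)).trans ?_)
    exact (congrArg (· ≫ α.app X.carrier ◁ G.map₂ (Hom₂.two η)) (eqToHom_two _)).symm)

lemma unit_nat (E : TwoEquivalence B C) {X Y : EndLax B} (f : X ⟶ Y) :
    f ≫ (mapIso E.unit).app Y =
      (mapIso E.unit).app X ≫ mapHom E.inverse (mapHom E.functor f) :=
  (congrArg (· ≫ (mapIso E.unit).app Y) (mapHom_idFunctor f).symm).trans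
    (((mapIso E.unit).nat f).trans
      (congrArg ((mapIso E.unit).app X ≫ ·) (mapHom_mapHom E.functor E.inverse f)))

lemma counit_nat (E : TwoEquivalence B C) {X Y : EndLax C} (f : X ⟶ Y) :
    mapHom E.functor (mapHom E.inverse f) ≫ (mapIso E.counit).app Y =
      (mapIso E.counit).app X ≫ f :=
  (congrArg (· ≫ (mapIso E.counit).app Y) (mapHom_mapHom E.inverse E.functor f).symm).trans
    (((mapIso E.counit).nat f).trans
      (congrArg ((mapIso E.counit).app X ≫ ·) (mapHom_idFunctor f)))

/-- The lift of a `2`-equivalence. -/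
def mapEquivalence (E : TwoEquivalence B C) : TwoEquivalence (EndLax B) (EndLax C) where
  functor := map E.functor
  inverse := map E.inverse
  unit :=
    { app X := (mapIso E.unit).app X
      inv X := (mapIso E.unit).inv X
      app_inv X := (mapIso E.unit).app_inv X
      inv_app X := (mapIso E.unit).inv_app X
      nat f := unit_nat E f
      nat₂ {X Y f g} η := Hom₂.ext (by
        refine (congrArg (Hom₂.two η ▷ E.unit.app Y.carrier ≫ ·) (eqToHom_two (unit_nat E g))).trans
          ((E.unit.nat₂ (Hom₂.two η)).trans ?_)
        exact (congrArg (· ≫ E.unit.app X.carrier ◁ E.inverse.map₂ (E.functor.map₂ (Hom₂.two η)))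
          (eqToHom_two (unit_nat E f))).symm) }
  counit :=
    { app X := (mapIso E.counit).app X
      inv X := (mapIso E.counit).inv X
      app_inv X := (mapIso E.counit).app_inv X
      inv_app X := (mapIso E.counit).inv_app X
      nat f := counit_nat E f
      nat₂ {X Y f g} η := Hom₂.ext (by
        refine (congrArg (E.functor.map₂ (E.inverse.map₂ (Hom₂.two η)) ▷
          E.counit.app Y.carrier ≫ ·) (eqToHom_two (counit_nat E g))).trans
          ((E.counit.nat₂ (Hom₂.two η)).trans ?_)
        exact (congrArg (· ≫ E.counit.app X.carrier ◁ Hom₂.two η)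
          (eqToHom_two (counit_nat E f))).symm) }

lemma isEndLaxLift_mapEquivalence (E : TwoEquivalence B C) : IsEndLaxLift E (mapEquivalence E) where
  functor := rfl
  inverse := rfl
  unit _ := HEq.rfl
  counit _ := HEq.rfl

end EndLax

namespace EndColax

lemma hom_hext {X Y : EndColax B} {f g : X ⟶ Y} (h : Hom.one f = Hom.one g)
    (h' : HEq (Hom.law f) (Hom.law g)) : f = g := by
  obtain ⟨f, a⟩ := f
  obtain ⟨g, b⟩ := g
  dsimp at h h'
  subst h
  subst h'
  rfl

lemma hom₂_hext {X Y : EndColax B} {f f' g g' : X ⟶ Y} (h : f = f') (h' : g = g') {η : f ⟶ g}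
    {θ : f' ⟶ g'} (e : HEq (Hom₂.two η) (Hom₂.two θ)) : HEq η θ := by
  subst h h'
  exact heq_of_eq (Hom₂.ext (eq_of_heq e))

lemma comp_law {X Y Z : EndColax B} (f : X ⟶ Y) (g : Y ⟶ Z) : Hom.law (f ≫ g) =
    (α_ (Hom.one f) (Hom.one g) Z.T).hom ≫ Hom.one f ◁ Hom.law g ≫
      (α_ (Hom.one f) Y.T (Hom.one g)).inv ≫ Hom.law f ▷ Hom.one g ≫
        (α_ X.T (Hom.one f) (Hom.one g)).hom := rfl

lemma mapHom_law (P : StrictPseudofunctor B C) {X Y : EndColax B} (f : X ⟶ Y) :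
    Hom.law (mapHom P f) = eqToHom (P.map_comp (Hom.one f) Y.T).symm ≫ P.map₂ (Hom.law f) ≫
      eqToHom (P.map_comp X.T (Hom.one f)) := by
  show (P.mapComp f.one Y.T).inv ≫ P.map₂ f.law ≫ (P.mapComp X.T f.one).hom = _
  rw [P.mapComp_eq_eqToIso, P.mapComp_eq_eqToIso]
  rfl

lemma mapHom_law_heq (P : StrictPseudofunctor B C) {X Y : EndColax B} (f : X ⟶ Y) :
    HEq (Hom.law (mapHom P f)) (P.map₂ (Hom.law f)) := by
  rw [mapHom_law]
  exact heq_conj_eqToHom _ _ _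

lemma mapHom_mapHom (P : StrictPseudofunctor B C) (Q : StrictPseudofunctor C D) {X Y : EndColax B}
    (f : X ⟶ Y) : mapHom (P.comp Q) f = mapHom Q (mapHom P f) :=
  hom_hext rfl ((mapHom_law_heq (P.comp Q) f).trans
    ((mapHom_law_heq Q (mapHom P f)).trans (map₂_heq Q (P.map_comp _ _).symm (P.map_comp _ _).symm
      (mapHom_law_heq P f))).symm)

lemma map_comp (P : StrictPseudofunctor B C) (Q : StrictPseudofunctor C D) :
    map (P.comp Q) = (map P).comp (map Q) :=
  strictPseudofunctor_hext rfl (fun f => heq_of_eq (mapHom_mapHom P Q f))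
    (fun {X Y f g} η => hom₂_hext (mapHom_mapHom P Q f) (mapHom_mapHom P Q g) HEq.rfl)

lemma mapHom_idFunctor {X Y : EndColax B} (f : X ⟶ Y) : mapHom (StrictPseudofunctor.id B) f = f :=
  hom_hext rfl (mapHom_law_heq _ f)

/-- A `1`-morphism that commutes strictly with the endomorphisms. -/
def ofEq {X Y : EndColax B} (f : X.carrier ⟶ Y.carrier) (h : X.T ≫ f = f ≫ Y.T) : X ⟶ Y :=
  ⟨f, eqToHom h.symm⟩

lemma ofEq_congr {X Y : EndColax B} {f g : X.carrier ⟶ Y.carrier} (e : f = g)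
    (h : X.T ≫ f = f ≫ Y.T) (h' : X.T ≫ g = g ≫ Y.T) : ofEq f h = ofEq g h' := by
  subst e
  rfl

lemma ofEq_id (X : EndColax B) (h : X.T ≫ 𝟙 X.carrier = 𝟙 X.carrier ≫ X.T) :
    ofEq (𝟙 X.carrier) h = 𝟙 X :=
  hom_hext rfl (heq_of_eq (by
    show eqToHom h.symm = (λ_ X.T).hom ≫ (ρ_ X.T).inv
    simp [Strict.leftUnitor_eqToIso, Strict.rightUnitor_eqToIso]))

lemma ofEq_comp {X Y Z : EndColax B} (f : X.carrier ⟶ Y.carrier) (h : X.T ≫ f = f ≫ Y.T)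
    (g : Y.carrier ⟶ Z.carrier) (h' : Y.T ≫ g = g ≫ Z.T) :
    ofEq f h ≫ ofEq g h' =
      ofEq (f ≫ g) (by rw [← Strict.assoc, h, Strict.assoc, h', Strict.assoc]) :=
  hom_hext rfl (heq_of_eq (by
    show (α_ f g Z.T).hom ≫ f ◁ eqToHom h'.symm ≫ (α_ f Y.T g).inv ≫ eqToHom h.symm ▷ g ≫
      (α_ X.T f g).hom = eqToHom (by rw [← Strict.assoc X.T, h, Strict.assoc, Strict.assoc, h'])
    simp [Strict.associator_eqToIso]))

lemma comp_ofEq_law_heq {X Y Z : EndColax B} (f : X ⟶ Y) (g : Y.carrier ⟶ Z.carrier)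
    (h : Y.T ≫ g = g ≫ Z.T) : HEq (Hom.law (f ≫ ofEq g h)) (Hom.law f ▷ g) := by
  have e : Hom.law (f ≫ ofEq g h) = eqToHom (show (Hom.one f ≫ g) ≫ Z.T = (Hom.one f ≫ Y.T) ≫ g by
        rw [Strict.assoc, Strict.assoc, h]) ≫ Hom.law f ▷ g ≫ eqToHom (Strict.assoc _ _ _) := by
    rw [comp_law]
    show (α_ (Hom.one f) g Z.T).hom ≫ Hom.one f ◁ eqToHom h.symm ≫
      (α_ (Hom.one f) Y.T g).inv ≫ Hom.law f ▷ g ≫ (α_ X.T (Hom.one f) g).hom = _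
    simp [Strict.associator_eqToIso]
  exact (heq_of_eq e).trans (heq_conj_eqToHom _ _ _)

lemma ofEq_comp_law_heq {X Y Z : EndColax B} (f : X.carrier ⟶ Y.carrier) (h : X.T ≫ f = f ≫ Y.T)
    (g : Y ⟶ Z) : HEq (Hom.law (ofEq f h ≫ g)) (f ◁ Hom.law g) := by
  have e : Hom.law (ofEq f h ≫ g) = eqToHom (Strict.assoc _ _ _) ≫ f ◁ Hom.law g ≫
      eqToHom (show f ≫ Y.T ≫ Hom.one g = X.T ≫ f ≫ Hom.one g by
        rw [← Strict.assoc, ← h, Strict.assoc]) := by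
    rw [comp_law]
    show (α_ f (Hom.one g) Z.T).hom ≫ f ◁ Hom.law g ≫ (α_ f Y.T (Hom.one g)).inv ≫
      eqToHom h.symm ▷ Hom.one g ≫ (α_ X.T f (Hom.one g)).hom = _
    simp [Strict.associator_eqToIso]
  exact (heq_of_eq e).trans (heq_conj_eqToHom _ _ _)

lemma mapHom_ofEq (P : StrictPseudofunctor B C) {X Y : EndColax B} (f : X.carrier ⟶ Y.carrier)
    (h : X.T ≫ f = f ≫ Y.T) : (map P).map (ofEq f h) =
      ofEq (P.map f) (by
        show P.map X.T ≫ P.map f = P.map f ≫ P.map Y.T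
        rw [← P.map_comp, h, P.map_comp]) :=
  hom_hext rfl (heq_of_eq ((mapHom_law P (ofEq f h)).trans (by
    show eqToHom (P.map_comp f Y.T).symm ≫ P.map₂ (eqToHom h.symm) ≫ eqToHom (P.map_comp X.T f) =
      eqToHom (by rw [← P.map_comp, ← h, P.map_comp])
    rw [PrelaxFunctor.map₂_eqToHom, eqToHom_trans, eqToHom_trans])))

/-- The lift of a `2`-natural isomorphism. -/
def mapIso {F G : StrictPseudofunctor B C} (α : TwoNatIso F G) : TwoNatIso (map F) (map G) where
  app X := ofEq (α.app X.carrier) (α.nat X.T)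
  inv X := ofEq (α.inv X.carrier) (by
    show G.map X.T ≫ α.inv X.carrier = α.inv X.carrier ≫ F.map X.T
    rw [← Strict.id_comp (G.map X.T), ← α.inv_app, Strict.assoc (α.inv _), ← α.nat, Strict.assoc,
      Strict.assoc, α.app_inv, Strict.comp_id])
  app_inv X := (ofEq_comp _ _ _ _).trans
    ((ofEq_congr (α.app_inv X.carrier) _ (by rw [Strict.comp_id, Strict.id_comp])).trans (ofEq_id _ _))
  inv_app X := (ofEq_comp _ _ _ _).trans
    ((ofEq_congr (α.inv_app X.carrier) _ (by rw [Strict.comp_id, Strict.id_comp])).trans (ofEq_id _ _))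
  nat {X Y} f := hom_hext (α.nat (Hom.one f))
    (((comp_ofEq_law_heq (Z := (map G).obj Y) ((map F).map f) (α.app Y.carrier) (α.nat Y.T)).trans
      (whiskerRight_heq (F.map_comp _ _).symm (F.map_comp _ _).symm (mapHom_law_heq F f) _)).trans
      (((heq_of_eq (α.nat₂' (Hom.law f))).trans (heq_conj_eqToHom _ _ _)).trans
        ((ofEq_comp_law_heq (X := (map F).obj X) (Y := (map G).obj X) (α.app X.carrier) (α.nat X.T) ((map G).map f)).trans
          (whiskerLeft_heq _ (G.map_comp _ _).symm (G.map_comp _ _).symm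
            (mapHom_law_heq G f))).symm))
  nat₂ {X Y f g} η := Hom₂.ext (by
    refine (congrArg (F.map₂ (Hom₂.two η) ▷ α.app Y.carrier ≫ ·) (eqToHom_two _)).trans
      ((α.nat₂ (Hom₂.two η)).trans ?_)
    exact (congrArg (· ≫ α.app X.carrier ◁ G.map₂ (Hom₂.two η)) (eqToHom_two _)).symm)

lemma unit_nat (E : TwoEquivalence B C) {X Y : EndColax B} (f : X ⟶ Y) :
    f ≫ (mapIso E.unit).app Y =
      (mapIso E.unit).app X ≫ mapHom E.inverse (mapHom E.functor f) :=
  (congrArg (· ≫ (mapIso E.unit).app Y) (mapHom_idFunctor f).symm).trans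
    (((mapIso E.unit).nat f).trans
      (congrArg ((mapIso E.unit).app X ≫ ·) (mapHom_mapHom E.functor E.inverse f)))

lemma counit_nat (E : TwoEquivalence B C) {X Y : EndColax C} (f : X ⟶ Y) :
    mapHom E.functor (mapHom E.inverse f) ≫ (mapIso E.counit).app Y =
      (mapIso E.counit).app X ≫ f :=
  (congrArg (· ≫ (mapIso E.counit).app Y) (mapHom_mapHom E.inverse E.functor f).symm).trans
    (((mapIso E.counit).nat f).trans
      (congrArg ((mapIso E.counit).app X ≫ ·) (mapHom_idFunctor f)))

/-- The lift of a `2`-equivalence. -/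
def mapEquivalence (E : TwoEquivalence B C) : TwoEquivalence (EndColax B) (EndColax C) where
  functor := map E.functor
  inverse := map E.inverse
  unit :=
    { app X := (mapIso E.unit).app X
      inv X := (mapIso E.unit).inv X
      app_inv X := (mapIso E.unit).app_inv X
      inv_app X := (mapIso E.unit).inv_app X
      nat f := unit_nat E f
      nat₂ {X Y f g} η := Hom₂.ext (by
        refine (congrArg (Hom₂.two η ▷ E.unit.app Y.carrier ≫ ·) (eqToHom_two (unit_nat E g))).trans
          ((E.unit.nat₂ (Hom₂.two η)).trans ?_)
        exact (congrArg (· ≫ E.unit.app X.carrier ◁ E.inverse.map₂ (E.functor.map₂ (Hom₂.two η)))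
          (eqToHom_two (unit_nat E f))).symm) }
  counit :=
    { app X := (mapIso E.counit).app X
      inv X := (mapIso E.counit).inv X
      app_inv X := (mapIso E.counit).app_inv X
      inv_app X := (mapIso E.counit).inv_app X
      nat f := counit_nat E f
      nat₂ {X Y f g} η := Hom₂.ext (by
        refine (congrArg (E.functor.map₂ (E.inverse.map₂ (Hom₂.two η)) ▷
          E.counit.app Y.carrier ≫ ·) (eqToHom_two (counit_nat E g))).trans
          ((E.counit.nat₂ (Hom₂.two η)).trans ?_)
        exact (congrArg (· ≫ E.counit.app X.carrier ◁ Hom₂.two η)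
          (eqToHom_two (counit_nat E f))).symm) }

lemma isEndColaxLift_mapEquivalence (E : TwoEquivalence B C) : IsEndColaxLift E (mapEquivalence E) where
  functor := rfl
  inverse := rfl
  unit _ := HEq.rfl
  counit _ := HEq.rfl

end EndColax

end EndLift

/-! ### Fibred powers and additive bundles under isomorphisms and functors -/

section Bundles

variable {C : Type u₁} [Category.{v₁} C] {C' : Type u₂} [Category.{v₂} C']

namespace IsNFoldPullback

variable {E B P : C} {q : E ⟶ B} {n : ℕ} {π : Fin n → (P ⟶ E)}

lemma hom_ext (h : IsNFoldPullback q π) {W : C} {k k' : W ⟶ P} (hk : ∀ i, k ≫ π i = k' ≫ π i) :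
    k = k' :=
  (h.exists_unique W (fun i => k' ≫ π i) (fun i j => by
    rw [Category.assoc, Category.assoc, h.comm i j])).unique hk (fun _ => rfl)

lemma exists_lift (h : IsNFoldPullback q π) {W : C} (f : Fin n → (W ⟶ E))
    (hf : ∀ i j, f i ≫ q = f j ≫ q) : ∃ k : W ⟶ P, ∀ i, k ≫ π i = f i :=
  (h.exists_unique W f hf).exists

lemma of_iso (h : IsNFoldPullback q π) {E' B' P' : C} {q' : E' ⟶ B'} {π' : Fin n → (P' ⟶ E')}
    (b : B ≅ B') (e : E ≅ E') (p : P ≅ P') (hq : q ≫ b.hom = e.hom ≫ q')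
    (hπ : ∀ i, π i ≫ e.hom = p.hom ≫ π' i) : IsNFoldPullback q' π' where
  comm i j := by
    rw [← cancel_epi p.hom, ← Category.assoc, ← Category.assoc, ← hπ, ← hπ, Category.assoc,
      Category.assoc, ← hq, ← Category.assoc, ← Category.assoc, h.comm i j]
  exists_unique W f hf := by
    have hq' : q' ≫ b.inv = e.inv ≫ q := by
      rw [Iso.comp_inv_eq, Category.assoc, hq, Iso.inv_hom_id_assoc]
    have hπ' i : π' i ≫ e.inv = p.inv ≫ π i := by
      rw [Iso.comp_inv_eq, Category.assoc, hπ, Iso.inv_hom_id_assoc]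
    obtain ⟨k, hk⟩ := h.exists_lift (fun i => f i ≫ e.inv) (fun i j => by
      rw [Category.assoc, Category.assoc, ← hq', ← Category.assoc, hf i j, Category.assoc])
    refine ⟨k ≫ p.hom, fun i => ?_, fun k' hk' => ?_⟩
    · rw [Category.assoc, ← hπ, ← Category.assoc, hk, Category.assoc, Iso.inv_hom_id,
        Category.comp_id]
    · rw [← Iso.comp_inv_eq]
      refine h.hom_ext fun i => ?_
      rw [hk, Category.assoc, ← hπ', ← Category.assoc, hk']

/-- Two fibred powers are isomorphic. -/
lemma exists_iso (h : IsNFoldPullback q π) {P' : C} {π' : Fin n → (P' ⟶ E)}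
    (h' : IsNFoldPullback q π') : ∃ e : P ≅ P', ∀ i, e.hom ≫ π' i = π i := by
  obtain ⟨k, hk⟩ := h'.exists_lift π h.comm
  obtain ⟨k', hk'⟩ := h.exists_lift π' h'.comm
  exact ⟨⟨k, k', h.hom_ext fun i => by rw [Category.assoc, hk', hk, Category.id_comp],
    h'.hom_ext fun i => by rw [Category.assoc, hk, hk', Category.id_comp]⟩, hk⟩

lemma map_of_isEquivalence (h : IsNFoldPullback q π) (F : C ⥤ C') [F.IsEquivalence] :
    IsNFoldPullback (F.map q) (fun i => F.map (π i)) where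
  comm i j := by rw [← F.map_comp, h.comm i j, F.map_comp]
  exists_unique W f hf := by
    let e := F.objObjPreimageIso W
    obtain ⟨k, hk⟩ := h.exists_lift (fun i => F.preimage (e.hom ≫ f i)) (fun i j =>
      F.map_injective (by simp [hf i j]))
    refine ⟨e.inv ≫ F.map k, fun i => ?_, fun k' hk' => ?_⟩
    · rw [Category.assoc, ← F.map_comp, hk]
      simp
    · rw [Iso.eq_inv_comp]
      refine (F.map_preimage (e.hom ≫ k')).symm.trans (congrArg F.map (h.hom_ext fun i =>
        F.map_injective ?_))
      rw [F.map_comp, F.map_preimage, hk, F.map_preimage, Category.assoc, hk']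

lemma of_map (F : C ⥤ C') [F.Full] [F.Faithful]
    (h : IsNFoldPullback (F.map q) (fun i => F.map (π i))) : IsNFoldPullback q π where
  comm i j := F.map_injective (by simpa using h.comm i j)
  exists_unique W f hf := by
    obtain ⟨k, hk⟩ := h.exists_lift (fun i => F.map (f i)) (fun i j => by
      rw [← F.map_comp, hf i j, F.map_comp])
    refine ⟨F.preimage k, fun i => F.map_injective (by simpa using hk i), fun k' hk' =>
      F.map_injective (h.hom_ext fun i => ?_)⟩
    rw [← F.map_comp, hk', F.map_preimage, hk]

end IsNFoldPullback

namespace BundleData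

/-- An isomorphism of the data of additive bundles. -/
structure Iso (D D' : BundleData C) where
  b : D.B ≅ D'.B
  e : D.E ≅ D'.E
  e₂ : D.E₂ ≅ D'.E₂
  hq : D.q ≫ b.hom = e.hom ≫ D'.q
  hz : D.z ≫ e.hom = b.hom ≫ D'.z
  h₁ : D.π₁ ≫ e.hom = e₂.hom ≫ D'.π₁
  h₂ : D.π₂ ≫ e.hom = e₂.hom ≫ D'.π₂
  hs : D.s ≫ e.hom = e₂.hom ≫ D'.s

lemma inv_comm {X Y X' Y' : C} {f : X ⟶ Y} {f' : X' ⟶ Y'} {a : X ≅ X'} {b : Y ≅ Y'}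
    (h : f ≫ b.hom = a.hom ≫ f') : f' ≫ b.inv = a.inv ≫ f := by
  rw [Iso.comp_inv_eq, Category.assoc, h, Iso.inv_hom_id_assoc]

/-- The inverse isomorphism. -/
def Iso.symm {D D' : BundleData C} (i : Iso D D') : Iso D' D :=
  ⟨i.b.symm, i.e.symm, i.e₂.symm, inv_comm i.hq, inv_comm i.hz, inv_comm i.h₁, inv_comm i.h₂,
    inv_comm i.hs⟩

lemma IsAdditive.of_iso {D D' : BundleData C} (h : D.IsAdditive) (i : Iso D D') :
    D'.IsAdditive where
  zero_proj := by
    rw [← cancel_epi i.b.hom, ← Category.assoc, ← i.hz, Category.assoc, ← i.hq, ← Category.assoc,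
      h.zero_proj, Category.id_comp, Category.comp_id]
  isPullback := h.isPullback.of_iso i.e₂ i.e i.e i.b i.h₁ i.h₂ i.hq i.hq
  nfold n hn := by
    obtain ⟨P, π, hπ⟩ := h.nfold n hn
    exact ⟨P, fun j => π j ≫ i.e.hom, hπ.of_iso i.b i.e (Iso.refl P) i.hq (by simp)⟩
  sum_proj := by
    rw [← cancel_epi i.e₂.hom, ← Category.assoc, ← Category.assoc, ← i.hs, ← i.h₁, Category.assoc,
      Category.assoc, ← i.hq, ← Category.assoc, ← Category.assoc, h.sum_proj]
  assoc W ab bc ab_c a_bc h1 h2 h3 h4 h5 := by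
    have k1 := i.symm.h₁
    have k2 := i.symm.h₂
    have ks := i.symm.hs
    dsimp only [Iso.symm, CategoryTheory.Iso.symm_hom] at k1 k2 ks
    have := h.assoc W (ab ≫ i.e₂.inv) (bc ≫ i.e₂.inv) (ab_c ≫ i.e₂.inv) (a_bc ≫ i.e₂.inv)
      (by simp only [Category.assoc, ← k1, ← k2]; rw [reassoc_of% h1])
      (by simp only [Category.assoc, ← k1, ← ks]; rw [reassoc_of% h2])
      (by simp only [Category.assoc, ← k2]; rw [reassoc_of% h3])
      (by simp only [Category.assoc, ← k1]; rw [reassoc_of% h4])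
      (by simp only [Category.assoc, ← k2, ← ks]; rw [reassoc_of% h5])
    simp only [Category.assoc, ← ks] at this
    rwa [← Category.assoc, ← Category.assoc, cancel_mono] at this
  zero_sum a h1 h2 := by
    have := h.zero_sum (i.e.hom ≫ a ≫ i.e₂.inv)
      (by rw [← cancel_mono i.e.hom]; simp only [Category.assoc, i.h₁, i.hz]; simp [h1, reassoc_of% i.hq])
      (by rw [← cancel_mono i.e.hom]; simp only [Category.assoc, i.h₂]; simp [h2])
    rw [← cancel_mono i.e.hom] at this
    simp only [Category.assoc, i.hs, CategoryTheory.Iso.inv_hom_id_assoc] at this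
    rw [← cancel_epi i.e.hom, this, Category.id_comp, Category.comp_id]
  sum_comm τ h1 h2 := by
    have := h.sum_comm (i.e₂.hom ≫ τ ≫ i.e₂.inv)
      (by rw [← cancel_mono i.e.hom]; simp only [Category.assoc, i.h₁, i.h₂]; simp [h1])
      (by rw [← cancel_mono i.e.hom]; simp only [Category.assoc, i.h₁, i.h₂]; simp [h2])
    rw [← cancel_mono i.e.hom] at this
    simp only [Category.assoc, i.hs, CategoryTheory.Iso.inv_hom_id_assoc] at this
    rwa [cancel_epi] at this

lemma IsMorphism.of_iso {D D' D₁ D₁' : BundleData C} {f : D.B ⟶ D'.B} {g : D.E ⟶ D'.E}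
    (h : D.IsMorphism D' f g) (i : Iso D D₁) (j : Iso D' D₁') {f₁ : D₁.B ⟶ D₁'.B}
    {g₁ : D₁.E ⟶ D₁'.E} (hf : f ≫ j.b.hom = i.b.hom ≫ f₁) (hg : g ≫ j.e.hom = i.e.hom ≫ g₁) :
    D₁.IsMorphism D₁' f₁ g₁ where
  proj := by
    rw [← cancel_epi i.e.hom, ← reassoc_of% hg, ← j.hq, reassoc_of% h.proj, hf, reassoc_of% i.hq]
  zero := by
    rw [← cancel_epi i.b.hom, ← reassoc_of% i.hz, ← hg, reassoc_of% h.zero, j.hz, reassoc_of% hf]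
  sum g₂ h1 h2 := by
    have := h.sum (i.e₂.hom ≫ g₂ ≫ j.e₂.inv)
      (by rw [← cancel_mono j.e.hom]; simp only [Category.assoc, j.h₁, hg]; simp [h1, reassoc_of% i.h₁])
      (by rw [← cancel_mono j.e.hom]; simp only [Category.assoc, j.h₂, hg]; simp [h2, reassoc_of% i.h₂])
    rw [← cancel_mono j.e.hom] at this
    simp only [Category.assoc, j.hs, CategoryTheory.Iso.inv_hom_id_assoc, hg] at this
    rw [← cancel_epi i.e₂.hom, ← reassoc_of% i.hs, this]

/-- Functors preserve additive bundles if they preserve the fibred powers of the projection. -/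
lemma IsAdditive.map {D : BundleData C} (h : D.IsAdditive) (F : C ⥤ C')
    (h₂ : IsPullback (F.map D.π₁) (F.map D.π₂) (F.map D.q) (F.map D.q))
    (hn : ∀ (n : ℕ) (hn : 0 < n) (P : C) (π : Fin n → (P ⟶ D.E)), IsNFoldPullback D.q π →
      ∃ (P' : C) (π' : Fin n → (P' ⟶ D.E)), IsNFoldPullback D.q π' ∧
      IsNFoldPullback (F.map D.q) (fun i => F.map (π' i))) : (D.map F).IsAdditive where
  zero_proj := by
    show F.map _ ≫ F.map _ = 𝟙 (F.obj _)
    rw [← F.map_comp, h.zero_proj, F.map_id]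
  isPullback := h₂
  nfold n hn' := by
    obtain ⟨P, π, hπ⟩ := h.nfold n hn'
    obtain ⟨P', π', -, hπ'⟩ := hn n hn' P π hπ
    exact ⟨_, _, hπ'⟩
  sum_proj := by
    show F.map _ ≫ F.map _ = F.map _ ≫ F.map _
    rw [← F.map_comp, h.sum_proj, F.map_comp]
  assoc := fun W (ab bc ab_c a_bc : W ⟶ F.obj D.E₂) (h1 : ab ≫ F.map D.π₂ = bc ≫ F.map D.π₁)
      (h2 : ab_c ≫ F.map D.π₁ = ab ≫ F.map D.s) (h3 : ab_c ≫ F.map D.π₂ = bc ≫ F.map D.π₂)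
      (h4 : a_bc ≫ F.map D.π₁ = ab ≫ F.map D.π₁) (h5 : a_bc ≫ F.map D.π₂ = bc ≫ F.map D.s) => by
    show ab_c ≫ F.map D.s = a_bc ≫ F.map D.s
    obtain ⟨P₀, π₀, h₀⟩ := h.nfold 3 (by omega)
    obtain ⟨P, π, hπ, hF⟩ := hn 3 (by omega) P₀ π₀ h₀
    have hw := h₂.w
    obtain ⟨k, hk⟩ := hF.exists_lift ![ab ≫ F.map D.π₁, ab ≫ F.map D.π₂, bc ≫ F.map D.π₂] (by
      have e1 : (ab ≫ F.map D.π₁) ≫ F.map D.q = (ab ≫ F.map D.π₂) ≫ F.map D.q := by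
        rw [Category.assoc, hw, Category.assoc]
      have e2 : (ab ≫ F.map D.π₂) ≫ F.map D.q = (bc ≫ F.map D.π₂) ≫ F.map D.q := by
        rw [h1, Category.assoc, hw, Category.assoc]
      intro i j
      fin_cases i <;> fin_cases j <;> simp [e1, e2])
    let AB := h.isPullback.lift (π 0) (π 1) (hπ.comm 0 1)
    let BC := h.isPullback.lift (π 1) (π 2) (hπ.comm 1 2)
    have hAB1 : AB ≫ D.π₁ = π 0 := h.isPullback.lift_fst _ _ _
    have hAB2 : AB ≫ D.π₂ = π 1 := h.isPullback.lift_snd _ _ _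
    have hBC1 : BC ≫ D.π₁ = π 1 := h.isPullback.lift_fst _ _ _
    have hBC2 : BC ≫ D.π₂ = π 2 := h.isPullback.lift_snd _ _ _
    have hc : D.s ≫ D.q = D.π₁ ≫ D.q := h.sum_proj
    let ABC := h.isPullback.lift (AB ≫ D.s) (BC ≫ D.π₂) (by
      rw [Category.assoc, hc, ← Category.assoc, hAB1, hBC2, hπ.comm 0 2])
    let ABC' := h.isPullback.lift (AB ≫ D.π₁) (BC ≫ D.s) (by
      rw [Category.assoc BC, hc, ← Category.assoc BC, hAB1, hBC1, hπ.comm 0 1])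
    have a1 : ABC ≫ D.π₁ = AB ≫ D.s := h.isPullback.lift_fst _ _ _
    have a2 : ABC ≫ D.π₂ = BC ≫ D.π₂ := h.isPullback.lift_snd _ _ _
    have a3 : ABC' ≫ D.π₁ = AB ≫ D.π₁ := h.isPullback.lift_fst _ _ _
    have a4 : ABC' ≫ D.π₂ = BC ≫ D.s := h.isPullback.lift_snd _ _ _
    have key := h.assoc P AB BC ABC ABC' (hAB2.trans hBC1.symm) a1 a2 a3 a4
    have k0 : k ≫ F.map (π 0) = ab ≫ F.map D.π₁ := hk 0
    have k1 : k ≫ F.map (π 1) = ab ≫ F.map D.π₂ := hk 1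
    have k2 : k ≫ F.map (π 2) = bc ≫ F.map D.π₂ := hk 2
    have b1 : k ≫ F.map AB = ab := h₂.hom_ext
      (by rw [Category.assoc, ← F.map_comp, hAB1, k0]) (by rw [Category.assoc, ← F.map_comp, hAB2, k1])
    have b2 : k ≫ F.map BC = bc := h₂.hom_ext
      (by rw [Category.assoc, ← F.map_comp, hBC1, k1, h1])
      (by rw [Category.assoc, ← F.map_comp, hBC2, k2])
    have b3 : k ≫ F.map ABC = ab_c := h₂.hom_ext
      (by rw [Category.assoc, ← F.map_comp, a1, F.map_comp, ← Category.assoc, b1, h2])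
      (by rw [Category.assoc, ← F.map_comp, a2, F.map_comp, ← Category.assoc, b2, h3])
    have b4 : k ≫ F.map ABC' = a_bc := h₂.hom_ext
      (by rw [Category.assoc, ← F.map_comp, a3, F.map_comp, ← Category.assoc, b1, h4])
      (by rw [Category.assoc, ← F.map_comp, a4, F.map_comp, ← Category.assoc, b2, h5])
    rw [← b3, ← b4, Category.assoc, Category.assoc, ← F.map_comp, ← F.map_comp, key]
  zero_sum := fun (a : F.obj D.E ⟶ F.obj D.E₂) (h1 : a ≫ F.map D.π₁ = F.map D.q ≫ F.map D.z)
      (h2 : a ≫ F.map D.π₂ = 𝟙 (F.obj D.E)) => by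
    show a ≫ F.map D.s = 𝟙 (F.obj D.E)
    let a' := h.isPullback.lift (D.q ≫ D.z) (𝟙 D.E) (by
      rw [Category.assoc, h.zero_proj, Category.comp_id, Category.id_comp])
    have e1 : a' ≫ D.π₁ = D.q ≫ D.z := h.isPullback.lift_fst _ _ _
    have e2 : a' ≫ D.π₂ = 𝟙 D.E := h.isPullback.lift_snd _ _ _
    have e : F.map a' = a := h₂.hom_ext
      (by rw [← F.map_comp, e1, h1, F.map_comp]) (by rw [← F.map_comp, e2, h2, F.map_id])
    rw [← e, ← F.map_comp, h.zero_sum a' e1 e2, F.map_id]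
  sum_comm := fun (τ : F.obj D.E₂ ⟶ F.obj D.E₂) (h1 : τ ≫ F.map D.π₁ = F.map D.π₂)
      (h2 : τ ≫ F.map D.π₂ = F.map D.π₁) => by
    show τ ≫ F.map D.s = F.map D.s
    let t := h.isPullback.lift D.π₂ D.π₁ h.isPullback.w.symm
    have e1 : t ≫ D.π₁ = D.π₂ := h.isPullback.lift_fst _ _ _
    have e2 : t ≫ D.π₂ = D.π₁ := h.isPullback.lift_snd _ _ _
    have e : F.map t = τ := h₂.hom_ext
      (by rw [← F.map_comp, e1, h1]) (by rw [← F.map_comp, e2, h2])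
    rw [← e, ← F.map_comp, h.sum_comm t e1 e2]

lemma IsAdditive.map_of_isEquivalence {D : BundleData C} (h : D.IsAdditive) (F : C ⥤ C')
    [F.IsEquivalence] : (D.map F).IsAdditive :=
  h.map F (h.isPullback.map F) (fun n _ P π hπ => ⟨P, π, hπ, hπ.map_of_isEquivalence F⟩)

/-- Functors preserve morphisms of additive bundles if they preserve the pullback of the target. -/
lemma IsMorphism.map {D D' : BundleData C} {f : D.B ⟶ D'.B} {g : D.E ⟶ D'.E}
    (h : D.IsMorphism D' f g) (F : C ⥤ C') (hD : D.π₁ ≫ D.q = D.π₂ ≫ D.q)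
    (h' : IsPullback D'.π₁ D'.π₂ D'.q D'.q)
    (h₂ : IsPullback (F.map D'.π₁) (F.map D'.π₂) (F.map D'.q) (F.map D'.q)) :
    (D.map F).IsMorphism (D'.map F) (F.map f) (F.map g) where
  proj := by
    show F.map _ ≫ F.map _ = F.map _ ≫ F.map _
    rw [← F.map_comp, h.proj, F.map_comp]
  zero := by
    show F.map _ ≫ F.map _ = F.map _ ≫ F.map _
    rw [← F.map_comp, h.zero, F.map_comp]
  sum := fun (k : F.obj D.E₂ ⟶ F.obj D'.E₂) (h1 : k ≫ F.map D'.π₁ = F.map D.π₁ ≫ F.map g)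
      (h2 : k ≫ F.map D'.π₂ = F.map D.π₂ ≫ F.map g) => by
    show F.map D.s ≫ F.map g = k ≫ F.map D'.s
    let t := h'.lift (D.π₁ ≫ g) (D.π₂ ≫ g) (by
      rw [Category.assoc, Category.assoc, h.proj, reassoc_of% hD])
    have e1 : t ≫ D'.π₁ = D.π₁ ≫ g := h'.lift_fst _ _ _
    have e2 : t ≫ D'.π₂ = D.π₂ ≫ g := h'.lift_snd _ _ _
    have e : F.map t = k := h₂.hom_ext
      (by rw [← F.map_comp, e1, h1, F.map_comp]) (by rw [← F.map_comp, e2, h2, F.map_comp])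
    rw [← e, ← F.map_comp, ← F.map_comp, h.sum t e1 e2]

lemma isMorphism_map_iff {D D' : BundleData C} {f : D.B ⟶ D'.B} {g : D.E ⟶ D'.E} (F : C ⥤ C')
    [F.Full] [F.Faithful] :
    (D.map F).IsMorphism (D'.map F) (F.map f) (F.map g) ↔ D.IsMorphism D' f g := by
  constructor
  · intro h
    refine ⟨F.map_injective ?_, F.map_injective ?_, fun k h1 h2 => F.map_injective ?_⟩
    · rw [F.map_comp, F.map_comp]
      exact h.proj
    · rw [F.map_comp, F.map_comp]
      exact h.zero
    · rw [F.map_comp, F.map_comp]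
      exact h.sum (F.map k)
        ((F.map_comp _ _).symm.trans ((congrArg F.map h1).trans (F.map_comp _ _)))
        ((F.map_comp _ _).symm.trans ((congrArg F.map h2).trans (F.map_comp _ _)))
  · intro h
    refine ⟨?_, ?_, fun k h1 h2 => ?_⟩
    · exact (F.map_comp _ _).symm.trans ((congrArg F.map h.proj).trans (F.map_comp _ _))
    · exact (F.map_comp _ _).symm.trans ((congrArg F.map h.zero).trans (F.map_comp _ _))
    · obtain ⟨k, rfl⟩ := F.map_surjective (X := D.E₂) (Y := D'.E₂) k
      have e1 : k ≫ D'.π₁ = D.π₁ ≫ g := F.map_injective (by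
        rw [F.map_comp, F.map_comp]; exact h1)
      have e2 : k ≫ D'.π₂ = D.π₂ ≫ g := F.map_injective (by
        rw [F.map_comp, F.map_comp]; exact h2)
      exact (F.map_comp _ _).symm.trans ((congrArg F.map (h.sum k e1 e2)).trans (F.map_comp _ _))

end BundleData

end Bundles

/-! ### Tangent structures and locally bijective `2`-functors -/

section Transport

variable {B : Type u₁} [Bicategory.{w₁, v₁} B] {C : Type u₂} [Bicategory.{w₂, v₂} C]
  [Strict B] [Strict C] (P : StrictPseudofunctor B C)

section Bundle

variable {X Y : B}

/-- The bundle of the image of tangent data is the image of the bundle. -/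
def bundleIso (D : TangentData X) : (D.bundle.map (P.mapFunctor X X)).Iso (D.map P).bundle where
  b := P.mapId X
  e := Iso.refl _
  e₂ := Iso.refl _
  hq := (Category.id_comp _).symm
  hz := by
    show P.map₂ D.z ≫ 𝟙 (P.map D.T) = (P.mapId X).hom ≫ (P.mapId X).inv ≫ P.map₂ D.z
    simp
  h₁ := (Category.comp_id _).trans (Category.id_comp _).symm
  h₂ := (Category.comp_id _).trans (Category.id_comp _).symm
  hs := (Category.comp_id _).trans (Category.id_comp _).symm

lemma bundleIso_post_aux {Z W : B} {f g : Z ⟶ W} (η : f ⟶ g) {V : B} (F : W ⟶ V) :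
    P.map₂ (η ▷ F) ≫ (P.mapComp g F).hom = (P.mapComp f F).hom ≫ P.map₂ η ▷ P.map F := by
  rw [P.map₂_whisker_right]
  simp

lemma bundleIso_pre_aux {Z W : B} {f g : Z ⟶ W} (η : f ⟶ g) {V : B} (F : V ⟶ Z) :
    P.map₂ (F ◁ η) ≫ (P.mapComp F g).hom = (P.mapComp F f).hom ≫ P.map F ◁ P.map₂ η := by
  rw [P.map₂_whisker_left]
  simp

/-- The bundle of the image of tangent data, postcomposed with the image of a `1`-morphism. -/
def bundlePostIso (D : TangentData X) (F : X ⟶ Y) :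
    ((D.bundle.map (postcomp X F)).map (P.mapFunctor X Y)).Iso
      ((D.map P).bundle.map (postcomp (P.obj X) (P.map F))) where
  b := P.mapComp (𝟙 X) F ≪≫ whiskerRightIso (P.mapId X) (P.map F)
  e := P.mapComp D.T F
  e₂ := P.mapComp D.T₂ F
  hq := by
    show P.map₂ (D.p ▷ F) ≫ (P.mapComp (𝟙 X) F).hom ≫ (P.mapId X).hom ▷ P.map F =
      (P.mapComp D.T F).hom ≫ (P.map₂ D.p ≫ (P.mapId X).hom) ▷ P.map F
    rw [← Category.assoc, bundleIso_post_aux, Category.assoc, ← comp_whiskerRight]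
  hz := by
    show P.map₂ (D.z ▷ F) ≫ (P.mapComp D.T F).hom =
      ((P.mapComp (𝟙 X) F).hom ≫ (P.mapId X).hom ▷ P.map F) ≫
        ((P.mapId X).inv ≫ P.map₂ D.z) ▷ P.map F
    rw [bundleIso_post_aux, Category.assoc, ← comp_whiskerRight, Iso.hom_inv_id_assoc]
  h₁ := bundleIso_post_aux P D.π₁ F
  h₂ := bundleIso_post_aux P D.π₂ F
  hs := bundleIso_post_aux P D.s F

/-- The bundle of the image of tangent data, precomposed with the image of a `1`-morphism. -/
def bundlePreIso (D : TangentData Y) (F : X ⟶ Y) :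
    ((D.bundle.map (precomp Y F)).map (P.mapFunctor X Y)).Iso
      ((D.map P).bundle.map (precomp (P.obj Y) (P.map F))) where
  b := P.mapComp F (𝟙 Y) ≪≫ whiskerLeftIso (P.map F) (P.mapId Y)
  e := P.mapComp F D.T
  e₂ := P.mapComp F D.T₂
  hq := by
    show P.map₂ (F ◁ D.p) ≫ (P.mapComp F (𝟙 Y)).hom ≫ P.map F ◁ (P.mapId Y).hom =
      (P.mapComp F D.T).hom ≫ P.map F ◁ (P.map₂ D.p ≫ (P.mapId Y).hom)
    rw [← Category.assoc, bundleIso_pre_aux, Category.assoc, ← whiskerLeft_comp]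
  hz := by
    show P.map₂ (F ◁ D.z) ≫ (P.mapComp F D.T).hom =
      ((P.mapComp F (𝟙 Y)).hom ≫ P.map F ◁ (P.mapId Y).hom) ≫
        P.map F ◁ ((P.mapId Y).inv ≫ P.map₂ D.z)
    rw [bundleIso_pre_aux, Category.assoc, ← whiskerLeft_comp, Iso.hom_inv_id_assoc]
  h₁ := bundleIso_pre_aux P D.π₁ F
  h₂ := bundleIso_pre_aux P D.π₂ F
  hs := bundleIso_pre_aux P D.s F

end Bundle

section Equations

variable {X Y : B}

/-- The image of a `2`-morphism with composite target. -/
abbrev mapTo {X Y Z : B} {f : X ⟶ Z} {g : X ⟶ Y} {h : Y ⟶ Z} (l : f ⟶ g ≫ h) :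
    P.map f ⟶ P.map g ≫ P.map h := P.map₂ l ≫ (P.mapComp g h).hom

/-- The image of a `2`-morphism with composite source and target. -/
abbrev mapSq {X Y Y' Z : B} {f : X ⟶ Y'} {f' : Y' ⟶ Z} {g : X ⟶ Y} {h : Y ⟶ Z}
    (l : f ≫ f' ⟶ g ≫ h) : P.map f ≫ P.map f' ⟶ P.map g ≫ P.map h :=
  (P.mapComp f f').inv ≫ P.map₂ l ≫ (P.mapComp g h).hom

/-- The compositor of three `1`-morphisms, associated to the left. -/
def mapCompL {X Y Z W : B} (f : X ⟶ Y) (g : Y ⟶ Z) (h : Z ⟶ W) :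
    P.map ((f ≫ g) ≫ h) ≅ (P.map f ≫ P.map g) ≫ P.map h :=
  P.mapComp (f ≫ g) h ≪≫ whiskerRightIso (P.mapComp f g) (P.map h)

/-- The compositor of three `1`-morphisms, associated to the right. -/
def mapCompR {X Y Z W : B} (f : X ⟶ Y) (g : Y ⟶ Z) (h : Z ⟶ W) :
    P.map (f ≫ g ≫ h) ≅ P.map f ≫ P.map g ≫ P.map h :=
  P.mapComp f (g ≫ h) ≪≫ whiskerLeftIso (P.map f) (P.mapComp g h)

variable {T : X ⟶ X} {T' : Y ⟶ Y} (l : T ⟶ T ≫ T) (c : T ≫ T ⟶ T ≫ T)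

lemma lift_coassoc_map (l : T ⟶ T ≫ T) :
    mapTo P l ≫ mapTo P l ▷ P.map T ≫ (α_ _ _ _).hom =
      P.map₂ (l ≫ l ▷ T ≫ (α_ T T T).hom) ≫ (mapCompR P T T T).hom := by
  simp [mapTo, mapCompR, Strict.associator_eqToIso, PrelaxFunctor.map₂_eqToHom,
    P.mapComp_eq_eqToIso]

lemma lift_coassoc_map' (l : T ⟶ T ≫ T) :
    mapTo P l ≫ P.map T ◁ mapTo P l = P.map₂ (l ≫ T ◁ l) ≫ (mapCompR P T T T).hom := by
  simp [mapTo, mapCompR, P.mapComp_eq_eqToIso]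

lemma flip_flip_map (c : T ≫ T ⟶ T ≫ T) :
    mapSq P c ≫ mapSq P c = (P.mapComp T T).inv ≫ P.map₂ (c ≫ c) ≫ (P.mapComp T T).hom := by
  simp [mapSq]

lemma yang_baxter_map (c : T ≫ T ⟶ T ≫ T) :
    mapSq P c ▷ P.map T ≫ ((α_ _ _ _).hom ≫ P.map T ◁ mapSq P c ≫ (α_ _ _ _).inv) ≫
      mapSq P c ▷ P.map T = (mapCompL P T T T).inv ≫ P.map₂ (c ▷ T ≫
        ((α_ _ _ _).hom ≫ T ◁ c ≫ (α_ _ _ _).inv) ≫ c ▷ T) ≫ (mapCompL P T T T).hom := by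
  simp [mapSq, mapCompL, P.mapComp_eq_eqToIso, Strict.associator_eqToIso,
    PrelaxFunctor.map₂_eqToHom]

lemma yang_baxter_map' (c : T ≫ T ⟶ T ≫ T) :
    ((α_ _ _ _).hom ≫ P.map T ◁ mapSq P c ≫ (α_ _ _ _).inv) ≫ mapSq P c ▷ P.map T ≫
      ((α_ _ _ _).hom ≫ P.map T ◁ mapSq P c ≫ (α_ _ _ _).inv) = (mapCompL P T T T).inv ≫
        P.map₂ (((α_ _ _ _).hom ≫ T ◁ c ≫ (α_ _ _ _).inv) ≫ c ▷ T ≫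
          ((α_ _ _ _).hom ≫ T ◁ c ≫ (α_ _ _ _).inv)) ≫ (mapCompL P T T T).hom := by
  simp [mapSq, mapCompL, P.mapComp_eq_eqToIso, Strict.associator_eqToIso,
    PrelaxFunctor.map₂_eqToHom]

lemma lift_flip_map (l : T ⟶ T ≫ T) (c : T ≫ T ⟶ T ≫ T) :
    mapTo P l ≫ mapSq P c = P.map₂ (l ≫ c) ≫ (P.mapComp T T).hom := by
  simp [mapSq, mapTo]

lemma lift_flip_flip_map (l : T ⟶ T ≫ T) (c : T ≫ T ⟶ T ≫ T) :
    P.map T ◁ mapTo P l ≫ (α_ _ _ _).inv ≫ mapSq P c ▷ P.map T ≫ (α_ _ _ _).hom ≫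
      P.map T ◁ mapSq P c ≫ (α_ _ _ _).inv = (P.mapComp T T).inv ≫ P.map₂ (T ◁ l ≫
        (α_ _ _ _).inv ≫ c ▷ T ≫ (α_ _ _ _).hom ≫ T ◁ c ≫ (α_ _ _ _).inv) ≫
          (mapCompL P T T T).hom := by
  simp [mapSq, mapTo, mapCompL, P.mapComp_eq_eqToIso, Strict.associator_eqToIso,
    PrelaxFunctor.map₂_eqToHom]

lemma lift_flip_flip_map' (l : T ⟶ T ≫ T) (c : T ≫ T ⟶ T ≫ T) :
    mapSq P c ≫ mapTo P l ▷ P.map T = (P.mapComp T T).inv ≫ P.map₂ (c ≫ l ▷ T) ≫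
          (mapCompL P T T T).hom := by
  simp [mapSq, mapTo, mapCompL, P.mapComp_eq_eqToIso]

lemma lax_lift_map {F : X ⟶ Y} (l : T ⟶ T ≫ T) (a : T ≫ F ⟶ F ≫ T') :
    mapTo P l ▷ P.map F ≫ (α_ _ _ _).hom ≫ P.map T ◁ mapSq P a ≫ (α_ _ _ _).inv ≫
      mapSq P a ▷ P.map T' ≫ (α_ _ _ _).hom = (P.mapComp T F).inv ≫ P.map₂ (l ▷ F ≫
        (α_ _ _ _).hom ≫ T ◁ a ≫ (α_ _ _ _).inv ≫ a ▷ T' ≫ (α_ _ _ _).hom) ≫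
          (mapCompR P F T' T').hom := by
  simp [mapSq, mapTo, mapCompR, P.mapComp_eq_eqToIso, Strict.associator_eqToIso,
    PrelaxFunctor.map₂_eqToHom]

lemma lax_lift_map' {F : X ⟶ Y} (l : T' ⟶ T' ≫ T') (a : T ≫ F ⟶ F ≫ T') :
    mapSq P a ≫ P.map F ◁ mapTo P l = (P.mapComp T F).inv ≫ P.map₂ (a ≫ F ◁ l) ≫
          (mapCompR P F T' T').hom := by
  simp [mapSq, mapTo, mapCompR, P.mapComp_eq_eqToIso]

lemma lax_flip_map {F : X ⟶ Y} (c : T ≫ T ⟶ T ≫ T) (a : T ≫ F ⟶ F ≫ T') :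
    mapSq P c ▷ P.map F ≫ (α_ _ _ _).hom ≫ P.map T ◁ mapSq P a ≫ (α_ _ _ _).inv ≫
      mapSq P a ▷ P.map T' ≫ (α_ _ _ _).hom = (mapCompL P T T F).inv ≫ P.map₂ (c ▷ F ≫
        (α_ _ _ _).hom ≫ T ◁ a ≫ (α_ _ _ _).inv ≫ a ▷ T' ≫ (α_ _ _ _).hom) ≫
          (mapCompR P F T' T').hom := by
  simp [mapSq, mapCompL, mapCompR, P.mapComp_eq_eqToIso, Strict.associator_eqToIso,
    PrelaxFunctor.map₂_eqToHom]

lemma lax_flip_map' {F : X ⟶ Y} (c : T' ≫ T' ⟶ T' ≫ T') (a : T ≫ F ⟶ F ≫ T') :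
    ((α_ _ _ _).hom ≫ P.map T ◁ mapSq P a ≫ (α_ _ _ _).inv ≫
      mapSq P a ▷ P.map T' ≫ (α_ _ _ _).hom) ≫ P.map F ◁ mapSq P c = (mapCompL P T T F).inv ≫
        P.map₂ (((α_ _ _ _).hom ≫ T ◁ a ≫ (α_ _ _ _).inv ≫ a ▷ T' ≫ (α_ _ _ _).hom) ≫ F ◁ c) ≫
          (mapCompR P F T' T').hom := by
  simp [mapSq, mapCompL, mapCompR, P.mapComp_eq_eqToIso, Strict.associator_eqToIso,
    PrelaxFunctor.map₂_eqToHom]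

lemma colax_lift_map {F : X ⟶ Y} (l : T' ⟶ T' ≫ T') (a : F ≫ T' ⟶ T ≫ F) :
    P.map F ◁ mapTo P l ≫ (α_ _ _ _).inv ≫ mapSq P a ▷ P.map T' ≫ (α_ _ _ _).hom ≫
      P.map T ◁ mapSq P a ≫ (α_ _ _ _).inv = (P.mapComp F T').inv ≫ P.map₂ (F ◁ l ≫
        (α_ _ _ _).inv ≫ a ▷ T' ≫ (α_ _ _ _).hom ≫ T ◁ a ≫ (α_ _ _ _).inv) ≫
          (mapCompL P T T F).hom := by
  simp [mapSq, mapTo, mapCompL, P.mapComp_eq_eqToIso, Strict.associator_eqToIso,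
    PrelaxFunctor.map₂_eqToHom]

lemma colax_lift_map' {F : X ⟶ Y} (l : T ⟶ T ≫ T) (a : F ≫ T' ⟶ T ≫ F) :
    mapSq P a ≫ mapTo P l ▷ P.map F = (P.mapComp F T').inv ≫ P.map₂ (a ≫ l ▷ F) ≫
          (mapCompL P T T F).hom := by
  simp [mapSq, mapTo, mapCompL, P.mapComp_eq_eqToIso]

lemma colax_flip_map {F : X ⟶ Y} (c : T' ≫ T' ⟶ T' ≫ T') (a : F ≫ T' ⟶ T ≫ F) :
    P.map F ◁ mapSq P c ≫ (α_ _ _ _).inv ≫ mapSq P a ▷ P.map T' ≫ (α_ _ _ _).hom ≫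
      P.map T ◁ mapSq P a ≫ (α_ _ _ _).inv = (mapCompR P F T' T').inv ≫ P.map₂ (F ◁ c ≫
        (α_ _ _ _).inv ≫ a ▷ T' ≫ (α_ _ _ _).hom ≫ T ◁ a ≫ (α_ _ _ _).inv) ≫
          (mapCompL P T T F).hom := by
  simp [mapSq, mapCompR, mapCompL, P.mapComp_eq_eqToIso, Strict.associator_eqToIso,
    PrelaxFunctor.map₂_eqToHom]

lemma colax_flip_map' {F : X ⟶ Y} (c : T ≫ T ⟶ T ≫ T) (a : F ≫ T' ⟶ T ≫ F) :
    ((α_ _ _ _).inv ≫ mapSq P a ▷ P.map T' ≫ (α_ _ _ _).hom ≫ P.map T ◁ mapSq P a ≫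
      (α_ _ _ _).inv) ≫ mapSq P c ▷ P.map F = (mapCompR P F T' T').inv ≫ P.map₂ (((α_ _ _ _).inv ≫
        a ▷ T' ≫ (α_ _ _ _).hom ≫ T ◁ a ≫ (α_ _ _ _).inv) ≫ c ▷ F) ≫ (mapCompL P T T F).hom := by
  simp [mapSq, mapCompR, mapCompL, P.mapComp_eq_eqToIso, Strict.associator_eqToIso,
    PrelaxFunctor.map₂_eqToHom]

end Equations

variable {P}

namespace LocalIso

variable (hP : LocalIso P)

include hP

lemma full (X Y : B) : (P.mapFunctor X Y).Full := ⟨fun η => (hP.map₂_bij _ _).2 η⟩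

lemma faithful (X Y : B) : (P.mapFunctor X Y).Faithful := ⟨fun h => hP.map₂_inj h⟩

lemma isEquivalence (X Y : B) : (P.mapFunctor X Y).IsEquivalence where
  full := hP.full X Y
  faithful := hP.faithful X Y
  essSurj := ⟨fun f => ⟨hP.pre f, ⟨eqToIso (hP.map_pre f)⟩⟩⟩

lemma map₂_iff {X Y : B} {f g : X ⟶ Y} (η θ : f ⟶ g) {f' g' : P.obj X ⟶ P.obj Y} (i : P.map f ≅ f')
    (j : P.map g ≅ g') : i.inv ≫ P.map₂ η ≫ j.hom = i.inv ≫ P.map₂ θ ≫ j.hom ↔ η = θ := by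
  rw [cancel_epi, cancel_mono]
  exact ⟨fun h => hP.map₂_inj h, fun h => congrArg P.map₂ h⟩

end LocalIso

/-- Every object of the target is isomorphic to a value of the `2`-functor. -/
def EssSurjIso (P : StrictPseudofunctor B C) : Prop :=
  ∀ W : C, ∃ (W' : B) (e : W ⟶ P.obj W') (e' : P.obj W' ⟶ W), e ≫ e' = 𝟙 W ∧ e' ≫ e = 𝟙 (P.obj W')

lemma faithful_precomp {W W' : C} (Z : C) {e : W ⟶ W'} {e' : W' ⟶ W} (h' : e' ≫ e = 𝟙 W') :
    (precomp Z e).Faithful where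
  map_injective {f g η θ} h := by
    have h1 := congrArg (fun x => e' ◁ x) (show e ◁ η = e ◁ θ from h)
    rw [whiskerLeft_cancel h', whiskerLeft_cancel h', cancel_epi, cancel_mono] at h1
    exact h1

lemma isEquivalence_precomp {W W' : C} (Z : C) {e : W ⟶ W'} {e' : W' ⟶ W} (h : e ≫ e' = 𝟙 W)
    (h' : e' ≫ e = 𝟙 W') : (precomp Z e).IsEquivalence where
  faithful := faithful_precomp Z h'
  full := ⟨fun {f g} θ => by
    have := faithful_precomp Z h
    refine ⟨eqToHom (by rw [← Strict.assoc, h', Strict.id_comp]) ≫ e' ◁ (show e ≫ f ⟶ e ≫ g from θ) ≫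
      eqToHom (by rw [← Strict.assoc, h', Strict.id_comp]), ?_⟩
    refine (precomp Z e').map_injective ?_
    show e' ◁ e ◁ _ = e' ◁ (show e ≫ f ⟶ e ≫ g from θ)
    rw [whiskerLeft_cancel h']
    simp⟩
  essSurj := ⟨fun f => ⟨e' ≫ f, ⟨eqToIso (show e ≫ e' ≫ f = f by
    rw [← Strict.assoc, h, Strict.id_comp])⟩⟩⟩

section Pointwise

variable (hP : LocalIso P) (hE : EssSurjIso P) {X : B} {Z : C}

include hP hE

lemma exists_factor {W : C} (h : W ⟶ P.obj X) : ∃ (W' : B) (h' : W' ⟶ X) (e : W ⟶ P.obj W'),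
    e ≫ P.map h' = h ∧ (precomp Z e).IsEquivalence := by
  obtain ⟨W', e, e', h1, h2⟩ := hE W
  refine ⟨W', hP.pre (e' ≫ h), e, ?_, isEquivalence_precomp Z h1 h2⟩
  rw [hP.map_pre, ← Strict.assoc, h1, Strict.id_comp]

lemma pointwise_nfold {E A Q : P.obj X ⟶ Z} {q : E ⟶ A} {n : ℕ} {π : Fin n → (Q ⟶ E)}
    (H : ∀ (W : B) (h : W ⟶ X), IsNFoldPullback (P.map h ◁ q) (fun i => P.map h ◁ π i))
    (W : C) (h : W ⟶ P.obj X) : IsNFoldPullback (h ◁ q) (fun i => h ◁ π i) := by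
  obtain ⟨W', h', e, rfl, he⟩ := exists_factor (Z := Z) hP hE h
  exact ((H W' h').map_of_isEquivalence (precomp Z e)).of_iso (α_ e (P.map h') A).symm
    (α_ e (P.map h') E).symm (α_ e (P.map h') Q).symm (associator_inv_naturality_right _ _ _)
    (fun i => associator_inv_naturality_right _ _ _)

lemma pointwise_pullback {f₁ f₂ f₃ f₄ : P.obj X ⟶ Z} {a : f₁ ⟶ f₂} {b : f₁ ⟶ f₃} {c : f₂ ⟶ f₄}
    {d : f₃ ⟶ f₄}
    (H : ∀ (W : B) (h : W ⟶ X), IsPullback (P.map h ◁ a) (P.map h ◁ b) (P.map h ◁ c) (P.map h ◁ d))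
    (W : C) (h : W ⟶ P.obj X) : IsPullback (h ◁ a) (h ◁ b) (h ◁ c) (h ◁ d) := by
  obtain ⟨W', h', e, rfl, he⟩ := exists_factor (Z := Z) hP hE h
  exact ((H W' h').map (precomp Z e)).of_iso (α_ e (P.map h') f₁).symm
    (α_ e (P.map h') f₂).symm (α_ e (P.map h') f₃).symm (α_ e (P.map h') f₄).symm
    (associator_inv_naturality_right _ _ _) (associator_inv_naturality_right _ _ _)
    (associator_inv_naturality_right _ _ _) (associator_inv_naturality_right _ _ _)

end Pointwise

section Wrap

variable {W X Y : B}

/-- The comparison for precomposition. -/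
def preIso (h : W ⟶ X) {g : X ⟶ Y} {g' : P.obj X ⟶ P.obj Y} (γ : P.map g ≅ g') :
    P.map (h ≫ g) ≅ P.map h ≫ g' := P.mapComp h g ≪≫ whiskerLeftIso (P.map h) γ

/-- The comparison for postcomposition. -/
def postIso {g : W ⟶ X} {g' : P.obj W ⟶ P.obj X} (γ : P.map g ≅ g') (F : X ⟶ Y) :
    P.map (g ≫ F) ≅ g' ≫ P.map F := P.mapComp g F ≪≫ whiskerRightIso γ (P.map F)

lemma preIso_comm (h : W ⟶ X) {g k : X ⟶ Y} {g' k' : P.obj X ⟶ P.obj Y} {γ : P.map g ≅ g'}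
    {δ : P.map k ≅ k'} {η : g ⟶ k} {η' : g' ⟶ k'} (e : P.map₂ η ≫ δ.hom = γ.hom ≫ η') :
    P.map₂ (h ◁ η) ≫ (preIso h δ).hom = (preIso h γ).hom ≫ P.map h ◁ η' := by
  simp only [preIso, Iso.trans_hom, whiskerLeftIso_hom, Category.assoc]
  rw [← Category.assoc, bundleIso_pre_aux, Category.assoc, ← whiskerLeft_comp, e, whiskerLeft_comp]

lemma postIso_comm {g k : W ⟶ X} {g' k' : P.obj W ⟶ P.obj X} {γ : P.map g ≅ g'}
    {δ : P.map k ≅ k'} {η : g ⟶ k} {η' : g' ⟶ k'} (e : P.map₂ η ≫ δ.hom = γ.hom ≫ η') (F : X ⟶ Y) :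
    P.map₂ (η ▷ F) ≫ (postIso δ F).hom = (postIso γ F).hom ≫ η' ▷ P.map F := by
  simp only [postIso, Iso.trans_hom, whiskerRightIso_hom, Category.assoc]
  rw [← Category.assoc, bundleIso_post_aux, Category.assoc, ← comp_whiskerRight, e,
    comp_whiskerRight]

lemma comm_comp {f g k : W ⟶ X} {f' g' k' : P.obj W ⟶ P.obj X} {γ : P.map f ≅ f'}
    {δ : P.map g ≅ g'} {χ : P.map k ≅ k'} {η : f ⟶ g} {η' : f' ⟶ g'} {θ : g ⟶ k} {θ' : g' ⟶ k'}
    (e : P.map₂ η ≫ δ.hom = γ.hom ≫ η') (e' : P.map₂ θ ≫ χ.hom = δ.hom ≫ θ') :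
    P.map₂ (η ≫ θ) ≫ χ.hom = γ.hom ≫ η' ≫ θ' := by
  rw [P.map₂_comp, Category.assoc, e', reassoc_of% e]

end Wrap

end Transport

/-! ### Transport of tangent structures and tangent morphisms -/

section Transport

variable {B : Type u₁} [Bicategory.{w₁, v₁} B] {C : Type u₂} [Bicategory.{w₂, v₂} C]
  [Strict B] [Strict C] {P : StrictPseudofunctor B C}

lemma iter_map {X : B} (T : X ⟶ X) (m : ℕ) : iter (P.map T) m = P.map (iter T m) := by
  induction m with
  | zero => exact (P.map_id X).symm
  | succ m ih => exact (congrArg (· ≫ P.map T) ih).trans (P.map_comp _ _).symm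

section Comm

variable {X : B} (D : TangentData X)

lemma map_p_comm : P.map₂ D.p ≫ (P.mapId X).hom = (Iso.refl (P.map D.T)).hom ≫ (D.map P).p :=
  (Category.id_comp _).symm

lemma map_z_comm : P.map₂ D.z ≫ (Iso.refl (P.map D.T)).hom = (P.mapId X).hom ≫ (D.map P).z :=
  (bundleIso P D).hz

lemma map_refl_comm {Y : B} {f g : X ⟶ Y} (η : f ⟶ g) :
    P.map₂ η ≫ (Iso.refl (P.map g)).hom = (Iso.refl (P.map f)).hom ≫ P.map₂ η :=
  (Category.comp_id _).trans (Category.id_comp _).symm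

lemma map_to_comm {Y Z : B} {f : X ⟶ Z} {g : X ⟶ Y} {h : Y ⟶ Z} (η : f ⟶ g ≫ h) :
    P.map₂ η ≫ (P.mapComp g h).hom = (Iso.refl (P.map f)).hom ≫ mapTo P η :=
  (Category.id_comp _).symm

lemma map_post_comm {Y : B} {f g : X ⟶ X} (η : f ⟶ g) (F : X ⟶ Y) :
    P.map₂ (η ▷ F) ≫ (P.mapComp g F).hom = (P.mapComp f F).hom ≫ P.map₂ η ▷ P.map F :=
  bundleIso_post_aux P η F

lemma map_pT_comm : P.map₂ (D.p ▷ D.T ≫ (λ_ D.T).hom) ≫ (Iso.refl (P.map D.T)).hom =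
    (P.mapComp D.T D.T).hom ≫ (D.map P).p ▷ (D.map P).T ≫ (λ_ (D.map P).T).hom := by
  show P.map₂ (D.p ▷ D.T ≫ (λ_ D.T).hom) ≫ 𝟙 (P.map D.T) =
    (P.mapComp D.T D.T).hom ≫ (P.map₂ D.p ≫ (P.mapId X).hom) ▷ P.map D.T ≫ (λ_ (P.map D.T)).hom
  simp [P.mapId_eq_eqToIso, P.mapComp_eq_eqToIso, Strict.leftUnitor_eqToIso, PrelaxFunctor.map₂_eqToHom]

lemma isLiftPair_map_iff (hP : LocalIso P) (v : D.T₂ ⟶ D.T₂ ≫ D.T) :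
    (D.map P).IsLiftPair (mapTo P v) ↔ D.IsLiftPair v := by
  have e1 : mapTo P v ≫ P.map₂ D.π₁ ▷ P.map D.T =
      P.map₂ (v ≫ D.π₁ ▷ D.T) ≫ (P.mapComp D.T D.T).hom := by simp [mapTo]
  have e2 : P.map₂ D.π₁ ≫ mapTo P D.l = P.map₂ (D.π₁ ≫ D.l) ≫ (P.mapComp D.T D.T).hom := by
    simp [mapTo]
  have e3 : mapTo P v ≫ P.map₂ D.π₂ ▷ P.map D.T =
      P.map₂ (v ≫ D.π₂ ▷ D.T) ≫ (P.mapComp D.T D.T).hom := by simp [mapTo]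
  have e4 : P.map₂ D.π₂ ≫ (ρ_ (P.map D.T)).inv ≫ P.map D.T ◁ ((P.mapId X).inv ≫ P.map₂ D.z) =
      P.map₂ (D.π₂ ≫ (ρ_ D.T).inv ≫ D.T ◁ D.z) ≫ (P.mapComp D.T D.T).hom := by
    simp [P.mapId_eq_eqToIso, P.mapComp_eq_eqToIso, Strict.rightUnitor_eqToIso, PrelaxFunctor.map₂_eqToHom]
  refine and_congr ?_ ?_
  · show mapTo P v ≫ P.map₂ D.π₁ ▷ P.map D.T = P.map₂ D.π₁ ≫ mapTo P D.l ↔ _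
    rw [e1, e2, cancel_mono]
    exact ⟨fun h => hP.map₂_inj h, fun h => congrArg _ h⟩
  · show mapTo P v ≫ P.map₂ D.π₂ ▷ P.map D.T =
      P.map₂ D.π₂ ≫ (ρ_ (P.map D.T)).inv ≫ P.map D.T ◁ ((P.mapId X).inv ≫ P.map₂ D.z) ↔ _
    rw [e3, e4, cancel_mono]
    exact ⟨fun h => hP.map₂_inj h, fun h => congrArg _ h⟩

lemma exists_mapTo (hP : LocalIso P) {Y Z : B} {f : X ⟶ Z} {g : X ⟶ Y} {h : Y ⟶ Z}
    (v : P.map f ⟶ P.map g ≫ P.map h) : ∃ u : f ⟶ g ≫ h, mapTo P u = v :=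
  ⟨hP.pre₂ (v ≫ (P.mapComp g h).inv), by simp [mapTo, hP.map₂_pre₂]⟩

end Comm

/-- Locally bijective `2`-functors preserve tangent objects. -/
lemma TangentData.IsTangent.map {X : B} {D : TangentData X} (h : D.IsTangent) (hP : LocalIso P)
    (hE : EssSurjIso P) : (D.map P).IsTangent where
  additive := by
    have := hP.isEquivalence X X
    exact (h.additive.map_of_isEquivalence (P.mapFunctor X X)).of_iso (bundleIso P D)
  nfold n hn := by
    obtain ⟨Tn, π, hT⟩ := h.nfold n hn
    refine ⟨P.map Tn, fun i => P.map₂ (π i), fun m W k => ?_⟩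
    show IsNFoldPullback (k ◁ ((P.map₂ D.p ≫ (P.mapId X).hom) ▷ iter (P.map D.T) m))
      (fun i => k ◁ (P.map₂ (π i) ▷ iter (P.map D.T) m))
    rw [iter_map]
    refine pointwise_nfold hP hE (fun W k => ?_) W k
    have := hP.isEquivalence W X
    exact ((hT m W k).map_of_isEquivalence (P.mapFunctor W X)).of_iso
      (preIso k (postIso (P.mapId X) _)) (preIso k (postIso (Iso.refl _) _))
      (preIso k (postIso (Iso.refl _) _)) (preIso_comm k (postIso_comm (map_p_comm D) _))
      (fun i => preIso_comm k (postIso_comm (map_refl_comm (π i)) _))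
  lift_additive := by
    have := hP.full X X
    have := hP.faithful X X
    refine ((BundleData.isMorphism_map_iff (P.mapFunctor X X)).2 h.lift_additive).of_iso
      (bundleIso P D) (bundlePostIso P D D.T) ?_ ?_
    · show P.map₂ (D.z ≫ (λ_ D.T).inv) ≫ (P.mapComp (𝟙 X) D.T).hom ≫ (P.mapId X).hom ▷ P.map D.T =
        (P.mapId X).hom ≫ ((P.mapId X).inv ≫ P.map₂ D.z) ≫ (λ_ (P.map D.T)).inv
      simp [P.mapId_eq_eqToIso, P.mapComp_eq_eqToIso, Strict.leftUnitor_eqToIso, PrelaxFunctor.map₂_eqToHom]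
    · exact map_to_comm D.l
  flip_additive := by
    have := hP.full X X
    have := hP.faithful X X
    refine ((BundleData.isMorphism_map_iff (P.mapFunctor X X)).2 h.flip_additive).of_iso
      (bundlePostIso P D D.T) (bundlePreIso P D D.T) ?_ ?_
    · show P.map₂ ((λ_ D.T).hom ≫ (ρ_ D.T).inv) ≫ (P.mapComp D.T (𝟙 X)).hom ≫
          P.map D.T ◁ (P.mapId X).hom =
        ((P.mapComp (𝟙 X) D.T).hom ≫ (P.mapId X).hom ▷ P.map D.T) ≫
          (λ_ (P.map D.T)).hom ≫ (ρ_ (P.map D.T)).inv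
      simp [P.mapId_eq_eqToIso, P.mapComp_eq_eqToIso, Strict.leftUnitor_eqToIso, Strict.rightUnitor_eqToIso,
        PrelaxFunctor.map₂_eqToHom]
    · show P.map₂ D.c ≫ (P.mapComp D.T D.T).hom = (P.mapComp D.T D.T).hom ≫ mapSq P D.c
      simp [mapSq]
  lift_coassoc := by
    refine (lift_coassoc_map P D.l).trans ?_
    rw [h.lift_coassoc]
    exact (lift_coassoc_map' P D.l).symm
  flip_flip := by
    refine (flip_flip_map P D.c).trans ?_
    rw [h.flip_flip, P.map₂_id, Category.id_comp, Iso.inv_hom_id]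
    rfl
  yang_baxter := by
    refine (yang_baxter_map P D.c).trans ?_
    rw [h.yang_baxter]
    exact (yang_baxter_map' P D.c).symm
  lift_flip := by
    refine (lift_flip_map P D.l D.c).trans ?_
    rw [h.lift_flip]
    rfl
  lift_flip_flip := by
    refine (lift_flip_flip_map P D.l D.c).trans ?_
    rw [h.lift_flip_flip]
    exact (lift_flip_flip_map' P D.l D.c).symm
  lift_universal := by
    obtain ⟨v, hv, hu⟩ := h.lift_universal
    refine ⟨mapTo P v, (isLiftPair_map_iff D hP v).2 hv, pointwise_pullback hP hE fun W k => ?_⟩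
    have := hP.isEquivalence W X
    exact ((hu W k).map (P.mapFunctor W X)).of_iso (preIso k (Iso.refl _))
      (preIso k (P.mapComp D.T D.T)) (preIso k (P.mapId X)) (preIso k (Iso.refl _))
      (preIso_comm k (comm_comp (map_to_comm v) (map_post_comm D.s D.T)))
      (preIso_comm k (comm_comp (map_refl_comm D.π₁) (map_p_comm D)))
      (preIso_comm k (map_pT_comm D)) (preIso_comm k (map_z_comm D))

variable {X Y : B} (D : TangentData X) (D' : TangentData Y)

lemma isLax_map_iff (hP : LocalIso P) (F : X ⟶ Y) (law : D.T ≫ F ⟶ F ≫ D'.T) :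
    (D.map P).IsLax (D'.map P) (P.map F) (mapSq P law) ↔ D.IsLax D' F law := by
  have := hP.full X Y
  have := hP.faithful X Y
  have e1 : P.map₂ ((λ_ F).hom ≫ (ρ_ F).inv) ≫ (P.mapComp F (𝟙 Y)).hom ≫
      P.map F ◁ (P.mapId Y).hom = ((P.mapComp (𝟙 X) F).hom ≫ (P.mapId X).hom ▷ P.map F) ≫
        (λ_ (P.map F)).hom ≫ (ρ_ (P.map F)).inv := by
    simp [P.mapId_eq_eqToIso, P.mapComp_eq_eqToIso, Strict.leftUnitor_eqToIso, Strict.rightUnitor_eqToIso,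
        PrelaxFunctor.map₂_eqToHom]
  have e2 : P.map₂ law ≫ (P.mapComp F D'.T).hom = (P.mapComp D.T F).hom ≫ mapSq P law := by
    simp [mapSq]
  have a1 := lax_lift_map P D.l law
  have a2 := lax_lift_map' P D'.l law
  have a3 := lax_flip_map P D.c law
  have a4 := lax_flip_map' P D'.c law
  constructor
  · intro h
    refine ⟨(BundleData.isMorphism_map_iff (P.mapFunctor X Y)).1 (h.additive.of_iso
      (bundlePostIso P D F).symm (bundlePreIso P D' F).symm (BundleData.inv_comm e1)
        (BundleData.inv_comm e2)), ?_, ?_⟩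
    · exact (hP.map₂_iff _ _ _ _).1 (a1.symm.trans (Eq.trans h.lift a2))
    · exact (hP.map₂_iff _ _ _ _).1 (a3.symm.trans (Eq.trans h.flip a4))
  · intro h
    refine ⟨((BundleData.isMorphism_map_iff (P.mapFunctor X Y)).2 h.additive).of_iso
      (bundlePostIso P D F) (bundlePreIso P D' F) e1 e2, ?_, ?_⟩
    · exact a1.trans (Eq.trans ((hP.map₂_iff _ _ _ _).2 h.lift) a2.symm)
    · exact a3.trans (Eq.trans ((hP.map₂_iff _ _ _ _).2 h.flip) a4.symm)

lemma isColax_map_iff (hP : LocalIso P) (hE : EssSurjIso P) (F : X ⟶ Y)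
    (law : F ≫ D'.T ⟶ D.T ≫ F) :
    (D.map P).IsColax (D'.map P) (P.map F) (mapSq P law) ↔ D.IsColax D' F law := by
  have := hP.full X Y
  have := hP.faithful X Y
  have e1 : P.map₂ ((ρ_ F).hom ≫ (λ_ F).inv) ≫ (P.mapComp (𝟙 X) F).hom ≫
      (P.mapId X).hom ▷ P.map F = ((P.mapComp F (𝟙 Y)).hom ≫ P.map F ◁ (P.mapId Y).hom) ≫
        (ρ_ (P.map F)).hom ≫ (λ_ (P.map F)).inv := by
    simp [P.mapId_eq_eqToIso, P.mapComp_eq_eqToIso, Strict.leftUnitor_eqToIso, Strict.rightUnitor_eqToIso,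
        PrelaxFunctor.map₂_eqToHom]
  have e2 : P.map₂ law ≫ (P.mapComp D.T F).hom = (P.mapComp F D'.T).hom ≫ mapSq P law := by
    simp [mapSq]
  have a1 := colax_lift_map P D'.l law
  have a2 := colax_lift_map' P D.l law
  have a3 := colax_flip_map P D'.c law
  have a4 := colax_flip_map' P D.c law
  have hn {n : ℕ} {Tn : X ⟶ X} (π : Fin n → (Tn ⟶ D.T)) :
      IsNFoldPullback (D.map P).p (fun i => P.map₂ (π i)) ↔ IsNFoldPullback D.p π := by
    have := hP.isEquivalence X X
    refine ⟨fun h => IsNFoldPullback.of_map (P.mapFunctor X X) (h.of_iso (P.mapId X).symm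
      (Iso.refl _) (Iso.refl _) (BundleData.inv_comm (map_p_comm D))
      (fun i => BundleData.inv_comm (map_refl_comm (π i)))), fun h =>
      (h.map_of_isEquivalence (P.mapFunctor X X)).of_iso (P.mapId X)
      (Iso.refl _) (Iso.refl _) (map_p_comm D) (fun i => (map_refl_comm (π i)))⟩
  have hw {n : ℕ} {Tn : X ⟶ X} (π : Fin n → (Tn ⟶ D.T)) {W : B} (k : W ⟶ X) :
      IsNFoldPullback (P.map k ◁ ((D.map P).p ▷ P.map F))
        (fun i => P.map k ◁ (P.map₂ (π i) ▷ P.map F)) ↔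
      IsNFoldPullback (k ◁ (D.p ▷ F)) (fun i => k ◁ (π i ▷ F)) := by
    have := hP.isEquivalence W Y
    refine ⟨fun h => IsNFoldPullback.of_map (P.mapFunctor W Y) (h.of_iso
      (preIso k (postIso (P.mapId X) _)).symm (preIso k (postIso (Iso.refl _) _)).symm
      (preIso k (postIso (Iso.refl _) _)).symm
      (BundleData.inv_comm (preIso_comm k (postIso_comm (map_p_comm D) _)))
      (fun i => BundleData.inv_comm (preIso_comm k (postIso_comm (map_refl_comm (π i)) _)))),
      fun h => (h.map_of_isEquivalence (P.mapFunctor W Y)).of_iso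
      (preIso k (postIso (P.mapId X) _)) (preIso k (postIso (Iso.refl _) _))
      (preIso k (postIso (Iso.refl _) _)) (preIso_comm k (postIso_comm (map_p_comm D) _))
      (fun i => preIso_comm k (postIso_comm (map_refl_comm (π i)) _))⟩
  have hl (v : D.T₂ ⟶ D.T₂ ≫ D.T) {W : B} (k : W ⟶ X) :
      IsPullback (P.map k ◁ ((mapTo P v ≫ (D.map P).s ▷ (D.map P).T) ▷ P.map F))
        (P.map k ◁ (((D.map P).π₁ ≫ (D.map P).p) ▷ P.map F))
        (P.map k ◁ (((D.map P).p ▷ (D.map P).T ≫ (λ_ (D.map P).T).hom) ▷ P.map F))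
        (P.map k ◁ ((D.map P).z ▷ P.map F)) ↔
      IsPullback (k ◁ ((v ≫ D.s ▷ D.T) ▷ F)) (k ◁ ((D.π₁ ≫ D.p) ▷ F))
        (k ◁ ((D.p ▷ D.T ≫ (λ_ D.T).hom) ▷ F)) (k ◁ (D.z ▷ F)) := by
    have := hP.isEquivalence W Y
    have b1 := preIso_comm k (postIso_comm (comm_comp (map_to_comm (P := P) v) (map_post_comm D.s D.T)) F)
    have b2 := preIso_comm k (postIso_comm (comm_comp (map_refl_comm (P := P) D.π₁) (map_p_comm D)) F)
    have b3 := preIso_comm k (postIso_comm (map_pT_comm (P := P) D) F)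
    have b4 := preIso_comm k (postIso_comm (map_z_comm (P := P) D) F)
    refine ⟨fun h => ?_, fun h => (h.map (P.mapFunctor W Y)).of_iso _ _ _ _ b1 b2 b3 b4⟩
    have h1 := h.of_iso (preIso k (postIso (Iso.refl (P.map D.T₂)) F)).symm
      (preIso k (postIso (P.mapComp D.T D.T) F)).symm (preIso k (postIso (P.mapId X) F)).symm
      (preIso k (postIso (Iso.refl (P.map D.T)) F)).symm (BundleData.inv_comm b1) (BundleData.inv_comm b2)
      (BundleData.inv_comm b3) (BundleData.inv_comm b4)
    exact IsPullback.of_map (P.mapFunctor W Y) ((P.mapFunctor W Y).map_injective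
      (((P.mapFunctor W Y).map_comp _ _).trans
        (h1.w.trans ((P.mapFunctor W Y).map_comp _ _).symm))) h1
  constructor
  · intro h
    refine ⟨(BundleData.isMorphism_map_iff (P.mapFunctor X Y)).1 (h.additive.of_iso
      (bundlePreIso P D' F).symm (bundlePostIso P D F).symm (BundleData.inv_comm e1)
        (BundleData.inv_comm e2)), ?_, ?_, fun n hn' Tn π hπ W k => (hw π k).1
          (h.nfold n hn' _ _ ((hn π).2 hπ) _ _), fun v hv W k => (hl v k).1
            (h.lift_universal _ ((isLiftPair_map_iff D hP v).2 hv) _ _)⟩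
    · exact (hP.map₂_iff _ _ _ _).1 (a1.symm.trans (Eq.trans h.lift a2))
    · exact (hP.map₂_iff _ _ _ _).1 (a3.symm.trans (Eq.trans h.flip a4))
  · intro h
    refine ⟨((BundleData.isMorphism_map_iff (P.mapFunctor X Y)).2 h.additive).of_iso
      (bundlePreIso P D' F) (bundlePostIso P D F) e1 e2, ?_, ?_, fun n hn' Tn π hπ => ?_,
      fun v hv => ?_⟩
    · exact a1.trans (Eq.trans ((hP.map₂_iff _ _ _ _).2 h.lift) a2.symm)
    · exact a3.trans (Eq.trans ((hP.map₂_iff _ _ _ _).2 h.flip) a4.symm)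
    · obtain ⟨Tn, rfl⟩ := (hP.map_bij X X).2 Tn
      obtain ⟨π, rfl⟩ : ∃ π' : Fin n → (Tn ⟶ D.T), (fun i => P.map₂ (π' i)) = π :=
        ⟨fun i => hP.pre₂ (π i), funext fun i => hP.map₂_pre₂ _⟩
      exact pointwise_nfold hP hE fun W k => (hw π k).2 (h.nfold n hn' _ _ ((hn π).1 hπ) W k)
    · obtain ⟨v, rfl⟩ := exists_mapTo hP (X := X) v
      exact pointwise_pullback hP hE fun W k =>
        (hl v k).2 (h.lift_universal _ ((isLiftPair_map_iff D hP v).1 hv) W k)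

section MapSq

variable {X Y Y' Z : B} {f : X ⟶ Y'} {f' : Y' ⟶ Z} {g : X ⟶ Y} {h : Y ⟶ Z}

lemma map_square (e : f ≫ f' = g ≫ h) : P.map f ≫ P.map f' = P.map g ≫ P.map h :=
  (P.map_comp f f').symm.trans ((congrArg P.map e).trans (P.map_comp g h))

lemma mapSq_eqToHom (e : f ≫ f' = g ≫ h) : mapSq P (eqToHom e) = eqToHom (map_square e) := by
  simp [mapSq, P.mapComp_eq_eqToIso, PrelaxFunctor.map₂_eqToHom]

lemma exists_eq_of_mapSq (hP : LocalIso P) {l : f ≫ f' ⟶ g ≫ h}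
    (e : P.map f ≫ P.map f' = P.map g ≫ P.map h) (he : mapSq P l = eqToHom e) :
    ∃ e₀ : f ≫ f' = g ≫ h, l = eqToHom e₀ := by
  have e₀ : f ≫ f' = g ≫ h := hP.map_inj ((P.map_comp f f').trans (e.trans (P.map_comp g h).symm))
  refine ⟨e₀, hP.map₂_inj ?_⟩
  have := congrArg (fun y => (P.mapComp f f').hom ≫ y ≫ (P.mapComp g h).inv)
    (he.trans (mapSq_eqToHom e₀).symm)
  simpa [mapSq] using this

lemma exists_mapSqIso (e : f ≫ f' ≅ g ≫ h) : ∃ e' : P.map f ≫ P.map f' ≅ P.map g ≫ P.map h,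
    e'.hom = mapSq P e.hom ∧ e'.inv = mapSq P e.inv :=
  ⟨(P.mapComp f f').symm ≪≫ P.map₂Iso e ≪≫ P.mapComp g h, by simp [mapSq], by simp [mapSq]⟩

lemma exists_iso_of_mapSq (hP : LocalIso P) {l : f ≫ f' ⟶ g ≫ h}
    (e : P.map f ≫ P.map f' ≅ P.map g ≫ P.map h) (he : e.hom = mapSq P l) :
    ∃ e₀ : f ≫ f' ≅ g ≫ h, e₀.hom = l ∧ e.inv = mapSq P e₀.inv := by
  have := hP.full X Z
  have := hP.faithful X Z
  have e1 : P.map₂ l = (P.mapComp f f').hom ≫ e.hom ≫ (P.mapComp g h).inv := by simp [he, mapSq]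
  have h1 : IsIso ((P.mapFunctor X Z).map l) := by
    show IsIso (P.map₂ l)
    rw [e1]
    infer_instance
  have := isIso_of_reflects_iso l (P.mapFunctor X Z)
  obtain ⟨e', h2, h3⟩ := exists_mapSqIso (P := P) (asIso l)
  obtain rfl : e = e' := Iso.ext (he.trans h2.symm)
  exact ⟨asIso l, rfl, h3⟩

end MapSq

lemma isStrong_map_iff (hP : LocalIso P) (hE : EssSurjIso P) (F : X ⟶ Y)
    (law : D.T ≫ F ⟶ F ≫ D'.T) :
    (D.map P).IsStrong (D'.map P) (P.map F) (mapSq P law) ↔ D.IsStrong D' F law := by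
  constructor
  · rintro ⟨e, he, h⟩
    obtain ⟨e₀, h1, h2⟩ := exists_iso_of_mapSq hP e he
    exact ⟨e₀, h1, (isColax_map_iff D D' hP hE F _).1 (h2 ▸ h)⟩
  · rintro ⟨e, rfl, h⟩
    obtain ⟨e', h1, h2⟩ := exists_mapSqIso (P := P) e
    exact ⟨e', h1, h2 ▸ (isColax_map_iff D D' hP hE F _).2 h⟩

lemma isStrict_map_iff (hP : LocalIso P) (hE : EssSurjIso P) (F : X ⟶ Y)
    (law : D.T ≫ F ⟶ F ≫ D'.T) :
    (D.map P).IsStrict (D'.map P) (P.map F) (mapSq P law) ↔ D.IsStrict D' F law := by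
  constructor
  · rintro ⟨e, he, h⟩
    obtain ⟨e₀, h1⟩ := exists_eq_of_mapSq hP e he
    exact ⟨e₀, h1, (isColax_map_iff D D' hP hE F _).1 (mapSq_eqToHom (P := P) e₀.symm ▸ h)⟩
  · rintro ⟨e, rfl, h⟩
    exact ⟨map_square e, mapSq_eqToHom e,
      mapSq_eqToHom (P := P) e.symm ▸ (isColax_map_iff D D' hP hE F _).2 h⟩

end Transport

/-! ### Pointwise limits of cloven fibrations -/

lemma IsNFoldPullback.lift_comm {C : Type u₁} [Category.{v₁} C] {E B P E₀ P₀ R R₀ : C} {q : E ⟶ B}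
    {n : ℕ} {π : Fin n → (P ⟶ E)} (h : IsNFoldPullback q π) {ρ : Fin n → (P₀ ⟶ E₀)}
    {a : Fin n → (R ⟶ E)} {b : Fin n → (R₀ ⟶ E₀)} {k : R ⟶ P} {k₀ : R₀ ⟶ P₀} {r : R₀ ⟶ R}
    {p : P₀ ⟶ P} {m : E₀ ⟶ E} (hk : ∀ i, k ≫ π i = a i) (hk₀ : ∀ i, k₀ ≫ ρ i = b i)
    (hr : ∀ i, r ≫ a i = b i ≫ m) (hp : ∀ i, p ≫ π i = ρ i ≫ m) : r ≫ k = k₀ ≫ p :=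
  h.hom_ext fun i => by rw [Category.assoc, Category.assoc, hk, hr, hp, reassoc_of% hk₀]

namespace Fib

/-- The objects of the terminal category. -/
inductive Pt : Type u
  | star

instance : Category.{v} Pt.{u} where
  Hom _ _ := PUnit.{v + 1}
  id _ := ⟨⟩
  comp _ _ := ⟨⟩

/-- The objects of the empty category. -/
inductive Em : Type u

instance : Category.{v} Em.{u} where
  Hom _ _ := PUnit.{v + 1}
  id _ := ⟨⟩
  comp _ _ := ⟨⟩

lemma isStronglyCartesian_id {C : Type u₁} [Category.{v₁} C] (X : C) :
    (𝟭 C).IsStronglyCartesian (𝟙 X) (𝟙 X) := by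
  have : (𝟭 C).IsHomLift (𝟙 X) (𝟙 X) := CategoryTheory.IsHomLift.id rfl
  infer_instance

/-- The identity of the terminal category, as a cloven fibration. -/
def point : Fib.{v, u} where
  base := Cat.of Pt.{u}
  total := Cat.of Pt.{u}
  proj := 𝟙 _
  pull E _ := E
  lift E _ := 𝟙 E
  cart {A} E f := isStronglyCartesian_id (C := Pt.{u}) E

/-- The empty fibration over the terminal category. -/
def emptyFib : Fib.{v, u} where
  base := Cat.of Pt.{u}
  total := Cat.of Em.{u}
  proj := Functor.toCatHom { obj := nofun, map := fun {E} => nomatch E }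
  pull E := nomatch E
  lift E := nomatch E
  cart E := nomatch E

/-- Evaluation at an object of the base. -/
def evB {W : Fib.{v, u}} (Z : Fib.{v, u}) (A : W.base) : (W ⟶ Z) ⥤ Z.base where
  obj F := F.base.toFunctor.obj A
  map a := a.base.toNatTrans.app A
  map_id _ := rfl
  map_comp _ _ := rfl

/-- Evaluation at an object of the total category. -/
def evT {W : Fib.{v, u}} (Z : Fib.{v, u}) (E : W.total) : (W ⟶ Z) ⥤ Z.total where
  obj F := F.total.toFunctor.obj E
  map a := a.total.toNatTrans.app E
  map_id _ := rfl
  map_comp _ _ := rfl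

variable {W X Y Z : Fib.{v, u}}

lemma ev_ext {F G : W ⟶ Z} {a b : F ⟶ G} (h : ∀ A, (evB Z A).map a = (evB Z A).map b)
    (h' : ∀ E, (evT Z E).map a = (evT Z E).map b) : a = b :=
  hom₂_ext (Cat.Hom₂.ext (NatTrans.ext (funext h))) (Cat.Hom₂.ext (NatTrans.ext (funext h')))

lemma isHomLift_unique {C : Type u₁} [Category.{v₁} C] {S : Type u₂} [Category.{v₂} S] (p : C ⥤ S)
    {A B : S} {f g : A ⟶ B} {X Y : C} (m : X ⟶ Y) (h : p.IsHomLift f m) (h' : p.IsHomLift g m) :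
    f = g := by
  cases h
  simpa using (CategoryTheory.IsHomLift.fac p g m).symm

lemma isHomLift_iff {C : Type u₁} [Category.{v₁} C] {S : Type u₂} [Category.{v₂} S] (p : C ⥤ S)
    {A B : S} {f : A ⟶ B} {X Y : C} (m : X ⟶ Y) (hA : p.obj X = A) (hB : p.obj Y = B) :
    p.IsHomLift f m ↔ p.map m ≫ eqToHom hB = eqToHom hA ≫ f := by
  subst hA hB
  simp only [eqToHom_refl, Category.comp_id, Category.id_comp]
  exact ⟨fun h => by simpa using (CategoryTheory.IsHomLift.fac' p f m), fun h => h ▸ inferInstance⟩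

/-- A `2`-morphism of cloven fibrations from its components. -/
def hom₂Mk {F G : W ⟶ Z} (b : ∀ A, (evB Z A).obj F ⟶ (evB Z A).obj G)
    (t : ∀ E, (evT Z E).obj F ⟶ (evT Z E).obj G)
    (hb : ∀ {A A' : W.base} (f : A ⟶ A'), F.base.toFunctor.map f ≫ b A' =
      b A ≫ G.base.toFunctor.map f)
    (ht : ∀ {E E' : W.total} (f : E ⟶ E'), F.total.toFunctor.map f ≫ t E' =
      t E ≫ G.total.toFunctor.map f)
    (h : ∀ E, Z.proj.toFunctor.IsHomLift (b (W.proj.toFunctor.obj E)) (t E)) : F ⟶ G :=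
  Hom₂.mk (NatTrans.toCatHom₂ { app := b, naturality := fun _ _ f => hb f })
    (NatTrans.toCatHom₂ { app := t, naturality := fun _ _ f => ht f }) h

/-- The `1`-morphism given by an object of the total category. -/
def ofTotal (E : X.total) : point ⟶ X where
  base := Functor.toCatHom ((Functor.const Pt.{u}).obj (X.proj.toFunctor.obj E))
  total := Functor.toCatHom ((Functor.const Pt.{u}).obj E)
  comm := Cat.Hom.ext (CategoryTheory.Functor.ext (fun _ => rfl) (fun _ _ _ =>
    (X.proj.toFunctor.map_id E).trans (by simp; rfl)))
  cart E' f := inferInstanceAs (X.proj.toFunctor.IsStronglyCartesian (𝟙 (X.proj.toFunctor.obj E))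
    (𝟙 E))

/-- The `1`-morphism given by an object of the base. -/
def ofBase (A : X.base) : emptyFib ⟶ X where
  base := Functor.toCatHom ((Functor.const Pt.{u}).obj A)
  total := Functor.toCatHom { obj := nofun, map := fun {E} => nomatch E }
  comm := Cat.Hom.ext (CategoryTheory.Functor.ext (fun E => nomatch E) (fun E => nomatch E))
  cart E := nomatch E

/-- Families of morphisms indexed by the terminal category. -/
def pt_rec {C : Type u₁} [Category.{v₁} C] {F G : Pt.{u} → C} (θ : F .star ⟶ G .star) :
    ∀ A : Pt.{u}, F A ⟶ G A
  | .star => θ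

lemma pt_rec_nat {C : Type u₁} [Category.{v₁} C] (F G : Pt.{u} ⥤ C)
    (θ : F.obj .star ⟶ G.obj .star) {A A' : Pt.{u}} (f : A ⟶ A') :
    F.map f ≫ pt_rec (F := F.obj) (G := G.obj) θ A' =
      pt_rec (F := F.obj) (G := G.obj) θ A ≫ G.map f := by
  cases A
  cases A'
  rw [show f = 𝟙 Pt.star from rfl, F.map_id, G.map_id, Category.id_comp, Category.comp_id]

lemma eq_conj_eqToHom {C : Type u₁} [Category.{v₁} C] {X X' Y Y' : C} (h : X = X') (h' : Y = Y')
    (m : X ⟶ Y) : m ≫ eqToHom h' = eqToHom h ≫ eqToHom h.symm ≫ m ≫ eqToHom h' := by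
  simp

instance : (evT (W := point) X Pt.star).IsEquivalence where
  faithful := ⟨fun {F G a b} h => by
    have h1 : a.total = b.total := Cat.Hom₂.ext (NatTrans.ext (funext fun E => by
      cases E; exact h))
    refine hom₂_ext (Cat.Hom₂.ext (NatTrans.ext (funext fun A => ?_))) h1
    have ha := a.isLift A
    rw [h1] at ha
    exact isHomLift_unique _ _ ha (b.isLift A)⟩
  full := ⟨fun {F G} θ => by
    have hp (H : point ⟶ X) : X.proj.toFunctor.obj (H.total.toFunctor.obj Pt.star) =
      H.base.toFunctor.obj Pt.star := H.proj_obj Pt.star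
    refine ⟨hom₂Mk (pt_rec (eqToHom (hp F).symm ≫ X.proj.toFunctor.map θ ≫ eqToHom (hp G)))
      (pt_rec θ) (pt_rec_nat F.base.toFunctor G.base.toFunctor _)
      (pt_rec_nat F.total.toFunctor G.total.toFunctor _) ?_, rfl⟩
    rintro ⟨⟩
    exact (isHomLift_iff _ _ (hp F) (hp G)).2 (eq_conj_eqToHom (hp F) (hp G) _)⟩
  essSurj := ⟨fun E => ⟨ofTotal E, ⟨Iso.refl _⟩⟩⟩

instance : (evB (W := emptyFib) X Pt.star).IsEquivalence where
  faithful := ⟨fun {F G a b} h => hom₂_ext (Cat.Hom₂.ext (NatTrans.ext (funext fun A => by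
    cases A; exact h))) (Cat.Hom₂.ext (NatTrans.ext (funext fun E => nomatch E)))⟩
  full := ⟨fun {F G} θ => by
    exact ⟨hom₂Mk (pt_rec θ) (fun E => nomatch E)
      (pt_rec_nat F.base.toFunctor G.base.toFunctor _)
      (fun {E} => nomatch E) (fun E => nomatch E), rfl⟩⟩
  essSurj := ⟨fun A => ⟨ofBase A, ⟨Iso.refl _⟩⟩⟩

section NFold

variable {P f g : X ⟶ Z} {q : f ⟶ g} {n : ℕ} {π : Fin n → (P ⟶ f)}

lemma isNFoldPullback_of_ev
    (hb : ∀ A, IsNFoldPullback ((evB Z A).map q) (fun i => (evB Z A).map (π i)))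
    (ht : ∀ E, IsNFoldPullback ((evT Z E).map q) (fun i => (evT Z E).map (π i))) :
    IsNFoldPullback q π where
  comm i j := ev_ext (fun A => (hb A).comm i j) (fun E => (ht E).comm i j)
  exists_unique R h hh := by
    choose kb hkb using fun A => (hb A).exists_lift (fun i => (evB Z A).map (h i))
      (fun i j => congrArg (evB Z A).map (hh i j))
    choose kt hkt using fun E => (ht E).exists_lift (fun i => (evT Z E).map (h i))
      (fun i j => congrArg (evT Z E).map (hh i j))
    refine ⟨hom₂Mk kb kt
      (fun {A A'} m => (hb A').lift_comm (hkb A') (hkb A)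
        (fun i => (h i).base.toNatTrans.naturality m) (fun i => (π i).base.toNatTrans.naturality m))
      (fun {E E'} m => (ht E').lift_comm (hkt E') (hkt E)
        (fun i => (h i).total.toNatTrans.naturality m)
        (fun i => (π i).total.toNatTrans.naturality m))
      (fun E => (isHomLift_iff _ _ (R.proj_obj E) (P.proj_obj E)).2
        ((hb (X.proj.toFunctor.obj E)).lift_comm (hkb _)
        (fun i => (Z.proj.toFunctor.map_comp _ _).symm.trans
          (congrArg Z.proj.toFunctor.map (hkt E i)))
        (fun i => ((isHomLift_iff _ _ (R.proj_obj E) (f.proj_obj E)).1 ((h i).isLift E)).symm)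
        (fun i => ((isHomLift_iff _ _ (P.proj_obj E) (f.proj_obj E)).1
          ((π i).isLift E)).symm)).symm), fun i =>
      ev_ext (fun A => hkb A i) (fun E => hkt E i), fun k' hk' => ev_ext (fun A =>
      (hb A).hom_ext fun i => ?_) (fun E => (ht E).hom_ext fun i => ?_)⟩
    · exact ((evB Z A).map_comp _ _).symm.trans ((congrArg (evB Z A).map (hk' i)).trans
        (hkb A i).symm)
    · exact ((evT Z E).map_comp _ _).symm.trans ((congrArg (evT Z E).map (hk' i)).trans
        (hkt E i).symm)

lemma pointwise_nfold_iff :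
    (∀ (W : Fib.{v, u}) (h : W ⟶ X), IsNFoldPullback (h ◁ q) (fun i => h ◁ π i)) ↔
    (∀ A, IsNFoldPullback ((evB Z A).map q) (fun i => (evB Z A).map (π i))) ∧
    (∀ E, IsNFoldPullback ((evT Z E).map q) (fun i => (evT Z E).map (π i))) :=
  ⟨fun h => ⟨fun A => (h _ (ofBase A)).map_of_isEquivalence (evB (W := emptyFib) Z Pt.star),
    fun E => (h _ (ofTotal E)).map_of_isEquivalence (evT (W := point) Z Pt.star)⟩,
    fun h W k => isNFoldPullback_of_ev (fun A => h.1 (k.base.toFunctor.obj A))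
      (fun E => h.2 (k.total.toFunctor.obj E))⟩

end NFold

end Fib

section

variable {C : Type u₁} [Category.{v₁} C]

lemma isNFoldPullback_two {P E B : C} {a b : P ⟶ E} {q : E ⟶ B} (h : IsPullback a b q q) :
    IsNFoldPullback q ![a, b] where
  comm i j := by
    fin_cases i <;> fin_cases j
    exacts [rfl, h.w, h.w.symm, rfl]
  exists_unique W f hf := by
    refine ⟨h.lift (f 0) (f 1) (hf 0 1), fun i => ?_, fun k hk => h.hom_ext ?_ ?_⟩
    · fin_cases i
      exacts [h.lift_fst _ _ _, h.lift_snd _ _ _]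
    · exact (hk 0).trans (h.lift_fst _ _ _).symm
    · exact (hk 1).trans (h.lift_snd _ _ _).symm

lemma IsNFoldPullback.isPullback {P E B : C} {q : E ⟶ B} {π : Fin 2 → (P ⟶ E)}
    (h : IsNFoldPullback q π) : IsPullback (π 0) (π 1) q q := by
  have hc (s : Limits.PullbackCone q q) (i j : Fin 2) :
      ![s.fst, s.snd] i ≫ q = ![s.fst, s.snd] j ≫ q := by
    fin_cases i <;> fin_cases j
    exacts [rfl, s.condition, s.condition.symm, rfl]
  choose k hk using fun s : Limits.PullbackCone q q => h.exists_lift ![s.fst, s.snd] (hc s)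
  refine ⟨⟨h.comm 0 1⟩, ⟨Limits.PullbackCone.IsLimit.mk _ k (fun s => hk s 0) (fun s => hk s 1)
    fun s m h0 h1 => h.hom_ext fun i => ?_⟩⟩
  fin_cases i
  exacts [h0.trans (hk s 0).symm, h1.trans (hk s 1).symm]

lemma isPullback_lift_comm {P A B D P₀ A₀ B₀ R R₀ : C} {f : P ⟶ A} {g : P ⟶ B} {f' : A ⟶ D}
    {g' : B ⟶ D} (h : IsPullback f g f' g') {f₀ : P₀ ⟶ A₀} {g₀ : P₀ ⟶ B₀} {a : R ⟶ A} {b : R ⟶ B}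
    {a₀ : R₀ ⟶ A₀} {b₀ : R₀ ⟶ B₀} {k : R ⟶ P} {k₀ : R₀ ⟶ P₀} {r : R₀ ⟶ R} {p : P₀ ⟶ P}
    {m : A₀ ⟶ A} {m' : B₀ ⟶ B} (hf : k ≫ f = a) (hg : k ≫ g = b) (hf₀ : k₀ ≫ f₀ = a₀)
    (hg₀ : k₀ ≫ g₀ = b₀) (ha : r ≫ a = a₀ ≫ m) (hb : r ≫ b = b₀ ≫ m') (hpf : p ≫ f = f₀ ≫ m)
    (hpg : p ≫ g = g₀ ≫ m') : r ≫ k = k₀ ≫ p := by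
  apply h.hom_ext
  · rw [Category.assoc, Category.assoc, hf, ha, hpf, reassoc_of% hf₀]
  · rw [Category.assoc, Category.assoc, hg, hb, hpg, reassoc_of% hg₀]

lemma isPullback_comp_id_iff {P A B D : C} {f : P ⟶ A} {g : P ⟶ B} {f' : A ⟶ D}
    {g' : B ⟶ D} : IsPullback f g (f' ≫ 𝟙 D) g' ↔ IsPullback f g f' g' := by
  rw [Category.comp_id]

lemma isMorphism_comp_id_iff {D D' : BundleData C} {f : D.B ⟶ D'.B} {g : D.E ⟶ D'.E} :
    D.IsMorphism D' (f ≫ 𝟙 _) g ↔ D.IsMorphism D' f g := by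
  rw [Category.comp_id]

end

lemma unitors_naturality {K : Type u₁} [Bicategory.{w₁, v₁} K] {X Y : K} {f g : X ⟶ Y}
    (η : f ⟶ g) : 𝟙 X ◁ (η ▷ 𝟙 Y) ≫ (λ_ (g ≫ 𝟙 Y) ≪≫ ρ_ g).hom =
      (λ_ (f ≫ 𝟙 Y) ≪≫ ρ_ f).hom ≫ η := by
  rw [Iso.trans_hom, Iso.trans_hom, ← Category.assoc, leftUnitor_naturality, Category.assoc,
    rightUnitor_naturality, Category.assoc]

/-- In a tangent object the `n`-fold pullbacks of the projection are pointwise and preserved by the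
iterates of the tangent `1`-morphism. -/
lemma TangentData.IsTangent.pointwise {K : Type u₁} [Bicategory.{w₁, v₁} K] {X : K}
    {D : TangentData X} (h : D.IsTangent) {n : ℕ} (hn : 0 < n) {P : X ⟶ X}
    {π : Fin n → (P ⟶ D.T)} (hπ : IsNFoldPullback D.p π) (m : ℕ) (W : K) (k : W ⟶ X) :
    IsNFoldPullback (k ◁ (D.p ▷ iter D.T m)) (fun i => k ◁ (π i ▷ iter D.T m)) := by
  obtain ⟨Tn, ρ, hρ⟩ := h.nfold n hn
  have h1 : IsNFoldPullback D.p ρ := (hρ 0 X (𝟙 X)).of_iso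
    (λ_ _ ≪≫ ρ_ _) (λ_ _ ≪≫ ρ_ _) (λ_ _ ≪≫ ρ_ _) (unitors_naturality _)
    (fun i => unitors_naturality _)
  obtain ⟨e, he⟩ := h1.exists_iso hπ
  refine (hρ m W k).of_iso (Iso.refl _) (Iso.refl _) (whiskerLeftIso k (whiskerRightIso e _))
    (by simp) (fun i => ?_)
  rw [Iso.refl_hom, Category.comp_id, whiskerLeftIso_hom, whiskerRightIso_hom,
    ← whiskerLeft_comp, ← comp_whiskerRight, he]

namespace Fib

variable {X Y Z : Fib.{v, u}}

lemma isPullback_of_ev {P f f' g : X ⟶ Z} {a : P ⟶ f} {b : P ⟶ f'} {c : f ⟶ g} {d : f' ⟶ g}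
    (hb : ∀ A, IsPullback ((evB Z A).map a) ((evB Z A).map b) ((evB Z A).map c) ((evB Z A).map d))
    (ht : ∀ E, IsPullback ((evT Z E).map a) ((evT Z E).map b) ((evT Z E).map c)
      ((evT Z E).map d)) : IsPullback a b c d := by
  have key (s : Limits.PullbackCone c d) : ∃ k : s.pt ⟶ P, k ≫ a = s.fst ∧ k ≫ b = s.snd := by
    obtain ⟨R, h, h', w⟩ : ∃ (R : X ⟶ Z) (h : R ⟶ f) (h' : R ⟶ f'), h ≫ c = h' ≫ d :=
      ⟨s.pt, s.fst, s.snd, s.condition⟩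
    choose kb hkb using fun A => (hb A).exists_lift ((evB Z A).map s.fst) ((evB Z A).map s.snd)
      (congrArg (evB Z A).map s.condition)
    choose kt hkt using fun E => (ht E).exists_lift ((evT Z E).map s.fst) ((evT Z E).map s.snd)
      (congrArg (evT Z E).map s.condition)
    refine ⟨hom₂Mk kb kt
      (fun {A A'} m => isPullback_lift_comm (hb A') (hkb A').1 (hkb A').2 (hkb A).1 (hkb A).2
        (s.fst.base.toNatTrans.naturality m) (s.snd.base.toNatTrans.naturality m)
        (a.base.toNatTrans.naturality m) (b.base.toNatTrans.naturality m))
      (fun {A A'} m => isPullback_lift_comm (ht A') (hkt A').1 (hkt A').2 (hkt A).1 (hkt A).2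
        (s.fst.total.toNatTrans.naturality m) (s.snd.total.toNatTrans.naturality m)
        (a.total.toNatTrans.naturality m) (b.total.toNatTrans.naturality m))
      (fun E => (isHomLift_iff _ _ (s.pt.proj_obj E) (P.proj_obj E)).2
        (isPullback_lift_comm (hb (X.proj.toFunctor.obj E)) (hkb _).1 (hkb _).2
        ((Z.proj.toFunctor.map_comp _ _).symm.trans
          (congrArg Z.proj.toFunctor.map (hkt E).1))
        ((Z.proj.toFunctor.map_comp _ _).symm.trans
          (congrArg Z.proj.toFunctor.map (hkt E).2))
        ((isHomLift_iff _ _ (s.pt.proj_obj E) (f.proj_obj E)).1 (s.fst.isLift E)).symm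
        ((isHomLift_iff _ _ (s.pt.proj_obj E) (f'.proj_obj E)).1 (s.snd.isLift E)).symm
        ((isHomLift_iff _ _ (P.proj_obj E) (f.proj_obj E)).1 (a.isLift E)).symm
        ((isHomLift_iff _ _ (P.proj_obj E) (f'.proj_obj E)).1 (b.isLift E)).symm).symm),
      ev_ext (fun A => (hkb A).1) (fun E => (hkt E).1),
      ev_ext (fun A => (hkb A).2) (fun E => (hkt E).2)⟩
  choose k hk using key
  refine ⟨⟨ev_ext (fun A => (hb A).w) (fun E => (ht E).w)⟩,
    ⟨Limits.PullbackCone.IsLimit.mk _ k (fun s => (hk s).1) (fun s => (hk s).2)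
    fun s m h0 h1 => ev_ext (fun A => (hb A).hom_ext ?_ ?_) (fun E => (ht E).hom_ext ?_ ?_)⟩⟩
  · exact congrArg (evB Z A).map (h0.trans (hk s).1.symm)
  · exact congrArg (evB Z A).map (h1.trans (hk s).2.symm)
  · exact congrArg (evT Z E).map (h0.trans (hk s).1.symm)
  · exact congrArg (evT Z E).map (h1.trans (hk s).2.symm)

lemma pointwise_pullback_iff {P f f' g : X ⟶ Z} {a : P ⟶ f} {b : P ⟶ f'} {c : f ⟶ g} {d : f' ⟶ g} :
    (∀ (W : Fib.{v, u}) (h : W ⟶ X), IsPullback (h ◁ a) (h ◁ b) (h ◁ c) (h ◁ d)) ↔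
    (∀ A, IsPullback ((evB Z A).map a) ((evB Z A).map b) ((evB Z A).map c) ((evB Z A).map d)) ∧
    (∀ E, IsPullback ((evT Z E).map a) ((evT Z E).map b) ((evT Z E).map c) ((evT Z E).map d)) :=
  ⟨fun h => ⟨fun A => (h _ (ofBase A)).map (evB (W := emptyFib) Z Pt.star),
    fun E => (h _ (ofTotal E)).map (evT (W := point) Z Pt.star)⟩,
    fun h W k => isPullback_of_ev (fun A => h.1 (k.base.toFunctor.obj A))
      (fun E => h.2 (k.total.toFunctor.obj E))⟩

lemma isMorphism_iff_ev {D D' : BundleData (X ⟶ Z)} {f : D.B ⟶ D'.B} {g : D.E ⟶ D'.E}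
    (hD : D.π₁ ≫ D.q = D.π₂ ≫ D.q)
    (hb : ∀ A, IsPullback ((evB Z A).map D'.π₁) ((evB Z A).map D'.π₂) ((evB Z A).map D'.q)
      ((evB Z A).map D'.q))
    (ht : ∀ E, IsPullback ((evT Z E).map D'.π₁) ((evT Z E).map D'.π₂) ((evT Z E).map D'.q)
      ((evT Z E).map D'.q)) : D.IsMorphism D' f g ↔
    (∀ A, (D.map (evB Z A)).IsMorphism (D'.map (evB Z A)) ((evB Z A).map f) ((evB Z A).map g)) ∧
    (∀ E, (D.map (evT Z E)).IsMorphism (D'.map (evT Z E)) ((evT Z E).map f) ((evT Z E).map g)) := by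
  refine ⟨fun h => ⟨fun A => h.map _ hD (isPullback_of_ev hb ht) (hb A),
    fun E => h.map _ hD (isPullback_of_ev hb ht) (ht E)⟩, fun ⟨h, h'⟩ =>
    ⟨ev_ext (fun A => (h A).proj) (fun E => (h' E).proj),
    ev_ext (fun A => (h A).zero) (fun E => (h' E).zero), fun g₂ h1 h2 =>
    ev_ext (fun A => (h A).sum ((evB Z A).map g₂) ?_ ?_)
      (fun E => (h' E).sum ((evT Z E).map g₂) ?_ ?_)⟩⟩
  · exact congrArg (evB Z A).map h1
  · exact congrArg (evB Z A).map h2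
  · exact congrArg (evT Z E).map h1
  · exact congrArg (evT Z E).map h2

lemma isAdditive_of_ev {D : BundleData (X ⟶ Z)} (h : ∀ A, (D.map (evB Z A)).IsAdditive)
    (h' : ∀ E, (D.map (evT Z E)).IsAdditive)
    (hn : ∀ n : ℕ, 0 < n → ∃ (P : X ⟶ Z) (π : Fin n → (P ⟶ D.E)), IsNFoldPullback D.q π) :
    D.IsAdditive where
  zero_proj := ev_ext (fun A => (h A).zero_proj) (fun E => (h' E).zero_proj)
  isPullback := isPullback_of_ev (fun A => (h A).isPullback) (fun E => (h' E).isPullback)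
  nfold := hn
  sum_proj := ev_ext (fun A => (h A).sum_proj) (fun E => (h' E).sum_proj)
  assoc W ab bc ab_c a_bc h1 h2 h3 h4 h5 := ev_ext
    (fun A => (h A).assoc _ ((evB Z A).map ab) ((evB Z A).map bc) ((evB Z A).map ab_c)
      ((evB Z A).map a_bc) (congrArg (evB Z A).map h1) (congrArg (evB Z A).map h2)
      (congrArg (evB Z A).map h3) (congrArg (evB Z A).map h4) (congrArg (evB Z A).map h5))
    (fun E => (h' E).assoc _ ((evT Z E).map ab) ((evT Z E).map bc) ((evT Z E).map ab_c)
      ((evT Z E).map a_bc) (congrArg (evT Z E).map h1) (congrArg (evT Z E).map h2)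
      (congrArg (evT Z E).map h3) (congrArg (evT Z E).map h4) (congrArg (evT Z E).map h5))
  zero_sum a h1 h2 := ev_ext
    (fun A => (h A).zero_sum ((evB Z A).map a) (congrArg (evB Z A).map h1)
      (congrArg (evB Z A).map h2))
    (fun E => (h' E).zero_sum ((evT Z E).map a) (congrArg (evT Z E).map h1)
      (congrArg (evT Z E).map h2))
  sum_comm τ h1 h2 := ev_ext
    (fun A => (h A).sum_comm ((evB Z A).map τ) (congrArg (evB Z A).map h1)
      (congrArg (evB Z A).map h2))
    (fun E => (h' E).sum_comm ((evT Z E).map τ) (congrArg (evT Z E).map h1)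
      (congrArg (evT Z E).map h2))

end Fib

section

variable {C : Type u₁} [Category.{v₁} C]

lemma comp_comp_id_iff {X Y Z : C} {a : X ⟶ Y} {b : Y ⟶ Z} {w : X ⟶ Z} :
    a ≫ b ≫ 𝟙 Z = w ↔ a ≫ b = w := by simp

lemma comp_id_comp_iff {X Y Z : C} {a : X ⟶ Y} {b : Y ⟶ Z} {w : X ⟶ Z} :
    w = a ≫ 𝟙 Y ≫ b ↔ w = a ≫ b := by simp

lemma hexagon_iff {X : C} {a b c d e f : X ⟶ X} :
    a ≫ (𝟙 X ≫ b ≫ 𝟙 X) ≫ c = (𝟙 X ≫ d ≫ 𝟙 X) ≫ e ≫ (𝟙 X ≫ f ≫ 𝟙 X) ↔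
      a ≫ b ≫ c = d ≫ e ≫ f := by simp

lemma comp₃_iff {X Y Z U : C} {a : X ⟶ Y} {b : Y ⟶ Z} {c : Z ⟶ U} {w : X ⟶ U} :
    a ≫ 𝟙 Y ≫ b ≫ 𝟙 Z ≫ c ≫ 𝟙 U = w ↔ a ≫ b ≫ c = w := by simp

lemma comp₃_eq_iff {X Z U : C} {a : X ⟶ X} {b : X ⟶ Z} {c : Z ⟶ U} {w : U ⟶ U} :
    a ≫ 𝟙 X ≫ b ≫ 𝟙 Z ≫ c ≫ 𝟙 U = (𝟙 X ≫ b ≫ 𝟙 Z ≫ c ≫ 𝟙 U) ≫ w ↔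
      a ≫ b ≫ c = b ≫ c ≫ w := by simp

lemma IsNFoldPullback.map_of_map {C' : Type u₂} [Category.{v₂} C'] {F : C ⥤ C'} {E B P P' : C}
    {q : E ⟶ B} {n : ℕ} {π : Fin n → (P ⟶ E)} {ρ : Fin n → (P' ⟶ E)} (h : IsNFoldPullback q π)
    (h' : IsNFoldPullback q ρ) (hF : IsNFoldPullback (F.map q) (fun i => F.map (π i))) :
    IsNFoldPullback (F.map q) (fun i => F.map (ρ i)) := by
  obtain ⟨e, he⟩ := h.exists_iso h'
  exact hF.of_iso (Iso.refl _) (Iso.refl _) (F.mapIso e) (by simp)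
    (fun i => by simp [← F.map_comp, he])

lemma isPullback_map_comp_iff {C' : Type u₂} [Category.{v₂} C'] (F : C ⥤ C') {P A B D : C}
    {f : P ⟶ A} {g : P ⟶ B} {f' : A ⟶ D} {g' : B ⟶ D} :
    IsPullback (F.map f) (F.map g) (F.map (f' ≫ 𝟙 D)) (F.map g') ↔
      IsPullback (F.map f) (F.map g) (F.map f') (F.map g') := by
  rw [Category.comp_id]

end

namespace TangentData

section Cat

variable {X : Cat.{v, u}} {D : TangentData X}

lemma IsTangentCategory.nfold_iter (h : D.IsTangentCategory) {n : ℕ} (hn : 0 < n) {A P : X}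
    {π : Fin n → (P ⟶ (D.bundleAt A).E)} (hπ : IsNFoldPullback (D.bundleAt A).q π) (m : ℕ) :
    IsNFoldPullback ((iter D.T m).toFunctor.map (D.bundleAt A).q)
      (fun i => (iter D.T m).toFunctor.map (π i)) := by
  obtain ⟨P', ρ, hρ⟩ := h.nfold n hn A
  exact IsNFoldPullback.map_of_map (hρ 0) hπ (hρ m)

lemma IsTangentCategory.isPullback_map (h : D.IsTangentCategory) (A : X) :
    IsPullback (D.T.toFunctor.map (D.bundleAt A).π₁) (D.T.toFunctor.map (D.bundleAt A).π₂)
      (D.T.toFunctor.map (D.bundleAt A).q) (D.T.toFunctor.map (D.bundleAt A).q) :=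
  (h.nfold_iter Nat.two_pos (isNFoldPullback_two (h.additive A).isPullback) 1).isPullback

lemma IsTangentCategory.isLiftPairAt_unique (h : D.IsTangentCategory) {A : X}
    {v w : (D.bundleAt A).E₂ ⟶ D.T.toFunctor.obj (D.bundleAt A).E₂} (hv : D.IsLiftPairAt A v)
    (hw : D.IsLiftPairAt A w) : v = w :=
  (h.isPullback_map A).hom_ext (hv.1.trans hw.1.symm) (hv.2.trans hw.2.symm)

end Cat

variable {X Y : Fib.{v, u}}

/-- The tangent data of the base category. -/
def fibBase (D : TangentData X) : TangentData X.base :=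
  ⟨D.T.base, D.T₂.base, D.p.base, D.z.base, D.π₁.base, D.π₂.base, D.s.base, D.l.base, D.c.base⟩

/-- The tangent data of the total category. -/
def fibTotal (D : TangentData X) : TangentData X.total :=
  ⟨D.T.total, D.T₂.total, D.p.total, D.z.total, D.π₁.total, D.π₂.total, D.s.total, D.l.total,
    D.c.total⟩

lemma iter_total (T : X ⟶ X) (m : ℕ) : (iter T m).total = iter T.total m := by
  induction m with
  | zero => rfl
  | succ m ih => exact congrArg (· ≫ T.total) ih

lemma IsTangent.nfold_total {D : TangentData X} (h : D.IsTangent) {n : ℕ} (hn : 0 < n) {P : X ⟶ X}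
    {π : Fin n → (P ⟶ D.T)} (hπ : IsNFoldPullback D.p π) (m : ℕ) (E : X.total) :
    IsNFoldPullback ((iter D.T.total m).toFunctor.map ((Fib.evT X E).map D.p))
      (fun i => (iter D.T.total m).toFunctor.map ((Fib.evT X E).map (π i))) := by
  rw [← iter_total]
  exact (Fib.pointwise_nfold_iff.1 (fun W k => h.pointwise hn hπ m W k)).2 E

lemma IsTangent.isPullback_total {D : TangentData X} (h : D.IsTangent) (m : ℕ) (E : X.total) :
    IsPullback ((iter D.T.total m).toFunctor.map ((Fib.evT X E).map D.π₁))
      ((iter D.T.total m).toFunctor.map ((Fib.evT X E).map D.π₂))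
      ((iter D.T.total m).toFunctor.map ((Fib.evT X E).map D.p))
      ((iter D.T.total m).toFunctor.map ((Fib.evT X E).map D.p)) :=
  (h.nfold_total Nat.two_pos (isNFoldPullback_two h.additive.isPullback) m E).isPullback

lemma iter_base (T : X ⟶ X) (m : ℕ) : (iter T m).base = iter T.base m := by
  induction m with
  | zero => rfl
  | succ m ih => exact congrArg (· ≫ T.base) ih

lemma IsTangent.nfold_base {D : TangentData X} (h : D.IsTangent) {n : ℕ} (hn : 0 < n) {P : X ⟶ X}
    {π : Fin n → (P ⟶ D.T)} (hπ : IsNFoldPullback D.p π) (m : ℕ) (A : X.base) :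
    IsNFoldPullback ((iter D.T.base m).toFunctor.map ((Fib.evB X A).map D.p))
      (fun i => (iter D.T.base m).toFunctor.map ((Fib.evB X A).map (π i))) := by
  rw [← iter_base]
  exact (Fib.pointwise_nfold_iff.1 (fun W k => h.pointwise hn hπ m W k)).1 A

lemma IsTangent.isPullback_base {D : TangentData X} (h : D.IsTangent) (m : ℕ) (A : X.base) :
    IsPullback ((iter D.T.base m).toFunctor.map ((Fib.evB X A).map D.π₁))
      ((iter D.T.base m).toFunctor.map ((Fib.evB X A).map D.π₂))
      ((iter D.T.base m).toFunctor.map ((Fib.evB X A).map D.p))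
      ((iter D.T.base m).toFunctor.map ((Fib.evB X A).map D.p)) :=
  (h.nfold_base Nat.two_pos (isNFoldPullback_two h.additive.isPullback) m A).isPullback

lemma IsTangent.lift_ev {D : TangentData X} (h : D.IsTangent) :
    (∀ A, (D.bundle.map (Fib.evB X A)).IsMorphism
      ((D.bundle.map (postcomp X D.T)).map (Fib.evB X A))
      ((Fib.evB X A).map (D.z ≫ (λ_ D.T).inv)) ((Fib.evB X A).map D.l)) ∧
    (∀ E, (D.bundle.map (Fib.evT X E)).IsMorphism
      ((D.bundle.map (postcomp X D.T)).map (Fib.evT X E))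
      ((Fib.evT X E).map (D.z ≫ (λ_ D.T).inv)) ((Fib.evT X E).map D.l)) :=
  (Fib.isMorphism_iff_ev (D' := D.bundle.map (postcomp X D.T)) h.additive.isPullback.w (h.isPullback_base 1)
    (h.isPullback_total 1)).1 h.lift_additive

lemma IsTangent.flip_ev {D : TangentData X} (h : D.IsTangent) :
    (∀ A, ((D.bundle.map (postcomp X D.T)).map (Fib.evB X A)).IsMorphism
      ((D.bundle.map (precomp X D.T)).map (Fib.evB X A))
      ((Fib.evB X A).map ((λ_ D.T).hom ≫ (ρ_ D.T).inv)) ((Fib.evB X A).map D.c)) ∧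
    (∀ E, ((D.bundle.map (postcomp X D.T)).map (Fib.evT X E)).IsMorphism
      ((D.bundle.map (precomp X D.T)).map (Fib.evT X E))
      ((Fib.evT X E).map ((λ_ D.T).hom ≫ (ρ_ D.T).inv)) ((Fib.evT X E).map D.c)) :=
  (Fib.isMorphism_iff_ev (D := D.bundle.map (postcomp X D.T))
    (D' := D.bundle.map (precomp X D.T)) (((postcomp X D.T).map_comp _ _).symm.trans
    ((congrArg (postcomp X D.T).map h.additive.isPullback.w).trans
      ((postcomp X D.T).map_comp _ _)))
    (fun A => h.isPullback_base 0 (D.T.base.toFunctor.obj A))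
    (fun E => h.isPullback_total 0 (D.T.total.toFunctor.obj E))).1 h.flip_additive

lemma IsLiftPair.total {D : TangentData X} {v : D.T₂ ⟶ D.T₂ ≫ D.T} (h : D.IsLiftPair v)
    (E : X.total) : D.fibTotal.IsLiftPairAt E ((Fib.evT X E).map v) :=
  ⟨congrArg (Fib.evT X E).map h.1, comp_id_comp_iff.1 (congrArg (Fib.evT X E).map h.2)⟩

/-- The total category of a tangent object in cloven fibrations is a tangent category. -/
lemma IsTangent.total {D : TangentData X} (h : D.IsTangent) : D.fibTotal.IsTangentCategory where
  additive E := h.additive.map (Fib.evT X E) (h.isPullback_total 0 E)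
    (fun n hn P π hπ => ⟨P, π, hπ, h.nfold_total hn hπ 0 E⟩)
  nfold n hn E := by
    obtain ⟨P, π, hπ⟩ := h.additive.nfold n hn
    exact ⟨P.total.toFunctor.obj E, fun i => (Fib.evT X E).map (π i),
      fun m => h.nfold_total hn hπ m E⟩
  lift_additive E := isMorphism_comp_id_iff.1 (h.lift_ev.2 E)
  flip_additive E := isMorphism_comp_id_iff.1 (h.flip_ev.2 E)
  lift_coassoc E := comp_comp_id_iff.1 (congrArg (Fib.evT X E).map h.lift_coassoc)
  flip_flip E := congrArg (Fib.evT X E).map h.flip_flip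
  yang_baxter E := hexagon_iff.1 (congrArg (Fib.evT X E).map h.yang_baxter)
  lift_flip E := congrArg (Fib.evT X E).map h.lift_flip
  lift_flip_flip E := comp₃_iff.1 (congrArg (Fib.evT X E).map h.lift_flip_flip)
  lift_universal E := by
    obtain ⟨v, hv, hu⟩ := h.lift_universal
    exact ⟨(Fib.evT X E).map v, hv.total E,
      isPullback_comp_id_iff.1 ((Fib.pointwise_pullback_iff.1 hu).2 E)⟩

lemma IsLiftPair.base {D : TangentData X} {v : D.T₂ ⟶ D.T₂ ≫ D.T} (h : D.IsLiftPair v)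
    (A : X.base) : D.fibBase.IsLiftPairAt A ((Fib.evB X A).map v) :=
  ⟨congrArg (Fib.evB X A).map h.1, comp_id_comp_iff.1 (congrArg (Fib.evB X A).map h.2)⟩

/-- The base category of a tangent object in cloven fibrations is a tangent category. -/
lemma IsTangent.base {D : TangentData X} (h : D.IsTangent) : D.fibBase.IsTangentCategory where
  additive A := h.additive.map (Fib.evB X A) (h.isPullback_base 0 A)
    (fun n hn P π hπ => ⟨P, π, hπ, h.nfold_base hn hπ 0 A⟩)
  nfold n hn A := by
    obtain ⟨P, π, hπ⟩ := h.additive.nfold n hn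
    exact ⟨P.base.toFunctor.obj A, fun i => (Fib.evB X A).map (π i),
      fun m => h.nfold_base hn hπ m A⟩
  lift_additive A := isMorphism_comp_id_iff.1 (h.lift_ev.1 A)
  flip_additive A := isMorphism_comp_id_iff.1 (h.flip_ev.1 A)
  lift_coassoc A := comp_comp_id_iff.1 (congrArg (Fib.evB X A).map h.lift_coassoc)
  flip_flip A := congrArg (Fib.evB X A).map h.flip_flip
  yang_baxter A := hexagon_iff.1 (congrArg (Fib.evB X A).map h.yang_baxter)
  lift_flip A := congrArg (Fib.evB X A).map h.lift_flip
  lift_flip_flip A := comp₃_iff.1 (congrArg (Fib.evB X A).map h.lift_flip_flip)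
  lift_universal A := by
    obtain ⟨v, hv, hu⟩ := h.lift_universal
    exact ⟨(Fib.evB X A).map v, hv.base A,
      isPullback_comp_id_iff.1 ((Fib.pointwise_pullback_iff.1 hu).1 A)⟩

end TangentData

lemma Fib.inv_square {C : Type u₁} [Category.{v₁} C] {A B A' B' : C} {b : A ⟶ B} {b' : B ⟶ A}
    {t : A' ⟶ B'} {t' : B' ⟶ A'} {p : A' ⟶ A} {q : B' ⟶ B} (hb : b ≫ b' = 𝟙 A)
    (ht : t' ≫ t = 𝟙 B') (h : t ≫ q = p ≫ b) : t' ≫ p = q ≫ b' := by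
  have h1 : t' ≫ p ≫ b ≫ b' = t' ≫ t ≫ q ≫ b' := by rw [reassoc_of% h]
  rwa [hb, Category.comp_id, reassoc_of% ht] at h1

namespace TangentData

variable {X Y : Fib.{v, u}}

lemma isPullback_postcomp {D : TangentData X} (hb : D.fibBase.IsTangentCategory)
    (ht : D.fibTotal.IsTangentCategory) :
    IsPullback (D.π₁ ▷ D.T) (D.π₂ ▷ D.T) (D.p ▷ D.T) (D.p ▷ D.T) :=
  Fib.isPullback_of_ev hb.isPullback_map ht.isPullback_map

lemma exists_isLiftPair {D : TangentData X} (hb : D.fibBase.IsTangentCategory)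
    (ht : D.fibTotal.IsTangentCategory) : ∃ v, D.IsLiftPair v := by
  have key {C : Type u} [Category.{v} C] {P E B Q Z : C} {a b : P ⟶ E} {q : E ⟶ B} {k : Z ⟶ P}
      {c : Z ⟶ E} {d' : Z ⟶ Q} {d'' : Q ⟶ E} (h : a ≫ q = b ≫ q) (h1 : k ≫ a = c)
      (h2 : k ≫ b = d' ≫ d'') : c ≫ q = (d' ≫ 𝟙 Q ≫ d'') ≫ q := by
    rw [Category.id_comp, ← h1, ← h2, Category.assoc, h, Category.assoc]
  obtain ⟨v, hv⟩ := (isPullback_postcomp hb ht).exists_lift (D.π₁ ≫ D.l)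
    (D.π₂ ≫ (ρ_ D.T).inv ≫ D.T ◁ D.z) (Fib.ev_ext (fun A => by
      obtain ⟨v, hv, -⟩ := hb.lift_universal A
      exact key (hb.isPullback_map A).w hv.1 hv.2) (fun E => by
      obtain ⟨v, hv, -⟩ := ht.lift_universal E
      exact key (ht.isPullback_map E).w hv.1 hv.2))
  exact ⟨v, hv⟩

/-- A tangent structure on a cloven fibration from tangent structures on its base and total
categories. -/
lemma isTangent_of_fib {D : TangentData X} (hb : D.fibBase.IsTangentCategory)
    (ht : D.fibTotal.IsTangentCategory)
    (hn : ∀ n : ℕ, 0 < n → ∃ (P : X ⟶ X) (π : Fin n → (P ⟶ D.T)),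
      (∀ A, IsNFoldPullback ((Fib.evB X A).map D.p) (fun i => (Fib.evB X A).map (π i))) ∧
      ∀ E, IsNFoldPullback ((Fib.evT X E).map D.p) (fun i => (Fib.evT X E).map (π i))) :
    D.IsTangent where
  additive := Fib.isAdditive_of_ev hb.additive ht.additive (fun n hn' => by
    obtain ⟨P, π, h, h'⟩ := hn n hn'
    exact ⟨P, π, Fib.isNFoldPullback_of_ev h h'⟩)
  nfold n hn' := by
    obtain ⟨P, π, h, h'⟩ := hn n hn'
    refine ⟨P, π, fun m => Fib.pointwise_nfold_iff.2 ⟨fun A => ?_, fun E => ?_⟩⟩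
    · have := hb.nfold_iter hn' (h A) m
      rwa [← show (iter D.T m).base = iter D.fibBase.T m from iter_base D.T m] at this
    · have := ht.nfold_iter hn' (h' E) m
      rwa [← show (iter D.T m).total = iter D.fibTotal.T m from iter_total D.T m] at this
  lift_additive := (Fib.isMorphism_iff_ev (D := D.bundle) (D' := D.bundle.map (postcomp X D.T))
    (Fib.ev_ext (fun A => (hb.additive A).isPullback.w) (fun E => (ht.additive E).isPullback.w))
    hb.isPullback_map ht.isPullback_map).2 ⟨fun A => isMorphism_comp_id_iff.2 (hb.lift_additive A),
      fun E => isMorphism_comp_id_iff.2 (ht.lift_additive E)⟩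
  flip_additive := (Fib.isMorphism_iff_ev (D := D.bundle.map (postcomp X D.T))
    (D' := D.bundle.map (precomp X D.T)) (isPullback_postcomp hb ht).w
    (fun A => (hb.additive (D.T.base.toFunctor.obj A)).isPullback)
    (fun E => (ht.additive (D.T.total.toFunctor.obj E)).isPullback)).2
    ⟨fun A => isMorphism_comp_id_iff.2 (hb.flip_additive A),
      fun E => isMorphism_comp_id_iff.2 (ht.flip_additive E)⟩
  lift_coassoc := Fib.ev_ext (fun A => comp_comp_id_iff.2 (hb.lift_coassoc A))
    (fun E => comp_comp_id_iff.2 (ht.lift_coassoc E))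
  flip_flip := Fib.ev_ext hb.flip_flip ht.flip_flip
  yang_baxter := Fib.ev_ext (fun A => hexagon_iff.2 (hb.yang_baxter A))
    (fun E => hexagon_iff.2 (ht.yang_baxter E))
  lift_flip := Fib.ev_ext hb.lift_flip ht.lift_flip
  lift_flip_flip := Fib.ev_ext (fun A => comp₃_iff.2 (hb.lift_flip_flip A))
    (fun E => comp₃_iff.2 (ht.lift_flip_flip E))
  lift_universal := by
    obtain ⟨v, hv⟩ := exists_isLiftPair hb ht
    refine ⟨v, hv, Fib.pointwise_pullback_iff.2 ⟨fun A => isPullback_comp_id_iff.2 ?_,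
      fun E => isPullback_comp_id_iff.2 ?_⟩⟩
    · obtain ⟨w, hw, h⟩ := hb.lift_universal A
      obtain rfl := hb.isLiftPairAt_unique hw (hv.base A)
      exact h
    · obtain ⟨w, hw, h⟩ := ht.lift_universal E
      obtain rfl := ht.isLiftPairAt_unique hw (hv.total E)
      exact h

variable {D : TangentData X} {D' : TangentData Y}

/-- Lax morphisms of tangent objects in cloven fibrations are pairs of lax tangent morphisms. -/
lemma isLax_iff_fib (h : D.IsTangent) (h' : D'.IsTangent) {F : X ⟶ Y} {law : D.T ≫ F ⟶ F ≫ D'.T} :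
    D.IsLax D' F law ↔ D.fibBase.IsLaxFunctor D'.fibBase F.base law.base ∧
      D.fibTotal.IsLaxFunctor D'.fibTotal F.total law.total := by
  have key := Fib.isMorphism_iff_ev (D := D.bundle.map (postcomp X F))
    (D' := D'.bundle.map (precomp Y F)) (f := (λ_ F).hom ≫ (ρ_ F).inv) (g := law)
    (((postcomp X F).map_comp _ _).symm.trans
      ((congrArg (postcomp X F).map h.additive.isPullback.w).trans
      ((postcomp X F).map_comp _ _))) (fun A => (h'.base.additive _).isPullback)
      (fun E => (h'.total.additive _).isPullback)
  refine ⟨fun hl => ?_, fun ⟨hb, ht⟩ => ?_⟩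
  · obtain ⟨hb, ht⟩ := key.1 hl.additive
    exact ⟨⟨fun A => (isMorphism_comp_id_iff (D := (D.fibBase.bundleAt A).map F.base.toFunctor)
        (D' := D'.fibBase.bundleAt (F.base.toFunctor.obj A)) (f := 𝟙 (F.base.toFunctor.obj A))).1 (hb A),
      fun A => comp₃_iff.1 (congrArg (Fib.evB Y A).map hl.lift),
      fun A => comp₃_eq_iff.1 (congrArg (Fib.evB Y A).map hl.flip)⟩,
      ⟨fun E => (isMorphism_comp_id_iff (D := (D.fibTotal.bundleAt E).map F.total.toFunctor)
        (D' := D'.fibTotal.bundleAt (F.total.toFunctor.obj E)) (f := 𝟙 (F.total.toFunctor.obj E))).1 (ht E),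
      fun E => comp₃_iff.1 (congrArg (Fib.evT Y E).map hl.lift),
      fun E => comp₃_eq_iff.1 (congrArg (Fib.evT Y E).map hl.flip)⟩⟩
  · exact ⟨key.2 ⟨fun A => isMorphism_comp_id_iff.2 (hb.additive A),
      fun E => isMorphism_comp_id_iff.2 (ht.additive E)⟩,
      Fib.ev_ext (fun A => comp₃_iff.2 (hb.lift A)) (fun E => comp₃_iff.2 (ht.lift E)),
      Fib.ev_ext (fun A => comp₃_eq_iff.2 (hb.flip A)) (fun E => comp₃_eq_iff.2 (ht.flip E))⟩

/-- Colax morphisms of tangent objects in cloven fibrations are pairs of colax tangent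
morphisms. -/
lemma isColax_iff_fib (h : D.IsTangent) (h' : D'.IsTangent) {F : X ⟶ Y}
    {law : F ≫ D'.T ⟶ D.T ≫ F} :
    D.IsColax D' F law ↔ D.fibBase.IsColaxFunctor D'.fibBase F.base law.base ∧
      D.fibTotal.IsColaxFunctor D'.fibTotal F.total law.total := by
  have key (hb : ∀ A, IsPullback ((Fib.evB Y A).map (D.π₁ ▷ F)) ((Fib.evB Y A).map (D.π₂ ▷ F))
      ((Fib.evB Y A).map (D.p ▷ F)) ((Fib.evB Y A).map (D.p ▷ F)))
      (ht : ∀ E, IsPullback ((Fib.evT Y E).map (D.π₁ ▷ F)) ((Fib.evT Y E).map (D.π₂ ▷ F))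
      ((Fib.evT Y E).map (D.p ▷ F)) ((Fib.evT Y E).map (D.p ▷ F))) :=
    Fib.isMorphism_iff_ev (D := D'.bundle.map (precomp Y F))
    (D' := D.bundle.map (postcomp X F)) (f := (ρ_ F).hom ≫ (λ_ F).inv) (g := law)
    (((precomp Y F).map_comp _ _).symm.trans
      ((congrArg (precomp Y F).map h'.additive.isPullback.w).trans
      ((precomp Y F).map_comp _ _))) hb ht
  have h2 := isNFoldPullback_two h.additive.isPullback
  refine ⟨fun hl => ?_, fun ⟨hb, ht⟩ => ?_⟩
  · have hn := fun (n : ℕ) hn P π hπ => Fib.pointwise_nfold_iff.1 (hl.nfold n hn P π hπ)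
    obtain ⟨hb, ht⟩ := (key (fun A => ((hn 2 Nat.two_pos _ _ h2).1 A).isPullback)
      (fun E => ((hn 2 Nat.two_pos _ _ h2).2 E).isPullback)).1 hl.additive
    obtain ⟨v, hv, -⟩ := h.lift_universal
    have hu := Fib.pointwise_pullback_iff.1 (hl.lift_universal v hv)
    refine ⟨⟨fun A => (isMorphism_comp_id_iff (D := D'.fibBase.bundleAt (F.base.toFunctor.obj A))
        (D' := (D.fibBase.bundleAt A).map F.base.toFunctor) (f := 𝟙 (F.base.toFunctor.obj A))).1 (hb A),
      fun A => comp₃_iff.1 (congrArg (Fib.evB Y A).map hl.lift),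
      fun A => comp₃_eq_iff.1 (congrArg (Fib.evB Y A).map hl.flip),
      fun n hn' A P π hπ => ?_, fun A w hw => ?_⟩,
      ⟨fun E => (isMorphism_comp_id_iff (D := D'.fibTotal.bundleAt (F.total.toFunctor.obj E))
        (D' := (D.fibTotal.bundleAt E).map F.total.toFunctor) (f := 𝟙 (F.total.toFunctor.obj E))).1 (ht E),
      fun E => comp₃_iff.1 (congrArg (Fib.evT Y E).map hl.lift),
      fun E => comp₃_eq_iff.1 (congrArg (Fib.evT Y E).map hl.flip),
      fun n hn' E P π hπ => ?_, fun E w hw => ?_⟩⟩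
    · obtain ⟨Tn, ρ, hρ⟩ := h.additive.nfold n hn'
      exact IsNFoldPullback.map_of_map (h.nfold_base hn' hρ 0 A) hπ ((hn n hn' _ _ hρ).1 A)
    · obtain rfl := h.base.isLiftPairAt_unique (hv.base A) hw
      exact (isPullback_map_comp_iff F.base.toFunctor).1 (hu.1 A)
    · obtain ⟨Tn, ρ, hρ⟩ := h.additive.nfold n hn'
      exact IsNFoldPullback.map_of_map (h.nfold_total hn' hρ 0 E) hπ ((hn n hn' _ _ hρ).2 E)
    · obtain rfl := h.total.isLiftPairAt_unique (hv.total E) hw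
      exact (isPullback_map_comp_iff F.total.toFunctor).1 (hu.2 E)
  · refine ⟨(key (fun A => (hb.nfold 2 Nat.two_pos _ _ _ (h.nfold_base Nat.two_pos h2 0 A)).isPullback)
      (fun E => (ht.nfold 2 Nat.two_pos _ _ _ (h.nfold_total Nat.two_pos h2 0 E)).isPullback)).2
      ⟨fun A => isMorphism_comp_id_iff.2 (hb.additive A),
      fun E => isMorphism_comp_id_iff.2 (ht.additive E)⟩,
      Fib.ev_ext (fun A => comp₃_iff.2 (hb.lift A)) (fun E => comp₃_iff.2 (ht.lift E)),
      Fib.ev_ext (fun A => comp₃_eq_iff.2 (hb.flip A)) (fun E => comp₃_eq_iff.2 (ht.flip E)),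
      fun n hn' Tn π hπ => Fib.pointwise_nfold_iff.2
        ⟨fun A => hb.nfold n hn' A _ _ (h.nfold_base hn' hπ 0 A),
        fun E => ht.nfold n hn' E _ _ (h.nfold_total hn' hπ 0 E)⟩,
      fun v hv => Fib.pointwise_pullback_iff.2
        ⟨fun A => (isPullback_map_comp_iff F.base.toFunctor).2 (hb.lift_universal A _ (hv.base A)),
        fun E => (isPullback_map_comp_iff F.total.toFunctor).2
          (ht.lift_universal E _ (hv.total E))⟩⟩

/-- Strong morphisms of tangent objects in cloven fibrations are pairs of strong tangent
morphisms. -/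
lemma isStrong_iff_fib (h : D.IsTangent) (h' : D'.IsTangent) {F : X ⟶ Y}
    {law : D.T ≫ F ⟶ F ≫ D'.T} :
    D.IsStrong D' F law ↔ D.fibBase.IsStrongFunctor D'.fibBase F.base law.base ∧
      D.fibTotal.IsStrongFunctor D'.fibTotal F.total law.total := by
  constructor
  · rintro ⟨e, rfl, he⟩
    obtain ⟨hb, ht⟩ := (isColax_iff_fib h h').1 he
    exact ⟨⟨⟨e.hom.base, e.inv.base, congrArg Fib.Hom₂.base e.hom_inv_id,
      congrArg Fib.Hom₂.base e.inv_hom_id⟩, rfl, hb⟩,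
      ⟨⟨e.hom.total, e.inv.total, congrArg Fib.Hom₂.total e.hom_inv_id,
      congrArg Fib.Hom₂.total e.inv_hom_id⟩, rfl, ht⟩⟩
  · rintro ⟨⟨b, hb, hb'⟩, ⟨t, ht, ht'⟩⟩
    have hl (E : X.total) := law.isLift E
    rw [← hb, ← ht] at hl
    refine ⟨Fib.isoMk b t hl (fun E => ?_), Fib.hom₂_ext hb ht, (isColax_iff_fib h h').2 ⟨hb', ht'⟩⟩
    have h1 := (Fib.isHomLift_iff _ _ ((D.T ≫ F).proj_obj E) ((F ≫ D'.T).proj_obj E)).1 (hl E)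
    refine (Fib.isHomLift_iff _ _ ((F ≫ D'.T).proj_obj E) ((D.T ≫ F).proj_obj E)).2 ?_
    exact Fib.inv_square (Cat.Hom.hom_inv_id_toNatTrans_app b _)
      ((Y.proj.toFunctor.map_comp _ _).symm.trans ((congrArg Y.proj.toFunctor.map
        (Cat.Hom.inv_hom_id_toNatTrans_app t E)).trans (Y.proj.toFunctor.map_id _))) h1

/-- Strict morphisms of tangent objects in cloven fibrations are pairs of strict tangent
morphisms. -/
lemma isStrict_iff_fib (h : D.IsTangent) (h' : D'.IsTangent) {F : X ⟶ Y}
    {law : D.T ≫ F ⟶ F ≫ D'.T} :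
    D.IsStrict D' F law ↔ D.fibBase.IsStrictFunctor D'.fibBase F.base law.base ∧
      D.fibTotal.IsStrictFunctor D'.fibTotal F.total law.total := by
  constructor
  · rintro ⟨e, rfl, he⟩
    obtain ⟨hb, ht⟩ := (isColax_iff_fib h h').1 he
    exact ⟨⟨congrArg Fib.Hom.base e, Fib.eqToHom_base e, Fib.eqToHom_base e.symm ▸ hb⟩,
      ⟨congrArg Fib.Hom.total e, Fib.eqToHom_total e, Fib.eqToHom_total e.symm ▸ ht⟩⟩
  · rintro ⟨⟨b, hb, hb'⟩, ⟨t, ht, ht'⟩⟩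
    have e : D.T ≫ F = F ≫ D'.T := Fib.Hom.ext b t
    refine ⟨e, Fib.hom₂_ext (hb.trans (Fib.eqToHom_base e).symm)
      (ht.trans (Fib.eqToHom_total e).symm), (isColax_iff_fib h h').2 ⟨?_, ?_⟩⟩
    · exact (Fib.eqToHom_base e.symm).symm ▸ hb'
    · exact (Fib.eqToHom_total e.symm).symm ▸ ht'

end TangentData

lemma eqToHom_square {C : Type u₁} [Category.{v₁} C] {X X' Y Y' : C} {x : X ⟶ Y} {y : X' ⟶ Y'}
    {e : X = X'} {e' : Y = Y'} (h : x ≫ eqToHom e' = eqToHom e ≫ y) :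
    y ≫ eqToHom e'.symm = eqToHom e.symm ≫ x := by
  subst e e'
  simpa using h.symm

lemma eqToIso_square {C : Type u₁} [Category.{v₁} C] {X X' Y Y' : C} {x : X ⟶ Y} {y : X' ⟶ Y'}
    {e : X = X'} {e' : Y = Y'} (h : x ≫ eqToHom e' = eqToHom e ≫ y) :
    y ≫ (eqToIso e'.symm).hom = (eqToIso e.symm).hom ≫ x :=
  eqToHom_square h

/-- An isomorphism of additive bundles is a morphism. -/
lemma BundleData.Iso.isMorphism {C : Type u₁} [Category.{v₁} C] {D D' : BundleData C}
    (i : D.Iso D') (h : D'.IsAdditive) : D.IsMorphism D' i.b.hom i.e.hom where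
  proj := i.hq.symm
  zero := i.hz
  sum g₂ h1 h2 := by
    rw [h.isPullback.hom_ext (h1.trans i.h₁) (h2.trans i.h₂)]
    exact i.hs

lemma Fib.Hom₂.proj_map {X Z : Fib.{v, u}} {F G : X ⟶ Z} (a : F ⟶ G) (E : X.total) :
    Z.proj.toFunctor.map (a.total.toNatTrans.app E) ≫ eqToHom (G.proj_obj E) =
      eqToHom (F.proj_obj E) ≫ a.base.toNatTrans.app (X.proj.toFunctor.obj E) :=
  (Fib.isHomLift_iff _ _ (F.proj_obj E) (G.proj_obj E)).1 (a.isLift E)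

namespace TangentData

variable {X : Fib.{v, u}} {D : TangentData X}

/-- The projection identifies the additive bundles of the total category with those of the base. -/
def projBundleIso (D : TangentData X) (E : X.total) :
    (D.fibBase.bundleAt (X.proj.toFunctor.obj E)).Iso
      ((D.fibTotal.bundleAt E).map X.proj.toFunctor) where
  b := Iso.refl _
  e := eqToIso (D.T.proj_obj E).symm
  e₂ := eqToIso (D.T₂.proj_obj E).symm
  hq := eqToIso_square (e' := rfl) (D.p.proj_map E)
  hz := eqToIso_square (e := rfl) (D.z.proj_map E)
  h₁ := eqToIso_square (D.π₁.proj_map E)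
  h₂ := eqToIso_square (D.π₂.proj_map E)
  hs := eqToIso_square (D.s.proj_map E)

lemma colaxAt_eqToHom {X Y : Cat.{v, u}} (D : TangentData X) (D' : TangentData Y) {F : X ⟶ Y}
    (h : F ≫ D'.T = D.T ≫ F) (A : X) : colaxAt D D' (eqToHom h) A =
      eqToHom (Functor.congr_obj (congrArg Cat.Hom.toFunctor h) A) :=
  Fib.cat_eqToHom_app h A

lemma lift_of_eqToHom {C : Type u₁} [Category.{v₁} C] (T : C ⥤ C) {X Y U V W : C}
    {y : X ⟶ T.obj V} {x : Y ⟶ W} {e : X = Y} {e₁ : V = U} {e₂ : T.obj U = W} {e₃ : T.obj V = W}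
    {k : X ⟶ Y} {k₁ : V ⟶ U} {k₂ : T.obj U ⟶ W} (hk : k = eqToHom e) (h₁ : k₁ = eqToHom e₁)
    (h₂ : k₂ = eqToHom e₂) (h : y ≫ eqToHom e₃ = eqToHom e ≫ x) : y ≫ T.map k₁ ≫ k₂ = k ≫ x := by
  subst e₁
  simpa [hk, h₁, h₂] using h

lemma flip_of_eqToHom {C : Type u₁} [Category.{v₁} C] (T : C ⥤ C) {U V W : C}
    {y : T.obj V ⟶ T.obj V} {x : W ⟶ W} {e₁ : V = U} {e₂ : T.obj U = W} {e₃ : T.obj V = W}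
    {k₁ : V ⟶ U} {k₂ : T.obj U ⟶ W} (h₁ : k₁ = eqToHom e₁) (h₂ : k₂ = eqToHom e₂)
    (h : y ≫ eqToHom e₃ = eqToHom e₃ ≫ x) : y ≫ T.map k₁ ≫ k₂ = T.map k₁ ≫ k₂ ≫ x := by
  subst e₁
  simpa [h₁, h₂] using h

lemma _root_.TangentFib.BundleData.IsMorphism.of_eq {C : Type u₁} [Category.{v₁} C]
    {D D' : BundleData C} {f : D.B ⟶ D'.B} {g g' : D.E ⟶ D'.E} (h : D.IsMorphism D' f g)
    (e : g' = g) : D.IsMorphism D' f g' :=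
  e ▸ h

lemma IsTangent.proj (h : D.IsTangent) : D.fibTotal.IsColaxFunctor D.fibBase X.proj
    (eqToHom D.T.comm.symm) where
  additive E := ((D.projBundleIso E).isMorphism
    ((h.base.additive _).of_iso (D.projBundleIso E))).of_eq (colaxAt_eqToHom _ _ _ E)
  lift E := lift_of_eqToHom D.fibBase.T.toFunctor (colaxAt_eqToHom _ _ _ _)
    (colaxAt_eqToHom _ _ _ _) (colaxAt_eqToHom _ _ _ _) (eqToHom_square (D.l.proj_map E))
  flip E := flip_of_eqToHom D.fibBase.T.toFunctor (colaxAt_eqToHom _ _ _ _)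
    (colaxAt_eqToHom _ _ _ _) (eqToHom_square (D.c.proj_map E))
  nfold n hn E P π hπ := by
    obtain ⟨Tn, ρ, hρ⟩ := h.additive.nfold n hn
    refine IsNFoldPullback.map_of_map (h.nfold_total hn hρ 0 E) hπ ?_
    exact (h.nfold_base hn hρ 0 (X.proj.toFunctor.obj E)).of_iso (Iso.refl _)
      (eqToIso (D.T.proj_obj E).symm) (eqToIso (Tn.proj_obj E).symm)
      (eqToIso_square (e' := rfl) (D.p.proj_map E)) (fun i => eqToIso_square ((ρ i).proj_map E))
  lift_universal E w hw := by
    obtain ⟨v, hv, hu⟩ := h.lift_universal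
    obtain rfl := h.total.isLiftPairAt_unique (hv.total E) hw
    refine (isPullback_map_comp_iff X.proj.toFunctor).1 ?_
    exact ((Fib.pointwise_pullback_iff.1 hu).1 (X.proj.toFunctor.obj E)).of_iso
      (eqToIso (D.T₂.proj_obj E).symm) (eqToIso ((D.T ≫ D.T).proj_obj E).symm) (Iso.refl _)
      (eqToIso (D.T.proj_obj E).symm)
      (eqToIso_square ((v ≫ D.s ▷ D.T).proj_map E))
      (eqToIso_square (e' := rfl) ((D.π₁ ≫ D.p).proj_map E))
      (eqToIso_square ((D.p ▷ D.T ≫ (λ_ D.T).hom).proj_map E))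
      (eqToIso_square (e := rfl) (D.z.proj_map E))

/-- The tangent fibration given by a tangent object in the `2`-category of cloven fibrations. -/
def tangentFibration (D : TangentData X) (h : D.IsTangent) : TangentFibration.{v, u} where
  fib := X
  baseData := D.fibBase
  totalData := D.fibTotal
  base_isTangent := h.base
  total_isTangent := h.total
  comm := D.T.comm
  strict := ⟨D.T.comm, rfl, h.proj⟩
  cart := D.T.cart

end TangentData

section NFoldFunctor

variable {C : Type u₁} [Category.{v₁} C] {C' : Type u₂} [Category.{v₂} C']

/-- The functor given by a family of `n`-fold pullbacks. -/
noncomputable def nfoldFunctor {f g : C ⥤ C'} {q : f ⟶ g} {n : ℕ} {P : C → C'}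
    {π : ∀ A, Fin n → (P A ⟶ f.obj A)} (h : ∀ A, IsNFoldPullback (q.app A) (π A)) : C ⥤ C' :=
  have key {A B : C} (m : A ⟶ B) : ∃ k : P A ⟶ P B, ∀ i, k ≫ π B i = π A i ≫ f.map m :=
    (h B).exists_lift (fun i => π A i ≫ f.map m) (fun i j => by
      rw [Category.assoc, q.naturality, reassoc_of% (h A).comm i j, Category.assoc, q.naturality])
  { obj := P
    map := fun m => (key m).choose
    map_id := fun A => (h A).hom_ext fun i => by rw [(key (𝟙 A)).choose_spec]; simp
    map_comp := fun {A B D} m m' => (h D).hom_ext fun i => by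
      rw [(key (m ≫ m')).choose_spec, Category.assoc, (key m').choose_spec,
        reassoc_of% (key m).choose_spec i, f.map_comp] }

lemma nfoldFunctor_map_comp {f g : C ⥤ C'} {q : f ⟶ g} {n : ℕ} {P : C → C'}
    {π : ∀ A, Fin n → (P A ⟶ f.obj A)} (h : ∀ A, IsNFoldPullback (q.app A) (π A)) {A B : C}
    (m : A ⟶ B) (i : Fin n) : (nfoldFunctor h).map m ≫ π B i = π A i ≫ f.map m :=
  ((h B).exists_lift (fun i => π A i ≫ f.map m) (fun i j => by
      rw [Category.assoc, q.naturality, reassoc_of% (h A).comm i j, Category.assoc,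
        q.naturality])).choose_spec i

/-- Morphisms between `n`-fold pullbacks induced by cartesian morphisms are cartesian. -/
lemma IsNFoldPullback.isStronglyCartesian (p : C ⥤ C') {n : ℕ} {E B P E' B' P' : C}
    {q : E ⟶ B} {π : Fin n → (P ⟶ E)} (h : IsNFoldPullback q π) {q' : E' ⟶ B'}
    {π' : Fin n → (P' ⟶ E')} (h' : IsNFoldPullback q' π') {e : E' ⟶ E} {b : B' ⟶ B} {k : P' ⟶ P}
    (hk : ∀ i, k ≫ π i = π' i ≫ e) (hb : q' ≫ b = e ≫ q) {E₀ P₀ E₀' B₀ B₀' P₀' : C'}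
    {q₀' : E₀' ⟶ B₀'} {π₀ : Fin n → (P₀ ⟶ E₀)} {π₀' : Fin n → (P₀' ⟶ E₀')} {e₀ : E₀' ⟶ E₀}
    {b₀ : B₀' ⟶ B₀} {k₀ : P₀' ⟶ P₀} (hq' : p.IsHomLift q₀' q')
    (hπ : ∀ i, p.IsHomLift (π₀ i) (π i)) (hπ' : ∀ i, p.IsHomLift (π₀' i) (π' i))
    (hk₀ : p.IsHomLift k₀ k) (he : p.IsStronglyCartesian e₀ e)
    (hb' : p.IsStronglyCartesian b₀ b) (h₀ : IsNFoldPullback q₀' π₀')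
    (hk₀' : ∀ i, k₀ ≫ π₀ i = π₀' i ≫ e₀) : p.IsStronglyCartesian k₀ k where
  toIsHomLift := hk₀
  universal_property' {Z} u m hm := by
    have hc (i : Fin n) : u ≫ k₀ ≫ π₀ i = (u ≫ π₀' i) ≫ e₀ := by rw [hk₀', Category.assoc]
    have hm' (i : Fin n) : p.IsHomLift (u ≫ k₀ ≫ π₀ i) (m ≫ π i) := by
      have := CategoryTheory.IsHomLift.comp p (u ≫ k₀) (π₀ i) m (π i)
      rwa [Category.assoc] at this
    have ht (i : Fin n) : ∃ t : Z ⟶ E', p.IsHomLift (u ≫ π₀' i) t ∧ t ≫ e = m ≫ π i := by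
      have := hm' i
      exact (Functor.IsStronglyCartesian.universal_property p e₀ e (u ≫ π₀' i) _ (hc i)
        (m ≫ π i)).exists
    choose t ht ht' using ht
    obtain ⟨k', hk'⟩ := h'.exists_lift t (fun i j => by
      have h1 : p.IsHomLift (u ≫ π₀' i ≫ q₀') (t i ≫ q') := by
        have := CategoryTheory.IsHomLift.comp p (u ≫ π₀' i) q₀' (t i) q'
        rwa [Category.assoc] at this
      have h2 : p.IsHomLift (u ≫ π₀' i ≫ q₀') (t j ≫ q') := by
        have := CategoryTheory.IsHomLift.comp p (u ≫ π₀' j) q₀' (t j) q'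
        rwa [Category.assoc, h₀.comm j i] at this
      refine Functor.IsStronglyCartesian.ext p b₀ b (u ≫ π₀' i ≫ q₀') ?_
      rw [Category.assoc, Category.assoc, hb, reassoc_of% ht' i, reassoc_of% ht' j, h.comm i j])
    have hZ : p.obj Z = _ := CategoryTheory.IsHomLift.domain_eq p (u ≫ k₀) m
    have hP : p.obj P' = _ := CategoryTheory.IsHomLift.domain_eq p k₀ k
    have hu : p.IsHomLift u k' := (Fib.isHomLift_iff p k' hZ hP).2 (h₀.hom_ext fun i => by
      have hE : p.obj E' = _ := CategoryTheory.IsHomLift.codomain_eq p (π₀' i) (π' i)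
      have h1 := (Fib.isHomLift_iff p _ hP hE).1 (hπ' i)
      have h2 := (Fib.isHomLift_iff p _ hZ hE).1 (ht i)
      rw [Category.assoc, Category.assoc, ← h1, ← h2, ← hk', p.map_comp, Category.assoc])
    refine ⟨k', ⟨hu, h.hom_ext fun i => ?_⟩, ?_⟩
    · rw [Category.assoc, hk, reassoc_of% hk', ht']
    · rintro l ⟨hl, hl'⟩
      refine h'.hom_ext fun i => ?_
      rw [hk']
      have h1 : p.IsHomLift (u ≫ π₀' i) (l ≫ π' i) := inferInstance
      have h2 := ht i
      refine Functor.IsStronglyCartesian.ext p e₀ e (u ≫ π₀' i) ?_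
      rw [Category.assoc, ← hk, ← Category.assoc, hl', ht']

lemma map_square_comp (p : C ⥤ C') {X Y Y' Z : C} {x : X ⟶ Y} {y : Y ⟶ Z} {z : X ⟶ Y'} {w : Y' ⟶ Z}
    (h : x ≫ y = z ≫ w) {A B : C'} {a : p.obj Z ⟶ A} {b : p.obj Y' ⟶ B} {c : B ⟶ A}
    (h' : p.map w ≫ a = b ≫ c) : p.map x ≫ p.map y ≫ a = (p.map z ≫ b) ≫ c := by
  rw [Category.assoc, ← h', ← Functor.map_comp_assoc, h, Functor.map_comp_assoc]

lemma eq_conj_of_square {X X' Y Y' : C} {x : X ⟶ Y} {y : X' ⟶ Y'} {e : X = X'} {e' : Y = Y'}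
    (h : x ≫ eqToHom e' = eqToHom e ≫ y) : x = eqToHom e ≫ y ≫ eqToHom e'.symm := by
  subst e e'
  simpa using h

end NFoldFunctor

namespace Fib

variable {X Z : Fib.{v, u}}

/-- An `n`-fold pullback in the total category can be chosen over a given one in the base. -/
lemma exists_nfold_over {E B P : Z.total} {q : E ⟶ B} {n : ℕ} {π : Fin n → (P ⟶ E)}
    (h : IsNFoldPullback q π)
    (hp : IsNFoldPullback (Z.proj.toFunctor.map q) (fun i => Z.proj.toFunctor.map (π i)))
    {E₀ B₀ P₀ : Z.base} {q₀ : E₀ ⟶ B₀} {π₀ : Fin n → (P₀ ⟶ E₀)} (h₀ : IsNFoldPullback q₀ π₀)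
    (hq : Z.proj.toFunctor.IsHomLift q₀ q) :
    ∃ (P' : Z.total) (π' : Fin n → (P' ⟶ E)), Z.proj.toFunctor.obj P' = P₀ ∧
      IsNFoldPullback q π' ∧ ∀ i, Z.proj.toFunctor.IsHomLift (π₀ i) (π' i) := by
  cases hq
  obtain ⟨e, he⟩ := h₀.exists_iso hp
  have := Z.cart P e.hom
  have : IsIso (Z.lift P e.hom) :=
    Functor.IsStronglyCartesian.isIso_of_base_isIso Z.proj.toFunctor e.hom (Z.lift P e.hom)
  refine ⟨Z.pull P e.hom, fun i => Z.lift P e.hom ≫ π i,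
    CategoryTheory.IsHomLift.domain_eq Z.proj.toFunctor e.hom (Z.lift P e.hom), ?_, fun i => ?_⟩
  · exact h.of_iso (Iso.refl _) (Iso.refl _) (asIso (Z.lift P e.hom)).symm (by simp) (by simp)
  · rw [← he i]
    infer_instance

/-- Pointwise `n`-fold pullbacks in the base and the total categories that are preserved by the
projection give a `1`-morphism of cloven fibrations over the one of the base. -/
lemma exists_nfold_hom {f g : X ⟶ Z} {q : f ⟶ g} {n : ℕ} {P₀ : X.base ⟶ Z.base}
    {π₀ : Fin n → (P₀ ⟶ f.base)}
    (h₀ : ∀ A, IsNFoldPullback (q.base.toNatTrans.app A) (fun i => (π₀ i).toNatTrans.app A))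
    (h : ∀ E, ∃ (P : Z.total) (π : Fin n → (P ⟶ f.total.toFunctor.obj E)),
      IsNFoldPullback (q.total.toNatTrans.app E) π ∧
      IsNFoldPullback (Z.proj.toFunctor.map (q.total.toNatTrans.app E))
        (fun i => Z.proj.toFunctor.map (π i))) :
    ∃ (P : X.total ⟶ Z.total) (π : Fin n → (P ⟶ f.total)) (comm : P ≫ Z.proj = X.proj ≫ P₀),
      (∀ {A : X.base} (E : X.total) (m : A ⟶ X.proj.toFunctor.obj E),
        Functor.IsStronglyCartesian Z.proj.toFunctor (P₀.toFunctor.map m)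
          (P.toFunctor.map (X.lift E m))) ∧
      (∀ i E, Z.proj.toFunctor.IsHomLift ((π₀ i).toNatTrans.app (X.proj.toFunctor.obj E))
        ((π i).toNatTrans.app E)) ∧
      ∀ E, IsNFoldPullback (q.total.toNatTrans.app E) (fun i => (π i).toNatTrans.app E) := by
  have key (E : X.total) : ∃ (P : Z.total) (π : Fin n → (P ⟶ f.total.toFunctor.obj E)),
      Z.proj.toFunctor.obj P = P₀.toFunctor.obj (X.proj.toFunctor.obj E) ∧
      IsNFoldPullback (q.total.toNatTrans.app E) π ∧
      ∀ i, Z.proj.toFunctor.IsHomLift ((π₀ i).toNatTrans.app (X.proj.toFunctor.obj E)) (π i) := by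
    obtain ⟨P, π, hπ, hp⟩ := h E
    exact exists_nfold_over hπ hp (h₀ (X.proj.toFunctor.obj E)) (q.isLift E)
  choose P π hP hπ hl using key
  let F : X.total.α ⥤ Z.total.α := nfoldFunctor (q := q.total.toNatTrans) hπ
  have hF {E E' : X.total} (m : E ⟶ E') (i : Fin n) :
      F.map m ≫ π E' i = π E i ≫ f.total.toFunctor.map m :=
    nfoldFunctor_map_comp (q := q.total.toNatTrans) hπ m i
  have hF' {E E' : X.total} (m : E ⟶ E') : Z.proj.toFunctor.map (F.map m) ≫ eqToHom (hP E') =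
      eqToHom (hP E) ≫ P₀.toFunctor.map (X.proj.toFunctor.map m) :=
    (h₀ _).lift_comm
      (fun i => ((isHomLift_iff _ _ (hP E') (f.proj_obj E')).1 (hl E' i)).symm)
      (fun i => ((isHomLift_iff _ _ (hP E) (f.proj_obj E)).1 (hl E i)).symm)
      (fun i => map_square_comp Z.proj.toFunctor (hF m i) ((isHomLift_iff _ _ (f.proj_obj E)
        (f.proj_obj E')).1 (f.isHomLift _ _ (CategoryTheory.IsHomLift.map _ m))))
      (fun i => (π₀ i).toNatTrans.naturality _)
  have hF₀ {A B : X.base} (m₀ : A ⟶ B) {E E' : X.total} (m : E ⟶ E')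
      (hm : X.proj.toFunctor.IsHomLift m₀ m) :
      Z.proj.toFunctor.IsHomLift (P₀.toFunctor.map m₀) (F.map m) := by
    cases hm
    exact (isHomLift_iff _ _ (hP E) (hP E')).2 (hF' m)
  let π' (i : Fin n) : F ⟶ f.total.toFunctor :=
    { app := fun E => π E i, naturality := fun _ _ m => hF m i }
  refine ⟨Functor.toCatHom F, fun i => NatTrans.toCatHom₂ (π' i),
    Cat.Hom.ext (CategoryTheory.Functor.ext hP fun E E' m => eq_conj_of_square (hF' m)),
    fun {A} E m => ?_, fun i E => hl E i, hπ⟩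
  have hA : X.proj.toFunctor.obj (X.pull E m) = A :=
    have := X.cart E m
    CategoryTheory.IsHomLift.domain_eq X.proj.toFunctor m (X.lift E m)
  have hl' {A : X.base} {E : X.total} (h : X.proj.toFunctor.obj E = A) (i : Fin n) :
      Z.proj.toFunctor.IsHomLift ((π₀ i).toNatTrans.app A) (π E i) := by
    subst h
    exact hl E i
  have hq {A : X.base} {E : X.total} (h : X.proj.toFunctor.obj E = A) :
      Z.proj.toFunctor.IsHomLift (q.base.toNatTrans.app A) (q.total.toNatTrans.app E) := by
    subst h
    exact q.isLift E
  exact (hπ E).isStronglyCartesian Z.proj.toFunctor (hπ _) (hF (X.lift E m))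
    (q.total.toNatTrans.naturality (X.lift E m)).symm (hq hA) (hl E) (hl' hA)
    (hF₀ m (X.lift E m) (X.cart E m).toIsHomLift) (f.cart E m) (g.cart E m) (h₀ A)
    (fun i => (π₀ i).toNatTrans.naturality m)

end Fib

section

variable {C : Type u₁} [Category.{v₁} C] {C' : Type u₂} [Category.{v₂} C'] {C'' : Type u₃}
  [Category.{v₃} C'']

/-- The identity isomorphism of additive bundles. -/
def BundleData.Iso.refl (D : BundleData C) : D.Iso D :=
  ⟨CategoryTheory.Iso.refl _, CategoryTheory.Iso.refl _, CategoryTheory.Iso.refl _, by simp,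
    by simp, by simp, by simp, by simp⟩

lemma map_comp_eq (F : C ⥤ C') {X Y Y' Z : C} {a : X ⟶ Y} {b : Y ⟶ Z} {c : X ⟶ Y'} {d : Y' ⟶ Z}
    (h : a ≫ b = c ≫ d) : F.map a ≫ F.map b = F.map c ≫ F.map d := by
  rw [← F.map_comp, h, F.map_comp]

lemma comp_id_map_id (F : C ⥤ C') {X : C} {Y : C'} (a : F.obj X ⟶ Y) :
    a ≫ 𝟙 Y = F.map (𝟙 X) ≫ a := by simp

lemma comp_map_id (F : C ⥤ C') {X : C} {Y : C'} (a : Y ⟶ F.obj X) :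
    a ≫ F.map (𝟙 X) = 𝟙 Y ≫ a := by simp

lemma conj_conj (T : C ⥤ C) {P P' : C} (i : P ≅ P') (v : P' ⟶ T.obj P') :
    i.inv ≫ (i.hom ≫ v ≫ T.map i.inv) ≫ T.map i.hom = v := by
  simp [← T.map_comp]

lemma iso_square_iff (T : C ⥤ C) {P P' E : C} {i : P ≅ P'} {w : P ⟶ T.obj P}
    {π : P' ⟶ E} {c : E ⟶ T.obj E} : w ≫ T.map (i.hom ≫ π) = (i.hom ≫ π) ≫ c ↔
      (i.inv ≫ w ≫ T.map i.hom) ≫ T.map π = π ≫ c := by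
  rw [Category.assoc, Category.assoc, Iso.inv_comp_eq, T.map_comp, Category.assoc]

lemma isPullback_iso_iff (T : C ⥤ C) (F : C ⥤ C') {P P' E B : C} {i : P ≅ P'}
    {w : P ⟶ T.obj P} {s π : P' ⟶ E} {q : E ⟶ B} {z : B ⟶ T.obj B} :
    IsPullback (F.map (w ≫ T.map (i.hom ≫ s))) (F.map ((i.hom ≫ π) ≫ q)) (F.map (T.map q))
      (F.map z) ↔
    IsPullback (F.map ((i.inv ≫ w ≫ T.map i.hom) ≫ T.map s)) (F.map (π ≫ q)) (F.map (T.map q))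
      (F.map z) := by
  have e1 : w ≫ T.map (i.hom ≫ s) = i.hom ≫ (i.inv ≫ w ≫ T.map i.hom) ≫ T.map s := by simp
  have e2 : (i.hom ≫ π) ≫ q = i.hom ≫ π ≫ q := Category.assoc _ _ _
  rw [e1, e2, F.map_comp i.hom, F.map_comp i.hom]
  generalize F.map ((i.inv ≫ w ≫ T.map i.hom) ≫ T.map s) = x
  generalize F.map (π ≫ q) = y
  constructor
  · intro h
    exact h.of_iso (F.mapIso i) (Iso.refl _) (Iso.refl _) (Iso.refl _)
      (by simp) (by simp) (by simp) (by simp)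
  · intro h
    exact h.of_iso (F.mapIso i).symm (Iso.refl _) (Iso.refl _) (Iso.refl _)
      (by simp) (by simp) (by simp) (by simp)

end

lemma exists_nfold_cat {X Z : Cat.{v, u}} {f g : X ⟶ Z} (q : f ⟶ g) {n : ℕ}
    (h : ∀ A : X, ∃ (P : Z) (π : Fin n → (P ⟶ f.toFunctor.obj A)),
      IsNFoldPullback (q.toNatTrans.app A) π) :
    ∃ (P : X ⟶ Z) (π : Fin n → (P ⟶ f)),
      ∀ A, IsNFoldPullback (q.toNatTrans.app A) (fun i => (π i).toNatTrans.app A) := by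
  choose P π hπ using h
  let F : X.α ⥤ Z.α := nfoldFunctor (q := q.toNatTrans) hπ
  let π' (i : Fin n) : F ⟶ f.toFunctor :=
    { app := fun E => π E i
      naturality := fun _ _ m => nfoldFunctor_map_comp (q := q.toNatTrans) hπ m i }
  exact ⟨Functor.toCatHom F, fun i => NatTrans.toCatHom₂ (π' i), hπ⟩

/-- The components of an invertible natural transformation. -/
def Cat.appIso {X Z : Cat.{v, u}} {f g : X ⟶ Z} (i : f ≅ g) (A : X) :
    f.toFunctor.obj A ≅ g.toFunctor.obj A :=
  ⟨i.hom.toNatTrans.app A, i.inv.toNatTrans.app A, Cat.Hom.hom_inv_id_toNatTrans_app i A,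
    Cat.Hom.inv_hom_id_toNatTrans_app i A⟩

namespace TangentData

section ChangeT₂

variable {X Y : Cat.{v, u}} (D : TangentData X) (D' : TangentData Y)

/-- The tangent data with another choice of the pullback `T₂`. -/
def changeT₂ (T₂ : X ⟶ X) (i : T₂ ≅ D.T₂) : TangentData X :=
  ⟨D.T, T₂, D.p, D.z, i.hom ≫ D.π₁, i.hom ≫ D.π₂, i.hom ≫ D.s, D.l, D.c⟩

variable {T₂ : X ⟶ X} {i : T₂ ≅ D.T₂}

/-- The additive bundles do not depend on the choice of `T₂`. -/
def changeT₂BundleIso (A : X) :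
    ((D.changeT₂ T₂ i).bundleAt A).Iso (D.bundleAt A) where
  b := Iso.refl _
  e := Iso.refl _
  e₂ := Cat.appIso i A
  hq := (Category.comp_id _).trans (Category.id_comp _).symm
  hz := (Category.comp_id _).trans (Category.id_comp _).symm
  h₁ := Category.comp_id _
  h₂ := Category.comp_id _
  hs := Category.comp_id _

end ChangeT₂

/-- The image of an isomorphism of additive bundles under a functor. -/
def _root_.TangentFib.BundleData.Iso.map {C : Type u₁} [Category.{v₁} C] {C' : Type u₂}
    [Category.{v₂} C'] {D D' : BundleData C} (i : D.Iso D') (F : C ⥤ C') :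
    (D.map F).Iso (D'.map F) where
  b := F.mapIso i.b
  e := F.mapIso i.e
  e₂ := F.mapIso i.e₂
  hq := map_comp_eq F i.hq
  hz := map_comp_eq F i.hz
  h₁ := map_comp_eq F i.h₁
  h₂ := map_comp_eq F i.h₂
  hs := map_comp_eq F i.hs

section ChangeT₂

variable {X Y : Cat.{v, u}} {D : TangentData X} {D' : TangentData Y}
  {T₂ : X ⟶ X} {i : T₂ ≅ D.T₂}
  {T₂' : Y ⟶ Y} {i' : T₂' ≅ D'.T₂}

lemma isLiftPairAt_changeT₂ {A : X} {w} :
    (D.changeT₂ T₂ i).IsLiftPairAt A w ↔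
      D.IsLiftPairAt A ((Cat.appIso i A).inv ≫ w ≫ D.T.toFunctor.map ((Cat.appIso i A).hom)) := by
  exact and_congr (iso_square_iff D.T.toFunctor (i := Cat.appIso i A) (π := (D.bundleAt A).π₁)
      (c := D.liftAt A))
    (iso_square_iff D.T.toFunctor (i := Cat.appIso i A) (π := (D.bundleAt A).π₂)
      (c := (D.bundleAt (D.T.toFunctor.obj A)).z))

lemma isPullback_changeT₂ {A : X} {w} {C : Type u} [Category.{v} C]
    (F : X ⥤ C) :
    IsPullback (F.map (w ≫ D.T.toFunctor.map ((D.changeT₂ T₂ i).bundleAt A).s))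
      (F.map (((D.changeT₂ T₂ i).bundleAt A).π₁ ≫ (D.bundleAt A).q))
      (F.map (D.T.toFunctor.map (D.bundleAt A).q)) (F.map (D.bundleAt A).z) ↔
    IsPullback (F.map (((Cat.appIso i A).inv ≫ w ≫ D.T.toFunctor.map ((Cat.appIso i A).hom)) ≫
        D.T.toFunctor.map (D.bundleAt A).s))
      (F.map ((D.bundleAt A).π₁ ≫ (D.bundleAt A).q)) (F.map (D.T.toFunctor.map (D.bundleAt A).q))
      (F.map (D.bundleAt A).z) :=
  isPullback_iso_iff D.T.toFunctor F (i := Cat.appIso i A) (s := (D.bundleAt A).s)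
    (π := (D.bundleAt A).π₁) (q := (D.bundleAt A).q) (z := (D.bundleAt A).z)

lemma IsTangentCategory.changeT₂ (h : D.IsTangentCategory) :
    (D.changeT₂ T₂ i).IsTangentCategory where
  additive A := (h.additive A).of_iso (D.changeT₂BundleIso A).symm
  nfold := h.nfold
  lift_additive A := (h.lift_additive A).of_iso (D.changeT₂BundleIso A).symm
    ((D.changeT₂BundleIso A).symm.map D.T.toFunctor)
    (comp_map_id D.T.toFunctor _) (comp_map_id D.T.toFunctor _)
  flip_additive A := (h.flip_additive A).of_iso
    ((D.changeT₂BundleIso A).symm.map D.T.toFunctor)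
    (D.changeT₂BundleIso (D.T.toFunctor.obj A)).symm
    (comp_id_map_id D.T.toFunctor _) (comp_id_map_id D.T.toFunctor _)
  lift_coassoc := h.lift_coassoc
  flip_flip := h.flip_flip
  yang_baxter := h.yang_baxter
  lift_flip := h.lift_flip
  lift_flip_flip := h.lift_flip_flip
  lift_universal A := by
    obtain ⟨v, hv, hu⟩ := h.lift_universal A
    have e := conj_conj D.T.toFunctor (Cat.appIso i A) v
    refine ⟨(Cat.appIso i A).hom ≫ v ≫ D.T.toFunctor.map ((Cat.appIso i A).inv),
      (isLiftPairAt_changeT₂).2 (e.symm ▸ hv),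
      (isPullback_changeT₂ (𝟭 _)).2 (e.symm ▸ hu)⟩

lemma isLaxFunctor_changeT₂_left {F : X ⟶ Y} {law : D.T ≫ F ⟶ F ≫ D'.T} :
    (D.changeT₂ T₂ i).IsLaxFunctor D' F law ↔ D.IsLaxFunctor D' F law := by
  refine ⟨fun h => ⟨fun A => (h.additive A).of_iso
    ((D.changeT₂BundleIso A).map F.toFunctor) (BundleData.Iso.refl _) ?_ ?_, h.lift, h.flip⟩,
    fun h => ⟨fun A => (h.additive A).of_iso
    ((D.changeT₂BundleIso A).symm.map F.toFunctor) (BundleData.Iso.refl _) ?_ ?_,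
      h.lift, h.flip⟩⟩
  all_goals exact comp_id_map_id F.toFunctor _

lemma isLaxFunctor_changeT₂_right {F : X ⟶ Y} {law : D.T ≫ F ⟶ F ≫ D'.T} :
    D.IsLaxFunctor (D'.changeT₂ T₂' i') F law ↔ D.IsLaxFunctor D' F law := by
  refine ⟨fun h => ⟨fun A => (h.additive A).of_iso (BundleData.Iso.refl _)
    (D'.changeT₂BundleIso (F.toFunctor.obj A)) ?_ ?_, h.lift, h.flip⟩,
    fun h => ⟨fun A => (h.additive A).of_iso (BundleData.Iso.refl _)
    (D'.changeT₂BundleIso (F.toFunctor.obj A)).symm ?_ ?_, h.lift, h.flip⟩⟩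
  all_goals exact (Category.comp_id _).trans (Category.id_comp _).symm

lemma isColaxFunctor_changeT₂_left {F : X ⟶ Y} {law : F ≫ D'.T ⟶ D.T ≫ F} :
    (D.changeT₂ T₂ i).IsColaxFunctor D' F law ↔ D.IsColaxFunctor D' F law := by
  refine ⟨fun h => ⟨fun A => (h.additive A).of_iso (BundleData.Iso.refl _)
    ((D.changeT₂BundleIso A).map F.toFunctor) ?_ ?_, h.lift, h.flip, h.nfold,
      fun A v hv => ?_⟩,
    fun h => ⟨fun A => (h.additive A).of_iso (BundleData.Iso.refl _)
    ((D.changeT₂BundleIso A).symm.map F.toFunctor) ?_ ?_,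
      h.lift, h.flip, h.nfold, fun A v hv => ?_⟩⟩
  · exact comp_map_id F.toFunctor _
  · exact comp_map_id F.toFunctor _
  · have e := conj_conj D.T.toFunctor (Cat.appIso i A) v
    have h1 := (isPullback_changeT₂ F.toFunctor).1
      (h.lift_universal A _ ((isLiftPairAt_changeT₂).2 (e.symm ▸ hv)))
    exact e ▸ h1
  · exact comp_map_id F.toFunctor _
  · exact comp_map_id F.toFunctor _
  · exact (isPullback_changeT₂ F.toFunctor).2
      (h.lift_universal A _ ((isLiftPairAt_changeT₂).1 hv))

lemma isColaxFunctor_changeT₂_right {F : X ⟶ Y} {law : F ≫ D'.T ⟶ D.T ≫ F} :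
    D.IsColaxFunctor (D'.changeT₂ T₂' i') F law ↔ D.IsColaxFunctor D' F law := by
  refine ⟨fun h => ⟨fun A => (h.additive A).of_iso
    (D'.changeT₂BundleIso (F.toFunctor.obj A)) (BundleData.Iso.refl _) ?_ ?_, h.lift,
      h.flip, h.nfold, h.lift_universal⟩,
    fun h => ⟨fun A => (h.additive A).of_iso
    (D'.changeT₂BundleIso (F.toFunctor.obj A)).symm (BundleData.Iso.refl _) ?_ ?_,
      h.lift, h.flip, h.nfold, h.lift_universal⟩⟩
  all_goals exact (Category.comp_id _).trans (Category.id_comp _).symm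

end ChangeT₂

end TangentData

lemma isHomLift_iff_of_eqToHom {C : Type u₁} [Category.{v₁} C] {C' : Type u₂} [Category.{v₂} C']
    (p : C ⥤ C') {A B : C'} {f : A ⟶ B} {X Y : C} {m : X ⟶ Y} {kA : A ⟶ p.obj X}
    {kB : B ⟶ p.obj Y} {hA : A = p.obj X} {hB : B = p.obj Y} (hkA : kA = eqToHom hA)
    (hkB : kB = eqToHom hB) : p.IsHomLift f m ↔ f ≫ kB = kA ≫ p.map m := by
  rw [Fib.isHomLift_iff p m hA.symm hB.symm]
  subst hA hB
  simp [hkA, hkB, eq_comm]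

lemma map_comp_eq_eqToHom {C : Type u₁} [Category.{v₁} C] (T : C ⥤ C) {U V W : C}
    {e₁ : V = U} {e₂ : T.obj U = W} {k₁ : V ⟶ U} {k₂ : T.obj U ⟶ W} (h₁ : k₁ = eqToHom e₁)
    (h₂ : k₂ = eqToHom e₂) : T.map k₁ ≫ k₂ = eqToHom ((congrArg T.obj e₁).trans e₂) := by
  subst e₁
  simp [h₁, h₂]

lemma IsNFoldPullback.exists_cat_iso {X Z : Cat.{v, u}} {f g : X ⟶ Z} {q : f ⟶ g} {n : ℕ}
    {P P' : X ⟶ Z} {π : Fin n → (P ⟶ f)} {π' : Fin n → (P' ⟶ f)}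
    (h : ∀ A, IsNFoldPullback (q.toNatTrans.app A) (fun i => (π i).toNatTrans.app A))
    (h' : ∀ A, IsNFoldPullback (q.toNatTrans.app A) (fun i => (π' i).toNatTrans.app A)) :
    ∃ e : P ≅ P', ∀ i, e.hom ≫ π' i = π i := by
  choose e he using fun A => (h A).exists_iso (h' A)
  let e' : P.toFunctor ≅ P'.toFunctor := NatIso.ofComponents e (fun {A B} m =>
    (h' B).lift_comm (he B) (he A) (fun i => (π i).toNatTrans.naturality m)
      (fun i => (π' i).toNatTrans.naturality m))
  refine ⟨⟨NatTrans.toCatHom₂ e'.hom, NatTrans.toCatHom₂ e'.inv,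
    Cat.Hom₂.ext e'.hom_inv_id, Cat.Hom₂.ext e'.inv_hom_id⟩, fun i => ?_⟩
  exact Cat.Hom₂.ext (NatTrans.ext (funext fun A => he A i))

namespace TangentFibration

variable (Q : TangentFibration.{v, u})

lemma proj_isColaxFunctor : Q.totalData.IsColaxFunctor Q.baseData Q.fib.proj
    (eqToHom Q.comm.symm) := by
  obtain ⟨h, -, hc⟩ := Q.strict
  exact hc

/-- The projection of the tangent bundle functors as a `2`-morphism of cloven fibrations. -/
def p : Q.endo ⟶ 𝟙 Q.fib where
  base := Q.baseData.p
  total := Q.totalData.p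
  isLift E := (isHomLift_iff_of_eqToHom Q.fib.proj.toFunctor (TangentData.colaxAt_eqToHom _ _ _ E)
    (eqToHom_refl _ rfl).symm).2 (Q.proj_isColaxFunctor.additive E).proj.symm

/-- The zero section of the tangent bundle functors as a `2`-morphism of cloven fibrations. -/
def z : 𝟙 Q.fib ⟶ Q.endo where
  base := Q.baseData.z
  total := Q.totalData.z
  isLift E := (isHomLift_iff_of_eqToHom Q.fib.proj.toFunctor (eqToHom_refl _ rfl).symm
    (TangentData.colaxAt_eqToHom _ _ _ E)).2 (Q.proj_isColaxFunctor.additive E).zero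

/-- The vertical lift as a `2`-morphism of cloven fibrations. -/
def l : Q.endo ⟶ Q.endo ≫ Q.endo where
  base := Q.baseData.l
  total := Q.totalData.l
  isLift E := (isHomLift_iff_of_eqToHom Q.fib.proj.toFunctor (TangentData.colaxAt_eqToHom _ _ _ E)
    (map_comp_eq_eqToHom Q.baseData.T.toFunctor (TangentData.colaxAt_eqToHom _ _ _ _)
      (TangentData.colaxAt_eqToHom _ _ _ _))).2 (Q.proj_isColaxFunctor.lift E)

/-- The canonical flip as a `2`-morphism of cloven fibrations. -/
def c : Q.endo ≫ Q.endo ⟶ Q.endo ≫ Q.endo where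
  base := Q.baseData.c
  total := Q.totalData.c
  isLift E := (isHomLift_iff_of_eqToHom Q.fib.proj.toFunctor
    (map_comp_eq_eqToHom Q.baseData.T.toFunctor (TangentData.colaxAt_eqToHom _ _ _ _)
      (TangentData.colaxAt_eqToHom _ _ _ _))
    (map_comp_eq_eqToHom Q.baseData.T.toFunctor (TangentData.colaxAt_eqToHom _ _ _ _)
      (TangentData.colaxAt_eqToHom _ _ _ _))).2
    ((Q.proj_isColaxFunctor.flip E).trans (Category.assoc _ _ _).symm)

lemma exists_nfold {n : ℕ} (hn : 0 < n) {P₀ : Q.fib.base ⟶ Q.fib.base}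
    {π₀ : Fin n → (P₀ ⟶ Q.baseData.T)}
    (h₀ : ∀ A, IsNFoldPullback (Q.baseData.p.toNatTrans.app A) (fun i => (π₀ i).toNatTrans.app A)) :
    ∃ (P : Q.fib.total ⟶ Q.fib.total) (π : Fin n → (P ⟶ Q.totalData.T))
      (comm : P ≫ Q.fib.proj = Q.fib.proj ≫ P₀),
      (∀ {A : Q.fib.base} (E : Q.fib.total) (m : A ⟶ Q.fib.proj.toFunctor.obj E),
        Functor.IsStronglyCartesian Q.fib.proj.toFunctor (P₀.toFunctor.map m)
          (P.toFunctor.map (Q.fib.lift E m))) ∧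
      (∀ i E, Q.fib.proj.toFunctor.IsHomLift ((π₀ i).toNatTrans.app (Q.fib.proj.toFunctor.obj E))
        ((π i).toNatTrans.app E)) ∧
      ∀ E, IsNFoldPullback (Q.totalData.p.toNatTrans.app E) (fun i => (π i).toNatTrans.app E) :=
  Fib.exists_nfold_hom (q := Q.p) h₀ (fun E => by
    obtain ⟨P, π, hπ⟩ := (Q.total_isTangent.additive E).nfold n hn
    exact ⟨P, π, hπ, Q.proj_isColaxFunctor.nfold n hn E P π hπ⟩)

lemma exists_T₂ : ∃ (T₂ : Q.fib.total ⟶ Q.fib.total) (i : T₂ ≅ Q.totalData.T₂)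
    (_ : T₂ ≫ Q.fib.proj = Q.fib.proj ≫ Q.baseData.T₂),
    (∀ {A : Q.fib.base} (E : Q.fib.total) (m : A ⟶ Q.fib.proj.toFunctor.obj E),
      Functor.IsStronglyCartesian Q.fib.proj.toFunctor (Q.baseData.T₂.toFunctor.map m)
        (T₂.toFunctor.map (Q.fib.lift E m))) ∧
    (∀ E, Q.fib.proj.toFunctor.IsHomLift
      (Q.baseData.π₁.toNatTrans.app (Q.fib.proj.toFunctor.obj E))
      ((i.hom ≫ Q.totalData.π₁).toNatTrans.app E)) ∧
    (∀ E, Q.fib.proj.toFunctor.IsHomLift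
      (Q.baseData.π₂.toNatTrans.app (Q.fib.proj.toFunctor.obj E))
      ((i.hom ≫ Q.totalData.π₂).toNatTrans.app E)) ∧
    (∀ E, Q.fib.proj.toFunctor.IsHomLift
      (Q.baseData.s.toNatTrans.app (Q.fib.proj.toFunctor.obj E))
      ((i.hom ≫ Q.totalData.s).toNatTrans.app E)) := by
  have hfin {X Z : Cat.{v, u}} {P f g : X ⟶ Z} (q : f ⟶ g) (a b : P ⟶ f) (A : X)
      (h : IsPullback (a.toNatTrans.app A) (b.toNatTrans.app A) (q.toNatTrans.app A)
        (q.toNatTrans.app A)) :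
      IsNFoldPullback (q.toNatTrans.app A) (fun i => ((![a, b] : Fin 2 → (P ⟶ f)) i).toNatTrans.app A) := by
    have e : (fun i => ((![a, b] : Fin 2 → (P ⟶ f)) i).toNatTrans.app A) =
        ![a.toNatTrans.app A, b.toNatTrans.app A] := by
      funext i
      fin_cases i <;> rfl
    rw [e]
    exact isNFoldPullback_two h
  obtain ⟨T₂, π, comm, cart, lift, hπ⟩ := Q.exists_nfold Nat.two_pos
    (π₀ := ![Q.baseData.π₁, Q.baseData.π₂])
    (fun A => hfin Q.baseData.p _ _ A (Q.base_isTangent.additive A).isPullback)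
  obtain ⟨i, hi⟩ := IsNFoldPullback.exists_cat_iso hπ (π' := ![Q.totalData.π₁, Q.totalData.π₂])
    (fun E => hfin Q.totalData.p _ _ E (Q.total_isTangent.additive E).isPullback)
  have h₁ (E) : Q.fib.proj.toFunctor.IsHomLift
      (Q.baseData.π₁.toNatTrans.app (Q.fib.proj.toFunctor.obj E))
      ((i.hom ≫ Q.totalData.π₁).toNatTrans.app E) := by
    have := lift 0 E
    rwa [← hi 0] at this
  have h₂ (E) : Q.fib.proj.toFunctor.IsHomLift
      (Q.baseData.π₂.toNatTrans.app (Q.fib.proj.toFunctor.obj E))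
      ((i.hom ≫ Q.totalData.π₂).toNatTrans.app E) := by
    have := lift 1 E
    rwa [← hi 1] at this
  have key {E : Q.fib.total} {f : Q.baseData.T₂.toFunctor.obj (Q.fib.proj.toFunctor.obj E) ⟶
      Q.baseData.T.toFunctor.obj (Q.fib.proj.toFunctor.obj E)}
      {m : Q.totalData.T₂.toFunctor.obj E ⟶ Q.totalData.T.toFunctor.obj E} :
      Q.fib.proj.toFunctor.IsHomLift f ((Cat.appIso i E).hom ≫ m) ↔
      f ≫ TangentData.colaxAt _ _ (eqToHom Q.comm.symm) E =
        (eqToHom (Functor.congr_obj (congrArg Cat.Hom.toFunctor comm) E).symm ≫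
          Q.fib.proj.toFunctor.map (Cat.appIso i E).hom) ≫ Q.fib.proj.toFunctor.map m :=
    (isHomLift_iff_of_eqToHom Q.fib.proj.toFunctor rfl
      (TangentData.colaxAt_eqToHom _ _ _ E)).trans (by
        rw [Q.fib.proj.toFunctor.map_comp, Category.assoc])
  refine ⟨T₂, i, comm, cart, h₁, h₂, fun E => key.2
    ((Q.proj_isColaxFunctor.additive E).sum _ (key.1 (h₁ E)).symm (key.1 (h₂ E)).symm)⟩

/-- The pullback of the tangent bundle with itself over the chosen pullback of the base. -/
noncomputable def T₂ : Q.fib ⟶ Q.fib :=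
  ⟨Q.baseData.T₂, Q.exists_T₂.choose, Q.exists_T₂.choose_spec.choose_spec.choose,
    Q.exists_T₂.choose_spec.choose_spec.choose_spec.1⟩

/-- The comparison of the two choices of the pullback of the tangent bundle. -/
noncomputable def i₂ : Q.T₂.total ≅ Q.totalData.T₂ := Q.exists_T₂.choose_spec.choose

/-- The tangent structure on the cloven fibration that underlies a tangent fibration. -/
noncomputable def data : TangentData Q.fib where
  T := Q.endo
  T₂ := Q.T₂
  p := Q.p
  z := Q.z
  π₁ := ⟨Q.baseData.π₁, Q.i₂.hom ≫ Q.totalData.π₁,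
    Q.exists_T₂.choose_spec.choose_spec.choose_spec.2.1⟩
  π₂ := ⟨Q.baseData.π₂, Q.i₂.hom ≫ Q.totalData.π₂,
    Q.exists_T₂.choose_spec.choose_spec.choose_spec.2.2.1⟩
  s := ⟨Q.baseData.s, Q.i₂.hom ≫ Q.totalData.s,
    Q.exists_T₂.choose_spec.choose_spec.choose_spec.2.2.2⟩
  l := Q.l
  c := Q.c

lemma data_isTangent : Q.data.IsTangent :=
  TangentData.isTangent_of_fib Q.base_isTangent Q.total_isTangent.changeT₂ (fun n hn => by
    obtain ⟨P₀, π₀, h₀⟩ := exists_nfold_cat Q.baseData.p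
      (fun A => (Q.base_isTangent.additive A).nfold n hn)
    obtain ⟨P, π, comm, cart, lift, h⟩ := Q.exists_nfold hn h₀
    exact ⟨⟨P₀, P, comm, cart⟩, fun i => ⟨π₀ i, π i, lift i⟩, h₀, h⟩)

end TangentFibration

namespace TangentData

lemma comp_map_id_comp_id {C : Type u₁} [Category.{v₁} C] (T : C ⥤ C) {X Y : C} (y : X ⟶ T.obj Y) :
    y ≫ T.map (𝟙 Y) ≫ 𝟙 _ = 𝟙 X ≫ y := by simp

lemma comp_map_id_comp_id' {C : Type u₁} [Category.{v₁} C] (T : C ⥤ C) {X : C}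
    (y : T.obj X ⟶ T.obj X) : y ≫ T.map (𝟙 X) ≫ 𝟙 _ = T.map (𝟙 X) ≫ 𝟙 _ ≫ y := by simp

lemma IsTangentCategory.isColaxFunctor_id {X : Cat.{v, u}} {D : TangentData X}
    (h : D.IsTangentCategory) : D.IsColaxFunctor D (𝟙 X) (𝟙 D.T) where
  additive A := (BundleData.Iso.refl (D.bundleAt A)).isMorphism (h.additive A)
  lift A := comp_map_id_comp_id D.T.toFunctor (D.liftAt A)
  flip A := comp_map_id_comp_id' D.T.toFunctor (D.flipAt A)
  nfold n hn A P π hπ := hπ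
  lift_universal A w hw := by
    obtain ⟨v, hv, hu⟩ := h.lift_universal A
    obtain rfl := h.isLiftPairAt_unique hv hw
    exact hu

end TangentData

namespace TNGFIB

variable {Q R : TangentFibration.{v, u}}

open TangentData

lemma laxMor_iff {f : Q.endLax ⟶ R.endLax} :
    laxMor Q R f ↔ Q.data.IsLax R.data f.one f.law :=
  ((isLax_iff_fib Q.data_isTangent R.data_isTangent).trans (and_congr Iff.rfl
    (isLaxFunctor_changeT₂_left.trans isLaxFunctor_changeT₂_right))).symm

lemma colaxMor_iff {f : Q.endColax ⟶ R.endColax} :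
    colaxMor Q R f ↔ Q.data.IsColax R.data f.one f.law :=
  ((isColax_iff_fib Q.data_isTangent R.data_isTangent).trans (and_congr Iff.rfl
    (isColaxFunctor_changeT₂_left.trans isColaxFunctor_changeT₂_right))).symm

lemma strongMor_iff {f : Q.endLax ⟶ R.endLax} :
    strongMor Q R f ↔ Q.data.IsStrong R.data f.one f.law :=
  ((isStrong_iff_fib Q.data_isTangent R.data_isTangent).trans (and_congr Iff.rfl
    (exists_congr fun e => and_congr Iff.rfl
      (isColaxFunctor_changeT₂_left.trans isColaxFunctor_changeT₂_right)))).symm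

lemma strictMor_iff {f : Q.endLax ⟶ R.endLax} :
    strictMor Q R f ↔ Q.data.IsStrict R.data f.one f.law :=
  ((isStrict_iff_fib Q.data_isTangent R.data_isTangent).trans (and_congr Iff.rfl
    (exists_congr fun e => and_congr Iff.rfl
      (isColaxFunctor_changeT₂_left.trans isColaxFunctor_changeT₂_right)))).symm

section

variable {X : Fib.{v, u}} {D : TangentData X} (h : D.IsTangent)

lemma strictMor_left_iff {f : (D.tangentFibration h).endLax ⟶ R.endLax} :
    strictMor (D.tangentFibration h) R f ↔ D.IsStrict R.data f.one f.law :=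
  ((isStrict_iff_fib h R.data_isTangent).trans (and_congr Iff.rfl
    (exists_congr fun e => and_congr Iff.rfl isColaxFunctor_changeT₂_right))).symm

lemma strictMor_right_iff {f : Q.endLax ⟶ (D.tangentFibration h).endLax} :
    strictMor Q (D.tangentFibration h) f ↔ Q.data.IsStrict D f.one f.law :=
  ((isStrict_iff_fib Q.data_isTangent h).trans (and_congr Iff.rfl
    (exists_congr fun e => and_congr Iff.rfl isColaxFunctor_changeT₂_left))).symm

end

lemma strictMor_id : strictMor Q Q (𝟙 Q.endLax) :=
  ⟨⟨rfl, Category.comp_id _, Q.base_isTangent.isColaxFunctor_id⟩,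
    ⟨rfl, Category.comp_id _, Q.total_isTangent.isColaxFunctor_id⟩⟩

end TNGFIB

/-! ### Invertible laws and `2`-natural isomorphisms -/

namespace BundleData

variable {C : Type u₁} [Category.{v₁} C]

/-- The inverse of an invertible morphism of additive bundles is a morphism. -/
lemma IsMorphism.inv {D D' : BundleData C} {f : D.B ≅ D'.B} {g : D.E ≅ D'.E}
    (h : D.IsMorphism D' f.hom g.hom) (hw : D.π₁ ≫ D.q = D.π₂ ≫ D.q)
    (hD' : IsPullback D'.π₁ D'.π₂ D'.q D'.q) : D'.IsMorphism D f.inv g.inv where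
  proj := by rw [Iso.inv_comp_eq, ← Category.assoc, h.proj, Category.assoc, Iso.hom_inv_id,
    Category.comp_id]
  zero := by rw [Iso.comp_inv_eq, Category.assoc, h.zero, Iso.inv_hom_id_assoc]
  sum k h₁ h₂ := by
    obtain ⟨k', h₁', h₂'⟩ := hD'.exists_lift (D.π₁ ≫ g.hom) (D.π₂ ≫ g.hom) (by
      rw [Category.assoc, h.proj, reassoc_of% hw, Category.assoc, h.proj])
    have e : k ≫ k' = 𝟙 _ := hD'.hom_ext
      (by rw [Category.assoc, h₁', reassoc_of% h₁, Iso.inv_hom_id, Category.comp_id,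
        Category.id_comp])
      (by rw [Category.assoc, h₂', reassoc_of% h₂, Iso.inv_hom_id, Category.comp_id,
        Category.id_comp])
    rw [Iso.comp_inv_eq, Category.assoc, h.sum k' h₁' h₂', reassoc_of% e]

end BundleData

section Bicat

variable {K : Type u₁} [Bicategory.{w₁, v₁} K] {X Y : K} {D : TangentData X} {D' : TangentData Y}

lemma comp_eq_of_inverse {C : Type u₁} [Category.{v₁} C] {A B : C} {a : A ⟶ B} {b : B ⟶ A}
    {x : B ⟶ B} {y : A ⟶ A} (hab : a ≫ b = 𝟙 A) (hba : b ≫ a = 𝟙 B) (h : x ≫ b = b ≫ y) :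
    a ≫ x = y ≫ a := by
  have h1 := congrArg (fun w => a ≫ w ≫ a) h
  simpa [hba, reassoc_of% hab] using h1

lemma whiskerLeft_rightUnitor_comm {W : K} (k : W ⟶ X) {f g : X ⟶ Y} (η : f ⟶ g) :
    k ◁ (η ▷ 𝟙 Y) ≫ (whiskerLeftIso k (ρ_ g)).hom = (whiskerLeftIso k (ρ_ f)).hom ≫ k ◁ η := by
  rw [whiskerLeftIso_hom, whiskerLeftIso_hom, ← whiskerLeft_comp, ← whiskerLeft_comp,
    rightUnitor_naturality]

lemma unitors_whiskerRight_comm {Z : K} (F : Y ⟶ Z) {f g : X ⟶ Y} (η : f ⟶ g) :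
    𝟙 X ◁ (η ▷ (𝟙 Y ≫ F)) ≫ (λ_ (g ≫ 𝟙 Y ≫ F) ≪≫ whiskerLeftIso g (λ_ F)).hom =
      (λ_ (f ≫ 𝟙 Y ≫ F) ≪≫ whiskerLeftIso f (λ_ F)).hom ≫ η ▷ F := by
  rw [Iso.trans_hom, Iso.trans_hom, ← Category.assoc, leftUnitor_naturality, Category.assoc,
    Category.assoc, whiskerLeftIso_hom, whiskerLeftIso_hom, whisker_exchange]

lemma TangentData.IsTangent.isLiftPair_unique (h : D.IsTangent) {v w : D.T₂ ⟶ D.T₂ ≫ D.T}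
    (hv : D.IsLiftPair v) (hw : D.IsLiftPair w) : v = w := by
  have h1 := (h.pointwise Nat.two_pos (isNFoldPullback_two h.additive.isPullback) 1 X
    (𝟙 X)).isPullback
  have h2 : IsPullback (D.π₁ ▷ D.T) (D.π₂ ▷ D.T) (D.p ▷ D.T) (D.p ▷ D.T) :=
    h1.of_iso (λ_ _ ≪≫ whiskerLeftIso _ (λ_ _)) (λ_ _ ≪≫ whiskerLeftIso _ (λ_ _))
      (λ_ _ ≪≫ whiskerLeftIso _ (λ_ _)) (λ_ _ ≪≫ whiskerLeftIso _ (λ_ _))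
      (unitors_whiskerRight_comm _ _) (unitors_whiskerRight_comm _ _)
      (unitors_whiskerRight_comm _ _) (unitors_whiskerRight_comm _ _)
  exact h2.hom_ext (hv.1.trans hw.1.symm) (hv.2.trans hw.2.symm)

lemma id_whiskerLeft_comm {f g : X ⟶ Y} (η : f ⟶ g) :
    𝟙 X ◁ η ≫ (λ_ g).hom = (λ_ f).hom ≫ η := leftUnitor_naturality η

lemma TangentData.IsColax.isPullback {F : X ⟶ Y} {law : F ≫ D'.T ⟶ D.T ≫ F}
    (hc : D.IsColax D' F law) (h : D.IsTangent) :
    IsPullback (D.π₁ ▷ F) (D.π₂ ▷ F) (D.p ▷ F) (D.p ▷ F) := by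
  have := hc.nfold 2 Nat.two_pos D.T₂ ![D.π₁, D.π₂] (isNFoldPullback_two h.additive.isPullback) X (𝟙 X)
  exact this.isPullback.of_iso (λ_ _) (λ_ _) (λ_ _) (λ_ _) (id_whiskerLeft_comm _)
    (id_whiskerLeft_comm _) (id_whiskerLeft_comm _) (id_whiskerLeft_comm _)

lemma TangentData.IsStrict.isStrong {F : X ⟶ Y} {law : D.T ≫ F ⟶ F ≫ D'.T}
    (h : D.IsStrict D' F law) : D.IsStrong D' F law := by
  obtain ⟨e, rfl, hc⟩ := h
  exact ⟨eqToIso e, rfl, hc⟩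

lemma TangentData.IsStrong.isLax {F : X ⟶ Y} {law : D.T ≫ F ⟶ F ≫ D'.T}
    (hs : D.IsStrong D' F law) (h : D.IsTangent) (h' : D'.IsTangent) : D.IsLax D' F law := by
  obtain ⟨e, rfl, hc⟩ := hs
  refine ⟨?_, ?_, ?_⟩
  · refine BundleData.IsMorphism.inv (D := D'.bundle.map (precomp Y F))
      (D' := D.bundle.map (postcomp X F)) (f := ρ_ F ≪≫ (λ_ F).symm) (g := e.symm) hc.additive
      ?_ (hc.isPullback h)
    exact map_comp_eq (precomp Y F) h'.additive.isPullback.w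
  · rw [← cancel_epi e.inv, ← reassoc_of% hc.lift]
    simp
  · have h1 : ((α_ D.T D.T F).hom ≫ D.T ◁ e.hom ≫ (α_ D.T F D'.T).inv ≫ e.hom ▷ D'.T ≫
        (α_ F D'.T D'.T).hom) ≫ (α_ F D'.T D'.T).inv ≫ e.inv ▷ D'.T ≫ (α_ D.T F D'.T).hom ≫
        D.T ◁ e.inv ≫ (α_ D.T D.T F).inv = 𝟙 _ := by simp
    have h2 : ((α_ F D'.T D'.T).inv ≫ e.inv ▷ D'.T ≫ (α_ D.T F D'.T).hom ≫
        D.T ◁ e.inv ≫ (α_ D.T D.T F).inv) ≫ (α_ D.T D.T F).hom ≫ D.T ◁ e.hom ≫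
        (α_ D.T F D'.T).inv ≫ e.hom ▷ D'.T ≫ (α_ F D'.T D'.T).hom = 𝟙 _ := by simp
    exact (comp_eq_of_inverse h1 h2 hc.flip).symm

end Bicat

section Strict

variable {B : Type u₁} [Bicategory.{w₁, v₁} B] {C : Type u₂} [Bicategory.{w₂, v₂} C]
  [Strict B] [Strict C]

lemma faithful_postcomp {W W' : C} (Z : C) {e : W ⟶ W'} {e' : W' ⟶ W} (h : e ≫ e' = 𝟙 W) :
    (postcomp Z e).Faithful where
  map_injective {f g η θ} h0 := by
    have h1 := congrArg (fun x => x ▷ e') (show η ▷ e = θ ▷ e from h0)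
    rw [whiskerRight_cancel h, whiskerRight_cancel h, cancel_epi, cancel_mono] at h1
    exact h1

lemma isEquivalence_postcomp {W W' : C} (Z : C) {e : W ⟶ W'} {e' : W' ⟶ W} (h : e ≫ e' = 𝟙 W)
    (h' : e' ≫ e = 𝟙 W') : (postcomp Z e).IsEquivalence where
  faithful := faithful_postcomp Z h
  full := ⟨fun {f g} θ => by
    have := faithful_postcomp Z h'
    refine ⟨eqToHom (by rw [Strict.assoc, h, Strict.comp_id]) ≫ (show f ≫ e ⟶ g ≫ e from θ) ▷ e' ≫
      eqToHom (by rw [Strict.assoc, h, Strict.comp_id]), ?_⟩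
    refine (postcomp Z e').map_injective ?_
    show _ ▷ e ▷ e' = (show f ≫ e ⟶ g ≫ e from θ) ▷ e'
    rw [whiskerRight_cancel h]
    simp⟩
  essSurj := ⟨fun f => ⟨f ≫ e', ⟨eqToIso (show (f ≫ e') ≫ e = f by
    rw [Strict.assoc, h', Strict.comp_id])⟩⟩⟩

variable {P R : StrictPseudofunctor B C} (α : TwoNatIso P R)

/-- The components of a `2`-natural isomorphism identify the additive bundles. -/
def TwoNatIso.bundleIso {X : B} (D : TangentData X) :
    ((D.map R).bundle.map (precomp (R.obj X) (α.app X))).Iso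
      ((D.map P).bundle.map (postcomp (P.obj X) (α.app X))) where
  b := ρ_ (α.app X) ≪≫ (λ_ (α.app X)).symm
  e := eqToIso (α.nat D.T).symm
  e₂ := eqToIso (α.nat D.T₂).symm
  hq := by
    have h := eqToHom_square (α.nat₂ D.p)
    show α.app X ◁ (R.map₂ D.p ≫ (R.mapId X).hom) ≫ (ρ_ (α.app X)).hom ≫ (λ_ (α.app X)).inv =
      eqToHom (α.nat D.T).symm ≫ (P.map₂ D.p ≫ (P.mapId X).hom) ▷ α.app X
    simp [R.mapId_eq_eqToIso, P.mapId_eq_eqToIso, Strict.leftUnitor_eqToIso,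
      Strict.rightUnitor_eqToIso, ← reassoc_of% h]
  hz := by
    have h := eqToHom_square (α.nat₂ D.z)
    show α.app X ◁ ((R.mapId X).inv ≫ R.map₂ D.z) ≫ eqToHom (α.nat D.T).symm =
      ((ρ_ (α.app X)).hom ≫ (λ_ (α.app X)).inv) ≫ ((P.mapId X).inv ≫ P.map₂ D.z) ▷ α.app X
    simp [R.mapId_eq_eqToIso, P.mapId_eq_eqToIso, Strict.leftUnitor_eqToIso,
      Strict.rightUnitor_eqToIso, h]
  h₁ := eqToIso_square (α.nat₂ D.π₁)
  h₂ := eqToIso_square (α.nat₂ D.π₂)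
  hs := eqToIso_square (α.nat₂ D.s)

/-- The components of a `2`-natural isomorphism are strict tangent morphisms. -/
lemma TwoNatIso.isStrict {X : B} {D : TangentData X} (h : (D.map P).IsTangent) :
    (D.map P).IsStrict (D.map R) (α.app X) (eqToHom (α.nat D.T)) := by
  have hE (W : C) := isEquivalence_postcomp W (α.app_inv X) (α.inv_app X)
  refine ⟨α.nat D.T, rfl, ?_, ?_, ?_, ?_, ?_⟩
  · refine (α.bundleIso D).isMorphism (h.additive.map_of_isEquivalence _)
  · have h := eqToHom_square (α.nat₂ D.l)
    show α.app X ◁ (R.map₂ D.l ≫ (R.mapComp D.T D.T).hom) ≫ (α_ _ _ _).inv ≫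
      eqToHom (α.nat D.T).symm ▷ R.map D.T ≫ (α_ _ _ _).hom ≫
      P.map D.T ◁ eqToHom (α.nat D.T).symm ≫ (α_ _ _ _).inv = eqToHom (α.nat D.T).symm ≫
        (P.map₂ D.l ≫ (P.mapComp D.T D.T).hom) ▷ α.app X
    simp [Strict.associator_eqToIso, R.mapComp_eq_eqToIso, P.mapComp_eq_eqToIso, ← reassoc_of% h]
  · have h := (eqToHom_comp_iff _ _ _).1 (eqToHom_square (α.nat₂ D.c)).symm
    show α.app X ◁ ((R.mapComp D.T D.T).inv ≫ R.map₂ D.c ≫ (R.mapComp D.T D.T).hom) ≫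
      (α_ _ _ _).inv ≫ eqToHom (α.nat D.T).symm ▷ R.map D.T ≫ (α_ _ _ _).hom ≫
      P.map D.T ◁ eqToHom (α.nat D.T).symm ≫ (α_ _ _ _).inv = ((α_ _ _ _).inv ≫
      eqToHom (α.nat D.T).symm ▷ R.map D.T ≫ (α_ _ _ _).hom ≫
      P.map D.T ◁ eqToHom (α.nat D.T).symm ≫ (α_ _ _ _).inv) ≫
        ((P.mapComp D.T D.T).inv ≫ P.map₂ D.c ≫ (P.mapComp D.T D.T).hom) ▷ α.app X
    simp [Strict.associator_eqToIso, R.mapComp_eq_eqToIso, P.mapComp_eq_eqToIso, h]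
  · intro n hn Tn π hπ W k
    have := ((h.pointwise hn hπ 0 W k).of_iso (whiskerLeftIso k (ρ_ _)) (whiskerLeftIso k (ρ_ _))
      (whiskerLeftIso k (ρ_ _)) (whiskerLeft_rightUnitor_comm k _)
      (fun i => whiskerLeft_rightUnitor_comm k _)).map_of_isEquivalence (postcomp W (α.app X))
    exact this.of_iso (α_ _ _ _) (α_ _ _ _) (α_ _ _ _) (associator_naturality_middle _ _ _)
      (fun i => associator_naturality_middle _ _ _)
  · intro v hv W k
    obtain ⟨v', hv', hu⟩ := h.lift_universal
    obtain rfl := h.isLiftPair_unique hv hv'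
    exact ((hu W k).map (postcomp W (α.app X))).of_iso (α_ _ _ _) (α_ _ _ _) (α_ _ _ _) (α_ _ _ _)
      (associator_naturality_middle _ _ _) (associator_naturality_middle _ _ _)
      (associator_naturality_middle _ _ _) (associator_naturality_middle _ _ _)

end Strict

/-! ### Restrictions over a fixed base -/

section FixedBase

variable {B : Type u₁} [Bicategory.{w₁, v₁} B] {C : Type u₂} [Bicategory.{w₂, v₂} C]
  {D : Type u₃} [Bicategory.{w₃, v₃} D] [Strict B] [Strict C] [Strict D]

lemma map_eq_eqToHom_congr {P P' : StrictPseudofunctor B D} (e : P = P') {a b : B} {f : a ⟶ b}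
    (h : ∃ h : P.obj a = P.obj b, P.map f = eqToHom h) :
    ∃ h : P'.obj a = P'.obj b, P'.map f = eqToHom h := by
  subst e
  exact h

lemma map₂_eq_eqToHom_congr {P P' : StrictPseudofunctor B D} (e : P = P') {a b : B} {f g : a ⟶ b}
    {η : f ⟶ g} (h : ∃ h : P.map f = P.map g, P.map₂ η = eqToHom h) :
    ∃ h : P'.map f = P'.map g, P'.map₂ η = eqToHom h := by
  subst e
  exact h

lemma map_inv_eq_eqToHom (P : StrictPseudofunctor B D) {a b : B} {f : a ⟶ b} {g : b ⟶ a}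
    (hfg : f ≫ g = 𝟙 a) (h : ∃ h : P.obj a = P.obj b, P.map f = eqToHom h) :
    ∃ h : P.obj b = P.obj a, P.map g = eqToHom h := by
  obtain ⟨h, e⟩ := h
  have h1 : eqToHom h ≫ P.map g = 𝟙 _ := by rw [← e, ← P.map_comp, hfg, P.map_id]
  refine ⟨h.symm, ?_⟩
  calc P.map g = (eqToHom h.symm ≫ eqToHom h) ≫ P.map g := by
        rw [eqToHom_trans, eqToHom_refl, Strict.id_comp]
    _ = eqToHom h.symm := by rw [Strict.assoc, h1, Strict.comp_id]

lemma map₂_whiskerLeft_eq (P : StrictPseudofunctor B C) {a b c : B} (f : a ⟶ b) {g h : b ⟶ c}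
    (η : g ⟶ h) : P.map₂ (f ◁ η) = eqToHom (P.map_comp f g) ≫ P.map f ◁ P.map₂ η ≫
      eqToHom (P.map_comp f h).symm := by
  rw [P.map₂_whisker_left, P.mapComp_eq_eqToIso, P.mapComp_eq_eqToIso]
  rfl

lemma map₂_whiskerRight_eq (P : StrictPseudofunctor B C) {a b c : B} {f g : a ⟶ b} (η : f ⟶ g)
    (h : b ⟶ c) : P.map₂ (η ▷ h) = eqToHom (P.map_comp f h) ≫ P.map₂ η ▷ P.map h ≫
      eqToHom (P.map_comp g h).symm := by
  rw [P.map₂_whisker_right, P.mapComp_eq_eqToIso, P.mapComp_eq_eqToIso]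
  rfl

lemma Sub.eq_conj_hom {O : Type t} {S : SubData B O} {a b : Sub S} {f f' g g' : a ⟶ b}
    (h : f' = f) (η : f ⟶ g) (h' : g = g') {θ : Sub.Hom.hom f' ⟶ Sub.Hom.hom g'}
    (e : θ = eqToHom (congrArg Sub.Hom.hom h) ≫ Sub.Hom₂.hom η ≫
      eqToHom (congrArg Sub.Hom.hom h')) : θ = Sub.Hom₂.hom (eqToHom h ≫ η ≫ eqToHom h') := by
  subst h h'
  rw [e, eqToHom_refl, eqToHom_refl, Category.comp_id, Category.id_comp]
  simp

lemma Sub.comp_eq_comp_hom {O : Type t} {S : SubData B O} {a b : Sub S} {f f' g g' : a ⟶ b}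
    (h : f' = f) (h' : g' = g) {η : f ⟶ g} {θ : f' ⟶ g'}
    (e : Sub.Hom₂.hom θ ≫ eqToHom (congrArg Sub.Hom.hom h') =
      eqToHom (congrArg Sub.Hom.hom h) ≫ Sub.Hom₂.hom η) :
    Sub.Hom₂.hom (θ ≫ eqToHom h') = Sub.Hom₂.hom (eqToHom h ≫ η) := by
  subst h h'
  rw [eqToHom_refl, eqToHom_refl, Category.comp_id, Category.id_comp] at e
  rw [eqToHom_refl, eqToHom_refl, Category.comp_id, Category.id_comp, e]

variable (E : TwoEquivalence B C) {Q : StrictPseudofunctor B D} {Q' : StrictPseudofunctor C D}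
  (hQ : E.functor.comp Q' = Q) (hQ' : E.inverse.comp Q = Q') {X : Type x} {base : B → X}
  {base' : C → X} (hb : ∀ a, base' (E.functor.obj a) = base a)
  (hb' : ∀ a, base (E.inverse.obj a) = base' a) (d : X)

/-- The restriction of a `2`-functor to the objects and morphisms over a fixed base. -/
def vertFunctor (P : StrictPseudofunctor B C) (hP : P.comp Q' = Q)
    (hb : ∀ a, base' (P.obj a) = base a) :
    StrictPseudofunctor (Sub (vertData Q (fun a : {a : B // base a = d} => a.1)))
      (Sub (vertData Q' (fun a : {a : C // base' a = d} => a.1))) :=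
  StrictPseudofunctor.mk''
    { obj a := ⟨⟨P.obj a.as.1, (hb _).trans a.as.2⟩⟩
      map f := ⟨P.map (Sub.Hom.hom f), map_eq_eqToHom_congr hP.symm (Sub.Hom.prop f)⟩
      map₂ η := ⟨P.map₂ (Sub.Hom₂.hom η), map₂_eq_eqToHom_congr hP.symm (Sub.Hom₂.prop η)⟩
      map₂_id _ := Sub.Hom₂.ext (P.map₂_id _)
      map₂_comp _ _ := Sub.Hom₂.ext (P.map₂_comp _ _)
      map_id _ := Sub.Hom.ext (P.map_id _)
      map_comp _ _ := Sub.Hom.ext (P.map_comp _ _)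
      map₂_whisker_left f _ _ η := Sub.Hom₂.ext (Sub.eq_conj_hom _ _ _
        (map₂_whiskerLeft_eq P (Sub.Hom.hom f) (Sub.Hom₂.hom η)))
      map₂_whisker_right η f := Sub.Hom₂.ext (Sub.eq_conj_hom _ _ _
        (map₂_whiskerRight_eq P (Sub.Hom₂.hom η) (Sub.Hom.hom f))) }

variable {E}

include hQ hQ' hb hb' in
/-- A `2`-equivalence over `D` restricts to the objects and morphisms over a fixed base. -/
lemma exists_vertEquivalence
    (hu : ∀ a, ∃ h : Q.obj a = Q.obj (E.inverse.obj (E.functor.obj a)),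
      Q.map (E.unit.app a) = eqToHom h)
    (hc : ∀ a, ∃ h : Q'.obj (E.functor.obj (E.inverse.obj a)) = Q'.obj a,
      Q'.map (E.counit.app a) = eqToHom h) :
    ∃ E' : TwoEquivalence (Sub (vertData Q (fun a : {a : B // base a = d} => a.1)))
      (Sub (vertData Q' (fun a : {a : C // base' a = d} => a.1))), RestrictsTo E E' := by
  refine ⟨⟨vertFunctor d E.functor hQ hb, vertFunctor d E.inverse hQ' hb',
    { app a := ⟨E.unit.app a.as.1, hu _⟩
      inv a := ⟨E.unit.inv a.as.1, map_inv_eq_eqToHom Q (E.unit.app_inv _) (hu _)⟩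
      app_inv a := Sub.Hom.ext (E.unit.app_inv _)
      inv_app a := Sub.Hom.ext (E.unit.inv_app _)
      nat f := Sub.Hom.ext (E.unit.nat (Sub.Hom.hom f))
      nat₂ η := Sub.Hom₂.ext (Sub.comp_eq_comp_hom _ _ (E.unit.nat₂ (Sub.Hom₂.hom η))) },
    { app a := ⟨E.counit.app a.as.1, hc _⟩
      inv a := ⟨E.counit.inv a.as.1, map_inv_eq_eqToHom Q' (E.counit.app_inv _) (hc _)⟩
      app_inv a := Sub.Hom.ext (E.counit.app_inv _)
      inv_app a := Sub.Hom.ext (E.counit.inv_app _)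
      nat f := Sub.Hom.ext (E.counit.nat (Sub.Hom.hom f))
      nat₂ η := Sub.Hom₂.ext (Sub.comp_eq_comp_hom _ _ (E.counit.nat₂ (Sub.Hom₂.hom η))) }⟩,
    ?_, ?_, fun _ => HEq.rfl, fun _ => HEq.rfl⟩
  · exact strictPseudofunctor_hext rfl (fun _ => HEq.rfl) (fun _ => HEq.rfl)
  · exact strictPseudofunctor_hext rfl (fun _ => HEq.rfl) (fun _ => HEq.rfl)

end FixedBase

/-! ### Strictness of the unit and of the counit -/

section Strictness

variable {B : Type u₁} [Bicategory.{w₁, v₁} B] {C : Type u₂} [Bicategory.{w₂, v₂} C]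
  {D : Type u₃} [Bicategory.{w₃, v₃} D] [Strict B] [Strict C] [Strict D]

lemma TangentData.IsStrict.of_eq {X Y : B} {D₁ D₂ : TangentData X} {D₁' D₂' : TangentData Y}
    {F F' : X ⟶ Y} {law : D₁.T ≫ F ⟶ F ≫ D₁'.T} (h : D₁.IsStrict D₁' F law) (e : D₁ = D₂)
    (e' : D₁' = D₂') (eF : F = F') (hF : D₂.T ≫ F' = F' ≫ D₂'.T) :
    D₂.IsStrict D₂' F' (eqToHom hF) := by
  subst e e' eF
  obtain ⟨_, -, hc⟩ := h
  exact ⟨hF, rfl, hc⟩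

lemma TangentData.ext' {X : B} {T T₂ : X ⟶ X} {p p' : T ⟶ 𝟙 X} {z z' : 𝟙 X ⟶ T}
    {π₁ π₁' π₂ π₂' s s' : T₂ ⟶ T} {l l' : T ⟶ T ≫ T} {c c' : T ≫ T ⟶ T ≫ T} (hp : p = p')
    (hz : z = z') (h₁ : π₁ = π₁') (h₂ : π₂ = π₂') (hs : s = s') (hl : l = l') (hc : c = c') :
    (⟨T, T₂, p, z, π₁, π₂, s, l, c⟩ : TangentData X) = ⟨T, T₂, p', z', π₁', π₂', s', l', c'⟩ := by
  subst hp hz h₁ h₂ hs hl hc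
  rfl

lemma TangentData.map_id {X : B} (D : TangentData X) : D.map (StrictPseudofunctor.id B) = D :=
  TangentData.ext' (Category.comp_id D.p) (Category.id_comp D.z) rfl rfl rfl (Category.comp_id D.l)
    ((Category.id_comp _).trans (Category.comp_id D.c))

section

variable {A : Type u₁} [Category.{v₁} A] {A' : Type u₂} [Category.{v₂} A'] (F : A ⥤ A')

lemma map_comp_comp {X Y Z : A} {W : A'} (a : X ⟶ Y) (b : Y ⟶ Z) (c : F.obj Z ⟶ W) :
    F.map a ≫ F.map b ≫ c = F.map (a ≫ b) ≫ c := by simp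

lemma comp_map_comp_map {X Y Z : A} {W : A'} (a : X ⟶ Y) (b : Y ⟶ Z) (c : W ⟶ F.obj X) :
    (c ≫ F.map a) ≫ F.map b = c ≫ F.map (a ≫ b) := by simp

lemma comp_map_comp_comp {X Y Z V : A} {W W' : A'} (a : X ⟶ Y) (b : Y ⟶ Z) (b' : Z ⟶ V)
    (c : W ⟶ F.obj X) (d : F.obj V ⟶ W') :
    (c ≫ F.map a) ≫ F.map b ≫ F.map b' ≫ d = c ≫ F.map (a ≫ b ≫ b') ≫ d := by simp

end

lemma TangentData.map_comp {X : B} (D' : TangentData X) (P : StrictPseudofunctor B C)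
    (R : StrictPseudofunctor C D) : D'.map (P.comp R) = (D'.map P).map R :=
  TangentData.ext' (map_comp_comp (R.mapFunctor _ _) _ _ _) (comp_map_comp_map (R.mapFunctor _ _) _ _ _)
    rfl rfl rfl (map_comp_comp (R.mapFunctor _ _) _ _ _) (comp_map_comp_comp (R.mapFunctor _ _) _ _ _ _ _)

lemma square_of_conj {A : Type u₁} [Category.{v₁} A] {X Y X₁ Y₁ X₂ Y₂ : A} {a : X₁ ⟶ Y₁}
    {b : X₂ ⟶ Y₂} {e₁ : X = X₁} {e₂ : Y₁ = Y} {e₃ : X = X₂} {e₄ : Y₂ = Y}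
    (h : eqToHom e₁ ≫ a ≫ eqToHom e₂ = eqToHom e₃ ≫ b ≫ eqToHom e₄) :
    b ≫ eqToHom (e₄.trans e₂.symm) = eqToHom (e₃.symm.trans e₁) ≫ a := by
  subst e₁ e₂ e₃ e₄
  simpa using h.symm

/-- The inverse of a `2`-natural isomorphism. -/
def TwoNatIso.symm {F G : StrictPseudofunctor B C} (α : TwoNatIso F G) : TwoNatIso G F where
  app := α.inv
  inv := α.app
  app_inv := α.inv_app
  inv_app := α.app_inv
  nat {X Y} f := by
    rw [← Strict.id_comp (G.map f), ← α.inv_app, Strict.assoc (α.inv _), ← α.nat, Strict.assoc,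
      Strict.assoc, α.app_inv, Strict.comp_id]
  nat₂ {X Y f g} η := by
    have h := congrArg (fun w => (α.inv X ◁ w) ▷ α.inv Y) (α.nat₂ η)
    simp [whiskerLeft_cancel (α.inv_app _), whiskerRight_cancel (α.app_inv _),
      Strict.associator_eqToIso] at h
    exact square_of_conj h

variable (E : TwoEquivalence B C)

lemma TwoEquivalence.unit_isStrict {X : B} {D : TangentData X} (h : D.IsTangent) :
    D.IsStrict ((D.map E.functor).map E.inverse) (E.unit.app X) (eqToHom (E.unit.nat D.T)) :=
  (E.unit.isStrict (D := D) ((D.map_id).symm ▸ h)).of_eq D.map_id (D.map_comp _ _) rfl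
    (E.unit.nat D.T)

lemma TwoEquivalence.unit_inv_isStrict {X : B} {D : TangentData X}
    (h : ((D.map E.functor).map E.inverse).IsTangent) :
    ((D.map E.functor).map E.inverse).IsStrict D (E.unit.inv X) (eqToHom (E.unit.symm.nat D.T)) :=
  (E.unit.symm.isStrict (D := D) ((D.map_comp E.functor E.inverse).symm ▸ h)).of_eq (D.map_comp _ _) D.map_id rfl
    (E.unit.symm.nat D.T)

lemma TwoEquivalence.counit_isStrict {X : C} {D : TangentData X}
    (h : ((D.map E.inverse).map E.functor).IsTangent) :
    ((D.map E.inverse).map E.functor).IsStrict D (E.counit.app X) (eqToHom (E.counit.nat D.T)) :=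
  (E.counit.isStrict (D := D) ((D.map_comp E.inverse E.functor).symm ▸ h)).of_eq (D.map_comp _ _) D.map_id rfl
    (E.counit.nat D.T)

lemma TwoEquivalence.counit_inv_isStrict {X : C} {D : TangentData X} (h : D.IsTangent) :
    D.IsStrict ((D.map E.inverse).map E.functor) (E.counit.inv X)
      (eqToHom (E.counit.symm.nat D.T)) :=
  (E.counit.symm.isStrict (D := D) ((D.map_id).symm ▸ h)).of_eq D.map_id (D.map_comp _ _) rfl
    (E.counit.symm.nat D.T)

end Strictness

section Objects

lemma TwoEquivalence.essSurjIso_functor {B : Type u₁} [Bicategory.{w₁, v₁} B] {C : Type u₂}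
    [Bicategory.{w₂, v₂} C] [Strict B] [Strict C] (E : TwoEquivalence B C) : EssSurjIso E.functor :=
  fun W => ⟨E.inverse.obj W, E.counit.inv W, E.counit.app W, E.counit.inv_app W, E.counit.app_inv W⟩

lemma TwoEquivalence.essSurjIso_inverse {B : Type u₁} [Bicategory.{w₁, v₁} B] {C : Type u₂}
    [Bicategory.{w₂, v₂} C] [Strict B] [Strict C] (E : TwoEquivalence B C) : EssSurjIso E.inverse := fun W =>
  ⟨E.functor.obj W, E.unit.app W, E.unit.inv W, E.unit.app_inv W, E.unit.inv_app W⟩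

lemma TangentData.map_baseFunctor {X : Fib.{v, u}} (D : TangentData X) :
    D.map Fib.baseFunctor = D.fibBase :=
  TangentData.ext' (Category.comp_id D.p.base) (Category.id_comp D.z.base) rfl rfl rfl
    (Category.comp_id D.l.base) ((Category.id_comp _).trans (Category.comp_id D.c.base))

lemma TangentData.map_totalFunctor {X : Fib.{v, u}} (D : TangentData X) :
    D.map Fib.totalFunctor = D.fibTotal :=
  TangentData.ext' (Category.comp_id D.p.total) (Category.id_comp D.z.total) rfl rfl rfl
    (Category.comp_id D.l.total) ((Category.id_comp _).trans (Category.comp_id D.c.total))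

lemma grothendieck_comp_baseFunctor : grothendieck.{v, u}.comp Fib.baseFunctor = Indx.baseFunctor :=
  strictPseudofunctor_hext rfl (fun _ => HEq.rfl) (fun _ => HEq.rfl)

/-- An equivalence of indexed categories and cloven fibrations over the base categories that is
given by the Grothendieck construction. -/
structure IsGrothendieckEquivalence (E : TwoEquivalence Indx.{v, u} Fib.{v, u}) : Prop where
  functor_eq : E.functor = grothendieck
  inverse_localIso : LocalIso E.inverse
  inverse_base : E.inverse.comp Indx.baseFunctor = Fib.baseFunctor
  unit_base (X : Indx.{v, u}) :
    ∃ h : Indx.baseFunctor.obj X = Indx.baseFunctor.obj (E.inverse.obj (E.functor.obj X)),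
      Indx.baseFunctor.map (E.unit.app X) = eqToHom h
  counit_base (X : Fib.{v, u}) :
    ∃ h : Fib.baseFunctor.obj (E.functor.obj (E.inverse.obj X)) = Fib.baseFunctor.obj X,
      Fib.baseFunctor.map (E.counit.app X) = eqToHom h

lemma isGrothendieckEquivalence : IsGrothendieckEquivalence grothendieckEquivalence.{v, u} where
  functor_eq := rfl
  inverse_localIso := grothendieckCover.localIso_inverse localIso_grothendieck
  inverse_base := grothendieckEquivalence_inverse_base
  unit_base X := ⟨rfl, congrArg Fib.Hom.base
    (localIso_grothendieck.map_pre (grothendieckCover.inv (grothendieck.obj X)))⟩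
  counit_base X := ⟨rfl, rfl⟩

variable {E : TwoEquivalence Indx.{v, u} Fib.{v, u}} (hE : IsGrothendieckEquivalence E)

include hE

lemma IsGrothendieckEquivalence.functor_localIso : LocalIso E.functor :=
  hE.functor_eq ▸ localIso_grothendieck

lemma IsGrothendieckEquivalence.functor_base : E.functor.comp Fib.baseFunctor = Indx.baseFunctor :=
  hE.functor_eq ▸ grothendieck_comp_baseFunctor

/-- The elements of a tangent indexed category as a tangent object. -/
noncomputable def TangentObject.groth (o : TangentObject Indx.{v, u}) : TangentObject Fib.{v, u} :=
  ⟨E.functor.obj o.carrier, o.data.map E.functor,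
    o.isTangent.map hE.functor_localIso E.essSurjIso_functor⟩

/-- The tangent indexed category of a tangent object in the `2`-category of cloven fibrations. -/
noncomputable def TangentObject.fibers (o : TangentObject Fib.{v, u}) : TangentObject Indx.{v, u} :=
  ⟨E.inverse.obj o.carrier, o.data.map E.inverse,
    o.isTangent.map hE.inverse_localIso E.essSurjIso_inverse⟩

/-- The tangent fibration of elements of a tangent indexed category. -/
noncomputable def TangentObject.elements (o : TangentObject Indx.{v, u}) :
    TangentFibration.{v, u} :=
  (o.groth hE).data.tangentFibration (o.groth hE).isTangent

omit hE in
/-- The tangent object that underlies a tangent fibration. -/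
noncomputable def TangentFibration.toTangentObject (Q : TangentFibration.{v, u}) :
    TangentObject Fib.{v, u} :=
  ⟨Q.fib, Q.data, Q.data_isTangent⟩

/-- The tangent indexed category of a tangent fibration. -/
noncomputable def TangentFibration.toIndx (Q : TangentFibration.{v, u}) :
    TangentObject Indx.{v, u} :=
  Q.toTangentObject.fibers hE

lemma TangentObject.elements_base (o : TangentObject Indx.{v, u}) :
    (o.elements hE).base = o.base := by
  have h (P : StrictPseudofunctor Indx.{v, u} Cat.{v, u}) (e : P = Indx.baseFunctor) :
      (⟨P.obj o.carrier, o.data.map P⟩ : Σ X : Cat.{v, u}, TangentData X) = o.base := by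
    subst e
    rfl
  exact (congrArg (Sigma.mk (E.functor.obj o.carrier).base)
    ((o.data.map E.functor).map_baseFunctor.symm.trans
    (o.data.map_comp E.functor Fib.baseFunctor).symm)).trans (h _ hE.functor_base)

lemma TangentObject.elements_total (o : TangentObject Indx.{v, u}) :
    (o.elements hE).total = o.total := by
  have h (P : StrictPseudofunctor Indx.{v, u} Fib.{v, u}) (e : P = grothendieck) :
      (⟨(P.obj o.carrier).total, o.data.map (P.comp Fib.totalFunctor)⟩ :
        Σ X : Cat.{v, u}, TangentData X) = o.total := by
    subst e
    rfl
  exact (congrArg (Sigma.mk (E.functor.obj o.carrier).total)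
    ((o.data.map E.functor).map_totalFunctor.symm.trans
    (o.data.map_comp E.functor Fib.totalFunctor).symm)).trans (h _ hE.functor_eq)

lemma TangentFibration.toIndx_base (Q : TangentFibration.{v, u}) :
    (Q.toIndx hE).base = Q.base := by
  have h (P : StrictPseudofunctor Fib.{v, u} Cat.{v, u}) (e : P = Fib.baseFunctor) :
      (⟨P.obj Q.fib, Q.data.map P⟩ : Σ X : Cat.{v, u}, TangentData X) = Q.base := by
    subst e
    exact congrArg (Sigma.mk Q.fib.base) Q.data.map_baseFunctor
  exact (congrArg (Sigma.mk (E.inverse.obj Q.fib).base)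
    (Q.data.map_comp E.inverse Indx.baseFunctor).symm).trans (h _ hE.inverse_base)

end Objects

/-! ### The restricted equivalences -/

section

variable {K : Type u₁} [Bicategory.{w₁, v₁} K] {X Y : K} {D : TangentData X} {D' : TangentData Y}

lemma TangentData.IsStrict.isLax {F : X ⟶ Y} {law : D.T ≫ F ⟶ F ≫ D'.T}
    (hs : D.IsStrict D' F law) (h : D.IsTangent) (h' : D'.IsTangent) : D.IsLax D' F law :=
  hs.isStrong.isLax h h'

lemma TangentData.IsStrict.isColax {F : X ⟶ Y} {h : D.T ≫ F = F ≫ D'.T}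
    (hs : D.IsStrict D' F (eqToHom h)) : D.IsColax D' F (eqToHom h.symm) := by
  obtain ⟨_, _, hc⟩ := hs
  exact hc

end

namespace TangentObject

variable {E : TwoEquivalence Indx.{v, u} Fib.{v, u}} (hE : IsGrothendieckEquivalence E)
  (o : TangentObject Indx.{v, u})

lemma id_isStrict_elements :
    (o.groth hE).data.IsStrict (o.elements hE).toTangentObject.data (𝟙 _) (eqToHom rfl) :=
  ((TNGFIB.strictMor_left_iff (o.groth hE).isTangent).1 TNGFIB.strictMor_id).of_eq rfl rfl rfl rfl

lemma elements_id_isStrict :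
    (o.elements hE).toTangentObject.data.IsStrict (o.groth hE).data (𝟙 _) (eqToHom rfl) :=
  ((TNGFIB.strictMor_right_iff (o.groth hE).isTangent).1 TNGFIB.strictMor_id).of_eq rfl rfl rfl rfl

lemma fibers_isStrict {D D' : TangentObject Fib.{v, u}} {F : D.carrier ⟶ D'.carrier}
    {law : D.data.T ≫ F ⟶ F ≫ D'.data.T} (h : D.data.IsStrict D'.data F law) :
    (D.fibers hE).data.IsStrict (D'.fibers hE).data (E.inverse.map F) (mapSq E.inverse law) :=
  (isStrict_map_iff _ _ hE.inverse_localIso E.essSurjIso_inverse _ _).2 h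

end TangentObject

/-! ### Equivalences of sub-`2`-categories from equivalences on chosen objects -/

section

variable {B : Type u₁} [Bicategory.{w₁, v₁} B] {C : Type u₂} [Bicategory.{w₂, v₂} C]

/-- The action on `1`-morphisms and `2`-morphisms between the objects `ι a` of a `2`-functor
with action `obj` on the indices of objects. -/
structure ActionOn {O : Type t} {O' : Type t'} (ι : O → B) (ι' : O' → C) (obj : O → O') where
  map {a b : O} (f : ι a ⟶ ι b) : ι' (obj a) ⟶ ι' (obj b)
  map₂ {a b : O} {f g : ι a ⟶ ι b} (η : f ⟶ g) : map f ⟶ map g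
  map_id (a : O) : map (𝟙 (ι a)) = 𝟙 (ι' (obj a))
  map_comp {a b c : O} (f : ι a ⟶ ι b) (g : ι b ⟶ ι c) : map (f ≫ g) = map f ≫ map g
  map₂_id {a b : O} (f : ι a ⟶ ι b) : map₂ (𝟙 f) = 𝟙 (map f)
  map₂_comp {a b : O} {f g h : ι a ⟶ ι b} (η : f ⟶ g) (θ : g ⟶ h) :
    map₂ (η ≫ θ) = map₂ η ≫ map₂ θ
  map₂_whiskerLeft {a b c : O} (f : ι a ⟶ ι b) {g h : ι b ⟶ ι c} (η : g ⟶ h) :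
    map₂ (f ◁ η) = eqToHom (map_comp f g) ≫ map f ◁ map₂ η ≫ eqToHom (map_comp f h).symm
  map₂_whiskerRight {a b c : O} {f g : ι a ⟶ ι b} (η : f ⟶ g) (h : ι b ⟶ ι c) :
    map₂ (η ▷ h) = eqToHom (map_comp f h) ≫ map₂ η ▷ map h ≫ eqToHom (map_comp g h).symm

namespace ActionOn

variable {O : Type t} {O' : Type t'} {ι : O → B} {ι' : O' → C}

section

variable {obj : O → O'} (A : ActionOn ι ι' obj) {V : ∀ a b : O, (ι a ⟶ ι b) → Prop}
  {V' : ∀ a b : O', (ι' a ⟶ ι' b) → Prop}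

lemma gen (hA : ∀ {a b} (f : ι a ⟶ ι b), V a b f → V' _ _ (A.map f)) {a b : O} {f : ι a ⟶ ι b}
    (h : Gen ι V a b f) : Gen ι' V' _ _ (A.map f) := by
  induction h with
  | of f hf => exact Gen.of _ (hA f hf)
  | id a => exact A.map_id a ▸ Gen.id _
  | comp f g _ _ hf hg => exact A.map_comp f g ▸ Gen.comp _ _ hf hg

variable [Strict B] [Strict C]

/-- The `2`-functor between sub-`2`-categories with a given action. -/
noncomputable def functor (hA : ∀ {a b} (f : ι a ⟶ ι b), V a b f → V' _ _ (A.map f)) :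
    StrictPseudofunctor (Sub (genData ι V)) (Sub (genData ι' V')) :=
  StrictPseudofunctor.mk''
    { obj a := ⟨obj a.as⟩
      map f := ⟨A.map (Sub.Hom.hom f), A.gen hA (Sub.Hom.prop f)⟩
      map₂ η := ⟨A.map₂ (Sub.Hom₂.hom η), trivial⟩
      map₂_id _ := Sub.Hom₂.ext (A.map₂_id _)
      map₂_comp _ _ := Sub.Hom₂.ext (A.map₂_comp _ _)
      map_id _ := Sub.Hom.ext (A.map_id _)
      map_comp _ _ := Sub.Hom.ext (A.map_comp _ _)
      map₂_whisker_left f _ _ η := Sub.Hom₂.ext (Sub.eq_conj_hom _ _ _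
        (A.map₂_whiskerLeft (Sub.Hom.hom f) (Sub.Hom₂.hom η)))
      map₂_whisker_right η f := Sub.Hom₂.ext (Sub.eq_conj_hom _ _ _
        (A.map₂_whiskerRight (Sub.Hom₂.hom η) (Sub.Hom.hom f))) }

end

end ActionOn

/-- The restriction of a `2`-equivalence to the objects `ι a` and `ι' a`, with actions `obj` and
`obj'` on their indices. -/
structure EquivalenceOn {O : Type t} {O' : Type t'} (ι : O → B) (ι' : O' → C) (obj : O → O')
    (obj' : O' → O) where
  functor : ActionOn ι ι' obj
  inverse : ActionOn ι' ι obj'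
  unit (a : O) : ι a ⟶ ι (obj' (obj a))
  unitInv (a : O) : ι (obj' (obj a)) ⟶ ι a
  unit_unitInv (a : O) : unit a ≫ unitInv a = 𝟙 _
  unitInv_unit (a : O) : unitInv a ≫ unit a = 𝟙 _
  unit_nat {a b : O} (f : ι a ⟶ ι b) : f ≫ unit b = unit a ≫ inverse.map (functor.map f)
  unit_nat₂ {a b : O} {f g : ι a ⟶ ι b} (η : f ⟶ g) : η ▷ unit b ≫ eqToHom (unit_nat g) =
    eqToHom (unit_nat f) ≫ unit a ◁ inverse.map₂ (functor.map₂ η)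
  counit (a : O') : ι' (obj (obj' a)) ⟶ ι' a
  counitInv (a : O') : ι' a ⟶ ι' (obj (obj' a))
  counit_counitInv (a : O') : counit a ≫ counitInv a = 𝟙 _
  counitInv_counit (a : O') : counitInv a ≫ counit a = 𝟙 _
  counit_nat {a b : O'} (f : ι' a ⟶ ι' b) :
    functor.map (inverse.map f) ≫ counit b = counit a ≫ f
  counit_nat₂ {a b : O'} {f g : ι' a ⟶ ι' b} (η : f ⟶ g) :
    functor.map₂ (inverse.map₂ η) ▷ counit b ≫ eqToHom (counit_nat g) =
      eqToHom (counit_nat f) ≫ counit a ◁ η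

namespace EquivalenceOn

variable {O : Type t} {O' : Type t'} {ι : O → B} {ι' : O' → C} {obj : O → O'} {obj' : O' → O}
  (A : EquivalenceOn ι ι' obj obj')

/-- Two classes of `1`-morphisms that correspond under an equivalence and that generate the units
and the counits. -/
structure Classes (V : ∀ a b : O, (ι a ⟶ ι b) → Prop) (V' : ∀ a b : O', (ι' a ⟶ ι' b) → Prop) :
    Prop where
  functor_iff {a b} (f : ι a ⟶ ι b) : V a b f ↔ V' _ _ (A.functor.map f)
  inverse_iff {a b} (f : ι' a ⟶ ι' b) : V' a b f ↔ V _ _ (A.inverse.map f)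
  unit (a : O) : Gen ι V _ _ (A.unit a)
  unitInv (a : O) : Gen ι V _ _ (A.unitInv a)
  counit (a : O') : Gen ι' V' _ _ (A.counit a)
  counitInv (a : O') : Gen ι' V' _ _ (A.counitInv a)

variable {A} [Strict B] [Strict C] {V : ∀ a b : O, (ι a ⟶ ι b) → Prop}
  {V' : ∀ a b : O', (ι' a ⟶ ι' b) → Prop}

/-- The equivalence between the sub-`2`-categories of the composites of corresponding
`1`-morphisms. -/
noncomputable def Classes.equivalence (hV : A.Classes V V') :
    TwoEquivalence (Sub (genData ι V)) (Sub (genData ι' V')) where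
  functor := A.functor.functor fun f => (hV.functor_iff f).1
  inverse := A.inverse.functor fun f => (hV.inverse_iff f).1
  unit :=
    { app a := ⟨_, hV.unit a.as⟩
      inv a := ⟨_, hV.unitInv a.as⟩
      app_inv a := Sub.Hom.ext (A.unit_unitInv a.as)
      inv_app a := Sub.Hom.ext (A.unitInv_unit a.as)
      nat f := Sub.Hom.ext (A.unit_nat (Sub.Hom.hom f))
      nat₂ η := Sub.Hom₂.ext (Sub.comp_eq_comp_hom _ _ (A.unit_nat₂ (Sub.Hom₂.hom η))) }
  counit :=
    { app a := ⟨_, hV.counit a.as⟩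
      inv a := ⟨_, hV.counitInv a.as⟩
      app_inv a := Sub.Hom.ext (A.counit_counitInv a.as)
      inv_app a := Sub.Hom.ext (A.counitInv_counit a.as)
      nat f := Sub.Hom.ext (A.counit_nat (Sub.Hom.hom f))
      nat₂ η := Sub.Hom₂.ext (Sub.comp_eq_comp_hom _ _ (A.counit_nat₂ (Sub.Hom₂.hom η))) }

end EquivalenceOn

end

lemma strictPseudofunctor_comp_assoc {A : Type u} [Bicategory.{t, v} A] {B : Type u₁}
    [Bicategory.{w₁, v₁} B] {C : Type u₂} [Bicategory.{w₂, v₂} C] {D : Type u₃}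
    [Bicategory.{w₃, v₃} D] (F : StrictPseudofunctor A B) (G : StrictPseudofunctor B C)
    (H : StrictPseudofunctor C D) : (F.comp G).comp H = F.comp (G.comp H) :=
  strictPseudofunctor_hext rfl (fun _ => HEq.rfl) (fun _ => HEq.rfl)

section

variable {B : Type u₁} [Bicategory.{w₁, v₁} B] {C : Type u₂} [Bicategory.{w₂, v₂} C]
  {O : Type t} {O' : Type t'} {ι : O → B} {ι' : O' → C} {obj : O → O'} {obj' : O' → O}

/-- The `2`-functor `P` has the action `A` between the objects `ι a`. -/
structure ActionOn.IsActionOf (A : ActionOn ι ι' obj) (P : StrictPseudofunctor B C) : Prop where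
  obj_eq (a : O) : ι' (obj a) = P.obj (ι a)
  map_heq {a b : O} (f : ι a ⟶ ι b) : HEq (A.map f) (P.map f)
  map₂_heq {a b : O} {f g : ι a ⟶ ι b} (η : f ⟶ g) : HEq (A.map₂ η) (P.map₂ η)

namespace EquivalenceOn

variable (A : EquivalenceOn ι ι' obj obj')

/-- `A` is a restriction of the `2`-equivalence `E`. -/
structure IsRestrictionOf (E : TwoEquivalence B C) : Prop where
  functor : A.functor.IsActionOf E.functor
  inverse : A.inverse.IsActionOf E.inverse
  unit_heq (a : O) : HEq (A.unit a) (E.unit.app (ι a))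
  counit_heq (a : O') : HEq (A.counit a) (E.counit.app (ι' a))

variable {A} [Strict B] [Strict C] {V : ∀ a b : O, (ι a ⟶ ι b) → Prop}
  {V' : ∀ a b : O', (ι' a ⟶ ι' b) → Prop} {E : TwoEquivalence B C}

lemma Classes.restrictsTo (hV : A.Classes V V') (hA : A.IsRestrictionOf E) :
    RestrictsTo E hV.equivalence where
  functor := strictPseudofunctor_hext (funext fun a => hA.functor.obj_eq a.as)
    (fun f => hA.functor.map_heq (Sub.Hom.hom f)) (fun η => hA.functor.map₂_heq (Sub.Hom₂.hom η))
  inverse := strictPseudofunctor_hext (funext fun a => hA.inverse.obj_eq a.as)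
    (fun f => hA.inverse.map_heq (Sub.Hom.hom f)) (fun η => hA.inverse.map₂_heq (Sub.Hom₂.hom η))
  unit a := hA.unit_heq a.as
  counit a := hA.counit_heq a.as

lemma Classes.restricts {D : Type u₃} [Bicategory.{w₃, v₃} D] [Strict D] (hV : A.Classes V V')
    (hA : A.IsRestrictionOf E) {Q : StrictPseudofunctor B D} {Q' : StrictPseudofunctor C D}
    (hQ : E.functor.comp Q' = Q) (hQ' : E.inverse.comp Q = Q') {X : Type x} {base : O → X}
    {base' : O' → X} (hb : ∀ a, base' (obj a) = base a) (hb' : ∀ a, base (obj' a) = base' a)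
    (hu : ∀ a, ∃ h, Q.map (A.unit a) = eqToHom h)
    (hc : ∀ a, ∃ h, Q'.map (A.counit a) = eqToHom h) :
    Restricts E hV.equivalence Q Q' base base' obj obj' where
  restrictsTo := hV.restrictsTo hA
  functor_obj _ := rfl
  inverse_obj _ := rfl
  functor_map _ _ f := hV.functor_iff (Sub.Hom.hom f)
  inverse_map _ _ f := hV.inverse_iff (Sub.Hom.hom f)
  fixedBase d := by
    have h₁ : hV.equivalence.functor.comp ((Sub.incl _).comp Q') =
        (Sub.incl (genData ι V)).comp Q := by
      refine (strictPseudofunctor_comp_assoc _ _ _).symm.trans ((congrArg (fun P : StrictPseudofunctor _ C => P.comp Q')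
        (hV.restrictsTo hA).functor).trans
        ((strictPseudofunctor_comp_assoc _ _ _).trans ?_))
      exact congrArg (fun P : StrictPseudofunctor B D => (Sub.incl (genData ι V)).comp P) hQ
    have h₂ : hV.equivalence.inverse.comp ((Sub.incl _).comp Q) =
        (Sub.incl (genData ι' V')).comp Q' := by
      refine (strictPseudofunctor_comp_assoc _ _ _).symm.trans ((congrArg (fun P : StrictPseudofunctor _ B => P.comp Q)
        (hV.restrictsTo hA).inverse).trans
        ((strictPseudofunctor_comp_assoc _ _ _).trans ?_))
      exact congrArg (fun P : StrictPseudofunctor C D => (Sub.incl (genData ι' V')).comp P) hQ'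
    exact exists_vertEquivalence (E := hV.equivalence) h₁ h₂
      (base := fun a : Sub (genData ι V) => base a.as)
      (base' := fun a : Sub (genData ι' V') => base' a.as) (fun a => hb a.as)
      (fun a => hb' a.as) d (fun a => hu a.as) (fun a => hc a.as)

end EquivalenceOn

end

section

variable {B : Type u₁} [Bicategory.{w₁, v₁} B] {C : Type u₂} [Bicategory.{w₂, v₂} C]
  [Strict B] [Strict C]

section

variable (P : StrictPseudofunctor B C) {X Y Z : C} {a b c : B} (ha : X = P.obj a)
  (hb : Y = P.obj b) (hc : Z = P.obj c)

/-- The action of a `2`-functor on a `1`-morphism, up to equality of its source and target. -/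
def mapOn (f : a ⟶ b) : X ⟶ Y :=
  cast (by rw [ha, hb]) (P.map f)

/-- The action of a `2`-functor on a `2`-morphism, up to equality of objects. -/
def map₂On {f g : a ⟶ b} (η : f ⟶ g) : mapOn P ha hb f ⟶ mapOn P ha hb g :=
  cast (by subst ha hb; rfl) (P.map₂ η)

lemma mapOn_heq (f : a ⟶ b) : HEq (mapOn P ha hb f) (P.map f) :=
  cast_heq _ _

lemma map₂On_heq {f g : a ⟶ b} (η : f ⟶ g) : HEq (map₂On P ha hb η) (P.map₂ η) :=
  cast_heq _ _

lemma mapOn_id : mapOn P ha ha (𝟙 a) = 𝟙 X := by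
  subst ha
  exact P.map_id a

lemma mapOn_comp (f : a ⟶ b) (g : b ⟶ c) :
    mapOn P ha hc (f ≫ g) = mapOn P ha hb f ≫ mapOn P hb hc g := by
  subst ha hb hc
  exact P.map_comp f g

lemma map₂On_id (f : a ⟶ b) : map₂On P ha hb (𝟙 f) = 𝟙 (mapOn P ha hb f) := by
  subst ha hb
  exact P.map₂_id f

lemma map₂On_comp {f g h : a ⟶ b} (η : f ⟶ g) (θ : g ⟶ h) :
    map₂On P ha hb (η ≫ θ) = map₂On P ha hb η ≫ map₂On P ha hb θ := by
  subst ha hb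
  exact P.map₂_comp η θ

lemma map₂On_whiskerLeft (f : a ⟶ b) {g h : b ⟶ c} (η : g ⟶ h) :
    map₂On P ha hc (f ◁ η) = eqToHom (mapOn_comp P ha hb hc f g) ≫
      mapOn P ha hb f ◁ map₂On P hb hc η ≫ eqToHom (mapOn_comp P ha hb hc f h).symm := by
  subst ha hb hc
  exact map₂_whiskerLeft_eq P f η

lemma map₂On_whiskerRight {f g : a ⟶ b} (η : f ⟶ g) (h : b ⟶ c) :
    map₂On P ha hc (η ▷ h) = eqToHom (mapOn_comp P ha hb hc f h) ≫
      map₂On P ha hb η ▷ mapOn P hb hc h ≫ eqToHom (mapOn_comp P ha hb hc g h).symm := by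
  subst ha hb hc
  exact map₂_whiskerRight_eq P η h

end

section

variable (E : TwoEquivalence B C)

section

variable {a b : B} {X Y : C} {a' b' : B} (ha : X = E.functor.obj a) (ha' : a' = E.inverse.obj X)
  (hb : Y = E.functor.obj b) (hb' : b' = E.inverse.obj Y)

/-- A component of the unit, up to equality of its target. -/
def unitOn : a ⟶ a' :=
  cast (by rw [ha', ha]; rfl) (E.unit.app a)

/-- A component of the inverse of the unit, up to equality of its source. -/
def unitInvOn : a' ⟶ a :=
  cast (by rw [ha', ha]; rfl) (E.unit.inv a)

lemma unitOn_heq : HEq (unitOn E ha ha') (E.unit.app a) :=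
  cast_heq _ _

lemma exists_map_unitOn_eq_eqToHom {D : Type u₃} [Bicategory.{w₃, v₃} D]
    (Q : StrictPseudofunctor B D) (h : ∃ k, Q.map (E.unit.app a) = eqToHom k) :
    ∃ k, Q.map (unitOn E ha ha') = eqToHom k := by
  subst ha ha'
  exact h

lemma unitOn_unitInvOn : unitOn E ha ha' ≫ unitInvOn E ha ha' = 𝟙 a := by
  subst ha ha'
  exact E.unit.app_inv a

lemma unitInvOn_unitOn : unitInvOn E ha ha' ≫ unitOn E ha ha' = 𝟙 a' := by
  subst ha ha'
  exact E.unit.inv_app a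

lemma unitOn_nat (f : a ⟶ b) : f ≫ unitOn E hb hb' =
    unitOn E ha ha' ≫ mapOn E.inverse ha' hb' (mapOn E.functor ha hb f) := by
  subst ha ha' hb hb'
  exact E.unit.nat f

lemma unitOn_nat₂ {f g : a ⟶ b} (η : f ⟶ g) :
    η ▷ unitOn E hb hb' ≫ eqToHom (unitOn_nat E ha ha' hb hb' g) =
      eqToHom (unitOn_nat E ha ha' hb hb' f) ≫
        unitOn E ha ha' ◁ map₂On E.inverse ha' hb' (map₂On E.functor ha hb η) := by
  subst ha ha' hb hb'
  exact E.unit.nat₂ η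

end

section

variable {a b : C} {X Y : B} {a' b' : C} (ha : X = E.inverse.obj a) (ha' : a' = E.functor.obj X)
  (hb : Y = E.inverse.obj b) (hb' : b' = E.functor.obj Y)

/-- A component of the counit, up to equality of its source. -/
def counitOn : a' ⟶ a :=
  cast (by rw [ha', ha]; rfl) (E.counit.app a)

/-- A component of the inverse of the counit, up to equality of its target. -/
def counitInvOn : a ⟶ a' :=
  cast (by rw [ha', ha]; rfl) (E.counit.inv a)

lemma counitOn_heq : HEq (counitOn E ha ha') (E.counit.app a) :=
  cast_heq _ _

lemma exists_map_counitOn_eq_eqToHom {D : Type u₃} [Bicategory.{w₃, v₃} D]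
    (Q : StrictPseudofunctor C D) (h : ∃ k, Q.map (E.counit.app a) = eqToHom k) :
    ∃ k, Q.map (counitOn E ha ha') = eqToHom k := by
  subst ha ha'
  exact h

lemma counitOn_counitInvOn : counitOn E ha ha' ≫ counitInvOn E ha ha' = 𝟙 a' := by
  subst ha ha'
  exact E.counit.app_inv a

lemma counitInvOn_counitOn : counitInvOn E ha ha' ≫ counitOn E ha ha' = 𝟙 a := by
  subst ha ha'
  exact E.counit.inv_app a

lemma counitOn_nat (f : a ⟶ b) :
    mapOn E.functor ha' hb' (mapOn E.inverse ha hb f) ≫ counitOn E hb hb' =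
      counitOn E ha ha' ≫ f := by
  subst ha ha' hb hb'
  exact E.counit.nat f

lemma counitOn_nat₂ {f g : a ⟶ b} (η : f ⟶ g) :
    map₂On E.functor ha' hb' (map₂On E.inverse ha hb η) ▷ counitOn E hb hb' ≫
        eqToHom (counitOn_nat E ha ha' hb hb' g) =
      eqToHom (counitOn_nat E ha ha' hb hb' f) ≫ counitOn E ha ha' ◁ η := by
  subst ha ha' hb hb'
  exact E.counit.nat₂ η

end

end

variable {O : Type t} {O' : Type t'} {ι : O → B} {ι' : O' → C} {obj : O → O'} {obj' : O' → O}

/-- The action of a `2`-functor between chosen objects. -/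
def ActionOn.ofFunctor (P : StrictPseudofunctor B C) (h : ∀ a, ι' (obj a) = P.obj (ι a)) :
    ActionOn ι ι' obj where
  map {a b} f := mapOn P (h a) (h b) f
  map₂ {a b _ _} η := map₂On P (h a) (h b) η
  map_id a := mapOn_id P (h a)
  map_comp {a b c} := mapOn_comp P (h a) (h b) (h c)
  map₂_id {a b} := map₂On_id P (h a) (h b)
  map₂_comp {a b _ _ _} := map₂On_comp P (h a) (h b)
  map₂_whiskerLeft {a b c} f _ _ := map₂On_whiskerLeft P (h a) (h b) (h c) f
  map₂_whiskerRight {a b c _ _} := map₂On_whiskerRight P (h a) (h b) (h c)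

lemma ActionOn.isActionOf_ofFunctor (P : StrictPseudofunctor B C)
    (h : ∀ a, ι' (obj a) = P.obj (ι a)) : (ActionOn.ofFunctor P h).IsActionOf P where
  obj_eq := h
  map_heq {a b} f := mapOn_heq P (h a) (h b) f
  map₂_heq {a b _ _} η := map₂On_heq P (h a) (h b) η

/-- The restriction of a `2`-equivalence to chosen objects. -/
def EquivalenceOn.ofEquivalence (E : TwoEquivalence B C)
    (h : ∀ a, ι' (obj a) = E.functor.obj (ι a)) (h' : ∀ a, ι (obj' a) = E.inverse.obj (ι' a)) :
    EquivalenceOn ι ι' obj obj' where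
  functor := .ofFunctor E.functor h
  inverse := .ofFunctor E.inverse h'
  unit a := unitOn E (h a) (h' (obj a))
  unitInv a := unitInvOn E (h a) (h' (obj a))
  unit_unitInv a := unitOn_unitInvOn E (h a) (h' (obj a))
  unitInv_unit a := unitInvOn_unitOn E (h a) (h' (obj a))
  unit_nat {a b} f := unitOn_nat E (h a) (h' (obj a)) (h b) (h' (obj b)) f
  unit_nat₂ {a b _ _} η := unitOn_nat₂ E (h a) (h' (obj a)) (h b) (h' (obj b)) η
  counit a := counitOn E (h' a) (h (obj' a))
  counitInv a := counitInvOn E (h' a) (h (obj' a))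
  counit_counitInv a := counitOn_counitInvOn E (h' a) (h (obj' a))
  counitInv_counit a := counitInvOn_counitOn E (h' a) (h (obj' a))
  counit_nat {a b} f := counitOn_nat E (h' a) (h (obj' a)) (h' b) (h (obj' b)) f
  counit_nat₂ {a b _ _} η := counitOn_nat₂ E (h' a) (h (obj' a)) (h' b) (h (obj' b)) η

lemma EquivalenceOn.isRestrictionOf_ofEquivalence (E : TwoEquivalence B C)
    (h : ∀ a, ι' (obj a) = E.functor.obj (ι a)) (h' : ∀ a, ι (obj' a) = E.inverse.obj (ι' a)) :
    (EquivalenceOn.ofEquivalence E h h').IsRestrictionOf E where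
  functor := ActionOn.isActionOf_ofFunctor _ _
  inverse := ActionOn.isActionOf_ofFunctor _ _
  unit_heq a := unitOn_heq E (h a) (h' (obj a))
  counit_heq a := counitOn_heq E (h' a) (h (obj' a))

lemma EquivalenceOn.exists_map_unit_eq_eqToHom {E : TwoEquivalence B C}
    {h : ∀ a, ι' (obj a) = E.functor.obj (ι a)} {h' : ∀ a, ι (obj' a) = E.inverse.obj (ι' a)}
    {D : Type u₃} [Bicategory.{w₃, v₃} D] (Q : StrictPseudofunctor B D) (a : O)
    (e : ∃ k, Q.map (E.unit.app (ι a)) = eqToHom k) :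
    ∃ k, Q.map ((EquivalenceOn.ofEquivalence E h h').unit a) = eqToHom k :=
  exists_map_unitOn_eq_eqToHom E (h a) (h' (obj a)) Q e

lemma EquivalenceOn.exists_map_counit_eq_eqToHom {E : TwoEquivalence B C}
    {h : ∀ a, ι' (obj a) = E.functor.obj (ι a)} {h' : ∀ a, ι (obj' a) = E.inverse.obj (ι' a)}
    {D : Type u₃} [Bicategory.{w₃, v₃} D] (Q : StrictPseudofunctor C D) (a : O')
    (e : ∃ k, Q.map (E.counit.app (ι' a)) = eqToHom k) :
    ∃ k, Q.map ((EquivalenceOn.ofEquivalence E h h').counit a) = eqToHom k :=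
  exists_map_counitOn_eq_eqToHom E (h' a) (h (obj' a)) Q e

end

namespace EndLax

section

variable {B : Type u₁} [Bicategory.{w₁, v₁} B] [Strict B] {C : Type u₂} [Bicategory.{w₂, v₂} C]
  [Strict C]

lemma exists_ofEq_eq_eqToHom {X Y : EndLax B} {f : X.carrier ⟶ Y.carrier}
    (h : X.T ≫ f = f ≫ Y.T) (e : ∃ k, f = eqToHom k) : ∃ k, ofEq f h = eqToHom k := by
  obtain ⟨X, T⟩ := X
  obtain ⟨Y, T'⟩ := Y
  obtain ⟨k, rfl⟩ := e
  dsimp only at k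
  subst k
  obtain rfl : T = T' := (Strict.comp_id T).symm.trans (h.trans (Strict.id_comp T'))
  exact ⟨rfl, ofEq_id _ _⟩

lemma exists_map_ofEq_eq_eqToHom (P : StrictPseudofunctor B C) {X Y : EndLax B}
    {f : X.carrier ⟶ Y.carrier} (h : X.T ≫ f = f ≫ Y.T) (e : ∃ k, P.map f = eqToHom k) :
    ∃ k, (map P).map (ofEq f h) = eqToHom k := by
  rw [mapHom_ofEq]
  exact exists_ofEq_eq_eqToHom (X := (map P).obj X) (Y := (map P).obj Y) _ e

end

section Restrict

variable {E : TwoEquivalence Indx.{v, u} Fib.{v, u}} (hE : IsGrothendieckEquivalence E)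

/-- The Grothendieck construction as an equivalence between tangent indexed categories and tangent
fibrations, with morphisms with lax distributive laws. -/
noncomputable def elementsEquivalence :
    EquivalenceOn TangentObject.endLax TangentFibration.endLax (TangentObject.elements hE)
      (TangentFibration.toIndx hE) :=
  .ofEquivalence (mapEquivalence E) (fun _ => rfl) (fun _ => rfl)

lemma isRestrictionOf_elementsEquivalence :
    (elementsEquivalence hE).IsRestrictionOf (mapEquivalence E) :=
  EquivalenceOn.isRestrictionOf_ofEquivalence _ _ _

/-- The classes `V` and `V'` correspond under the equivalence of indexed categories and fibrations
and contain the strict tangent morphisms. -/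
structure Correspond (V : ∀ a b : TangentObject Indx.{v, u}, (a.endLax ⟶ b.endLax) → Prop)
    (V' : ∀ a b : TangentFibration.{v, u}, (a.endLax ⟶ b.endLax) → Prop) : Prop where
  functor_iff {a b : TangentObject Indx.{v, u}} (f : a.endLax ⟶ b.endLax) :
    V a b f ↔ V' (a.elements hE) (b.elements hE) (mapHom E.functor f)
  inverse_iff {a b : TangentFibration.{v, u}} (f : a.endLax ⟶ b.endLax) :
    V' a b f ↔ V (a.toIndx hE) (b.toIndx hE) (mapHom E.inverse f)
  of_strict {a b : TangentObject Indx.{v, u}} {f : a.carrier ⟶ b.carrier}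
    {h : a.data.T ≫ f = f ≫ b.data.T} :
    a.data.IsStrict b.data f (eqToHom h) → V a b (ofEq (X := a.endLax) (Y := b.endLax) f h)
  of_strict' {a b : TangentFibration.{v, u}} {f : a.fib ⟶ b.fib}
    {h : a.endo ≫ f = f ≫ b.endo} :
    TNGFIB.strictMor a b ⟨f, eqToHom h⟩ → V' a b (ofEq (X := a.endLax) (Y := b.endLax) f h)

variable {V : ∀ a b : TangentObject Indx.{v, u}, (a.endLax ⟶ b.endLax) → Prop}
  {V' : ∀ a b : TangentFibration.{v, u}, (a.endLax ⟶ b.endLax) → Prop} {hE}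

lemma restricts_equivalence (hV : (elementsEquivalence hE).Classes V V') :
    Restricts (mapEquivalence E) hV.equivalence (map Indx.baseFunctor) (map Fib.baseFunctor)
      TangentObject.base TangentFibration.base (TangentObject.elements hE)
      (TangentFibration.toIndx hE) :=
  hV.restricts (isRestrictionOf_elementsEquivalence hE)
    ((map_comp _ _).symm.trans (congrArg map hE.functor_base))
    ((map_comp _ _).symm.trans (congrArg map hE.inverse_base))
    (TangentObject.elements_base hE) (TangentFibration.toIndx_base hE)
    (fun a => EquivalenceOn.exists_map_unit_eq_eqToHom (E := mapEquivalence E) _ a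
      (exists_map_ofEq_eq_eqToHom _ (E.unit.nat a.data.T) (hE.unit_base a.carrier)))
    (fun a => EquivalenceOn.exists_map_counit_eq_eqToHom (E := mapEquivalence E) _ a
      (exists_map_ofEq_eq_eqToHom _ (E.counit.nat a.endo) (hE.counit_base a.fib)))

namespace Correspond

variable (hV : Correspond hE V V')

include hV

lemma gen_of_strict {a b c : TangentObject Indx.{v, u}} {f : a.carrier ⟶ b.carrier}
    {g : b.carrier ⟶ c.carrier} {h : a.data.T ≫ f = f ≫ b.data.T} {h' : b.data.T ≫ g = g ≫ c.data.T}
    (hf : a.data.IsStrict b.data f (eqToHom h)) (hg : b.data.IsStrict c.data g (eqToHom h'))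
    {k : a.carrier ⟶ c.carrier} (e : f ≫ g = k) (hk : a.data.T ≫ k = k ≫ c.data.T) :
    Gen TangentObject.endLax V a c (ofEq (X := a.endLax) (Y := c.endLax) k hk) := by
  have h1 := Gen.comp (ι := TangentObject.endLax) (V := V) (ofEq (X := a.endLax) (Y := b.endLax) f h)
    (ofEq (X := b.endLax) (Y := c.endLax) g h') (Gen.of _ (hV.of_strict hf))
    (Gen.of _ (hV.of_strict hg))
  have h2 : ofEq (X := a.endLax) (Y := b.endLax) f h ≫ ofEq (X := b.endLax) (Y := c.endLax) g h' =
      ofEq (X := a.endLax) (Y := c.endLax) k hk := (ofEq_comp _ _ _ _).trans (ofEq_congr e _ hk)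
  exact h2 ▸ h1

lemma gen_unit (a : TangentObject Indx.{v, u}) :
    Gen TangentObject.endLax V a ((a.elements hE).toIndx hE)
      (ofEq (X := a.endLax) (Y := ((a.elements hE).toIndx hE).endLax) (E.unit.app a.carrier)
        (E.unit.nat a.data.T)) :=
  hV.gen_of_strict (b := (a.groth hE).fibers hE) (E.unit_isStrict a.isTangent)
    ((TangentObject.fibers_isStrict hE (a.id_isStrict_elements hE)).of_eq rfl rfl
      (E.inverse.map_id _) ((Strict.comp_id _).trans (Strict.id_comp _).symm)) (Strict.comp_id _) _

lemma gen_unit_inv (a : TangentObject Indx.{v, u}) :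
    Gen TangentObject.endLax V ((a.elements hE).toIndx hE) a
      (ofEq (X := ((a.elements hE).toIndx hE).endLax) (Y := a.endLax) (E.unit.inv a.carrier)
        (E.unit.symm.nat a.data.T)) :=
  hV.gen_of_strict (b := (a.groth hE).fibers hE)
    ((TangentObject.fibers_isStrict hE (a.elements_id_isStrict hE)).of_eq rfl rfl
      (E.inverse.map_id _) ((Strict.comp_id _).trans (Strict.id_comp _).symm))
    (E.unit_inv_isStrict ((a.groth hE).fibers hE).isTangent) (Strict.id_comp _) _

lemma gen_counit (a : TangentFibration.{v, u}) :
    Gen TangentFibration.endLax V' ((a.toIndx hE).elements hE) a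
      (ofEq (X := ((a.toIndx hE).elements hE).endLax) (Y := a.endLax) (E.counit.app a.fib)
        (E.counit.nat a.endo)) :=
  Gen.of _ (hV.of_strict' ((TNGFIB.strictMor_left_iff ((a.toIndx hE).groth hE).isTangent).2
    (E.counit_isStrict ((a.toIndx hE).groth hE).isTangent)))

lemma gen_counit_inv (a : TangentFibration.{v, u}) :
    Gen TangentFibration.endLax V' a ((a.toIndx hE).elements hE)
      (ofEq (X := a.endLax) (Y := ((a.toIndx hE).elements hE).endLax) (E.counit.inv a.fib)
        (E.counit.symm.nat a.endo)) :=
  Gen.of _ (hV.of_strict' ((TNGFIB.strictMor_right_iff ((a.toIndx hE).groth hE).isTangent).2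
    (E.counit_inv_isStrict a.data_isTangent)))

lemma classes : (elementsEquivalence hE).Classes V V' where
  functor_iff f := hV.functor_iff f
  inverse_iff f := hV.inverse_iff f
  unit a := hV.gen_unit a
  unitInv a := hV.gen_unit_inv a
  counit a := hV.gen_counit a
  counitInv a := hV.gen_counit_inv a

end Correspond

end Restrict

end EndLax

namespace EndColax

section

variable {B : Type u₁} [Bicategory.{w₁, v₁} B] [Strict B] {C : Type u₂} [Bicategory.{w₂, v₂} C]
  [Strict C]

lemma exists_ofEq_eq_eqToHom {X Y : EndColax B} {f : X.carrier ⟶ Y.carrier}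
    (h : X.T ≫ f = f ≫ Y.T) (e : ∃ k, f = eqToHom k) : ∃ k, ofEq f h = eqToHom k := by
  obtain ⟨X, T⟩ := X
  obtain ⟨Y, T'⟩ := Y
  obtain ⟨k, rfl⟩ := e
  dsimp only at k
  subst k
  obtain rfl : T = T' := (Strict.comp_id T).symm.trans (h.trans (Strict.id_comp T'))
  exact ⟨rfl, ofEq_id _ _⟩

lemma exists_map_ofEq_eq_eqToHom (P : StrictPseudofunctor B C) {X Y : EndColax B}
    {f : X.carrier ⟶ Y.carrier} (h : X.T ≫ f = f ≫ Y.T) (e : ∃ k, P.map f = eqToHom k) :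
    ∃ k, (map P).map (ofEq f h) = eqToHom k := by
  rw [mapHom_ofEq]
  exact exists_ofEq_eq_eqToHom (X := (map P).obj X) (Y := (map P).obj Y) _ e

end

section Restrict

variable {E : TwoEquivalence Indx.{v, u} Fib.{v, u}} (hE : IsGrothendieckEquivalence E)

/-- The Grothendieck construction as an equivalence between tangent indexed categories and tangent
fibrations, with morphisms with colax distributive laws. -/
noncomputable def elementsEquivalence :
    EquivalenceOn TangentObject.endColax TangentFibration.endColax (TangentObject.elements hE)
      (TangentFibration.toIndx hE) :=
  .ofEquivalence (mapEquivalence E) (fun _ => rfl) (fun _ => rfl)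

lemma isRestrictionOf_elementsEquivalence :
    (elementsEquivalence hE).IsRestrictionOf (mapEquivalence E) :=
  EquivalenceOn.isRestrictionOf_ofEquivalence _ _ _

/-- The classes `V` and `V'` correspond under the equivalence of indexed categories and fibrations
and contain the strict tangent morphisms. -/
structure Correspond (V : ∀ a b : TangentObject Indx.{v, u}, (a.endColax ⟶ b.endColax) → Prop)
    (V' : ∀ a b : TangentFibration.{v, u}, (a.endColax ⟶ b.endColax) → Prop) : Prop where
  functor_iff {a b : TangentObject Indx.{v, u}} (f : a.endColax ⟶ b.endColax) :
    V a b f ↔ V' (a.elements hE) (b.elements hE) (mapHom E.functor f)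
  inverse_iff {a b : TangentFibration.{v, u}} (f : a.endColax ⟶ b.endColax) :
    V' a b f ↔ V (a.toIndx hE) (b.toIndx hE) (mapHom E.inverse f)
  of_strict {a b : TangentObject Indx.{v, u}} {f : a.carrier ⟶ b.carrier}
    {h : a.data.T ≫ f = f ≫ b.data.T} :
    a.data.IsStrict b.data f (eqToHom h) → V a b (ofEq (X := a.endColax) (Y := b.endColax) f h)
  of_strict' {a b : TangentFibration.{v, u}} {f : a.fib ⟶ b.fib}
    {h : a.endo ≫ f = f ≫ b.endo} :
    TNGFIB.strictMor a b ⟨f, eqToHom h⟩ → V' a b (ofEq (X := a.endColax) (Y := b.endColax) f h)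

variable {V : ∀ a b : TangentObject Indx.{v, u}, (a.endColax ⟶ b.endColax) → Prop}
  {V' : ∀ a b : TangentFibration.{v, u}, (a.endColax ⟶ b.endColax) → Prop} {hE}

lemma restricts_equivalence (hV : (elementsEquivalence hE).Classes V V') :
    Restricts (mapEquivalence E) hV.equivalence (map Indx.baseFunctor) (map Fib.baseFunctor)
      TangentObject.base TangentFibration.base (TangentObject.elements hE)
      (TangentFibration.toIndx hE) :=
  hV.restricts (isRestrictionOf_elementsEquivalence hE)
    ((map_comp _ _).symm.trans (congrArg map hE.functor_base))
    ((map_comp _ _).symm.trans (congrArg map hE.inverse_base))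
    (TangentObject.elements_base hE) (TangentFibration.toIndx_base hE)
    (fun a => EquivalenceOn.exists_map_unit_eq_eqToHom (E := mapEquivalence E) _ a
      (exists_map_ofEq_eq_eqToHom _ (E.unit.nat a.data.T) (hE.unit_base a.carrier)))
    (fun a => EquivalenceOn.exists_map_counit_eq_eqToHom (E := mapEquivalence E) _ a
      (exists_map_ofEq_eq_eqToHom _ (E.counit.nat a.endo) (hE.counit_base a.fib)))

namespace Correspond

variable (hV : Correspond hE V V')

include hV

lemma gen_of_strict {a b c : TangentObject Indx.{v, u}} {f : a.carrier ⟶ b.carrier}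
    {g : b.carrier ⟶ c.carrier} {h : a.data.T ≫ f = f ≫ b.data.T} {h' : b.data.T ≫ g = g ≫ c.data.T}
    (hf : a.data.IsStrict b.data f (eqToHom h)) (hg : b.data.IsStrict c.data g (eqToHom h'))
    {k : a.carrier ⟶ c.carrier} (e : f ≫ g = k) (hk : a.data.T ≫ k = k ≫ c.data.T) :
    Gen TangentObject.endColax V a c (ofEq (X := a.endColax) (Y := c.endColax) k hk) := by
  have h1 := Gen.comp (ι := TangentObject.endColax) (V := V) (ofEq (X := a.endColax) (Y := b.endColax) f h)
    (ofEq (X := b.endColax) (Y := c.endColax) g h') (Gen.of _ (hV.of_strict hf))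
    (Gen.of _ (hV.of_strict hg))
  have h2 : ofEq (X := a.endColax) (Y := b.endColax) f h ≫ ofEq (X := b.endColax) (Y := c.endColax) g h' =
      ofEq (X := a.endColax) (Y := c.endColax) k hk := (ofEq_comp _ _ _ _).trans (ofEq_congr e _ hk)
  exact h2 ▸ h1

lemma gen_unit (a : TangentObject Indx.{v, u}) :
    Gen TangentObject.endColax V a ((a.elements hE).toIndx hE)
      (ofEq (X := a.endColax) (Y := ((a.elements hE).toIndx hE).endColax) (E.unit.app a.carrier)
        (E.unit.nat a.data.T)) :=
  hV.gen_of_strict (b := (a.groth hE).fibers hE) (E.unit_isStrict a.isTangent)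
    ((TangentObject.fibers_isStrict hE (a.id_isStrict_elements hE)).of_eq rfl rfl
      (E.inverse.map_id _) ((Strict.comp_id _).trans (Strict.id_comp _).symm)) (Strict.comp_id _) _

lemma gen_unit_inv (a : TangentObject Indx.{v, u}) :
    Gen TangentObject.endColax V ((a.elements hE).toIndx hE) a
      (ofEq (X := ((a.elements hE).toIndx hE).endColax) (Y := a.endColax) (E.unit.inv a.carrier)
        (E.unit.symm.nat a.data.T)) :=
  hV.gen_of_strict (b := (a.groth hE).fibers hE)
    ((TangentObject.fibers_isStrict hE (a.elements_id_isStrict hE)).of_eq rfl rfl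
      (E.inverse.map_id _) ((Strict.comp_id _).trans (Strict.id_comp _).symm))
    (E.unit_inv_isStrict ((a.groth hE).fibers hE).isTangent) (Strict.id_comp _) _

lemma gen_counit (a : TangentFibration.{v, u}) :
    Gen TangentFibration.endColax V' ((a.toIndx hE).elements hE) a
      (ofEq (X := ((a.toIndx hE).elements hE).endColax) (Y := a.endColax) (E.counit.app a.fib)
        (E.counit.nat a.endo)) :=
  Gen.of _ (hV.of_strict' ((TNGFIB.strictMor_left_iff ((a.toIndx hE).groth hE).isTangent).2
    (E.counit_isStrict ((a.toIndx hE).groth hE).isTangent)))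

lemma gen_counit_inv (a : TangentFibration.{v, u}) :
    Gen TangentFibration.endColax V' a ((a.toIndx hE).elements hE)
      (ofEq (X := a.endColax) (Y := ((a.toIndx hE).elements hE).endColax) (E.counit.inv a.fib)
        (E.counit.symm.nat a.endo)) :=
  Gen.of _ (hV.of_strict' ((TNGFIB.strictMor_right_iff ((a.toIndx hE).groth hE).isTangent).2
    (E.counit_inv_isStrict a.data_isTangent)))

lemma classes : (elementsEquivalence hE).Classes V V' where
  functor_iff f := hV.functor_iff f
  inverse_iff f := hV.inverse_iff f
  unit a := hV.gen_unit a
  unitInv a := hV.gen_unit_inv a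
  counit a := hV.gen_counit a
  counitInv a := hV.gen_counit_inv a

end Correspond

end Restrict

end EndColax

section

variable {E : TwoEquivalence Indx.{v, u} Fib.{v, u}} (hE : IsGrothendieckEquivalence E)

lemma lax_correspond : EndLax.Correspond hE TNG.laxMor TNGFIB.laxMor where
  functor_iff {a b} f := (isLax_map_iff a.data b.data hE.functor_localIso f.one f.law).symm.trans
    (TangentData.isLax_iff_fib (a.groth hE).isTangent (b.groth hE).isTangent)
  inverse_iff {a b} f := TNGFIB.laxMor_iff.trans
    (isLax_map_iff a.data b.data hE.inverse_localIso f.one f.law).symm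
  of_strict {a b _ _} h := h.isLax a.isTangent b.isTangent
  of_strict' {a b _ _} h := TNGFIB.laxMor_iff.2
    ((TNGFIB.strictMor_iff.1 h).isLax a.data_isTangent b.data_isTangent)

lemma colax_correspond : EndColax.Correspond hE TNG.colaxMor TNGFIB.colaxMor where
  functor_iff {a b} f := (isColax_map_iff a.data b.data hE.functor_localIso
    E.essSurjIso_functor f.one f.law).symm.trans
      (TangentData.isColax_iff_fib (a.groth hE).isTangent (b.groth hE).isTangent)
  inverse_iff {a b} f := TNGFIB.colaxMor_iff.trans
    (isColax_map_iff a.data b.data hE.inverse_localIso E.essSurjIso_inverse f.one f.law).symm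
  of_strict h := h.isColax
  of_strict' {_ _ _ k} h := TNGFIB.colaxMor_iff.2 ((TNGFIB.strictMor_iff.1 h).isColax (h := k))

lemma strong_correspond : EndLax.Correspond hE TNG.strongMor TNGFIB.strongMor where
  functor_iff {a b} f := (isStrong_map_iff a.data b.data hE.functor_localIso
    E.essSurjIso_functor f.one f.law).symm.trans
      (TangentData.isStrong_iff_fib (a.groth hE).isTangent (b.groth hE).isTangent)
  inverse_iff {a b} f := TNGFIB.strongMor_iff.trans
    (isStrong_map_iff a.data b.data hE.inverse_localIso E.essSurjIso_inverse f.one f.law).symm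
  of_strict h := h.isStrong
  of_strict' h := TNGFIB.strongMor_iff.2 (TNGFIB.strictMor_iff.1 h).isStrong

lemma strict_correspond : EndLax.Correspond hE TNG.strictMor TNGFIB.strictMor where
  functor_iff {a b} f := (isStrict_map_iff a.data b.data hE.functor_localIso
    E.essSurjIso_functor f.one f.law).symm.trans
      (TangentData.isStrict_iff_fib (a.groth hE).isTangent (b.groth hE).isTangent)
  inverse_iff {a b} f := TNGFIB.strictMor_iff.trans
    (isStrict_map_iff a.data b.data hE.inverse_localIso E.essSurjIso_inverse f.one f.law).symm
  of_strict h := h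
  of_strict' h := h

end

end TangentFib

theorem mainTheorem1 : ∃ E : TwoEquivalence Indx.{v, u} Fib.{v, u},
    E.functor = grothendieck ∧ E.inverse.comp Indx.baseFunctor = Fib.baseFunctor ∧
    ∃ (L : TwoEquivalence (EndLax Indx.{v, u}) (EndLax Fib.{v, u}))
      (M : TwoEquivalence (EndColax Indx.{v, u}) (EndColax Fib.{v, u}))
      (Fo : TangentObject Indx.{v, u} → TangentFibration.{v, u})
      (Go : TangentFibration.{v, u} → TangentObject Indx.{v, u})
      (lax : TwoEquivalence (TNG Indx.{v, u}) TNGFIB.{v, u})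
      (colax : TwoEquivalence (TNGco Indx.{v, u}) TNGFIBco.{v, u})
      (strong : TwoEquivalence (TNGstrong Indx.{v, u}) TNGFIBstrong.{v, u})
      (strict : TwoEquivalence (TNGstrict Indx.{v, u}) TNGFIBstrict.{v, u}),
      IsEndLaxLift E L ∧ IsEndColaxLift E M ∧
      (∀ o, (Fo o).base = o.base) ∧ (∀ o, (Fo o).total = o.total) ∧
      (∀ o, (Go o).base = o.base) ∧
      Restricts L lax (EndLax.map Indx.baseFunctor) (EndLax.map Fib.baseFunctor)
        TangentObject.base TangentFibration.base Fo Go ∧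
      Restricts M colax (EndColax.map Indx.baseFunctor) (EndColax.map Fib.baseFunctor)
        TangentObject.base TangentFibration.base Fo Go ∧
      Restricts L strong (EndLax.map Indx.baseFunctor) (EndLax.map Fib.baseFunctor)
        TangentObject.base TangentFibration.base Fo Go ∧
      Restricts L strict (EndLax.map Indx.baseFunctor) (EndLax.map Fib.baseFunctor)
        TangentObject.base TangentFibration.base Fo Go := by
  have hE := isGrothendieckEquivalence.{v, u}
  exact ⟨grothendieckEquivalence, grothendieckEquivalence_functor,
    grothendieckEquivalence_inverse_base, EndLax.mapEquivalence _, EndColax.mapEquivalence _,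
    TangentObject.elements hE, TangentFibration.toIndx hE,
    (lax_correspond hE).classes.equivalence, (colax_correspond hE).classes.equivalence,
    (strong_correspond hE).classes.equivalence, (strict_correspond hE).classes.equivalence,
    EndLax.isEndLaxLift_mapEquivalence _, EndColax.isEndColaxLift_mapEquivalence _,
    TangentObject.elements_base hE, TangentObject.elements_total hE,
    TangentFibration.toIndx_base hE,
    EndLax.restricts_equivalence (lax_correspond hE).classes,
    EndColax.restricts_equivalence (colax_correspond hE).classes,
    EndLax.restricts_equivalence (strong_correspond hE).classes,
    EndLax.restricts_equivalence (strict_correspond hE).classes⟩
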